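/- Let $q\colon A\to M$ be a Lie algebroid over a smooth manifold $M$, that is, a smooth real vector bundle of finite rank with an anchor $a\colon A\to TM$ (a vector bundle morphism over $M$) and a real Lie bracket on the space $\Gamma A$ of smooth sections, such that $[X,fY]=f[X,Y]+(a(X)f)Y$ and $a([X,Y])=[a(X),a(Y)]$ for $X,Y\in\Gamma A$, $f\in C^\infty(M)$. Regard $TA$ as a vector bundle over $TM$ with projection $T(q)$, its addition and scalar multiplication being the tangent maps of those of $A$. Let $(\Xi,x)$ be a linear vector field on $A$: smooth vector fields $\Xi$ on $A$ and $x$ on $M$ such that $\Xi\colon A\to TA$ is a morphism of vector bundles over $x\colon M\to TM$. Associated with $(\Xi,x)$ are - the operator $D_\Xi\colon\Gamma A\to\Gamma A$ with $\langle\varphi,D_\Xi(X)\rangle=x(\langle\varphi,X\rangle)-\Xi(\ell_\varphi)\circ X$ for $X\in\Gamma A$, $\varphi\in\Gamma A^*$, where $\ell_\varphi\colon A\to\mathbb R$ is the fibrewise linear function given by $\varphi$; equivalently, $T(X)(x(m))-\Xi(X(m))$ is the vertical tangent vector at $X(m)$ given by $D_\Xi(X)(m)$; - the dual vector field $\Xi_*$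 on $A^*$, determined by $\Xi_*(\ell_X)=\ell_{D_\Xi(X)}$ for $X\in\Gamma A$ and $\Xi_*(f\circ q_*)=x(f)\circ q_*$ for $f\in C^\infty(M)$, where $q_*\colon A^*\to M$ is the projection and $\ell_X\colon A^*\to\mathbb R$ is the fibrewise linear function given by $X$. Let $A^*$ carry the dual Poisson structure, determined by $\{\ell_X,\ell_Y\}=\ell_{[X,Y]}$, $\{\ell_X,f\circ q_*\}=(a(X)f)\circ q_*$, $\{f\circ q_*,g\circ q_*\}=0$. Let $TA\to TM$ carry the tangent Lie algebroid structure: its anchor is $J\circ T(a)$ with $J$ the canonical involution of $T(TM)$, and its bracket is determined by the Leibniz rule and by $[T(X),T(Y)]=T([X,Y])$, $[T(X),\hat Y]=\widehat{[X,Y]}$, $[\hat X,\hat Y]=0$ for $X,Y\in\Gamma A$, where $\hat X(v)=T(0)(v)+\overline{X(m)}$ for $v\in T_mM$, with $0$ the zero section of $A$ and $\overline{X(m)}\in T_{0_m}(A_m)$ the vector corresponding to $X(m)$. Then the following are equivalent: 1. $(\Xi,x)$ is a morphic vector field, that is, $\Xi\colon A\to TA$ is a morphism of Lie algebroids over $x\colon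 M\to TM$: $J\circ T(a)\circ\Xi=T(x)\circ a$, and whenever $X,Y\in\Gamma A$ satisfy $\Xi\circ X=\sum_i c_i(\sigma_i\circ x)$ and $\Xi\circ Y=\sum_j d_j(\tau_j\circ x)$ (finite sums, with $c_i,d_j\in C^\infty(M)$ and sections $\sigma_i,\tau_j$ of $TA\to TM$), then $\Xi\circ[X,Y]=\sum_{i,j}c_id_j([\sigma_i,\tau_j]\circ x)+\sum_j a(X)(d_j)(\tau_j\circ x)-\sum_i a(Y)(c_i)(\sigma_i\circ x)$. 2. The dual vector field $\Xi_*$ is Poisson, that is, a derivation of the Poisson bracket on $C^\infty(A^*)$. 3. $D_\Xi$ is a derivation of the bracket of $\Gamma A$: $D_\Xi[X,Y]=[D_\Xi X,Y]+[X,D_\Xi Y]$ for all $X,Y\in\Gamma A$. 4. The flows of $\Xi$ are local Lie algebroid automorphisms over the flows of $x$: for every $t\in\mathbb R$, if $U_t\subseteq M$ denotes the domain of the time $t$ flow $f_t$ of $x$, then the time $t$ flow $\varphi_t$ of $\Xi$ has domain $q^{-1}(U_t)$ and is an isomorphism of Lie algebroids $A|_{U_t}\to A|_{U_{-t}}$ over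 the diffeomorphism $f_t\colon U_t\to U_{-t}$. -/

import Mathlib

open Bundle Set Filter
open scoped Manifold ContDiff Topology

noncomputable section

set_option linter.unusedSectionVars false

namespace LieAlgebroidTheory

variable {E : Type*} [NormedAddCommGroup E] [NormedSpace ℝ E]
  {M : Type*} [TopologicalSpace M] [ChartedSpace E M]
  {F : Type*} [NormedAddCommGroup F] [NormedSpace ℝ F]
  {V : M → Type*} [TopologicalSpace (TotalSpace F V)] [∀ m, AddCommGroup (V m)]
  [∀ m, Module ℝ (V m)] [∀ m, TopologicalSpace (V m)] [FiberBundle F V]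

-- `IM` is the model of the base manifold `M`, `IA` the one of the total space `A` of the bundle `V`,
-- and `IAd` the one of the total space `Ad` of the dual bundle.
local notation "IM" => modelWithCornersSelf ℝ E
local notation "IA" => ModelWithCorners.prod (modelWithCornersSelf ℝ E) (modelWithCornersSelf ℝ F)
local notation "IAd" =>
  ModelWithCorners.prod (modelWithCornersSelf ℝ E) (modelWithCornersSelf ℝ (F →L[ℝ] ℝ))
local notation "TM" => TangentBundle (modelWithCornersSelf ℝ E) M
local notation "TA" => TangentBundle
  (ModelWithCorners.prod (modelWithCornersSelf ℝ E) (modelWithCornersSelf ℝ F)) (TotalSpace F V)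
local notation "Ad" => TotalSpace (F →L[ℝ] ℝ) (fun m : M => V m →L[ℝ] ℝ)
local notation "ΓA" => ContMDiffSection (modelWithCornersSelf ℝ E) F ∞ V
local notation "ΓAd" => ContMDiffSection (modelWithCornersSelf ℝ E) (F →L[ℝ] ℝ) ∞
  (fun m : M => V m →L[ℝ] ℝ)

/-- The derivative of a function along a tangent vector. -/
def derivAlong {E' H' N : Type*} [NormedAddCommGroup E'] [NormedSpace ℝ E'] [TopologicalSpace H']
    {J : ModelWithCorners ℝ E' H'} [TopologicalSpace N] [ChartedSpace H' N]
    (g : N → ℝ) (z : TangentBundle J N) : ℝ :=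
  mfderiv J 𝓘(ℝ, ℝ) g z.proj z.snd

theorem hasMFDerivAt_proj (p : TotalSpace F V) :
    HasMFDerivAt IA IM (π F V) p (ContinuousLinearMap.fst ℝ E F) := by
  refine ⟨(FiberBundle.continuous_proj F V).continuousAt, ?_⟩
  apply HasFDerivAt.hasFDerivWithinAt
  have h1 : HasFDerivAt (Prod.fst : E × F → E) (ContinuousLinearMap.fst ℝ E F)
    (extChartAt IA p p) := hasFDerivAt_fst
  refine h1.congr_of_eventuallyEq ?_
  filter_upwards [extChartAt_target_mem_nhds (I := IA) p] with y hy
  rw [FiberBundle.extChartAt_target] at hy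
  simp only [writtenInExtChartAt, Function.comp, FiberBundle.extChartAt]
  simp only [mfld_simps]
  have h2 := (trivializationAt F V p.proj).proj_symm_apply' (b := (chartAt E p.proj).symm y.1) (x := y.2) hy.1.2
  have h3 := (chartAt E p.proj).right_inv (x := y.1) (by simpa using hy.1.1)
  rw [h2, h3]

theorem hasMFDerivAt_triv (p : TotalSpace F V) :
    HasMFDerivAt IA 𝓘(ℝ, F) 
      (fun r : TotalSpace F V => (trivializationAt F V p.proj r).2) p 
      (ContinuousLinearMap.snd ℝ E F) := by
  refine ⟨?_, ?_⟩
  · have := ((trivializationAt F V p.proj).continuousOn.continuousAt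
      ((trivializationAt F V p.proj).open_source.mem_nhds
        (FiberBundle.mem_trivializationAt_proj_source (x := p))))
    exact continuousAt_snd.comp this
  apply HasFDerivAt.hasFDerivWithinAt
  have h1 : HasFDerivAt (Prod.snd : E × F → F) (ContinuousLinearMap.snd ℝ E F)
    (extChartAt IA p p) := hasFDerivAt_snd
  refine h1.congr_of_eventuallyEq ?_
  filter_upwards [extChartAt_target_mem_nhds (I := IA) p] with y hy
  rw [FiberBundle.extChartAt_target] at hy
  simp only [writtenInExtChartAt, Function.comp, FiberBundle.extChartAt]
  simp only [mfld_simps]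
  have h2 := (trivializationAt F V p.proj).apply_symm_apply' (b := (chartAt E p.proj).symm y.1) (x := y.2) hy.1.2
  rw [h2]
  rfl

theorem mfderiv_proj (p : TotalSpace F V) :
    mfderiv IA IM (π F V) p = ContinuousLinearMap.fst ℝ E F :=
  (hasMFDerivAt_proj p).mfderiv

theorem mfderiv_triv (p : TotalSpace F V) :
    mfderiv IA 𝓘(ℝ, F)
      (fun r : TotalSpace F V => (trivializationAt F V p.proj r).2) p =
      ContinuousLinearMap.snd ℝ E F :=
  (hasMFDerivAt_triv p).mfderiv

variable (F V) in
/-- The fibre `T(q)⁻¹(v)` over `v ∈ TM` of the tangent map `T(q) : TA → TM` of the bundle projection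
`q : A → M`. -/
@[ext]
structure TqFiber (v : TM) where
  val : TA
  property : tangentMap IA IM (π F V) val = v

theorem tangentMap_proj_mk (m : M) (a : V m) (w : E × F) :
    tangentMap IA IM (π F V) (⟨⟨m, a⟩, w⟩ : TA) = ⟨m, w.1⟩ := by
  simp only [tangentMap, mfderiv_proj]
  rfl

variable (F V) in
/-- The identification of `T(q)⁻¹(v)` with `F × F` given by the tangent map of the local trivialization
`A|_U ≅ U × F` at the base point of `v`. -/
def TqFiber.coord [VectorBundle ℝ F V] (v : TM) : TqFiber F V v ≃ F × F where
  toFun ξ :=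
    ((trivializationAt F V v.proj ξ.1.proj).2,
      mfderiv IA 𝓘(ℝ, F)
        (fun r : TotalSpace F V => (trivializationAt F V v.proj r).2) ξ.1.proj ξ.1.snd)
  invFun c :=
    ⟨⟨⟨v.proj, (trivializationAt F V v.proj).symm v.proj c.1⟩, ((v.snd, c.2) : E × F)⟩,
      tangentMap_proj_mk _ _ _⟩
  left_inv := by
    rintro ⟨⟨⟨m, a⟩, w⟩, rfl⟩
    apply TqFiber.ext
    simp only [tangentMap]
    rw [mfderiv_triv (⟨m, a⟩ : TotalSpace F V), mfderiv_proj (⟨m, a⟩ : TotalSpace F V)]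
    rw [(trivializationAt F V m).symm_apply_apply_mk (FiberBundle.mem_baseSet_trivializationAt' m) a]
    rfl
  right_inv := by
    rintro ⟨a, b⟩
    obtain ⟨m, v⟩ := v
    refine Prod.ext ?_ ?_
    · dsimp only
      rw [(trivializationAt F V m).apply_mk_symm (FiberBundle.mem_baseSet_trivializationAt' m)]
    · dsimp only
      rw [mfderiv_triv (⟨m, (trivializationAt F V m).symm m a⟩ : TotalSpace F V)]
      rfl

/-- The vector space structure of the fibres of the vector bundle `T(q) : TA → TM`. The addition and the
scalar multiplication are the tangent maps of those of `A`, that is, in a trivialization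
`T(A|_U) ≅ TU × F × F` they are those of `F × F`. -/
instance [VectorBundle ℝ F V] (v : TM) : AddCommGroup (TqFiber F V v) :=
  (TqFiber.coord F V v).addCommGroup

instance [VectorBundle ℝ F V] (v : TM) : Module ℝ (TqFiber F V v) :=
  (TqFiber.coord F V v).module ℝ

variable [VectorBundle ℝ F V]

theorem hasMFDerivAt_line (m : M) (a b : V m) :
    HasMFDerivAt 𝓘(ℝ, ℝ) IA (fun t : ℝ => (⟨m, a + t • b⟩ : TotalSpace F V)) 0
      ((ContinuousLinearMap.toSpanSingleton ℝ
        (((0 : E), (trivializationAt F V m ⟨m, b⟩).2) : E × F)) : ℝ →L[ℝ] E × F) := by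
  have key : ∀ t : ℝ, (trivializationAt F V m ⟨m, a + t • b⟩).2 =
      (trivializationAt F V m ⟨m, a⟩).2 + t • (trivializationAt F V m ⟨m, b⟩).2 := by
    intro t
    have hl := (trivializationAt F V m).linear ℝ (FiberBundle.mem_baseSet_trivializationAt' m)
    rw [hl.map_add, hl.map_smul]
  have hcont : ContMDiff 𝓘(ℝ, ℝ) IA ∞
      (fun t : ℝ => (⟨m, a + t • b⟩ : TotalSpace F V)) := by
    intro t
    rw [contMDiffAt_totalSpace]
    refine ⟨contMDiffAt_const, ?_⟩
    simp only [key]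
    exact ContDiffAt.contMDiffAt (by fun_prop)
  refine ⟨hcont.continuous.continuousAt, ?_⟩
  apply HasFDerivAt.hasFDerivWithinAt
  have h1 : HasFDerivAt (fun t : ℝ => ((extChartAt IM m m,
      (trivializationAt F V m ⟨m, a⟩).2 + t • (trivializationAt F V m ⟨m, b⟩).2) : E × F))
      (ContinuousLinearMap.toSpanSingleton ℝ
        (((0 : E), (trivializationAt F V m ⟨m, b⟩).2) : E × F)) (0 : ℝ) := by
    rw [hasFDerivAt_iff_hasDerivAt]
    simp only [ContinuousLinearMap.toSpanSingleton_apply, one_smul]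
    refine (hasDerivAt_const _ _).prodMk ?_
    simpa using ((hasDerivAt_id (0 : ℝ)).smul_const (trivializationAt F V m ⟨m, b⟩).2).const_add
      (trivializationAt F V m ⟨m, a⟩).2
  refine h1.congr_of_eventuallyEq (Eventually.of_forall fun t => ?_)
  simp only [writtenInExtChartAt, Function.comp, FiberBundle.extChartAt]
  simp only [mfld_simps]
  refine Prod.ext ?_ ?_
  · rw [Trivialization.coe_fst' _ (FiberBundle.mem_baseSet_trivializationAt' m)]
  · exact key t

variable (E F) in
/-- The tangent vector to the fibre `A_m` at `a` that is parallel to `b ∈ A_m`. -/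
def verticalLift {m : M} (a b : V m) : TangentSpace IA (⟨m, a⟩ : TotalSpace F V) :=
  (mfderiv 𝓘(ℝ, ℝ) IA (fun t : ℝ => (⟨m, a + t • b⟩ : TotalSpace F V)) 0 :
    ℝ →L[ℝ] E × F) 1

theorem verticalLift_eq {m : M} (a b : V m) :
    verticalLift E F a b = (((0 : E), (trivializationAt F V m ⟨m, b⟩).2) : E × F) := by
  have h : (mfderiv 𝓘(ℝ, ℝ) IA
      (fun t : ℝ => (⟨m, a + t • b⟩ : TotalSpace F V)) 0 : ℝ →L[ℝ] E × F) = _ :=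
    (hasMFDerivAt_line (E := E) (F := F) m a b).mfderiv
  rw [verticalLift, h]
  exact one_smul ℝ _


variable [IsManifold 𝓘(ℝ, E) ∞ M] [ContMDiffVectorBundle ∞ F V 𝓘(ℝ, E)]

/-- The section `T(X)` of `T(q) : TA → TM`, the tangent map of the section `X : M → A`. -/
def tangentSection (X : ΓA) (v : TM) : TqFiber F V v :=
  ⟨tangentMap IM IA (fun m => (⟨m, X m⟩ : TotalSpace F V)) v, by
    rw [← tangentMap_comp_at (g := π F V) (I' := IA) (f := fun m => (⟨m, X m⟩ : TotalSpace F V)) v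
      ((hasMFDerivAt_proj _).mdifferentiableAt) X.mdifferentiableAt]
    exact congrFun tangentMap_id v⟩

theorem coreSection_aux (v : TM) (b : V v.proj) :
    tangentMap IA IM (π F V)
      ⟨⟨v.proj, 0⟩, mfderiv IM IA
        (fun m => (⟨m, 0⟩ : TotalSpace F V)) v.proj v.snd + verticalLift E F 0 b⟩ = v := by
  have h0 := (tangentSection (F := F) (V := V) 0 v).2
  refine Eq.trans ?_ h0
  simp only [tangentMap, tangentSection, mfderiv_proj, verticalLift_eq]
  refine congrArg (TotalSpace.mk _) ?_
  exact add_zero _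
  

/-- The section `X^` of `T(q) : TA → TM` that corresponds to the section `X` of the core of `TA`: its
value at `v ∈ T_m M` is the sum in `T_{0_m} A` of `T(0)(v)`, where `0 : M → A` is the zero section, and of
`X(m)`, regarded as a tangent vector at `0_m` to the fibre `A_m`. -/
def coreSection (X : ΓA) (v : TM) : TqFiber F V v :=
  ⟨⟨⟨v.proj, 0⟩,
    mfderiv IM IA (fun m => (⟨m, 0⟩ : TotalSpace F V)) v.proj v.snd +
    verticalLift E F 0 (X v.proj)⟩, coreSection_aux v (X v.proj)⟩

variable (E F V) in
/-- A smooth section of the vector bundle `T(q) : TA → TM`. -/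
structure TqSection where
  toFun : ∀ v : TM, TqFiber F V v
  smooth : ContMDiff (IM).tangent (IA).tangent ∞ (fun v : TM => (toFun v).1)

variable (E F V) in
/-- A linear vector field `(Ξ, x)` on the vector bundle `A`: a smooth vector field `vf = Ξ` on the
total space and a smooth vector field `base = x` on `M` such that `Ξ : A → TA` is a morphism of vector
bundles over `x : M → TM`, where `TA` is a vector bundle over `TM` by means of `T(q)`. -/
structure LinearVectorField where
  vf : ∀ p : TotalSpace F V, TangentSpace IA p
  base : ∀ m : M, TangentSpace IM m
  smooth_vf : ContMDiff IA (IA).tangent ∞ (fun p => (⟨p, vf p⟩ : TA))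
  smooth_base : ContMDiff IM (IM).tangent ∞ (fun m => (⟨m, base m⟩ : TM))
  proj_eq : ∀ (m : M) (a : V m),
    tangentMap IA IM (π F V) (⟨⟨m, a⟩, vf ⟨m, a⟩⟩ : TA) = ⟨m, base m⟩
  map_add : ∀ (m : M) (a b : V m),
    (⟨⟨⟨m, a + b⟩, vf ⟨m, a + b⟩⟩, proj_eq m (a + b)⟩ : TqFiber F V (⟨m, base m⟩ : TM)) =
      (⟨⟨⟨m, a⟩, vf ⟨m, a⟩⟩, proj_eq m a⟩ : TqFiber F V (⟨m, base m⟩ : TM)) +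
      (⟨⟨⟨m, b⟩, vf ⟨m, b⟩⟩, proj_eq m b⟩ : TqFiber F V (⟨m, base m⟩ : TM))
  map_smul : ∀ (m : M) (c : ℝ) (a : V m),
    (⟨⟨⟨m, c • a⟩, vf ⟨m, c • a⟩⟩, proj_eq m (c • a)⟩ : TqFiber F V (⟨m, base m⟩ : TM)) =
      c • (⟨⟨⟨m, a⟩, vf ⟨m, a⟩⟩, proj_eq m a⟩ : TqFiber F V (⟨m, base m⟩ : TM))

/-- The map of fibres `A_m → T(q)⁻¹(x(m))` given by a linear vector field `(Ξ, x)`. -/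
def LinearVectorField.fiberMap (Ξ : LinearVectorField E F V) (m : M) :
    V m →ₗ[ℝ] TqFiber F V (⟨m, Ξ.base m⟩ : TM) where
  toFun a := ⟨⟨⟨m, a⟩, Ξ.vf ⟨m, a⟩⟩, Ξ.proj_eq m a⟩
  map_add' := Ξ.map_add m
  map_smul' := Ξ.map_smul m

variable (E F V) in
/-- A Lie algebroid structure on the vector bundle `A`: an anchor `A → TM`, which is a smooth
morphism of vector bundles over `M`, and a real Lie bracket on the smooth sections, such that
`[X, fY] = f[X, Y] + (a(X)f)Y` and `a([X, Y]) = [a(X), a(Y)]`. -/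
structure LieAlgebroid where
  anchor : ∀ m : M, V m →L[ℝ] TangentSpace IM m
  smooth_anchor : ContMDiff IA (IM).tangent ∞
    (fun p : TotalSpace F V => (⟨p.proj, anchor p.proj p.snd⟩ : TM))
  bracket : ΓA → ΓA → ΓA
  add_bracket : ∀ X Y Z, bracket (X + Y) Z = bracket X Z + bracket Y Z
  smul_bracket : ∀ (c : ℝ) X Y, bracket (c • X) Y = c • bracket X Y
  bracket_antisymm : ∀ X Y, bracket X Y = -bracket Y X
  jacobi : ∀ X Y Z,
    bracket X (bracket Y Z) + bracket Y (bracket Z X) + bracket Z (bracket X Y) = 0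
  leibniz : ∀ (f : M → ℝ), ContMDiff IM 𝓘(ℝ, ℝ) ∞ f → ∀ X Y fY : ΓA, (∀ m, fY m = f m • Y m) →
    ∀ m, bracket X fY m = f m • bracket X Y m +
      derivAlong f (⟨m, anchor m (X m)⟩ : TM) • Y m
  anchor_bracket : ∀ X Y m, anchor m (bracket X Y m) =
    VectorField.mlieBracket IM (fun m => anchor m (X m)) (fun m => anchor m (Y m)) m

namespace LieAlgebroid

variable (L : LieAlgebroid E F V)

/-- The anchor as a map of total spaces `A → TM`. -/
def anchorMap (p : TotalSpace F V) : TM := ⟨p.proj, L.anchor p.proj p.snd⟩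

end LieAlgebroid

/-! ### The tangent Lie algebroid `TA → TM` -/

/-- The canonical involution of `T(TM)`. The coordinates of an element of `T(TM)` above `m` that are
used by Mathlib are those induced by the chart of `M` at `m`, and in the coordinates `(m, v; u, w)`
induced by a chart of `M` the involution exchanges `v` and `u`. -/
def canonicalInvolution (z : TangentBundle (IM).tangent TM) : TangentBundle (IM).tangent TM :=
  ⟨⟨z.proj.proj, (show E × E from z.snd).1⟩,
    (show E × E from ((show E from z.proj.snd), (show E × E from z.snd).2))⟩

/-- The anchor `TA → T(TM)` of the tangent Lie algebroid: the tangent map `T(a) : TA → T(TM)` of the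
anchor of `A`, followed by the canonical involution of `T(TM)`. -/
def LieAlgebroid.tangentAnchor (L : LieAlgebroid E F V) (ξ : TA) : TangentBundle (IM).tangent TM :=
  canonicalInvolution (tangentMap IA (IM).tangent L.anchorMap ξ)

/-- An expression of a section `σ` of `TA → TM`, near `v₀ ∈ TM`, as a combination
`∑ᵢ (αᵢ T(Xᵢ) + βᵢ Xᵢ^)` of the sections `T(X)` (`tangentSection`) and `X^`
(`coreSection`) with coefficients in `C^∞(TM)`.
Such an expression always exists. -/
structure Expansion (σ : ∀ v : TM, TqFiber F V v) (v₀ : TM) where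
  n : ℕ
  X : Fin n → ΓA
  α : Fin n → TM → ℝ
  β : Fin n → TM → ℝ
  smooth_α : ∀ i, ContMDiff (IM).tangent 𝓘(ℝ, ℝ) ∞ (α i)
  smooth_β : ∀ i, ContMDiff (IM).tangent 𝓘(ℝ, ℝ) ∞ (β i)
  eq : ∀ᶠ v in 𝓝 v₀, σ v = ∑ i, (α i v • tangentSection (X i) v + β i v • coreSection (X i) v)

/-- The value at `v` of the bracket of two sections of `TA → TM` which are expanded near `v`, as it
is forced by `[T(X), T(Y)] = T([X, Y])`, `[T(X), Y^] = [X, Y]^`, `[X^, Y^] = 0` and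
the Leibniz rule for the anchor of `TA`. -/
def LieAlgebroid.expansionBracket (L : LieAlgebroid E F V) {σ τ : ∀ v : TM, TqFiber F V v} {v : TM}
    (r : Expansion σ v) (s : Expansion τ v) : TqFiber F V v :=
  (∑ i, ∑ j, ((r.α i v * s.α j v) • tangentSection (L.bracket (r.X i) (s.X j)) v +
    (r.α i v * s.β j v + r.β i v * s.α j v) • coreSection (L.bracket (r.X i) (s.X j)) v)) +
  (∑ j, (derivAlong (s.α j) (L.tangentAnchor (σ v).1) • tangentSection (s.X j) v +
    derivAlong (s.β j) (L.tangentAnchor (σ v).1) • coreSection (s.X j) v)) -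
  (∑ i, (derivAlong (r.α i) (L.tangentAnchor (τ v).1) • tangentSection (r.X i) v +
    derivAlong (r.β i) (L.tangentAnchor (τ v).1) • coreSection (r.X i) v))

open Classical in
/-- The bracket of the tangent Lie algebroid `TA → TM`. The value of `expansionBracket` does not
depend on the expansions, so that it does not matter which ones are chosen. -/
def LieAlgebroid.tangentBracket (L : LieAlgebroid E F V) (σ τ : ∀ v : TM, TqFiber F V v) (v : TM) :
    TqFiber F V v :=
  if h : Nonempty (Expansion σ v) ∧ Nonempty (Expansion τ v) then
    L.expansionBracket h.1.some h.2.some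
  else 0

/-- `(Ξ, x)` is a morphic vector field: the vector bundle morphism `Ξ : A → TA` over `x : M → TM` is a
morphism of Lie algebroids, that is, it is compatible with the anchors, and whenever
`Ξ ∘ X = ∑ᵢ cᵢ (σᵢ ∘ x)` and `Ξ ∘ Y = ∑ⱼ dⱼ (τⱼ ∘ x)` with `cᵢ, dⱼ ∈ C^∞(M)` and with sections
`σᵢ, τⱼ` of `TA → TM`, then
`Ξ ∘ [X, Y] = ∑ᵢⱼ cᵢ dⱼ ([σᵢ, τⱼ] ∘ x) + ∑ⱼ a(X)(dⱼ) (τⱼ ∘ x) - ∑ᵢ a(Y)(cᵢ) (σᵢ ∘ x)`. -/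
structure LieAlgebroid.IsMorphic (L : LieAlgebroid E F V) (Ξ : LinearVectorField E F V) : Prop where
  anchor : ∀ p : TotalSpace F V, L.tangentAnchor (⟨p, Ξ.vf p⟩ : TA) =
    tangentMap IM (IM).tangent (fun m => (⟨m, Ξ.base m⟩ : TM)) (L.anchorMap p)
  bracket : ∀ (X Y : ΓA) (n k : ℕ) (c : Fin n → M → ℝ) (d : Fin k → M → ℝ)
    (σ : Fin n → TqSection E F V) (τ : Fin k → TqSection E F V),
    (∀ i, ContMDiff IM 𝓘(ℝ, ℝ) ∞ (c i)) → (∀ j, ContMDiff IM 𝓘(ℝ, ℝ) ∞ (d j)) →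
    (∀ m, Ξ.fiberMap m (X m) = ∑ i, c i m • (σ i).toFun ⟨m, Ξ.base m⟩) →
    (∀ m, Ξ.fiberMap m (Y m) = ∑ j, d j m • (τ j).toFun ⟨m, Ξ.base m⟩) →
    ∀ m, Ξ.fiberMap m (L.bracket X Y m) =
      (∑ i, ∑ j, (c i m * d j m) • L.tangentBracket (σ i).toFun (τ j).toFun ⟨m, Ξ.base m⟩) +
      (∑ j, derivAlong (d j) (L.anchorMap ⟨m, X m⟩) • (τ j).toFun ⟨m, Ξ.base m⟩) -
      (∑ i, derivAlong (c i) (L.anchorMap ⟨m, Y m⟩) • (σ i).toFun ⟨m, Ξ.base m⟩)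

/-! ### The covariant differential operator of a linear vector field -/

/-- The fibrewise linear function `ℓ_φ` on `A` of a section `φ` of the dual bundle. -/
def linearFunction (φ : ΓAd) (p : TotalSpace F V) : ℝ := φ p.proj p.snd

/-- The fibrewise linear function `ℓ_X` on the dual bundle of a section `X` of `A`. -/
def dualLinearFunction (X : ΓA) (ψ : Ad) : ℝ := ψ.snd (X ψ.proj)

theorem mfderiv_verticalLift {G : Type*} [NormedAddCommGroup G] [NormedSpace ℝ G]
    {g : TotalSpace F V → G} {m : M} {a b : V m} {c : G}
    (hg : MDifferentiableAt IA 𝓘(ℝ, G) g ⟨m, a⟩)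
    (hlin : ∀ t : ℝ, g ⟨m, a + t • b⟩ = g ⟨m, a⟩ + t • c) :
    mfderiv IA 𝓘(ℝ, G) g ⟨m, a⟩ (verticalLift E F a b) = c := by
  have h0 : (⟨m, a + (0 : ℝ) • b⟩ : TotalSpace F V) = ⟨m, a⟩ := by simp
  have hg' : HasMFDerivAt IA 𝓘(ℝ, G) g ((fun t : ℝ => (⟨m, a + t • b⟩ : TotalSpace F V)) 0)
      (mfderiv IA 𝓘(ℝ, G) g ⟨m, a⟩ : E × F →L[ℝ] G) := by
    dsimp only
    rw [h0]
    exact hg.hasMFDerivAt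
  have h1 := HasMFDerivAt.comp (0 : ℝ) hg' (hasMFDerivAt_line (E := E) (F := F) m a b)
  have h2 : HasFDerivAt (g ∘ fun t : ℝ => (⟨m, a + t • b⟩ : TotalSpace F V))
      ((mfderiv IA 𝓘(ℝ, G) g ⟨m, a⟩ : E × F →L[ℝ] G).comp (ContinuousLinearMap.toSpanSingleton ℝ
        (((0 : E), (trivializationAt F V m ⟨m, b⟩).2) : E × F))) (0 : ℝ) :=
    h1.hasFDerivAt
  have h3 : HasDerivAt (g ∘ fun t : ℝ => (⟨m, a + t • b⟩ : TotalSpace F V)) c (0 : ℝ) := by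
    have h4 : (g ∘ fun t : ℝ => (⟨m, a + t • b⟩ : TotalSpace F V)) =
        fun t : ℝ => g ⟨m, a⟩ + t • c := funext hlin
    rw [h4]
    simpa using ((hasDerivAt_id (0 : ℝ)).smul_const c).const_add (g ⟨m, a⟩)
  have h5 : (mfderiv IA 𝓘(ℝ, G) g ⟨m, a⟩ : E × F →L[ℝ] G)
      ((1 : ℝ) • ((0 : E), (trivializationAt F V m ⟨m, b⟩).2)) = (1 : ℝ) • c :=
    (HasDerivAt.unique (𝕜 := ℝ) (F := G) (hasFDerivAt_iff_hasDerivAt.mp h2) h3).trans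
      (one_smul ℝ c).symm
  rw [one_smul, one_smul] at h5
  rw [verticalLift_eq]
  exact h5

/-- The element of `A_m` whose vertical lift to `X(m)` is `T(X)(x(m)) - Ξ(X(m))`. -/
def LinearVectorField.verticalPart (Ξ : LinearVectorField E F V) (X : ΓA) (m : M) : V m :=
  (trivializationAt F V m).symm m
    ((show E × F from mfderiv IM IA (fun m => (⟨m, X m⟩ : TotalSpace F V)) m (Ξ.base m)).2 -
      (show E × F from Ξ.vf ⟨m, X m⟩).2)

theorem LinearVectorField.verticalLift_verticalPart (Ξ : LinearVectorField E F V) (X : ΓA) (m : M) :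
    (mfderiv IM IA (fun m => (⟨m, X m⟩ : TotalSpace F V)) m (Ξ.base m) -
      Ξ.vf ⟨m, X m⟩ : TangentSpace IA (⟨m, X m⟩ : TotalSpace F V)) =
    verticalLift E F (X m) (Ξ.verticalPart X m) := by
  rw [verticalLift_eq, verticalPart]
  have h1 := (tangentMap_proj_mk m (X m) (mfderiv IM IA (fun m => (⟨m, X m⟩ : TotalSpace F V)) m
    (Ξ.base m))).symm.trans (tangentSection X ⟨m, Ξ.base m⟩).2
  have h2 := (tangentMap_proj_mk m (X m) (Ξ.vf ⟨m, X m⟩)).symm.trans (Ξ.proj_eq m (X m))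
  have h3 := eq_of_heq (TotalSpace.mk.inj (h1.trans h2.symm)).2
  rw [(trivializationAt F V m).apply_mk_symm (FiberBundle.mem_baseSet_trivializationAt' m)]
  refine Prod.ext ?_ rfl
  exact sub_eq_zero.mpr h3

theorem mdifferentiable_linearFunction (φ : ΓAd) :
    MDifferentiable IA 𝓘(ℝ, ℝ) (linearFunction φ) := by
  have h1 : ContMDiff IA IAd ∞ (fun p : TotalSpace F V => (⟨p.proj, φ p.proj⟩ : Ad)) :=
    φ.contMDiff.comp (contMDiff_proj V)
  have h2 : ContMDiff IA IA ∞ (fun p : TotalSpace F V => (⟨p.proj, p.snd⟩ : TotalSpace F V)) :=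
    contMDiff_id
  have h3 := ContMDiff.clm_bundle_apply (E₂ := Bundle.Trivial M ℝ) (F₂ := ℝ) h1 h2
  have h4 : ContMDiff IA 𝓘(ℝ, ℝ) ∞ (linearFunction φ) := by
    intro p
    exact (contMDiffAt_totalSpace.1 (h3 p)).2
  exact h4.mdifferentiable (by simp)

theorem contMDiffAt_mfderiv_triv (e : Trivialization F (π F V)) [MemTrivializationAtlas e]
    {w : M → TA} (hw : ContMDiff IM (IA).tangent ∞ w) {m₀ : M} (h : (w m₀).proj ∈ e.source) :
    ContMDiffAt IM 𝓘(ℝ, F) ∞ (fun m => (show F from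
      mfderiv IA 𝓘(ℝ, F) (fun p : TotalSpace F V => (e p).2) (w m).proj (w m).snd)) m₀ := by
  have h1 : ContMDiffOn IA 𝓘(ℝ, F) ∞ (fun p : TotalSpace F V => (e p).2) e.source :=
    contMDiff_snd.comp_contMDiffOn e.contMDiffOn
  have h2 := h1.contMDiffOn_tangentMapWithin (m := ∞) (by simp) e.open_source.uniqueMDiffOn
  have hc : ContinuousAt (fun m => (w m).proj) m₀ :=
    ((FiberBundle.continuous_proj _ _).comp hw.continuous).continuousAt
  have h3 : ContMDiffAt IM 𝓘(ℝ, F).tangent ∞ (fun m => tangentMapWithin IA 𝓘(ℝ, F)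
      (fun p : TotalSpace F V => (e p).2) e.source (w m)) m₀ := by
    refine ContMDiffAt.comp m₀ (h2.contMDiffAt ?_) (hw m₀)
    exact (e.open_source.preimage (FiberBundle.continuous_proj _ _)).mem_nhds h
  have h4 := (contMDiff_snd_tangentBundle_modelSpace F 𝓘(ℝ, F)).contMDiffAt.comp m₀ h3
  refine h4.congr_of_eventuallyEq ?_
  filter_upwards [hc.preimage_mem_nhds (e.open_source.mem_nhds h)] with m hm
  simp only [Function.comp, tangentMapWithin]
  rw [mfderivWithin_of_isOpen e.open_source hm]

theorem LinearVectorField.contMDiff_verticalPart (Ξ : LinearVectorField E F V) (X : ΓA) :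
    ContMDiff IM (IA) ∞ (fun m => (⟨m, Ξ.verticalPart X m⟩ : TotalSpace F V)) := by
  intro m₀
  rw [contMDiffAt_section]
  have hw1 : ContMDiff IM (IA).tangent ∞ (fun m => tangentMap IM IA
      (fun m => (⟨m, X m⟩ : TotalSpace F V)) (⟨m, Ξ.base m⟩ : TM)) :=
    (X.contMDiff.contMDiff_tangentMap (m := ∞) (by simp)).comp Ξ.smooth_base
  have hw2 : ContMDiff IM (IA).tangent ∞ (fun m => (⟨⟨m, X m⟩, Ξ.vf ⟨m, X m⟩⟩ : TA)) :=
    Ξ.smooth_vf.comp X.contMDiff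
  have hm₀ : (⟨m₀, X m₀⟩ : TotalSpace F V) ∈ (trivializationAt F V m₀).source :=
    FiberBundle.mem_trivializationAt_proj_source (x := (⟨m₀, X m₀⟩ : TotalSpace F V))
  refine ((contMDiffAt_mfderiv_triv (trivializationAt F V m₀) hw1 hm₀).sub
    (contMDiffAt_mfderiv_triv (trivializationAt F V m₀) hw2 hm₀)).congr_of_eventuallyEq ?_
  filter_upwards [(trivializationAt F V m₀).open_baseSet.mem_nhds
    (FiberBundle.mem_baseSet_trivializationAt' m₀)] with m hm
  have hg : MDifferentiableAt IA 𝓘(ℝ, F) (fun p : TotalSpace F V =>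
      (trivializationAt F V m₀ p).2) ⟨m, X m⟩ :=
    ((contMDiff_snd.comp_contMDiffOn (trivializationAt F V m₀).contMDiffOn).contMDiffAt
      ((trivializationAt F V m₀).open_source.mem_nhds
        ((trivializationAt F V m₀).mem_source.2 hm))).mdifferentiableAt (n := ∞) (by simp)
  have hl := (trivializationAt F V m₀).linear ℝ hm
  have key := mfderiv_verticalLift (E := E) hg (b := Ξ.verticalPart X m) (fun t => by rw [hl.map_add, hl.map_smul])
  rw [← Ξ.verticalLift_verticalPart X m, map_sub] at key
  exact key.symm

/-- The operator `D_Ξ : ΓA → ΓA` of a linear vector field `(Ξ, x)`: the vertical lift of `D_Ξ(X)(m)` to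
`X(m)` is `T(X)(x(m)) - Ξ(X(m))`. -/
def LinearVectorField.operator (Ξ : LinearVectorField E F V) (X : ΓA) : ΓA :=
  ⟨Ξ.verticalPart X, Ξ.contMDiff_verticalPart X⟩

/-- `⟨φ, D_Ξ(X)⟩ = x(⟨φ, X⟩) - Ξ(ℓ_φ) ∘ X` for all `X ∈ ΓA` and all sections `φ` of the dual bundle. -/
theorem LinearVectorField.apply_operator (Ξ : LinearVectorField E F V) (X : ΓA) (φ : ΓAd) (m : M) :
    φ m (Ξ.operator X m) =
      derivAlong (fun m => φ m (X m)) (⟨m, Ξ.base m⟩ : TM) -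
        derivAlong (linearFunction φ) (⟨⟨m, X m⟩, Ξ.vf ⟨m, X m⟩⟩ : TA) := by
  have key := mfderiv_verticalLift (E := E) (mdifferentiable_linearFunction φ ⟨m, X m⟩)
    (b := Ξ.verticalPart X m) (c := φ m (Ξ.verticalPart X m))
    (fun t => ((φ m : V m →L[ℝ] ℝ).map_add _ _).trans
      (congrArg _ ((φ m : V m →L[ℝ] ℝ).map_smul _ _)))
  rw [← Ξ.verticalLift_verticalPart X m, map_sub] at key
  refine key.symm.trans ?_
  refine congrArg₂ (· - ·) ?_ rfl
  have := mfderiv_comp (I' := IA) m (mdifferentiable_linearFunction φ ⟨m, X m⟩)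
    (X.mdifferentiableAt (x := m))
  exact (congrArg (fun A : E →L[ℝ] ℝ => A (Ξ.base m)) this).symm


/-- `D : ΓA → ΓA` is a derivation of the bracket of the Lie algebroid. -/
def LieAlgebroid.IsDerivation (L : LieAlgebroid E F V) (D : ΓA → ΓA) : Prop :=
  ∀ X Y, D (L.bracket X Y) = L.bracket (D X) Y + L.bracket X (D Y)

/-! ### The dual Poisson structure and the dual vector field -/

/-- A section `X` of `A` and a function `f` on `M` such that `G` and `ℓ_X + f ∘ q` have the same
differential at the point `ψ` of the dual bundle. They exist for every smooth `G`. -/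
structure LinearApprox (G : Ad → ℝ) (ψ : Ad) where
  X : ΓA
  f : M → ℝ
  smooth_f : ContMDiff IM 𝓘(ℝ, ℝ) ∞ f
  eq : mfderiv IAd 𝓘(ℝ, ℝ) G ψ =
    mfderiv IAd 𝓘(ℝ, ℝ) (fun η : Ad => dualLinearFunction X η + f η.proj) ψ

open Classical in
/-- The Poisson bracket of functions on the dual of a Lie algebroid: the bracket is a derivation in
each argument, so that its value at `ψ` only depends on the differentials at `ψ`, and
`{ℓ_X, ℓ_Y} = ℓ_[X, Y]`, `{ℓ_X, g ∘ q} = a(X)(g) ∘ q`, `{f ∘ q, g ∘ q} = 0`. -/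
def LieAlgebroid.poissonBracket (L : LieAlgebroid E F V) (G K : Ad → ℝ) (ψ : Ad) : ℝ :=
  if h : Nonempty (LinearApprox G ψ) ∧ Nonempty (LinearApprox K ψ) then
    dualLinearFunction (L.bracket h.1.some.X h.2.some.X) ψ +
      derivAlong h.2.some.f (L.anchorMap ⟨ψ.proj, h.1.some.X ψ.proj⟩) -
      derivAlong h.1.some.f (L.anchorMap ⟨ψ.proj, h.2.some.X ψ.proj⟩)
  else 0

/-- A vector field on the dual of a Lie algebroid is Poisson if it is a derivation of the Poisson
bracket of smooth functions. -/
def LieAlgebroid.IsPoisson (L : LieAlgebroid E F V) (H : ∀ ψ : Ad, TangentSpace IAd ψ) : Prop :=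
  ∀ G K : Ad → ℝ, ContMDiff IAd 𝓘(ℝ, ℝ) ∞ G → ContMDiff IAd 𝓘(ℝ, ℝ) ∞ K → ∀ ψ : Ad,
    derivAlong (L.poissonBracket G K) (⟨ψ, H ψ⟩ : TangentBundle IAd Ad) =
      L.poissonBracket (fun η => derivAlong G (⟨η, H η⟩ : TangentBundle IAd Ad)) K ψ +
      L.poissonBracket G (fun η => derivAlong K (⟨η, H η⟩ : TangentBundle IAd Ad)) ψ

/-- `h` is the value at the point `ψ` of the dual vector field `Ξ_*` of `(Ξ, x)`, which is the vector
field on the dual bundle with `Ξ_*(ℓ_X) = ℓ_{D_Ξ(X)}` for `X ∈ ΓA` and `Ξ_*(f ∘ q) = x(f) ∘ q` for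
`f ∈ C^∞(M)`. -/
def LinearVectorField.IsDualAt (Ξ : LinearVectorField E F V) (ψ : Ad) (h : TangentSpace IAd ψ) : Prop :=
  (∀ X : ΓA, derivAlong (dualLinearFunction X) (⟨ψ, h⟩ : TangentBundle IAd Ad) =
    dualLinearFunction (Ξ.operator X) ψ) ∧
  ∀ f : M → ℝ, ContMDiff IM 𝓘(ℝ, ℝ) ∞ f →
    derivAlong (fun η : Ad => f η.proj) (⟨ψ, h⟩ : TangentBundle IAd Ad) =
      derivAlong f (⟨ψ.proj, Ξ.base ψ.proj⟩ : TM)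

theorem mdifferentiable_dualLinearFunction (X : ΓA) :
    MDifferentiable IAd 𝓘(ℝ, ℝ) (dualLinearFunction X) := by
  have h1 : ContMDiff IAd IAd ∞ (fun p : Ad => (⟨p.proj, p.snd⟩ : Ad)) :=
    contMDiff_id
  have h2 : ContMDiff IAd IA ∞ (fun p : Ad => (⟨p.proj, X p.proj⟩ : TotalSpace F V)) :=
    X.contMDiff.comp (contMDiff_proj (fun m : M => V m →L[ℝ] ℝ))
  have h3 := ContMDiff.clm_bundle_apply (E₂ := Bundle.Trivial M ℝ) (F₂ := ℝ) h1 h2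
  have h4 : ContMDiff IAd 𝓘(ℝ, ℝ) ∞ (dualLinearFunction X) := by
    intro p
    exact (contMDiffAt_totalSpace.1 (h3 p)).2
  exact h4.mdifferentiable (by simp)

theorem LinearVectorField.snd_add (Ξ : LinearVectorField E F V) (m : M) (a b : V m) :
    (show E × F from Ξ.vf ⟨m, a + b⟩).2 =
      (show E × F from Ξ.vf ⟨m, a⟩).2 + (show E × F from Ξ.vf ⟨m, b⟩).2 := by
  have h := congrArg (fun ξ => (TqFiber.coord F V (⟨m, Ξ.base m⟩ : TM) ξ).2) (Ξ.map_add m a b)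
  simp only [Equiv.add_def, Equiv.apply_symm_apply, Prod.snd_add] at h
  simp only [TqFiber.coord, Equiv.coe_fn_mk] at h
  rw [mfderiv_triv (⟨m, a⟩ : TotalSpace F V), mfderiv_triv (⟨m, b⟩ : TotalSpace F V),
    mfderiv_triv (⟨m, a + b⟩ : TotalSpace F V)] at h
  exact h

theorem LinearVectorField.snd_smul (Ξ : LinearVectorField E F V) (m : M) (c : ℝ) (a : V m) :
    (show E × F from Ξ.vf ⟨m, c • a⟩).2 = c • (show E × F from Ξ.vf ⟨m, a⟩).2 := by
  have h := congrArg (fun ξ => (TqFiber.coord F V (⟨m, Ξ.base m⟩ : TM) ξ).2) (Ξ.map_smul m c a)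
  simp only [Equiv.smul_def, Equiv.apply_symm_apply, Prod.smul_snd] at h
  simp only [TqFiber.coord, Equiv.coe_fn_mk] at h
  rw [mfderiv_triv (⟨m, a⟩ : TotalSpace F V), mfderiv_triv (⟨m, c • a⟩ : TotalSpace F V)] at h
  exact h

theorem LinearVectorField.exists_isDualAt [FiniteDimensional ℝ F] (Ξ : LinearVectorField E F V)
    (ψ : Ad) : ∃ h, Ξ.IsDualAt ψ h := by
  obtain ⟨m, ψ⟩ := ψ
  have hm := FiberBundle.mem_baseSet_trivializationAt' (F := F) (E := V) m
  let e := trivializationAt F V m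
  let ψe : F →L[ℝ] ℝ := ψ.comp (e.symmL ℝ m)
  -- a section of the dual bundle through `ψ` that is constant in the trivialization
  let φ : ∀ m' : M, V m' →L[ℝ] ℝ := fun m' => ψe.comp (e.continuousLinearMapAt ℝ m')
  have hφm : φ m = ψ := by
    ext a
    exact congrArg ψ (e.symmL_continuousLinearMapAt hm a)
  have hφ : MDifferentiableAt IM IAd (fun m' => (⟨m', φ m'⟩ : Ad)) m := by
    rw [mdifferentiableAt_totalSpace]
    refine ⟨mdifferentiableAt_id, ?_⟩
    refine (mdifferentiableAt_const (c := ψe)).congr_of_eventuallyEq ?_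
    filter_upwards [e.open_baseSet.mem_nhds hm] with m' hm'
    change (trivializationAt (F →L[ℝ] ℝ) (fun m : M => V m →L[ℝ] Bundle.Trivial M ℝ m) m
      ⟨m', φ m'⟩).2 = ψe
    rw [hom_trivializationAt_apply]
    dsimp only
    rw [ContinuousLinearMap.inCoordinates_eq hm' (mem_univ _)]
    ext b
    have h1 : e.continuousLinearMapAt ℝ m' ((e.continuousLinearEquivAt ℝ m' hm').symm b) = b := by
      rw [← e.coe_continuousLinearEquivAt_eq (R := ℝ) hm']
      exact (e.continuousLinearEquivAt ℝ m' hm').apply_symm_apply b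
    exact congrArg ψe h1
  let B : F →ₗ[ℝ] ℝ :=
    { toFun := fun b => ψe ((show E × F from Ξ.vf ⟨m, e.symmL ℝ m b⟩).2)
      map_add' := fun b b' => by rw [_root_.map_add, Ξ.snd_add, _root_.map_add]
      map_smul' := fun c b => by rw [_root_.map_smul, Ξ.snd_smul, _root_.map_smul]; rfl }
  let η : V m →L[ℝ] ℝ := (LinearMap.toContinuousLinearMap B).comp (e.continuousLinearMapAt ℝ m)
  have hη : ∀ a : V m, η a = ψe ((show E × F from Ξ.vf ⟨m, a⟩).2) := by
    intro a
    change ψe ((show E × F from Ξ.vf ⟨m, e.symmL ℝ m (e.continuousLinearMapAt ℝ m a)⟩).2) = _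
    rw [e.symmL_continuousLinearMapAt hm a]
  have main : ∃ h, Ξ.IsDualAt ⟨m, φ m⟩ h := by
    refine ⟨mfderiv IM IAd (fun m' => (⟨m', φ m'⟩ : Ad)) m (Ξ.base m) -
      verticalLift E (F →L[ℝ] ℝ) (V := fun m : M => V m →L[ℝ] ℝ) (φ m) η, fun X => ?_, fun f hf => ?_⟩
    · have h1 := mfderiv_verticalLift (E := E) (F := F →L[ℝ] ℝ) (V := fun m : M => V m →L[ℝ] ℝ)
        (a := φ m) (b := η) (c := η (X m)) (mdifferentiable_dualLinearFunction X ⟨m, φ m⟩)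
        (fun t => rfl)
      have h2 := mfderiv_comp (I' := IAd) m (mdifferentiable_dualLinearFunction X ⟨m, φ m⟩) hφ
      have h3 : HasMFDerivAt IA 𝓘(ℝ, ℝ) (fun p : TotalSpace F V => ψe (e p).2) ⟨m, X m⟩
          (ψe.comp (ContinuousLinearMap.snd ℝ E F)) :=
        HasMFDerivAt.comp (I' := 𝓘(ℝ, F)) (⟨m, X m⟩ : TotalSpace F V) ψe.hasMFDerivAt
          (hasMFDerivAt_triv (⟨m, X m⟩ : TotalSpace F V))
      have h4 := HasMFDerivAt.comp (I' := IA) m h3 (X.mdifferentiableAt (x := m)).hasMFDerivAt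
      have h5 : (dualLinearFunction X ∘ fun m' => (⟨m', φ m'⟩ : Ad)) =ᶠ[𝓝 m]
          ((fun p : TotalSpace F V => ψe (e p).2) ∘ fun m' => (⟨m', X m'⟩ : TotalSpace F V)) := by
        filter_upwards [e.open_baseSet.mem_nhds hm] with m' hm'
        exact congrArg ψe (e.continuousLinearMapAt_apply_of_mem ℝ hm' (X m'))
      have h6 := (h4.congr_of_eventuallyEq h5).mfderiv.symm.trans h2
      have h7 : ψe (show E × F from mfderiv IM IA (fun m => (⟨m, X m⟩ : TotalSpace F V)) m
            (Ξ.base m)).2 =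
          mfderiv IAd 𝓘(ℝ, ℝ) (dualLinearFunction X) ⟨m, φ m⟩
            (mfderiv IM IAd (fun m' => (⟨m', φ m'⟩ : Ad)) m (Ξ.base m)) :=
        congrArg (fun A : E →L[ℝ] ℝ => A (Ξ.base m)) h6
      have h8 : φ m (Ξ.verticalPart X m) =
          ψe (show E × F from mfderiv IM IA (fun m => (⟨m, X m⟩ : TotalSpace F V)) m
            (Ξ.base m)).2 - ψe (show E × F from Ξ.vf ⟨m, X m⟩).2 := by
        rw [hφm, ← ContinuousLinearMap.map_sub ψe]
        change _ = ψ (e.symmL ℝ m _)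
        rw [e.symmL_apply hm]
        rfl
      refine Eq.trans ?_ h8.symm
      refine (ContinuousLinearMap.map_sub
        (mfderiv IAd 𝓘(ℝ, ℝ) (dualLinearFunction X) ⟨m, φ m⟩) _ _).trans ?_
      exact congrArg₂ (fun a b : ℝ => a - b) h7.symm (h1.trans (hη (X m)))
    · have h1 := mfderiv_verticalLift (E := E) (F := F →L[ℝ] ℝ) (V := fun m : M => V m →L[ℝ] ℝ)
        (a := φ m) (b := η) (c := (0 : ℝ)) (g := fun p => f p.proj)
        ((hf.comp (contMDiff_proj (fun m : M => V m →L[ℝ] ℝ))).mdifferentiable (by simp) ⟨m, φ m⟩)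
        (fun t => by simp)
      have h2 := mfderiv_comp (I' := IAd) m (g := fun p : Ad => f p.proj)
        ((hf.comp (contMDiff_proj (fun m : M => V m →L[ℝ] ℝ))).mdifferentiable (by simp) ⟨m, φ m⟩) hφ
      refine (ContinuousLinearMap.map_sub
        (mfderiv IAd 𝓘(ℝ, ℝ) (fun p : Ad => f p.proj) ⟨m, φ m⟩) _ _).trans ?_
      refine (congrArg₂ (fun a b : ℝ => a - b)
        (congrArg (fun A : E →L[ℝ] ℝ => A (Ξ.base m)) h2).symm h1).trans ?_
      exact sub_zero _
  rwa [hφm] at main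

/-- The dual vector field `Ξ_*` on the dual bundle of a linear vector field `(Ξ, x)`. -/
def LinearVectorField.dual [FiniteDimensional ℝ F] (Ξ : LinearVectorField E F V) (ψ : Ad) :
    TangentSpace IAd ψ :=
  (Ξ.exists_isDualAt ψ).choose


/-! ### Flows -/

section Flow

variable {E' H' N : Type*} [NormedAddCommGroup E'] [NormedSpace ℝ E'] [TopologicalSpace H']
  {J : ModelWithCorners ℝ E' H'} [TopologicalSpace N] [ChartedSpace H' N]

/-- The set of the points at which the time `t` flow of the vector field `y` is defined. -/
def flowDomain (y : ∀ p : N, TangentSpace J p) (t : ℝ) : Set N :=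
  {p | ∃ γ : ℝ → N, γ 0 = p ∧ IsMIntegralCurveOn γ y (uIcc 0 t)}

open Classical in
/-- The time `t` flow of the vector field `y`; its values outside `flowDomain y t` are irrelevant. -/
def flow (y : ∀ p : N, TangentSpace J p) (t : ℝ) (p : N) : N :=
  if h : ∃ γ : ℝ → N, γ 0 = p ∧ IsMIntegralCurveOn γ y (uIcc 0 t) then h.choose t else p

/-- `f` restricts to a diffeomorphism from the open set `U` onto the open set `U'`. -/
def IsLocalDiffeo (J : ModelWithCorners ℝ E' H') (U U' : Set N) (f : N → N) : Prop :=
  ∃ e : OpenPartialHomeomorph N N, e.source = U ∧ e.target = U' ∧ EqOn e f U ∧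
    ContMDiffOn J J ∞ e U ∧ ContMDiffOn J J ∞ e.symm U'

end Flow

/-- `Φ` restricts to an isomorphism of Lie algebroids from the restriction of `A` to the open set `U`
onto the restriction of `A` to the open set `U'`, over `f : U → U'`. -/
structure LieAlgebroid.IsLocalAutomorphism (L : LieAlgebroid E F V) (U U' : Set M) (f : M → M)
    (Φ : TotalSpace F V → TotalSpace F V) : Prop where
  diffeo_base : IsLocalDiffeo IM U U' f
  diffeo_total : IsLocalDiffeo IA (π F V ⁻¹' U) (π F V ⁻¹' U') Φ
  linear : ∃ Λ : ∀ m, V m →ₗ[ℝ] V (f m), ∀ m ∈ U, ∀ a : V m, Φ ⟨m, a⟩ = ⟨f m, Λ m a⟩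
  anchor : ∀ p : TotalSpace F V, p.proj ∈ U →
    L.anchorMap (Φ p) = tangentMap IM IM f (L.anchorMap p)
  bracket : ∀ W : Set M, IsOpen W → W ⊆ U → ∀ X Y X' Y' : ΓA,
    (∀ m ∈ W, Φ ⟨m, X m⟩ = ⟨f m, X' (f m)⟩) → (∀ m ∈ W, Φ ⟨m, Y m⟩ = ⟨f m, Y' (f m)⟩) →
    ∀ m ∈ W, Φ ⟨m, L.bracket X Y m⟩ = ⟨f m, L.bracket X' Y' (f m)⟩

/-- The flows of `Ξ` are local Lie algebroid automorphisms over the flows of `x`: for every time `t`,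
the flow of `Ξ` is defined over the domain of the flow of `x`, and it is an isomorphism of Lie
algebroids onto the restriction of `A` to the range of the flow of `x`. -/
def LieAlgebroid.FlowsAreLocalAutomorphisms (L : LieAlgebroid E F V) (Ξ : LinearVectorField E F V) :
    Prop :=
  ∀ t : ℝ, flowDomain Ξ.vf t = π F V ⁻¹' flowDomain Ξ.base t ∧
    L.IsLocalAutomorphism (flowDomain Ξ.base t) (flowDomain Ξ.base (-t))
      (flow Ξ.base t) (flow Ξ.vf t)

end LieAlgebroidTheory

end

/-! Each condition is compared with the third one, that `D = D_Ξ` is a derivation. Identities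
between vectors are tested on functions throughout: elements of `A` on dual sections, an element `ξ`
of a fibre of `T(q)` on the value of `ℓ_φ` at its base point and on `dℓ_φ(ξ)`
(`TqFiber.ext_pairing`), vectors of `T(TM)` on the functions `f ∘ π` and `df`
(`tangentBundle_tangent_ext`). Bump functions make local charts and frames global.

The anchor: expanding `D[X, fY]` in two ways shows that a derivation satisfies `a(DX) = [x, a(X)]`
(`IsDerivation.anchorCompatible`). This relation is equivalent to the anchor half of the morphism
condition (`anchor_iff_anchorCompatible`), because the involution `J` does not change the derivative
of `df`: second derivatives are symmetric.

1 ⇔ 3: one has `Ξ ∘ X = (T(X) - (DX)^) ∘ x` (`LinearVectorField.fiberMap_eq`). Once the anchor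
condition holds, the right hand side of the bracket condition is `T([X,Y]) - ([DX,Y] + [X,DY])^`
along `x`, whatever decompositions are used (`AnchorCompatible.bracket_sum_eq`), while the left hand
side is `T([X,Y]) - (D[X,Y])^`.

2 ⇔ 3: on the functions `ℓ_X` the Poisson condition is the derivation identity. Conversely a
derivation gives the Poisson condition for the functions `ℓ_X + f ∘ q`. Near a point these include
the coordinates of a chart of the dual bundle, and the passage to all functions rests on the
symmetry of second derivatives (`exists_coordinate_expansion`).

4 ⇔ 3: smooth local flows come from the inverse function theorem on a space of paths. Since `Ξ` is
linear on the fibres, its integral curves exist as long as those of `x` do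
(`LinearVectorField.flowDomain_vf`). Let `X_k`, `Y_k` be the sections transported by the time `k`
flow. The derivatives in `k` of `⟨φ, [X_k, Y_k]⟩` and of the pairing of `φ` with the transported
value of `[X, Y]` have the same form, except that the first contains the failure of `D` to be a
derivation (`AnchorCompatible.hasDerivAt_bracket`). If `D` is a derivation, the difference solves a
linear system which is locally finite and vanishes at time `0`, so it is zero
(`eq_zero_of_linear_system`). If the flows preserve brackets, comparing derivatives at `k = 0` kills
the failure. Compatibility of the flow with the anchor is treated in the same way. -/

noncomputable section

namespace LieAlgebroidTheory

/-! ### Smoothness of local flows in Banach spaces, by the inverse function theorem on path space -/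

section SmoothODE

open scoped unitInterval
open MeasureTheory intervalIntegral

universe u

set_option linter.unusedSectionVars false
set_option synthInstance.maxHeartbeats 200000

variable {E F : Type u} [NormedAddCommGroup E] [NormedSpace ℝ E]
  [NormedAddCommGroup F] [NormedSpace ℝ F]

/-- The pointwise product of continuous paths given by a continuous bilinear map. -/
def pathBilin {G : Type u} [NormedAddCommGroup G] [NormedSpace ℝ G] (B : G →L[ℝ] E →L[ℝ] F) :
    C(I, G) →L[ℝ] C(I, E) →L[ℝ] C(I, F) :=
  LinearMap.mkContinuous₂
    (LinearMap.mk₂ ℝ (fun (A : C(I, G)) (β : C(I, E)) =>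
        (⟨fun t => B (A t) (β t), by fun_prop⟩ : C(I, F)))
      (fun _ _ _ => by ext; simp) (fun _ _ _ => by ext; simp)
      (fun _ _ _ => by ext; simp) (fun _ _ _ => by ext; simp)) ‖B‖
    (fun A β => by
      rw [ContinuousMap.norm_le _ (by positivity)]
      intro t
      refine (B.le_opNorm₂ (A t) (β t)).trans ?_
      have h1 := ContinuousMap.norm_coe_le_norm A t
      have h2 := ContinuousMap.norm_coe_le_norm β t
      gcongr)

theorem contDiff_pathBilin_comp {G H : Type u} [NormedAddCommGroup G] [NormedSpace ℝ G]
    [NormedAddCommGroup H] [NormedSpace ℝ H] (B : G →L[ℝ] E →L[ℝ] F) {n : WithTop ℕ∞}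
    {g : H → C(I, G)} (hg : ContDiff ℝ n g) : ContDiff ℝ n (fun z => pathBilin B (g z)) :=
  have h : IsBoundedLinearMap ℝ (fun A : C(I, G) => pathBilin B A) :=
    { map_add := fun _ _ => map_add _ _ _
      map_smul := fun _ _ => map_smul _ _ _
      bound := by
        -- The constant has to be strictly positive, and `‖B‖` may vanish.
        refine ⟨‖B‖ + 1, by positivity, fun A => ?_⟩
        refine ContinuousLinearMap.opNorm_le_bound _ (by positivity) fun β => ?_
        rw [ContinuousMap.norm_le _ (by positivity)]
        intro t
        refine (B.le_opNorm₂ (A t) (β t)).trans ?_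
        have h1 := ContinuousMap.norm_coe_le_norm A t
        have h2 := ContinuousMap.norm_coe_le_norm β t
        gcongr
        linarith }
  h.contDiff.comp hg

/-- Pointwise application of a continuous family of operators to a continuous path. -/
def pathApply : C(I, E →L[ℝ] F) →L[ℝ] C(I, E) →L[ℝ] C(I, F) :=
  pathBilin (ContinuousLinearMap.id ℝ (E →L[ℝ] F))

/-- The map of path spaces given by composition with a continuous map. -/
def pathComp (f : C(E, F)) (α : C(I, E)) : C(I, F) := f.comp α

theorem continuous_pathComp (f : C(E, F)) : Continuous (pathComp f) :=
  ContinuousMap.continuous_postcomp f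

/-- Composition with `f'` is continuous for the uniform norm. This gives one radius around `α(t)`,
the same for all `t`, on which `f'` varies by at most `c`; the mean value inequality then bounds the
remainder uniformly in `t`. -/
theorem hasFDerivAt_pathComp {f : C(E, F)} {f' : C(E, E →L[ℝ] F)}
    (hf : ∀ x, HasFDerivAt f (f' x) x) (α : C(I, E)) :
    HasFDerivAt (pathComp f) (pathApply (pathComp f' α)) α := by
  rw [hasFDerivAt_iff_isLittleO_nhds_zero, Asymptotics.isLittleO_iff]
  intro c hc
  have h1 := (continuous_pathComp f').continuousAt (x := α)
  rw [Metric.continuousAt_iff] at h1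
  obtain ⟨δ, hδ, h⟩ := h1 c hc
  filter_upwards [Metric.ball_mem_nhds (0 : C(I, E)) hδ] with β hβ
  rw [mem_ball_zero_iff] at hβ
  rw [ContinuousMap.norm_le _ (by positivity)]
  intro t
  have key : ∀ y ∈ Metric.ball (α t) δ, ‖f' y - f' (α t)‖ ≤ c := by
    intro y hy
    -- A translate of `α` that passes through `y` at the time `t` turns closeness of points into
    -- closeness of paths.
    have h2 : dist (α + ContinuousMap.const I (y - α t)) α < δ := by
      rw [dist_eq_norm, add_sub_cancel_left]
      refine lt_of_le_of_lt ((ContinuousMap.norm_le _ (norm_nonneg (y - α t))).2 fun s => le_rfl) ?_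
      rwa [← dist_eq_norm]
    have h3 := (ContinuousMap.dist_apply_le_dist (f := pathComp f' _) (g := pathComp f' α) t).trans
      (h h2).le
    simp only [pathComp, ContinuousMap.comp_apply, ContinuousMap.add_apply,
      ContinuousMap.const_apply, add_sub_cancel, dist_eq_norm] at h3
    exact h3
  have h4 : α t + β t ∈ Metric.ball (α t) δ := by
    rw [mem_ball_iff_norm, add_sub_cancel_left]
    exact (ContinuousMap.norm_coe_le_norm β t).trans_lt hβ
  have h5 := (convex_ball (α t) δ).norm_image_sub_le_of_norm_hasFDerivWithin_le'
    (f := f) (f' := f') (φ := f' (α t))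
    (fun y _ => (hf y).hasFDerivWithinAt) key (Metric.mem_ball_self hδ) h4
  rw [add_sub_cancel_left] at h5
  refine (le_of_eq ?_).trans (h5.trans (by gcongr; exact ContinuousMap.norm_coe_le_norm β t))
  rfl

/-- The derivative of `α ↦ f ∘ α` is pointwise multiplication by `f' ∘ α`, again a composition
operator followed by a continuous linear map. The induction therefore has to range over all targets,
as `f'` takes values in `E →L[ℝ] F`; a common universe for `E` and `F` keeps this space in range. -/
theorem contDiff_pathComp_nat (n : ℕ) : ∀ {F : Type u} [NormedAddCommGroup F] [NormedSpace ℝ F]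
    (f : C(E, F)), ContDiff ℝ n f → ContDiff ℝ n (pathComp f) := by
  induction n with
  | zero =>
    intro F _ _ f _
    exact contDiff_zero.2 (continuous_pathComp f)
  | succ n ih =>
    intro F _ _ f hf
    have hf' : ContDiff ℝ n (fderiv ℝ f) := hf.fderiv_right (by simp)
    let f' : C(E, E →L[ℝ] F) := ⟨fderiv ℝ f, hf'.continuous⟩
    have hd : ∀ x, HasFDerivAt f (f' x) x := fun x =>
      ((hf.differentiable (by simp)) x).hasFDerivAt
    rw [show ((n + 1 : ℕ) : WithTop ℕ∞) = n + 1 by simp, contDiff_succ_iff_hasFDerivAt]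
    exact ⟨fun α => pathApply (pathComp f' α), contDiff_pathBilin_comp _ (ih f' hf'),
      fun α => hasFDerivAt_pathComp hd α⟩

theorem contDiff_pathComp (f : C(E, F)) (hf : ContDiff ℝ ∞ f) : ContDiff ℝ ∞ (pathComp f) :=
  contDiff_infty.2 fun n => contDiff_pathComp_nat n f (contDiff_infty.1 hf n)

/-- The primitive of a path that vanishes at `0`. -/
def pathPrimitive : C(I, E) →L[ℝ] C(I, E) :=
  have hc : ∀ β : C(I, E), Continuous (fun s : ℝ => β (projIcc 0 1 zero_le_one s)) := fun β =>
    β.continuous.comp continuous_projIcc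
  LinearMap.mkContinuous
    { toFun := fun β => ⟨fun t => ∫ s in (0 : ℝ)..t, β (projIcc 0 1 zero_le_one s),
        (continuous_primitive (fun a b => (hc β).intervalIntegrable a b) 0).comp
          continuous_subtype_val⟩
      map_add' := fun β β' => by
        ext t
        exact integral_add ((hc β).intervalIntegrable _ _) ((hc β').intervalIntegrable _ _)
      map_smul' := fun c β => by
        ext t
        exact intervalIntegral.integral_smul c _ } 1
    (fun β => by
      rw [one_mul, ContinuousMap.norm_le _ (by positivity)]
      intro t
      refine (norm_integral_le_of_norm_le_const (C := ‖β‖)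
        (fun s _ => ContinuousMap.norm_coe_le_norm β _)).trans ?_
      have h1 := t.2.1
      have h2 := t.2.2
      rw [sub_zero, abs_of_nonneg h1]
      nlinarith [norm_nonneg β])

/-- The constant paths. -/
def pathConst : E →L[ℝ] C(I, E) :=
  LinearMap.mkContinuous
    { toFun := fun x => ContinuousMap.const I x
      map_add' := fun _ _ => rfl
      map_smul' := fun _ _ => rfl } 1
    (fun x => by
      rw [one_mul, ContinuousMap.norm_le _ (by positivity)]
      intro t
      exact le_rfl)

theorem pathConst_apply (x : E) (t : I) : pathConst x t = x := rfl

/-- The defect of `α` as a solution of `α' = ε f(α)`, `α(0) = x`. -/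
def odeDefect (f : C(E, E)) (z : ℝ × E × C(I, E)) : ℝ × E × C(I, E) :=
  (z.1, z.2.1, z.2.2 - pathConst z.2.1 - z.1 • pathPrimitive (pathComp f z.2.2))

theorem contDiff_odeDefect (f : C(E, E)) (hf : ContDiff ℝ ∞ f) :
    ContDiff ℝ ∞ (odeDefect f) := by
  have h1 : ContDiff ℝ ∞ (fun z : ℝ × E × C(I, E) => pathComp f z.2.2) :=
    (contDiff_pathComp f hf).comp (contDiff_snd.comp contDiff_snd)
  unfold odeDefect
  have h2 := (pathPrimitive (E := E)).contDiff (n := ∞) |>.comp h1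
  have h3 := (pathConst (E := E)).contDiff (n := ∞) |>.comp
    ((contDiff_fst (n := ∞)).comp (contDiff_snd : ContDiff ℝ ∞ (fun z : ℝ × E × C(I, E) => z.2)))
  exact contDiff_fst.prodMk ((contDiff_fst.comp contDiff_snd).prodMk
    (((contDiff_snd.comp contDiff_snd).sub h3).sub (contDiff_fst.smul h2)))

/-- The derivative of `odeDefect` at `ε = 0`. -/
def odeDefectDeriv (c : C(I, E)) : (ℝ × E × C(I, E)) ≃L[ℝ] (ℝ × E × C(I, E)) :=
  ContinuousLinearEquiv.equivOfInverse
    ((ContinuousLinearMap.fst ℝ ℝ (E × C(I, E))).prod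
      (((ContinuousLinearMap.fst ℝ E C(I, E)).comp (ContinuousLinearMap.snd ℝ ℝ (E × C(I, E)))).prod
        ((ContinuousLinearMap.snd ℝ E C(I, E)).comp (ContinuousLinearMap.snd ℝ ℝ (E × C(I, E))) -
          pathConst.comp ((ContinuousLinearMap.fst ℝ E C(I, E)).comp
            (ContinuousLinearMap.snd ℝ ℝ (E × C(I, E)))) -
          (ContinuousLinearMap.fst ℝ ℝ (E × C(I, E))).smulRight c)))
    ((ContinuousLinearMap.fst ℝ ℝ (E × C(I, E))).prod
      (((ContinuousLinearMap.fst ℝ E C(I, E)).comp (ContinuousLinearMap.snd ℝ ℝ (E × C(I, E)))).prod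
        ((ContinuousLinearMap.snd ℝ E C(I, E)).comp (ContinuousLinearMap.snd ℝ ℝ (E × C(I, E))) +
          pathConst.comp ((ContinuousLinearMap.fst ℝ E C(I, E)).comp
            (ContinuousLinearMap.snd ℝ ℝ (E × C(I, E)))) +
          (ContinuousLinearMap.fst ℝ ℝ (E × C(I, E))).smulRight c)))
    (fun z => by
      refine Prod.ext rfl (Prod.ext rfl ?_)
      change z.2.2 - pathConst z.2.1 - z.1 • c + pathConst z.2.1 + z.1 • c = z.2.2
      abel)
    (fun z => by
      refine Prod.ext rfl (Prod.ext rfl ?_)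
      change z.2.2 + pathConst z.2.1 + z.1 • c - pathConst z.2.1 - z.1 • c = z.2.2
      abel)

/-- At `ε = 0` the term `ε ∫ f(α)` contributes only through its derivative in `ε`. The derivative is
thus triangular with identities on the diagonal, hence invertible, with no smallness assumption on
`f`. -/
theorem hasFDerivAt_odeDefect (f : C(E, E)) (hf : ContDiff ℝ ∞ f) (α : C(I, E)) (x : E) :
    HasFDerivAt (odeDefect f)
      (odeDefectDeriv (pathPrimitive (pathComp f α)) :
        (ℝ × E × C(I, E)) →L[ℝ] (ℝ × E × C(I, E))) (0, x, α) := by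
  have h1 : HasFDerivAt (fun z : ℝ × E × C(I, E) => pathPrimitive (pathComp f z.2.2))
      (fderiv ℝ (fun z : ℝ × E × C(I, E) => pathPrimitive (pathComp f z.2.2)) (0, x, α))
      (0, x, α) := by
    refine DifferentiableAt.hasFDerivAt ?_
    have := ((pathPrimitive (E := E)).contDiff (n := ∞)).comp ((contDiff_pathComp f hf).comp
      (contDiff_snd.comp (contDiff_snd : ContDiff ℝ ∞ (fun z : ℝ × E × C(I, E) => z.2))))
    exact (this.differentiable (by simp)) _
  have h2 : HasFDerivAt (fun z : ℝ × E × C(I, E) => z.1)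
    (ContinuousLinearMap.fst ℝ ℝ (E × C(I, E))) (0, x, α) := hasFDerivAt_fst
  have h3 : HasFDerivAt (fun z : ℝ × E × C(I, E) => z.2.1)
    ((ContinuousLinearMap.fst ℝ E C(I, E)).comp (ContinuousLinearMap.snd ℝ ℝ (E × C(I, E))))
    (0, x, α) := ((ContinuousLinearMap.fst ℝ E C(I, E)).comp
      (ContinuousLinearMap.snd ℝ ℝ (E × C(I, E)))).hasFDerivAt
  have h4 : HasFDerivAt (fun z : ℝ × E × C(I, E) => z.2.2)
    ((ContinuousLinearMap.snd ℝ E C(I, E)).comp (ContinuousLinearMap.snd ℝ ℝ (E × C(I, E))))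
    (0, x, α) := ((ContinuousLinearMap.snd ℝ E C(I, E)).comp
      (ContinuousLinearMap.snd ℝ ℝ (E × C(I, E)))).hasFDerivAt
  have h5 := h2.prodMk (h3.prodMk ((h4.sub (pathConst.hasFDerivAt.comp _ h3)).sub (h2.smul h1)))
  refine h5.congr_fderiv ?_
  ext z <;> simp [odeDefectDeriv]

/-- The path `s ↦ α(c s)`. -/
def pathScale (c : I) (α : C(I, E)) : C(I, E) :=
  ⟨fun s => α (c * s), by fun_prop⟩

theorem odeDefect_eq_iff (f : C(E, E)) (ε : ℝ) (x : E) (α : C(I, E)) :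
    odeDefect f (ε, x, α) = (ε, x, 0) ↔ ∀ t : I, α t = x +
      ε • ∫ s in (0 : ℝ)..t, f (α (projIcc 0 1 zero_le_one s)) := by
  simp only [odeDefect, Prod.mk.injEq, true_and]
  rw [sub_sub, sub_eq_zero]
  constructor
  · intro h t
    have := congrArg (fun γ : C(I, E) => γ t) h
    exact this
  · intro h
    ext t
    exact h t

/-- The substitution `s ↦ c s` in the integral trades the length of the time interval for the factor
`ε`. This is what allows the parameter `ε` to play the role of time. -/
theorem pathScale_solution (f : C(E, E)) {ε : ℝ} {x : E} {α : C(I, E)}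
    (h : ∀ t : I, α t = x + ε • ∫ s in (0 : ℝ)..t, f (α (projIcc 0 1 zero_le_one s))) (c : I) :
    ∀ t : I, pathScale c α t = x +
      (ε * c) • ∫ s in (0 : ℝ)..t, f (pathScale c α (projIcc 0 1 zero_le_one s)) := by
  intro t
  refine (h (c * t)).trans ?_
  rw [mul_smul]
  congr 2
  have h1 : ∫ s in (0 : ℝ)..t, f (pathScale c α (projIcc 0 1 zero_le_one s)) =
      ∫ s in (0 : ℝ)..t, f (α (projIcc 0 1 zero_le_one ((c : ℝ) * s))) := by
    refine integral_congr fun s hs => ?_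
    rw [uIcc_of_le t.2.1] at hs
    have hs' : s ∈ Icc (0 : ℝ) 1 := ⟨hs.1, hs.2.trans t.2.2⟩
    have hcs : (c : ℝ) * s ∈ Icc (0 : ℝ) 1 := (c * ⟨s, hs'⟩ : I).2
    simp only [pathScale, ContinuousMap.coe_mk]
    rw [projIcc_of_mem zero_le_one hs', projIcc_of_mem zero_le_one hcs]
    rfl
  rw [h1]
  have h2 := smul_integral_comp_mul_left (a := 0) (b := (t : ℝ))
    (fun s => f (α (projIcc 0 1 zero_le_one s))) (c : ℝ)
  rw [mul_zero] at h2
  exact h2.symm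

/-- The local flow of a smooth vector field on a Banach space is smooth. -/
theorem exists_contDiffOn_localFlow [CompleteSpace E] {f : E → E} (hf : ContDiff ℝ ∞ f) (x₀ : E) :
    ∃ δ > 0, ∃ Φ : ℝ × E → E,
      ContDiffOn ℝ ∞ Φ (Metric.ball 0 δ ×ˢ Metric.ball x₀ δ) ∧
      ∀ x ∈ Metric.ball x₀ δ, Φ (0, x) = x ∧
        ∀ t ∈ Metric.ball (0 : ℝ) δ, HasDerivAt (fun s => Φ (s, x)) (f (Φ (t, x))) t := by
  let fc : C(E, E) := ⟨f, hf.continuous⟩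
  have hG := contDiff_odeDefect fc hf
  set z₀ : ℝ × E × C(I, E) := (0, x₀, pathConst x₀) with hz₀
  have hG0 : odeDefect fc z₀ = (0, x₀, 0) := by
    rw [hz₀, odeDefect_eq_iff]
    intro t
    simp [pathConst_apply]
  let hd := hasFDerivAt_odeDefect fc hf (pathConst x₀) x₀
  let e := hG.contDiffAt.toOpenPartialHomeomorph (odeDefect fc) hd (by simp)
  have he : ∀ z, e z = odeDefect fc z := fun z => rfl
  have hsrc : z₀ ∈ e.source := ContDiffAt.mem_toOpenPartialHomeomorph_source hG.contDiffAt hd (by simp)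
  have htgt : ((0, x₀, 0) : ℝ × E × C(I, E)) ∈ e.target := by
    rw [← hG0]; exact e.map_source hsrc
  have hsymm0 : e.symm (0, x₀, 0) = z₀ := by rw [← hG0]; exact e.left_inv hsrc
  -- points near the base point at which the derivative is invertible
  have hinv : ∀ᶠ z in 𝓝 z₀, fderiv ℝ (odeDefect fc) z ∈
      range ((↑) : ((ℝ × E × C(I, E)) ≃L[ℝ] (ℝ × E × C(I, E))) → _) := by
    have hc : ContinuousAt (fderiv ℝ (odeDefect fc)) z₀ :=
      (hG.continuous_fderiv (by simp)).continuousAt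
    refine hc.eventually ?_
    rw [hd.fderiv]
    exact ContinuousLinearEquiv.nhds _
  obtain ⟨r, hr, hball⟩ := Metric.eventually_nhds_iff_ball.1
    (hinv.and (e.open_source.mem_nhds hsrc))
  have hcont : ContinuousAt (fun p : ℝ × E => e.symm (p.1, p.2, 0)) (0, x₀) := by
    refine ContinuousAt.comp (f := fun p : ℝ × E => ((p.1, p.2, 0) : ℝ × E × C(I, E)))
      (g := e.symm) (e.continuousAt_symm htgt) ?_
    fun_prop
  have hev : ∀ᶠ p : ℝ × E in 𝓝 (0, x₀), e.symm (p.1, p.2, 0) ∈ Metric.ball z₀ r ∧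
      ((p.1, p.2, 0) : ℝ × E × C(I, E)) ∈ e.target := by
    refine Filter.Eventually.and ?_ ?_
    · refine hcont.eventually (Metric.isOpen_ball.mem_nhds ?_)
      change e.symm (0, x₀, 0) ∈ _
      rw [hsymm0]; exact Metric.mem_ball_self hr
    · have : ContinuousAt (fun p : ℝ × E => ((p.1, p.2, 0) : ℝ × E × C(I, E))) (0, x₀) := by fun_prop
      exact this.eventually (e.open_target.mem_nhds htgt)
  obtain ⟨δ₀, hδ₀, hev⟩ := Metric.eventually_nhds_iff_ball.1 hev
  -- The bound by `r` serves the scaling property: there `(t, x)` itself has to lie in the `r`-ball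
  -- on which the inverse function theorem applies.
  let δ := min δ₀ r
  have hδ : 0 < δ := lt_min hδ₀ hr
  have hev' : ∀ t ∈ Metric.ball (0 : ℝ) δ, ∀ x ∈ Metric.ball x₀ δ,
      e.symm (t, x, 0) ∈ Metric.ball z₀ r ∧ ((t, x, 0) : ℝ × E × C(I, E)) ∈ e.target := by
    intro t ht x hx
    refine hev (t, x) ?_
    rw [← ball_prod_same]
    exact ⟨Metric.ball_subset_ball (min_le_left _ _) ht,
      Metric.ball_subset_ball (min_le_left _ _) hx⟩
  -- The path `A (t, x)` solves `α' = t f(α)` on `[0, 1]` with `α(0) = x`, so that its value at `1`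
  -- is the time `t` flow of `x`.
  let A : ℝ × E → C(I, E) := fun p => (e.symm (p.1, p.2, 0)).2.2
  have hA : ∀ t ∈ Metric.ball (0 : ℝ) δ, ∀ x ∈ Metric.ball x₀ δ,
      e.symm (t, x, 0) = (t, x, A (t, x)) ∧ odeDefect fc (t, x, A (t, x)) = (t, x, 0) := by
    intro t ht x hx
    have h1 := e.right_inv (hev' t ht x hx).2
    rw [he] at h1
    have h3 : (e.symm (t, x, 0)).1 = t := (Prod.ext_iff.1 h1).1
    have h4 : (e.symm (t, x, 0)).2.1 = x := (Prod.ext_iff.1 (Prod.ext_iff.1 h1).2).1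
    have h2 : e.symm (t, x, 0) = (t, x, A (t, x)) := Prod.ext h3 (Prod.ext h4 rfl)
    exact ⟨h2, h2 ▸ h1⟩
  have hAball : ∀ t ∈ Metric.ball (0 : ℝ) δ, ∀ x ∈ Metric.ball x₀ δ,
      ‖A (t, x) - pathConst x₀‖ < r := by
    intro t ht x hx
    have h1 := (hev' t ht x hx).1
    rw [(hA t ht x hx).1, hz₀, ← ball_prod_same, ← ball_prod_same] at h1
    exact mem_ball_iff_norm.1 h1.2.2
  -- the scaling property
  have hscale : ∀ t ∈ Metric.ball (0 : ℝ) δ, ∀ x ∈ Metric.ball x₀ δ, ∀ c : I,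
      A (t * c, x) 1 = A (t, x) c := by
    intro t ht x hx c
    have htc : t * c ∈ Metric.ball (0 : ℝ) δ := by
      rw [mem_ball_zero_iff] at ht ⊢
      refine lt_of_le_of_lt ?_ ht
      rw [norm_mul]
      have : ‖(c : ℝ)‖ ≤ 1 := by rw [Real.norm_of_nonneg c.2.1]; exact c.2.2
      nlinarith [norm_nonneg t]
    have h1 := (odeDefect_eq_iff fc t x _).1 (hA t ht x hx).2
    have h2 := (odeDefect_eq_iff fc (t * c) x _).2 (pathScale_solution fc h1 c)
    -- Local uniqueness: the rescaled path is as close to the constant path as `A (t, x)` is, so it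
    -- lies where the defect map is injective and has to be the path `A (t * c, x)`.
    have h3 : (t * c, x, pathScale c (A (t, x))) ∈ e.source := by
      refine (hball _ ?_).2
      rw [hz₀, ← ball_prod_same, ← ball_prod_same]
      refine ⟨Metric.ball_subset_ball (min_le_right _ _) htc,
        Metric.ball_subset_ball (min_le_right _ _) hx, ?_⟩
      rw [mem_ball_iff_norm]
      refine lt_of_le_of_lt ?_ (hAball t ht x hx)
      rw [ContinuousMap.norm_le _ (by positivity)]
      intro s
      exact ContinuousMap.norm_coe_le_norm (A (t, x) - pathConst x₀) (c * s)
    have h4 := e.left_inv h3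
    rw [he, h2, (hA _ htc x hx).1] at h4
    have h5 : A (t * c, x) = pathScale c (A (t, x)) := congrArg (fun z => z.2.2) h4
    rw [h5]
    simp [pathScale]
  let Φ : ℝ × E → E := fun p => A p 1
  have hΦ : ContDiffOn ℝ ∞ Φ (Metric.ball 0 δ ×ˢ Metric.ball x₀ δ) := by
    rintro ⟨t, x⟩ ⟨ht, hx⟩
    refine ContDiffAt.contDiffWithinAt ?_
    obtain ⟨h1, h2⟩ := hev' t ht x hx
    obtain ⟨e', he'⟩ := (hball _ h1).1
    have h3 : ContDiffAt ℝ ∞ e.symm (t, x, 0) := by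
      refine e.contDiffAt_symm h2 (f₀' := e') ?_ hG.contDiffAt
      rw [he']
      exact ((hG.differentiable (by simp)) _).hasFDerivAt
    have h4 : ContDiffAt ℝ ∞ (fun p : ℝ × E => e.symm (p.1, p.2, 0)) (t, x) :=
      ContDiffAt.comp (t, x) (g := e.symm)
        (f := fun p : ℝ × E => ((p.1, p.2, 0) : ℝ × E × C(I, E))) h3 (by fun_prop)
    exact ((ContinuousMap.evalCLM ℝ (1 : I)).contDiff.contDiffAt).comp (t, x) h4.snd.snd
  refine ⟨δ, hδ, Φ, hΦ, fun x hx => ⟨?_, fun t ht => ?_⟩⟩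
  · have h1 := (odeDefect_eq_iff fc 0 x _).1 (hA 0 (Metric.mem_ball_self hδ) x hx).2 1
    rw [zero_smul, add_zero] at h1
    exact h1
  · -- choose a larger time of the same sign
    obtain ⟨T, hT, hT0, c, hc⟩ : ∃ T ∈ Metric.ball (0 : ℝ) δ, T ≠ 0 ∧ ∃ c : I, T * c = t := by
      rw [mem_ball_zero_iff] at ht
      by_cases h0 : t = 0
      · refine ⟨δ / 2, ?_, by positivity, 0, by simp [h0]⟩
        rw [mem_ball_zero_iff, Real.norm_of_nonneg (by positivity)]
        linarith
      · exact ⟨t, mem_ball_zero_iff.2 ht, h0, 1, by simp⟩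
    -- The integral equation yields only a derivative within `[0, 1]`, and `c` is an endpoint. Since
    -- differentiability is already known from the smoothness of `Φ`, this suffices to identify the
    -- derivative.
    have hdiff : DifferentiableAt ℝ (fun s => Φ (s, x)) t := by
      have h1 : ContDiffAt ℝ ∞ Φ (t, x) :=
        hΦ.contDiffAt ((Metric.isOpen_ball.prod Metric.isOpen_ball).mem_nhds ⟨ht, hx⟩)
      have h2 : ContDiffAt ℝ ∞ (fun s => Φ (s, x)) t :=
        ContDiffAt.comp t (g := Φ) (f := fun s : ℝ => (s, x)) h1 (by fun_prop)
      exact h2.differentiableAt (by simp)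
    have h1 := (odeDefect_eq_iff fc T x _).1 (hA T hT x hx).2
    -- the derivative of the path at `c`
    have h2 : HasDerivWithinAt (fun s : ℝ => A (T, x) (projIcc 0 1 zero_le_one s))
        (T • f (A (T, x) c)) (Icc 0 1) c := by
      have hcn : Continuous (fun s : ℝ => f (A (T, x) (projIcc 0 1 zero_le_one s))) :=
        hf.continuous.comp ((A (T, x)).continuous.comp continuous_projIcc)
      have h3 := ((hcn.integral_hasStrictDerivAt 0 (c : ℝ)).hasDerivAt.const_smul T).const_add x
      have h4 : f (A (T, x) (projIcc 0 1 zero_le_one (c : ℝ))) = f (A (T, x) c) := by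
        rw [projIcc_val]
      rw [h4] at h3
      refine h3.hasDerivWithinAt.congr_of_mem (fun s hs => ?_) c.2
      have := h1 ⟨s, hs⟩
      rw [projIcc_of_mem zero_le_one hs]
      exact this
    have h3 : HasDerivWithinAt (fun s : ℝ => Φ (T * s, x))
        (T • deriv (fun s => Φ (s, x)) t) (Icc 0 1) c := by
      have h5 : HasDerivAt (fun s => Φ (s, x)) (deriv (fun s => Φ (s, x)) t) (T * c) := by
        rw [hc]; exact hdiff.hasDerivAt
      have h6 : HasDerivAt (fun s : ℝ => T * s) T (c : ℝ) := by
        simpa using (hasDerivAt_id (c : ℝ)).const_mul T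
      exact (HasDerivAt.scomp (c : ℝ) h5 h6).hasDerivWithinAt
    have h4 : HasDerivWithinAt (fun s : ℝ => Φ (T * s, x)) (T • f (A (T, x) c)) (Icc 0 1) c := by
      refine h2.congr_of_mem (fun s hs => ?_) c.2
      rw [projIcc_of_mem zero_le_one hs]
      exact hscale T hT x hx ⟨s, hs⟩
    have h5 := (uniqueDiffOn_Icc_zero_one (c : ℝ) c.2).eq_deriv _ h3 h4
    have h6 : deriv (fun s => Φ (s, x)) t = f (Φ (t, x)) := by
      have := smul_right_injective E hT0 h5
      rw [this, ← hscale T hT x hx c, hc]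
    rw [← h6]
    exact hdiff.hasDerivAt

end SmoothODE

end LieAlgebroidTheory

noncomputable section

namespace LieAlgebroidTheory

/-! ### Flows on manifolds without boundary: domains, group law and smoothness -/

section ManifoldFlow

set_option linter.unusedSectionVars false

variable {E' H' N : Type*} [NormedAddCommGroup E'] [NormedSpace ℝ E'] [TopologicalSpace H']
  [TopologicalSpace N] [ChartedSpace H' N] {J : ModelWithCorners ℝ E' H'}

theorem contMDiffOn_mfderiv_apply [IsManifold J ∞ N] {G : Type*} [NormedAddCommGroup G]
    [NormedSpace ℝ G] {g : N → G} {U : Set N} (hU : IsOpen U) (hg : ContMDiffOn J 𝓘(ℝ, G) ∞ g U) :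
    ContMDiffOn J.tangent 𝓘(ℝ, G) ∞ (fun z : TangentBundle J N =>
      (show G from mfderiv J 𝓘(ℝ, G) g z.proj z.snd)) (π E' (TangentSpace J) ⁻¹' U) := by
  have h2 := hg.contMDiffOn_tangentMapWithin (m := ∞) (by simp) hU.uniqueMDiffOn
  have h4 := (contMDiff_snd_tangentBundle_modelSpace G 𝓘(ℝ, G)).comp_contMDiffOn h2
  refine h4.congr fun z hz => ?_
  simp only [Function.comp, tangentMapWithin]
  rw [mfderivWithin_of_isOpen hU hz]

variable [J.Boundaryless]

/-- The derivatives of the chart and of its inverse cancel, so integral curves of the coordinate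
expression of a vector field become integral curves on the manifold. -/
theorem hasMFDerivAt_extChartAt_symm_comp [IsManifold J ∞ N] {p₀ : N} {γ : ℝ → E'} {t : ℝ}
    {w : TangentSpace J ((extChartAt J p₀).symm (γ t))} (ht : γ t ∈ (extChartAt J p₀).target)
    (h : HasDerivAt γ (mfderiv J 𝓘(ℝ, E') (extChartAt J p₀) ((extChartAt J p₀).symm (γ t)) w) t) :
    HasMFDerivAt 𝓘(ℝ, ℝ) J (fun s => (extChartAt J p₀).symm (γ s)) t
      ((1 : ℝ →L[ℝ] ℝ).smulRight w) := by
  have : IsManifold J 1 N := IsManifold.of_le (n := ∞) (by simp)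
  have h1 : HasMFDerivAt 𝓘(ℝ, E') J (extChartAt J p₀).symm (γ t)
      (mfderivWithin 𝓘(ℝ, E') J (extChartAt J p₀).symm (range J) (γ t)) :=
    (mdifferentiableWithinAt_extChartAt_symm ht).hasMFDerivWithinAt.hasMFDerivAt
      (by rw [J.range_eq_univ]; exact univ_mem)
  have h2 := HasMFDerivAt.comp (I' := 𝓘(ℝ, E')) t h1 h.hasFDerivAt.hasMFDerivAt
  refine h2.congr_mfderiv ?_
  have h3 := mfderivWithin_extChartAt_symm_comp_mfderiv_extChartAt (I := J) ht
  ext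
  have h4 := congrArg (fun A : E' →L[ℝ] E' => A w) h3
  have h5 : ((1 : ℝ →L[ℝ] ℝ).smulRight (show E' from w)) 1 = w := one_smul ℝ _
  have h6 : (ContinuousLinearMap.toSpanSingleton ℝ (show E' from mfderiv J 𝓘(ℝ, E') (extChartAt J p₀)
    ((extChartAt J p₀).symm (γ t)) w)) 1 = _ := one_smul ℝ _
  exact ((congrArg _ h6).trans h4).trans h5.symm

/-- The local flow of a smooth vector field is smooth. -/
theorem exists_contMDiffOn_localFlow [IsManifold J ∞ N] [FiniteDimensional ℝ E']
    {y : ∀ p : N, TangentSpace J p}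
    (hy : ContMDiff J J.tangent ∞ (fun p => (⟨p, y p⟩ : TangentBundle J N))) (p₀ : N) :
    ∃ ε > 0, ∃ O : Set N, IsOpen O ∧ p₀ ∈ O ∧ ∃ Θ : ℝ × N → N,
      ContMDiffOn (𝓘(ℝ, ℝ).prod J) J ∞ Θ (Ioo (-ε) ε ×ˢ O) ∧
      ∀ p ∈ O, Θ (0, p) = p ∧ IsMIntegralCurveOn (fun t => Θ (t, p)) y (Ioo (-ε) ε) := by
  have : CompleteSpace E' := FiniteDimensional.complete ℝ E'
  let c := extChartAt J p₀
  have hsrc : IsOpen c.source := isOpen_extChartAt_source p₀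
  have htgt : IsOpen c.target := isOpen_extChartAt_target p₀
  have hc : ContMDiffOn J 𝓘(ℝ, E') ∞ c c.source := by
    have := contMDiffOn_extChartAt (I := J) (n := ∞) (x := p₀)
    rwa [← extChartAt_source (I := J)] at this
  have hcs : ContMDiffOn 𝓘(ℝ, E') J ∞ c.symm c.target := contMDiffOn_extChartAt_symm p₀
  let v : E' → E' := fun z => mfderiv J 𝓘(ℝ, E') c (c.symm z) (y (c.symm z))
  have hv : ContDiffOn ℝ ∞ v c.target := by
    rw [← contMDiffOn_iff_contDiffOn]
    exact (contMDiffOn_mfderiv_apply hsrc hc).comp (hy.comp_contMDiffOn hcs)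
      (fun z hz => c.map_target hz)
  have hz₀ : c p₀ ∈ c.target := mem_extChartAt_target p₀
  obtain ⟨R, hR, hball⟩ := Metric.isOpen_iff.1 htgt (c p₀) hz₀
  -- The cut-off vanishes outside the ball of radius `R / 2`, which makes the coordinate field
  -- globally smooth, and equals `1` on the ball of radius `R / 4`, where the flow is kept for short
  -- times.
  let χ : ContDiffBump (c p₀) := ⟨R / 4, R / 2, by positivity, by linarith⟩
  let f : E' → E' := fun z => χ z • v z
  have hf : ContDiff ℝ ∞ f := by
    rw [contDiff_iff_contDiffAt]
    intro z
    by_cases hz : z ∈ c.target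
    · exact χ.contDiff.contDiffAt.smul (hv.contDiffAt (htgt.mem_nhds hz))
    · have h0 : f =ᶠ[𝓝 z] fun _ => 0 := by
        have h1 : z ∈ (Metric.closedBall (c p₀) (R / 2))ᶜ := fun h =>
          hz (hball (Metric.closedBall_subset_ball (by linarith) h))
        filter_upwards [Metric.isClosed_closedBall.isOpen_compl.mem_nhds h1] with z' hz'
        have h2 : χ z' = 0 := χ.zero_of_le_dist (by
          rw [mem_compl_iff, Metric.mem_closedBall, not_le] at hz'
          exact hz'.le)
        simp [f, h2]
      exact contDiffAt_const.congr_of_eventuallyEq h0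
  obtain ⟨δ, hδ, Φ, hΦ, hΦ'⟩ := exists_contDiffOn_localFlow hf (c p₀)
  have hΦc : ContinuousAt Φ (0, c p₀) := (hΦ.continuousOn.continuousAt
    ((Metric.isOpen_ball.prod Metric.isOpen_ball).mem_nhds
      ⟨Metric.mem_ball_self hδ, Metric.mem_ball_self hδ⟩))
  have hΦ0 : Φ (0, c p₀) = c p₀ := (hΦ' _ (Metric.mem_ball_self hδ)).1
  have hev : ∀ᶠ z in 𝓝 ((0 : ℝ), c p₀), Φ z ∈ Metric.ball (c p₀) (R / 4) := by
    refine hΦc.eventually (Metric.isOpen_ball.mem_nhds ?_)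
    rw [hΦ0]; exact Metric.mem_ball_self (by positivity)
  obtain ⟨δ', hδ', hev⟩ := Metric.eventually_nhds_iff_ball.1 hev
  rw [← ball_prod_same] at hev
  let ε := min δ δ'
  have hε : 0 < ε := lt_min hδ hδ'
  let O : Set N := c.source ∩ c ⁻¹' Metric.ball (c p₀) ε
  have hO : IsOpen O := (continuousOn_extChartAt p₀).isOpen_inter_preimage hsrc Metric.isOpen_ball
  have hmem : ∀ t ∈ Ioo (-ε) ε, ∀ p ∈ O, t ∈ Metric.ball (0 : ℝ) δ ∧ c p ∈ Metric.ball (c p₀) δ ∧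
      Φ (t, c p) ∈ Metric.ball (c p₀) (R / 4) := by
    intro t ht p hp
    have ht' : t ∈ Metric.ball (0 : ℝ) ε := by
      rw [mem_ball_zero_iff, Real.norm_eq_abs, abs_lt]; exact ht
    exact ⟨Metric.ball_subset_ball (min_le_left _ _) ht',
      Metric.ball_subset_ball (min_le_left _ _) hp.2,
      hev _ ⟨Metric.ball_subset_ball (min_le_right _ _) ht',
        Metric.ball_subset_ball (min_le_right _ _) hp.2⟩⟩
  refine ⟨ε, hε, O, hO, ⟨mem_extChartAt_source p₀, Metric.mem_ball_self hε⟩,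
    fun z => c.symm (Φ (z.1, c z.2)), ?_, fun p hp => ⟨?_, fun t ht => ?_⟩⟩
  · have h1 : ContMDiffOn (𝓘(ℝ, ℝ).prod J) 𝓘(ℝ, ℝ × E') ∞ (fun z : ℝ × N => (z.1, c z.2))
        (Ioo (-ε) ε ×ˢ O) :=
      contMDiffOn_fst.prodMk_space
        ((hc.mono inter_subset_left).comp contMDiffOn_snd (fun z hz => hz.2))
    have h2 : ContMDiffOn (𝓘(ℝ, ℝ).prod J) 𝓘(ℝ, E') ∞ (fun z : ℝ × N => Φ (z.1, c z.2))
        (Ioo (-ε) ε ×ˢ O) :=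
      hΦ.contMDiffOn.comp h1 (fun z hz => ⟨(hmem _ hz.1 _ hz.2).1, (hmem _ hz.1 _ hz.2).2.1⟩)
    exact hcs.comp h2 (fun z hz => hball (Metric.ball_subset_ball (by linarith)
      (hmem _ hz.1 _ hz.2).2.2))
  · have h1 := hmem 0 ⟨by linarith, hε⟩ p hp
    simp only [(hΦ' _ h1.2.1).1]
    exact c.left_inv hp.1
  · have h1 := hmem t ht p hp
    have h2 := (hΦ' _ h1.2.1).2 t h1.1
    have h3 : f (Φ (t, c p)) = v (Φ (t, c p)) := by
      have : χ (Φ (t, c p)) = 1 := χ.one_of_mem_closedBall (Metric.ball_subset_closedBall h1.2.2)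
      simp [f, this]
    rw [h3] at h2
    exact (hasMFDerivAt_extChartAt_symm_comp (hball (Metric.ball_subset_ball (by linarith) h1.2.2))
      h2).hasMFDerivWithinAt

/-- An integral curve on a closed interval extends to an open interval. -/
theorem exists_Ioo_of_mem_flowDomain [IsManifold J ∞ N] [FiniteDimensional ℝ E']
    {y : ∀ p : N, TangentSpace J p}
    (hy : ContMDiff J J.tangent ∞ (fun p => (⟨p, y p⟩ : TangentBundle J N))) {t : ℝ} {γ : ℝ → N}
    (hγ : IsMIntegralCurveOn γ y (uIcc 0 t)) :
    ∃ a b : ℝ, uIcc 0 t ⊆ Ioo a b ∧ ∃ δ : ℝ → N, EqOn δ γ (uIcc 0 t) ∧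
      IsMIntegralCurveOn δ y (Ioo a b) := by
  have : CompleteSpace E' := FiniteDimensional.complete ℝ E'
  have hM1 : IsManifold J 1 N := IsManifold.of_le (n := ∞) (by simp)
  have hy1 := hy.of_le (m := 1) (n := ∞) (by simp)
  set l := min 0 t with hl
  set r := max 0 t with hr
  have hlr : l ≤ r := min_le_max
  change IsMIntegralCurveOn γ y (Icc l r) at hγ
  change ∃ a b : ℝ, Icc l r ⊆ Ioo a b ∧ ∃ δ : ℝ → N, EqOn δ γ (Icc l r) ∧
      IsMIntegralCurveOn δ y (Ioo a b)
  obtain ⟨γl, hl0, hγl⟩ := exists_isMIntegralCurveAt_of_contMDiffAt_boundaryless l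
    (hy1.contMDiffAt (x := γ l))
  obtain ⟨γr, hr0, hγr⟩ := exists_isMIntegralCurveAt_of_contMDiffAt_boundaryless r
    (hy1.contMDiffAt (x := γ r))
  obtain ⟨εl, hεl, hγl⟩ := isMIntegralCurveAt_iff'.1 hγl
  obtain ⟨εr, hεr, hγr⟩ := isMIntegralCurveAt_iff'.1 hγr
  rw [Real.ball_eq_Ioo] at hγl hγr
  -- The curve on `[l, r]` is prolonged by the integral curves through its two endpoints.
  let δ : ℝ → N := fun s => if s < l then γl s else if s ≤ r then γ s else γr s
  have hδ1 : EqOn δ γl (Iic l) := by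
    intro s hs
    rcases (mem_Iic.1 hs).lt_or_eq with h | h
    · simp [δ, h]
    · subst h; simp [δ, hlr, hl0]
  have hδ2 : EqOn δ γ (Icc l r) := by
    intro s hs
    simp [δ, hs.1.not_gt, hs.2]
  have hδ3 : EqOn δ γr (Ici r) := by
    intro s hs
    rcases (mem_Ici.1 hs).lt_or_eq with h | h
    · simp [δ, (hlr.trans h.le).not_gt, h.not_ge]
    · subst h; simp [δ, hlr.not_gt, hr0]
  refine ⟨l - εl, r + εr, fun s hs => ⟨by linarith [hs.1], by linarith [hs.2]⟩, δ, hδ2, ?_⟩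
  intro s hs
  -- the derivative within each of the three pieces
  have d1 : s ≤ l → HasMFDerivWithinAt 𝓘(ℝ, ℝ) J δ (Iic l ∩ Ioo (l - εl) (r + εr)) s
      ((1 : ℝ →L[ℝ] ℝ).smulRight (y (δ s))) := by
    intro h
    have h1 := (hγl s ⟨hs.1, by linarith⟩).hasMFDerivAt (Ioo_mem_nhds hs.1 (by linarith))
    rw [← hδ1 h] at h1
    exact h1.hasMFDerivWithinAt.congr_of_eventuallyEq
      (Filter.eventually_of_mem self_mem_nhdsWithin fun u hu => hδ1 hu.1) (hδ1 h)
  have d2 : s ∈ Icc l r → HasMFDerivWithinAt 𝓘(ℝ, ℝ) J δ (Icc l r) s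
      ((1 : ℝ →L[ℝ] ℝ).smulRight (y (δ s))) := by
    intro h
    have h1 := hγ s h
    rw [← hδ2 h] at h1
    exact h1.congr_of_eventuallyEq
      (Filter.eventually_of_mem self_mem_nhdsWithin fun u hu => hδ2 hu) (hδ2 h)
  have d3 : r ≤ s → HasMFDerivWithinAt 𝓘(ℝ, ℝ) J δ (Ici r ∩ Ioo (l - εl) (r + εr)) s
      ((1 : ℝ →L[ℝ] ℝ).smulRight (y (δ s))) := by
    intro h
    have h1 := (hγr s ⟨by linarith, hs.2⟩).hasMFDerivAt (Ioo_mem_nhds (by linarith) hs.2)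
    rw [← hδ3 h] at h1
    exact h1.hasMFDerivWithinAt.congr_of_eventuallyEq
      (Filter.eventually_of_mem self_mem_nhdsWithin fun u hu => hδ3 hu.1) (hδ3 h)
  -- Each of the three pieces either carries the right derivative at `s` or misses a neighbourhood
  -- of `s`. Such alternatives are stable under unions, which disposes of all positions of `s` at
  -- once, including the case `l = r`.
  have e1 : HasMFDerivWithinAt 𝓘(ℝ, ℝ) J δ (Iic l ∩ Ioo (l - εl) (r + εr)) s
      ((1 : ℝ →L[ℝ] ℝ).smulRight (y (δ s))) ∨ (Iic l)ᶜ ∈ 𝓝 s := by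
    by_cases h : s ≤ l
    · exact Or.inl (d1 h)
    · exact Or.inr (isClosed_Iic.isOpen_compl.mem_nhds h)
  have e2 : HasMFDerivWithinAt 𝓘(ℝ, ℝ) J δ (Icc l r) s
      ((1 : ℝ →L[ℝ] ℝ).smulRight (y (δ s))) ∨ (Icc l r)ᶜ ∈ 𝓝 s := by
    by_cases h : s ∈ Icc l r
    · exact Or.inl (d2 h)
    · exact Or.inr (isClosed_Icc.isOpen_compl.mem_nhds h)
  have e3 : HasMFDerivWithinAt 𝓘(ℝ, ℝ) J δ (Ici r ∩ Ioo (l - εl) (r + εr)) s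
      ((1 : ℝ →L[ℝ] ℝ).smulRight (y (δ s))) ∨ (Ici r)ᶜ ∈ 𝓝 s := by
    by_cases h : r ≤ s
    · exact Or.inl (d3 h)
    · exact Or.inr (isClosed_Ici.isOpen_compl.mem_nhds h)
  have key : ∀ {A : Set ℝ} {B : Set ℝ}, (HasMFDerivWithinAt 𝓘(ℝ, ℝ) J δ A s
      ((1 : ℝ →L[ℝ] ℝ).smulRight (y (δ s))) ∨ Aᶜ ∈ 𝓝 s) → (HasMFDerivWithinAt 𝓘(ℝ, ℝ) J δ B s
      ((1 : ℝ →L[ℝ] ℝ).smulRight (y (δ s))) ∨ Bᶜ ∈ 𝓝 s) →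
      (HasMFDerivWithinAt 𝓘(ℝ, ℝ) J δ (A ∪ B) s
      ((1 : ℝ →L[ℝ] ℝ).smulRight (y (δ s))) ∨ (A ∪ B)ᶜ ∈ 𝓝 s) := by
    rintro A B (h | h) (h' | h')
    · exact Or.inl (h.union h')
    · refine Or.inl (h.mono_of_mem_nhdsWithin ?_)
      filter_upwards [self_mem_nhdsWithin, mem_nhdsWithin_of_mem_nhds h'] with u hu hu'
      exact hu.resolve_right hu'
    · refine Or.inl (h'.mono_of_mem_nhdsWithin ?_)
      filter_upwards [self_mem_nhdsWithin, mem_nhdsWithin_of_mem_nhds h] with u hu hu'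
      exact hu.resolve_left hu'
    · refine Or.inr ?_
      rw [compl_union]
      exact inter_mem h h'
  have e1' := e1.imp_right (fun h => mem_of_superset h
    (compl_subset_compl.2 (inter_subset_left (t := Ioo (l - εl) (r + εr)))))
  have e3' := e3.imp_right (fun h => mem_of_superset h
    (compl_subset_compl.2 (inter_subset_left (t := Ioo (l - εl) (r + εr)))))
  have hcover : Ioo (l - εl) (r + εr) ⊆ Iic l ∩ Ioo (l - εl) (r + εr) ∪ Icc l r ∪
      Ici r ∩ Ioo (l - εl) (r + εr) := by
    intro u hu
    rcases le_or_gt u l with h | h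
    · exact Or.inl (Or.inl ⟨h, hu⟩)
    · rcases le_or_gt u r with h' | h'
      · exact Or.inl (Or.inr ⟨h.le, h'⟩)
      · exact Or.inr ⟨h'.le, hu⟩
  rcases key (key e1' e2) e3' with h | h
  · exact h.mono hcover
  · exact absurd (hcover hs) (mem_of_mem_nhds h)

variable [IsManifold J ∞ N] [FiniteDimensional ℝ E'] [T2Space N] {y : ∀ p : N, TangentSpace J p}

theorem eqOn_Ioo_of_isMIntegralCurveOn
    (hy : ContMDiff J J.tangent ∞ (fun p => (⟨p, y p⟩ : TangentBundle J N)))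
    {γ γ' : ℝ → N} {a b a' b' t₀ : ℝ} (hγ : IsMIntegralCurveOn γ y (Ioo a b))
    (hγ' : IsMIntegralCurveOn γ' y (Ioo a' b')) (h : t₀ ∈ Ioo a b) (h' : t₀ ∈ Ioo a' b')
    (h0 : γ t₀ = γ' t₀) : EqOn γ γ' (Ioo a b ∩ Ioo a' b') := by
  have hM1 : IsManifold J 1 N := IsManifold.of_le (n := ∞) (by simp)
  rw [Ioo_inter_Ioo]
  refine isMIntegralCurveOn_Ioo_eqOn_of_contMDiff_boundaryless (t₀ := t₀) ?_
    (hy.of_le (m := 1) (n := ∞) (by simp))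
    (hγ.mono ?_) (hγ'.mono ?_) h0
  · rw [← Ioo_inter_Ioo]; exact ⟨h, h'⟩
  · rw [← Ioo_inter_Ioo]; exact inter_subset_left
  · rw [← Ioo_inter_Ioo]; exact inter_subset_right

theorem mem_flowDomain_of_Ioo {γ : ℝ → N} {a b t : ℝ} (hγ : IsMIntegralCurveOn γ y (Ioo a b))
    (h0 : (0 : ℝ) ∈ Ioo a b) (ht : t ∈ Ioo a b) : γ 0 ∈ flowDomain y t :=
  ⟨γ, rfl, hγ.mono (ordConnected_Ioo.uIcc_subset h0 ht)⟩

/-- The flow is defined by a chosen integral curve on a closed interval. Extended to an open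
interval, the chosen curve agrees with `γ` by uniqueness, so the choice is immaterial. -/
theorem flow_eq_of_Ioo
    (hy : ContMDiff J J.tangent ∞ (fun p => (⟨p, y p⟩ : TangentBundle J N)))
    {γ : ℝ → N} {a b t : ℝ} (hγ : IsMIntegralCurveOn γ y (Ioo a b))
    (h0 : (0 : ℝ) ∈ Ioo a b) (ht : t ∈ Ioo a b) : flow y t (γ 0) = γ t := by
  have h := mem_flowDomain_of_Ioo hγ h0 ht
  change ∃ γ', _ at h
  rw [flow, dif_pos h]
  obtain ⟨a', b', hab, δ, hδ, hδ'⟩ := exists_Ioo_of_mem_flowDomain hy h.choose_spec.2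
  have h1 := eqOn_Ioo_of_isMIntegralCurveOn hy hδ' hγ (hab left_mem_uIcc) h0
    ((hδ left_mem_uIcc).trans h.choose_spec.1) ⟨hab right_mem_uIcc, ht⟩
  exact (hδ right_mem_uIcc).symm.trans h1

/-- The flow line of a point of `flowDomain y t` is an integral curve on an open interval. -/
theorem exists_isMIntegralCurveOn_flow
    (hy : ContMDiff J J.tangent ∞ (fun p => (⟨p, y p⟩ : TangentBundle J N)))
    {t : ℝ} {p : N} (hp : p ∈ flowDomain y t) :
    ∃ a b : ℝ, (0 : ℝ) ∈ Ioo a b ∧ t ∈ Ioo a b ∧ (∀ s ∈ Ioo a b, p ∈ flowDomain y s) ∧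
      IsMIntegralCurveOn (fun s => flow y s p) y (Ioo a b) ∧ flow y 0 p = p := by
  obtain ⟨γ, rfl, hγ⟩ := hp
  obtain ⟨a, b, hab, δ, hδ, hδ'⟩ := exists_Ioo_of_mem_flowDomain hy hγ
  rw [← hδ left_mem_uIcc]
  have h0 := hab left_mem_uIcc
  refine ⟨a, b, h0, hab right_mem_uIcc, fun s hs => mem_flowDomain_of_Ioo hδ' h0 hs,
    fun s hs => ?_, flow_eq_of_Ioo hy hδ' h0 h0⟩
  have h1 : EqOn (fun s => flow y s (δ 0)) δ (Ioo a b) := fun u hu => flow_eq_of_Ioo hy hδ' h0 hu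
  have h2 := hδ' s hs
  rw [← h1 hs] at h2
  exact h2.congr_of_eventuallyEq (Filter.eventually_of_mem self_mem_nhdsWithin h1) (h1 hs)

theorem mem_flowDomain_zero
    (hy : ContMDiff J J.tangent ∞ (fun p => (⟨p, y p⟩ : TangentBundle J N))) (p : N) :
    p ∈ flowDomain y 0 := by
  obtain ⟨ε, hε, O, -, hp, Θ, -, h⟩ := exists_contMDiffOn_localFlow hy p
  have h1 := mem_flowDomain_of_Ioo (t := 0) (h p hp).2 ⟨by linarith, hε⟩ ⟨by linarith, hε⟩
  rwa [(h p hp).1] at h1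

theorem flow_zero
    (hy : ContMDiff J J.tangent ∞ (fun p => (⟨p, y p⟩ : TangentBundle J N))) (p : N) :
    flow y 0 p = p := by
  obtain ⟨a, b, -, -, -, -, h⟩ := exists_isMIntegralCurveOn_flow hy (mem_flowDomain_zero hy p)
  exact h

theorem hasMFDerivAt_flow
    (hy : ContMDiff J J.tangent ∞ (fun p => (⟨p, y p⟩ : TangentBundle J N)))
    {t : ℝ} {p : N} (hp : p ∈ flowDomain y t) :
    HasMFDerivAt 𝓘(ℝ, ℝ) J (fun s => flow y s p) t
      ((1 : ℝ →L[ℝ] ℝ).smulRight (y (flow y t p))) := by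
  obtain ⟨a, b, -, ht, -, h, -⟩ := exists_isMIntegralCurveOn_flow hy hp
  exact (h t ht).hasMFDerivAt (Ioo_mem_nhds ht.1 ht.2)

/-- The flow line of `p` and the flow line of `flow y s p`, shifted by `s`, agree at the time `s`
and glue to an integral curve on the union of their intervals. -/
theorem flow_add
    (hy : ContMDiff J J.tangent ∞ (fun p => (⟨p, y p⟩ : TangentBundle J N)))
    {s t : ℝ} {p : N} (hp : p ∈ flowDomain y s) (hq : flow y s p ∈ flowDomain y t) :
    p ∈ flowDomain y (s + t) ∧ flow y (s + t) p = flow y t (flow y s p) := by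
  have hM1 : IsManifold J 1 N := IsManifold.of_le (n := ∞) (by simp)
  obtain ⟨a, b, h0, hs, -, hγ, hγ0⟩ := exists_isMIntegralCurveOn_flow hy hp
  obtain ⟨a', b', h0', ht', -, hδ, hδ0⟩ := exists_isMIntegralCurveOn_flow hy hq
  have hδs := hδ.comp_add (-s)
  have hset : {u : ℝ | u + -s ∈ Ioo a' b'} = Ioo (a' + s) (b' + s) := by
    ext u
    simp only [mem_ofPred_eq, mem_Ioo]
    constructor <;> intro h <;> constructor <;> linarith [h.1, h.2]
  change IsMIntegralCurveOn _ y {u : ℝ | u + -s ∈ Ioo a' b'} at hδs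
  rw [hset] at hδs
  have hmem : s ∈ Ioo a b ∩ Ioo (a' + s) (b' + s) :=
    ⟨hs, by linarith [h0'.1], by linarith [h0'.2]⟩
  have heq : flow y s p = ((fun u => flow y u (flow y s p)) ∘ (· + -s)) s := by
    simp [hδ0]
  have hy1 := hy.of_le (m := 1) (n := ∞) (by simp)
  have hpw := isMIntegralCurveOn_piecewise hy1 hγ hδs hmem heq
  have heqon := eqOn_piecewise_of_isMIntegralCurveOn_Ioo hy1 hγ hδs hmem heq
  set γ := piecewise (Ioo a b) (fun u => flow y u p)
    ((fun u => flow y u (flow y s p)) ∘ (· + -s)) with hγdef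
  have hun : Ioo (min a (a' + s)) (max b (b' + s)) = Ioo a b ∪ Ioo (a' + s) (b' + s) := by
    rw [Ioo_union_Ioo']
    · linarith [hmem.1.1, hmem.1.2, hmem.2.1, hmem.2.2]
    · linarith [hmem.1.1, hmem.1.2, hmem.2.1, hmem.2.2]
  rw [← hun] at hpw
  have hγ0' : γ 0 = p := by
    rw [hγdef, piecewise, if_pos h0, hγ0]
  have hst : s + t ∈ Ioo (a' + s) (b' + s) := ⟨by linarith [ht'.1], by linarith [ht'.2]⟩
  have h0u : (0 : ℝ) ∈ Ioo (min a (a' + s)) (max b (b' + s)) := by rw [hun]; exact Or.inl h0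
  have hstu : s + t ∈ Ioo (min a (a' + s)) (max b (b' + s)) := by rw [hun]; exact Or.inr hst
  refine ⟨hγ0' ▸ mem_flowDomain_of_Ioo hpw h0u hstu, ?_⟩
  have h1 := flow_eq_of_Ioo hy hpw h0u hstu
  rw [hγ0'] at h1
  rw [h1, heqon hst]
  simp

/-- The flow line of `p`, shifted by `t`, starts at `flow y t p` and passes through `p` at the time
`-t`. -/
theorem flow_neg
    (hy : ContMDiff J J.tangent ∞ (fun p => (⟨p, y p⟩ : TangentBundle J N)))
    {t : ℝ} {p : N} (hp : p ∈ flowDomain y t) :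
    flow y t p ∈ flowDomain y (-t) ∧ flow y (-t) (flow y t p) = p := by
  obtain ⟨a, b, h0, ht, -, hγ, hγ0⟩ := exists_isMIntegralCurveOn_flow hy hp
  have hδ := hγ.comp_add t
  have hset : {u : ℝ | u + t ∈ Ioo a b} = Ioo (a - t) (b - t) := by
    ext u
    simp only [mem_ofPred_eq, mem_Ioo]
    constructor <;> intro h <;> constructor <;> linarith [h.1, h.2]
  change IsMIntegralCurveOn _ y {u : ℝ | u + t ∈ Ioo a b} at hδ
  rw [hset] at hδ
  have h0' : (0 : ℝ) ∈ Ioo (a - t) (b - t) := ⟨by linarith [ht.1], by linarith [ht.2]⟩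
  have ht' : -t ∈ Ioo (a - t) (b - t) := ⟨by linarith [h0.1], by linarith [h0.2]⟩
  have h1 := mem_flowDomain_of_Ioo hδ h0' ht'
  have h2 := flow_eq_of_Ioo hy hδ h0' ht'
  simp only [Function.comp, zero_add, neg_add_cancel] at h1 h2
  exact ⟨h1, h2.trans hγ0⟩

/-- The flow is defined and smooth on a neighbourhood of `z = (t, p)`. -/
def IsSmoothFlowAt (y : ∀ p : N, TangentSpace J p) (z : ℝ × N) : Prop :=
  ∃ W : Set (ℝ × N), IsOpen W ∧ z ∈ W ∧ (∀ w ∈ W, w.2 ∈ flowDomain y w.1) ∧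
    ContMDiffOn (𝓘(ℝ, ℝ).prod J) J ∞ (fun w : ℝ × N => flow y w.1 w.2) W

/-- Near every point the flow is smooth for a uniform time. -/
theorem exists_isSmoothFlowAt_step
    (hy : ContMDiff J J.tangent ∞ (fun p => (⟨p, y p⟩ : TangentBundle J N))) (q : N) :
    ∃ ε > 0, ∃ O : Set N, IsOpen O ∧ q ∈ O ∧ (∀ p ∈ O, IsSmoothFlowAt y (0, p)) ∧
      ∀ (s : ℝ) (p : N), IsSmoothFlowAt y (s, p) → flow y s p ∈ O → ∀ u ∈ Ioo (-ε) ε,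
        IsSmoothFlowAt y (s + u, p) := by
  obtain ⟨ε, hε, O, hO, hq, Θ, hΘ, h⟩ := exists_contMDiffOn_localFlow hy q
  have h0 : (0 : ℝ) ∈ Ioo (-ε) ε := ⟨by linarith, hε⟩
  have hdom : ∀ u ∈ Ioo (-ε) ε, ∀ p ∈ O, p ∈ flowDomain y u ∧ flow y u p = Θ (u, p) := by
    intro u hu p hp
    have h1 := mem_flowDomain_of_Ioo (h p hp).2 h0 hu
    have h2 := flow_eq_of_Ioo hy (h p hp).2 h0 hu
    simp only [(h p hp).1] at h1 h2
    exact ⟨h1, h2⟩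
  refine ⟨ε, hε, O, hO, hq, fun p hp => ?_, fun s p hs hp u hu => ?_⟩
  · refine ⟨Ioo (-ε) ε ×ˢ O, isOpen_Ioo.prod hO, ⟨h0, hp⟩, fun z hz => (hdom _ hz.1 _ hz.2).1,
      hΘ.congr fun z hz => (hdom _ hz.1 _ hz.2).2⟩
  · obtain ⟨W, hW, hz, hWd, hWs⟩ := hs
    let ι : ℝ × N → ℝ × N := fun z => (s, z.2)
    have hι : Continuous ι := by fun_prop
    have hιs : ContMDiff (𝓘(ℝ, ℝ).prod J) (𝓘(ℝ, ℝ).prod J) ∞ ι :=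
      contMDiff_const.prodMk contMDiff_snd
    let g : ℝ × N → N := fun z => flow y s z.2
    have hg : ContMDiffOn (𝓘(ℝ, ℝ).prod J) J ∞ g (ι ⁻¹' W) :=
      hWs.comp hιs.contMDiffOn (fun z hz => hz)
    have hopen1 : IsOpen (ι ⁻¹' W ∩ g ⁻¹' O) :=
      hg.continuousOn.isOpen_inter_preimage (hW.preimage hι) hO
    let W' : Set (ℝ × N) := (ι ⁻¹' W ∩ g ⁻¹' O) ∩ (fun z => z.1 - s) ⁻¹' Ioo (-ε) ε
    have hW' : IsOpen W' := hopen1.inter (isOpen_Ioo.preimage (by fun_prop))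
    -- The group law writes the flow near the time `s + u` as the local flow after the time `s`
    -- flow, and both are smooth.
    have key : ∀ z ∈ W', z.2 ∈ flowDomain y z.1 ∧ flow y z.1 z.2 = Θ (z.1 - s, g z) := by
      intro z hz
      have h1 := hdom _ hz.2 _ hz.1.2
      have h2 := flow_add hy (hWd _ hz.1.1) h1.1
      change z.2 ∈ flowDomain y (s + (z.1 - s)) ∧ _ at h2
      simp only [ι, add_sub_cancel] at h2
      exact ⟨h2.1, h2.2.trans h1.2⟩
    refine ⟨W', hW', ⟨⟨hz, hp⟩, ?_⟩, fun z hz => (key z hz).1, ?_⟩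
    · simpa using hu
    · have h1 : ContMDiffOn (𝓘(ℝ, ℝ).prod J) (𝓘(ℝ, ℝ).prod J) ∞ (fun z => (z.1 - s, g z)) W' := by
        refine ContMDiffOn.prodMk ?_ (hg.mono fun z hz => hz.1.1)
        exact contMDiffOn_fst.sub contMDiffOn_const
      exact (hΘ.comp h1 (fun z hz => ⟨hz.2, hz.1.2⟩)).congr fun z hz => (key z hz).2

/-- Near each time, smoothness propagates in both directions along the flow line, because the local
flow exists for a uniform time near the current point. Connectedness of the interval carries it from
`0` to `t`. -/
theorem isSmoothFlowAt_of_mem_flowDomain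
    (hy : ContMDiff J J.tangent ∞ (fun p => (⟨p, y p⟩ : TangentBundle J N))) {t : ℝ} {p : N}
    (hp : p ∈ flowDomain y t) : IsSmoothFlowAt y (t, p) := by
  obtain ⟨a, b, h0, ht, hdom, hγ, hγ0⟩ := exists_isMIntegralCurveOn_flow hy hp
  have h := (isPreconnected_Ioo (a := a) (b := b)).induction₂'
    (fun s s' => IsSmoothFlowAt y (s, p) → IsSmoothFlowAt y (s', p)) ?_
    (fun _ _ _ _ _ _ h1 h2 h3 => h2 (h1 h3)) h0 ht
  · refine h ?_
    obtain ⟨ε, hε, O, hO, hq, h1, -⟩ := exists_isSmoothFlowAt_step hy p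
    exact h1 p hq
  · intro s hs
    obtain ⟨ε, hε, O, hO, hq, -, hstep⟩ := exists_isSmoothFlowAt_step hy (flow y s p)
    have h1 : ∀ᶠ s' in 𝓝[Ioo a b] s, flow y s' p ∈ O :=
      (hγ.continuousOn s hs).eventually (hO.mem_nhds hq)
    have h2 : ∀ᶠ s' in 𝓝[Ioo a b] s, s' - s ∈ Ioo (-ε) ε := by
      have : ContinuousAt (fun s' : ℝ => s' - s) s := by fun_prop
      exact (this.eventually (Ioo_mem_nhds (by simpa using hε) (by simpa using hε))).filter_mono
        nhdsWithin_le_nhds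
    filter_upwards [h1, h2] with s' hs1 hs2
    refine ⟨fun h3 => ?_, fun h3 => ?_⟩
    · have := hstep s p h3 hq _ hs2
      rwa [add_sub_cancel] at this
    · have := hstep s' p h3 hs1 (s - s') ⟨by linarith [hs2.2], by linarith [hs2.1]⟩
      rwa [add_sub_cancel] at this

theorem isOpen_flowDomain_prod
    (hy : ContMDiff J J.tangent ∞ (fun p => (⟨p, y p⟩ : TangentBundle J N))) :
    IsOpen {z : ℝ × N | z.2 ∈ flowDomain y z.1} := by
  rw [isOpen_iff_mem_nhds]
  intro z hz
  obtain ⟨W, hW, hzW, hWd, -⟩ := isSmoothFlowAt_of_mem_flowDomain hy hz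
  exact mem_of_superset (hW.mem_nhds hzW) hWd

theorem contMDiffAt_flow
    (hy : ContMDiff J J.tangent ∞ (fun p => (⟨p, y p⟩ : TangentBundle J N))) {t : ℝ} {p : N}
    (hp : p ∈ flowDomain y t) :
    ContMDiffAt (𝓘(ℝ, ℝ).prod J) J ∞ (fun z : ℝ × N => flow y z.1 z.2) (t, p) := by
  obtain ⟨W, hW, hzW, -, hWs⟩ := isSmoothFlowAt_of_mem_flowDomain hy hp
  exact hWs.contMDiffAt (hW.mem_nhds hzW)

theorem isOpen_flowDomain
    (hy : ContMDiff J J.tangent ∞ (fun p => (⟨p, y p⟩ : TangentBundle J N))) (t : ℝ) :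
    IsOpen (flowDomain y t) :=
  (isOpen_flowDomain_prod hy).preimage (f := fun p : N => (t, p)) (by fun_prop)

theorem contMDiffAt_flow_time
    (hy : ContMDiff J J.tangent ∞ (fun p => (⟨p, y p⟩ : TangentBundle J N))) {t : ℝ} {p : N}
    (hp : p ∈ flowDomain y t) : ContMDiffAt J J ∞ (flow y t) p :=
  ContMDiffAt.comp p (g := fun z : ℝ × N => flow y z.1 z.2) (f := fun p' : N => (t, p'))
    (contMDiffAt_flow hy hp) (contMDiffAt_const.prodMk contMDiffAt_id)

/-- The time `t` flow is a diffeomorphism onto the domain of the time `-t` flow. -/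
theorem isLocalDiffeo_flow
    (hy : ContMDiff J J.tangent ∞ (fun p => (⟨p, y p⟩ : TangentBundle J N))) (t : ℝ) :
    IsLocalDiffeo J (flowDomain y t) (flowDomain y (-t)) (flow y t) := by
  have hinv : ∀ p ∈ flowDomain y (-t), flow y (-t) p ∈ flowDomain y t ∧
      flow y t (flow y (-t) p) = p := by
    intro p hp
    have := flow_neg hy hp
    rwa [neg_neg] at this
  have hs : ∀ t, ContMDiffOn J J ∞ (flow y t) (flowDomain y t) := fun t p hp =>
    (contMDiffAt_flow_time hy hp).contMDiffWithinAt
  refine ⟨{ toFun := flow y t, invFun := flow y (-t), source := flowDomain y t,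
            target := flowDomain y (-t), map_source' := fun p hp => (flow_neg hy hp).1,
            map_target' := fun p hp => (hinv p hp).1, left_inv' := fun p hp => (flow_neg hy hp).2,
            right_inv' := fun p hp => (hinv p hp).2,
            open_source := isOpen_flowDomain hy t, open_target := isOpen_flowDomain hy (-t),
            continuousOn_toFun := (hs t).continuousOn,
            continuousOn_invFun := (hs (-t)).continuousOn },
    rfl, rfl, fun _ _ => rfl, hs t, hs (-t)⟩

end ManifoldFlow

end LieAlgebroidTheory

noncomputable section

namespace LieAlgebroidTheory

/-! ### Derivatives of functions along tangent vectors, and bump functions -/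

section DerivAlong

set_option linter.unusedSectionVars false

variable {E' H' N : Type*} [NormedAddCommGroup E'] [NormedSpace ℝ E'] [TopologicalSpace H']
  {J : ModelWithCorners ℝ E' H'} [TopologicalSpace N] [ChartedSpace H' N]
  {z : TangentBundle J N} {f g : N → ℝ}

theorem derivAlong_congr (h : f =ᶠ[𝓝 z.proj] g) : derivAlong f z = derivAlong g z :=
  congrArg (fun A : E' →L[ℝ] ℝ => A z.snd) h.mfderiv_eq

theorem derivAlong_const (c : ℝ) : derivAlong (fun _ : N => c) z = 0 := by
  unfold derivAlong
  rw [mfderiv_const]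
  rfl

theorem derivAlong_add (hf : MDifferentiableAt J 𝓘(ℝ, ℝ) f z.proj)
    (hg : MDifferentiableAt J 𝓘(ℝ, ℝ) g z.proj) :
    derivAlong (fun p => f p + g p) z = derivAlong f z + derivAlong g z :=
  congrArg (fun A : E' →L[ℝ] ℝ => A z.snd) (mfderiv_add hf hg)

theorem derivAlong_sub (hf : MDifferentiableAt J 𝓘(ℝ, ℝ) f z.proj)
    (hg : MDifferentiableAt J 𝓘(ℝ, ℝ) g z.proj) :
    derivAlong (fun p => f p - g p) z = derivAlong f z - derivAlong g z :=
  congrArg (fun A : E' →L[ℝ] ℝ => A z.snd) (mfderiv_sub hf hg)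

theorem derivAlong_mul (hf : MDifferentiableAt J 𝓘(ℝ, ℝ) f z.proj)
    (hg : MDifferentiableAt J 𝓘(ℝ, ℝ) g z.proj) :
    derivAlong (fun p => f p * g p) z =
      f z.proj * derivAlong g z + derivAlong f z * g z.proj := by
  have h := (HasMFDerivAt.mul hf.hasMFDerivAt hg.hasMFDerivAt).mfderiv
  refine (congrArg (fun A : E' →L[ℝ] ℝ => A z.snd) h).trans ?_
  rw [mul_comm (derivAlong f z)]
  rfl

theorem derivAlong_sum {ι : Type} {s : Finset ι} {f : ι → N → ℝ}
    (hf : ∀ i ∈ s, MDifferentiableAt J 𝓘(ℝ, ℝ) (f i) z.proj) :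
    derivAlong (fun p => ∑ i ∈ s, f i p) z = ∑ i ∈ s, derivAlong (f i) z := by
  have h := (HasMFDerivAt.sum (f := f) (f' := fun i => mfderiv J 𝓘(ℝ, ℝ) (f i) z.proj)
    (fun i hi => (hf i hi).hasMFDerivAt)).mfderiv
  have h' : (fun p => ∑ i ∈ s, f i p) = ∑ i ∈ s, f i := by ext; simp
  rw [h']
  refine (congrArg (fun A : E' →L[ℝ] ℝ => A z.snd) h).trans ?_
  exact sum_apply (F := E' →L[ℝ] ℝ) _ _ _

theorem derivAlong_comp {E₂ H₂ N₂ : Type*} [NormedAddCommGroup E₂] [NormedSpace ℝ E₂]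
    [TopologicalSpace H₂] {J₂ : ModelWithCorners ℝ E₂ H₂} [TopologicalSpace N₂] [ChartedSpace H₂ N₂]
    {h : N₂ → ℝ} {k : N → N₂} (hh : MDifferentiableAt J₂ 𝓘(ℝ, ℝ) h (k z.proj))
    (hk : MDifferentiableAt J J₂ k z.proj) :
    derivAlong (fun p => h (k p)) z = derivAlong h (tangentMap J J₂ k z) :=
  congrArg (fun A : E' →L[ℝ] ℝ => A z.snd) (mfderiv_comp (I' := J₂) z.proj hh hk)

theorem derivAlong_mk_add (p : N) (u v : TangentSpace J p) :
    derivAlong f (⟨p, u + v⟩ : TangentBundle J N) =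
      derivAlong f (⟨p, u⟩ : TangentBundle J N) + derivAlong f (⟨p, v⟩ : TangentBundle J N) :=
  (mfderiv J 𝓘(ℝ, ℝ) f p).map_add u v

theorem derivAlong_mk_sub (p : N) (u v : TangentSpace J p) :
    derivAlong f (⟨p, u - v⟩ : TangentBundle J N) =
      derivAlong f (⟨p, u⟩ : TangentBundle J N) - derivAlong f (⟨p, v⟩ : TangentBundle J N) :=
  (mfderiv J 𝓘(ℝ, ℝ) f p).map_sub u v

theorem derivAlong_mk_smul (p : N) (c : ℝ) (v : TangentSpace J p) :
    derivAlong f (⟨p, c • v⟩ : TangentBundle J N) = c * derivAlong f (⟨p, v⟩ : TangentBundle J N) :=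
  (mfderiv J 𝓘(ℝ, ℝ) f p).map_smul c v

theorem contMDiff_derivAlong [IsManifold J ∞ N] (hf : ContMDiff J 𝓘(ℝ, ℝ) ∞ f) :
    ContMDiff J.tangent 𝓘(ℝ, ℝ) ∞ (fun z : TangentBundle J N => derivAlong f z) := by
  have := contMDiffOn_mfderiv_apply (J := J) isOpen_univ (hf.contMDiffOn (s := univ))
  rwa [preimage_univ, contMDiffOn_univ] at this

variable [IsManifold J ∞ N] [T2Space N] [FiniteDimensional ℝ E']

theorem exists_bump {p : N} {U : Set N} (hU : U ∈ 𝓝 p) :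
    ∃ χ : N → ℝ, ContMDiff J 𝓘(ℝ, ℝ) ∞ χ ∧ (∀ᶠ x in 𝓝 p, χ x = 1) ∧ tsupport χ ⊆ U := by
  obtain ⟨χ, -, hχ⟩ := (SmoothBumpFunction.nhds_basis_tsupport (I := J) p).mem_iff.1 hU
  exact ⟨χ, χ.contMDiff, χ.eventuallyEq_one, hχ⟩

/-- A bump function supported in `U` cuts `g` off. In this way chart coordinates become global
functions, to which conditions on all of `C^∞(M)` apply. -/
theorem exists_contMDiff_eventuallyEq {G : Type*} [NormedAddCommGroup G] [NormedSpace ℝ G]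
    {p : N} {U : Set N} (hU : IsOpen U) (hp : p ∈ U) {g : N → G}
    (hg : ContMDiffOn J 𝓘(ℝ, G) ∞ g U) :
    ∃ g' : N → G, ContMDiff J 𝓘(ℝ, G) ∞ g' ∧ g' =ᶠ[𝓝 p] g := by
  obtain ⟨χ, hχ, h1, hs⟩ := exists_bump (J := J) (hU.mem_nhds hp)
  refine ⟨fun x => χ x • g x, contMDiff_of_tsupport fun x hx => ?_, ?_⟩
  · have hx' := hs (tsupport_smul_subset_left χ g hx)
    exact (hχ x).smul (hg.contMDiffAt (hU.mem_nhds hx'))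
  · filter_upwards [h1] with x hx
    rw [hx, one_smul]

/-- Tangent vectors are separated by smooth functions. -/
theorem tangent_ext [J.Boundaryless] {p : N} {u v : TangentSpace J p}
    (h : ∀ f : N → ℝ, ContMDiff J 𝓘(ℝ, ℝ) ∞ f →
      derivAlong f (⟨p, u⟩ : TangentBundle J N) = derivAlong f (⟨p, v⟩ : TangentBundle J N)) :
    u = v := by
  obtain ⟨g, hg, hge⟩ := exists_contMDiff_eventuallyEq (J := J) (p := p)
    (chartAt H' p).open_source (mem_chart_source H' p) (contMDiffOn_extChartAt (I := J) (n := ∞) (x := p))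
  have hd : mfderiv J 𝓘(ℝ, E') g p = ContinuousLinearMap.id ℝ E' := by
    rw [hge.mfderiv_eq]
    have : IsManifold J 1 N := IsManifold.of_le (n := ∞) (by simp)
    exact mfderiv_extChartAt_self
  by_contra hne
  -- If `u ≠ v`, a linear functional separating them, composed with a globalised chart whose
  -- derivative at `p` is the identity, contradicts the hypothesis.
  obtain ⟨l, hl⟩ := SeparatingDual.exists_ne_zero (R := ℝ) (V := E') (sub_ne_zero.2 hne)
  have hk : ∀ w : TangentSpace J p, derivAlong (fun x => l (g x)) (⟨p, w⟩ : TangentBundle J N) = l w := by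
    intro w
    have h1 := mfderiv_comp (I' := 𝓘(ℝ, E')) p (l.mdifferentiableAt (x := g p))
      (hg.mdifferentiable (by simp) p)
    refine (congrArg (fun A : E' →L[ℝ] ℝ => A w) h1).trans ?_
    have h2 : mfderiv 𝓘(ℝ, E') 𝓘(ℝ, ℝ) l (g p) = l := by
      rw [mfderiv_eq_fderiv]; exact l.fderiv
    refine (congrArg (fun A : E' →L[ℝ] ℝ => A (mfderiv J 𝓘(ℝ, E') g p w)) h2).trans ?_
    exact congrArg (fun A : E' →L[ℝ] E' => l (A w)) hd
  refine hl ?_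
  have h3 := h (fun x => l (g x)) (l.contMDiff.comp hg)
  rw [hk, hk] at h3
  exact (l.map_sub u v).trans (sub_eq_zero.2 h3)

end DerivAlong

end LieAlgebroidTheory
end

noncomputable section

namespace LieAlgebroidTheory

/-! ### Sections of `A` and of its dual: global extensions, frames and tensoriality -/

section Sections

set_option linter.unusedSectionVars false

variable {E : Type*} [NormedAddCommGroup E] [NormedSpace ℝ E]
  {M : Type*} [TopologicalSpace M] [ChartedSpace E M]
  {F : Type*} [NormedAddCommGroup F] [NormedSpace ℝ F]
  {V : M → Type*} [TopologicalSpace (TotalSpace F V)] [∀ m, AddCommGroup (V m)]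
  [∀ m, Module ℝ (V m)] [∀ m, TopologicalSpace (V m)] [FiberBundle F V] [VectorBundle ℝ F V]

local notation "IM" => modelWithCornersSelf ℝ E
local notation "IA" => ModelWithCorners.prod (modelWithCornersSelf ℝ E) (modelWithCornersSelf ℝ F)
local notation "IAd" =>
  ModelWithCorners.prod (modelWithCornersSelf ℝ E) (modelWithCornersSelf ℝ (F →L[ℝ] ℝ))
local notation "TM" => TangentBundle (modelWithCornersSelf ℝ E) M
local notation "TA" => TangentBundle
  (ModelWithCorners.prod (modelWithCornersSelf ℝ E) (modelWithCornersSelf ℝ F)) (TotalSpace F V)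
local notation "Ad" => TotalSpace (F →L[ℝ] ℝ) (fun m : M => V m →L[ℝ] ℝ)
local notation "ΓA" => ContMDiffSection (modelWithCornersSelf ℝ E) F ∞ V
local notation "ΓAd" => ContMDiffSection (modelWithCornersSelf ℝ E) (F →L[ℝ] ℝ) ∞
  (fun m : M => V m →L[ℝ] ℝ)

/-- Two points of a fibre are separated in a trivialization, all others by their projections.
Uniqueness of the integral curves of `Ξ` depends on this. -/
theorem t2Space_totalSpace [T2Space M] : T2Space (TotalSpace F V) := by
  refine ⟨fun p p' hne => ?_⟩
  by_cases h : p.proj = p'.proj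
  · let e := trivializationAt F V p.proj
    have hp : p ∈ e.source := FiberBundle.mem_trivializationAt_proj_source
    have hp' : p' ∈ e.source := by
      rw [e.mem_source, ← h]
      exact FiberBundle.mem_baseSet_trivializationAt' _
    obtain ⟨u, v, hu, hv, hpu, hpv, huv⟩ := t2_separation (fun h' => hne (e.injOn hp hp' h'))
    exact ⟨_, _, e.continuousOn.isOpen_inter_preimage e.open_source hu,
      e.continuousOn.isOpen_inter_preimage e.open_source hv, ⟨hp, hpu⟩, ⟨hp', hpv⟩,
      (huv.preimage e).mono inter_subset_right inter_subset_right⟩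
  · obtain ⟨u, v, hu, hv, hpu, hpv, huv⟩ := t2_separation h
    exact ⟨_, _, hu.preimage (FiberBundle.continuous_proj F V),
      hv.preimage (FiberBundle.continuous_proj F V), hpu, hpv, huv.preimage _⟩

variable [IsManifold 𝓘(ℝ, E) ∞ M] [ContMDiffVectorBundle ∞ F V 𝓘(ℝ, E)]

/-- The product of a function and a section. -/
def smulSection (f : M → ℝ) (hf : ContMDiff IM 𝓘(ℝ, ℝ) ∞ f) (X : ΓA) : ΓA :=
  ⟨fun m => f m • X m, hf.smul_section X.contMDiff⟩

@[simp]
theorem smulSection_apply (f : M → ℝ) (hf : ContMDiff IM 𝓘(ℝ, ℝ) ∞ f) (X : ΓA) (m : M) :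
    smulSection f hf X m = f m • X m := rfl

theorem sum_section_apply {ι : Type*} (s : Finset ι) (X : ι → ΓA) (m : M) :
    (∑ i ∈ s, X i) m = ∑ i ∈ s, X i m := by
  have := congrFun (map_sum (ContMDiffSection.coeAddHom 𝓘(ℝ, E) F ∞ V) X s) m
  rw [Finset.sum_apply] at this
  exact this

theorem contMDiffOn_pairing {φ : ∀ m : M, V m →L[ℝ] ℝ} {X : ∀ m : M, V m} {U : Set M}
    (hφ : ContMDiffOn IM IAd ∞ (fun m => (⟨m, φ m⟩ : Ad)) U)
    (hX : ContMDiffOn IM IA ∞ (fun m => (⟨m, X m⟩ : TotalSpace F V)) U) :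
    ContMDiffOn IM 𝓘(ℝ, ℝ) ∞ (fun m => φ m (X m)) U := by
  have h3 := ContMDiffOn.clm_bundle_apply (E₂ := Bundle.Trivial M ℝ) (F₂ := ℝ) hφ hX
  intro p hp
  exact (contMDiffWithinAt_totalSpace.1 (h3 p hp)).2

theorem contMDiff_pairing (φ : ΓAd) (X : ΓA) : ContMDiff IM 𝓘(ℝ, ℝ) ∞ (fun m => φ m (X m)) :=
  contMDiffOn_univ.1 (contMDiffOn_pairing φ.contMDiff.contMDiffOn X.contMDiff.contMDiffOn)

theorem contMDiff_linearFunction (φ : ΓAd) : ContMDiff IA 𝓘(ℝ, ℝ) ∞ (linearFunction φ) := by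
  have h1 : ContMDiff IA IAd ∞ (fun p : TotalSpace F V => (⟨p.proj, φ p.proj⟩ : Ad)) :=
    φ.contMDiff.comp (contMDiff_proj V)
  have h2 : ContMDiff IA IA ∞ (fun p : TotalSpace F V => (⟨p.proj, p.snd⟩ : TotalSpace F V)) :=
    contMDiff_id
  have h3 := ContMDiff.clm_bundle_apply (E₂ := Bundle.Trivial M ℝ) (F₂ := ℝ) h1 h2
  exact fun p => (contMDiffAt_totalSpace.1 (h3 p)).2

theorem contMDiff_dualLinearFunction (X : ΓA) :
    ContMDiff IAd 𝓘(ℝ, ℝ) ∞ (dualLinearFunction X) := by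
  have h1 : ContMDiff IAd IAd ∞ (fun p : Ad => (⟨p.proj, p.snd⟩ : Ad)) :=
    contMDiff_id
  have h2 : ContMDiff IAd IA ∞ (fun p : Ad => (⟨p.proj, X p.proj⟩ : TotalSpace F V)) :=
    X.contMDiff.comp (contMDiff_proj (fun m : M => V m →L[ℝ] ℝ))
  have h3 := ContMDiff.clm_bundle_apply (E₂ := Bundle.Trivial M ℝ) (F₂ := ℝ) h1 h2
  exact fun p => (contMDiffAt_totalSpace.1 (h3 p)).2

/-- The section of the dual bundle that is constant in a trivialization. -/
theorem contMDiffOn_const_dual (m₀ : M) (l : F →L[ℝ] ℝ) :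
    ContMDiffOn IM IAd ∞ (fun m => (⟨m, l.comp ((trivializationAt F V m₀).continuousLinearMapAt ℝ m)⟩ : Ad))
      (trivializationAt F V m₀).baseSet := by
  intro m hm
  have hm2 : m ∈ (trivializationAt (F →L[ℝ] ℝ)
      (fun m : M => V m →L[ℝ] Bundle.Trivial M ℝ m) m₀).baseSet := by
    rw [hom_trivializationAt_baseSet]
    exact ⟨hm, mem_univ _⟩
  refine ContMDiffAt.contMDiffWithinAt ?_
  refine ((trivializationAt (F →L[ℝ] ℝ) (fun m : M => V m →L[ℝ] Bundle.Trivial M ℝ m) m₀).contMDiffAt_section_iff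
    hm2).2 ?_
  refine (contMDiffAt_const (c := l)).congr_of_eventuallyEq ?_
  filter_upwards [(trivializationAt F V m₀).open_baseSet.mem_nhds hm] with m' hm'
  rw [hom_trivializationAt_apply]
  dsimp only
  rw [ContinuousLinearMap.inCoordinates_eq hm' (mem_univ _)]
  ext b
  have h1 : (trivializationAt F V m₀).continuousLinearMapAt ℝ m'
      (((trivializationAt F V m₀).continuousLinearEquivAt ℝ m' hm').symm b) = b := by
    rw [← (trivializationAt F V m₀).coe_continuousLinearEquivAt_eq (R := ℝ) hm']
    exact ((trivializationAt F V m₀).continuousLinearEquivAt ℝ m' hm').apply_symm_apply b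
  exact congrArg l h1

variable [T2Space M] [FiniteDimensional ℝ E]

/-- A smooth local section agrees near any point with a global one. -/
theorem exists_section_eventuallyEq {U : Set M} (hU : IsOpen U) {m₀ : M} (hm₀ : m₀ ∈ U)
    {X : ∀ m, V m} (hX : ContMDiffOn IM IA ∞ (fun m => (⟨m, X m⟩ : TotalSpace F V)) U) :
    ∃ Y : ΓA, ∀ᶠ m in 𝓝 m₀, Y m = X m := by
  obtain ⟨χ, hχ, h1, hs⟩ := exists_bump (J := IM) (hU.mem_nhds hm₀)
  refine ⟨⟨fun m => χ m • X m, hχ.contMDiffOn.smul_section_of_tsupport hU hs hX⟩, ?_⟩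
  filter_upwards [h1] with m hm
  exact (congrArg (· • X m) hm).trans (one_smul ℝ (X m))

variable [FiniteDimensional ℝ F]

variable (E F V) in
/-- Global sections that form a frame near `m₀`, and sections of the dual bundle that form the dual
frame near `m₀`. -/
theorem exists_frame (m₀ : M) :
    ∃ (n : ℕ) (e : Fin n → ΓA) (φ : Fin n → ΓAd),
      ∀ᶠ m in 𝓝 m₀, (∀ a : V m, ∑ i, φ i m a • e i m = a) ∧
        ∀ i j, φ i m (e j m) = if i = j then 1 else 0 := by
  let b := Module.finBasis ℝ F
  let e := trivializationAt F V m₀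
  have hm₀ : m₀ ∈ e.baseSet := FiberBundle.mem_baseSet_trivializationAt' m₀
  have h1 : ∀ i, ∃ Y : ContMDiffSection 𝓘(ℝ, E) F ∞ V, ∀ᶠ m in 𝓝 m₀, Y m = e.symm m (b i) := by
    intro i
    refine exists_section_eventuallyEq e.open_baseSet hm₀ ?_
    rw [e.contMDiffOn_section_baseSet_iff]
    refine (contMDiffOn_const (c := b i)).congr fun m hm => ?_
    rw [e.apply_mk_symm hm]
  have h2 : ∀ i, ∃ Y : ContMDiffSection 𝓘(ℝ, E) (F →L[ℝ] ℝ) ∞ (fun m : M => V m →L[ℝ] ℝ),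
      ∀ᶠ m in 𝓝 m₀, Y m = (LinearMap.toContinuousLinearMap (b.coord i)).comp
        (e.continuousLinearMapAt ℝ m) := fun i =>
    exists_section_eventuallyEq (F := F →L[ℝ] ℝ) (V := fun m : M => V m →L[ℝ] ℝ) e.open_baseSet hm₀
      (contMDiffOn_const_dual m₀ _)
  choose X hX using h1
  choose φ hφ using h2
  refine ⟨_, X, φ, ?_⟩
  filter_upwards [eventually_all.2 hX, eventually_all.2 hφ, e.open_baseSet.mem_nhds hm₀]
    with m hX hφ hm
  have h3 : ∀ i, ∀ a : V m, φ i m a = b.coord i (e ⟨m, a⟩).2 := fun i a => by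
    rw [hφ]
    exact congrArg (b.coord i) (e.continuousLinearMapAt_apply_of_mem ℝ hm a)
  constructor
  · intro a
    simp only [h3, hX]
    have h4 : ∀ i, b.coord i (e ⟨m, a⟩).2 • e.symm m (b i) =
        e.symmL ℝ m (b.coord i (e ⟨m, a⟩).2 • b i) := fun i => by
      rw [map_smul, e.symmL_apply hm]
    simp only [h4]
    rw [← map_sum]
    simp only [Module.Basis.coord_apply]
    rw [b.sum_repr, e.symmL_apply hm, e.symm_apply_apply_mk hm]
  · intro i j
    rw [h3, hX, e.apply_mk_symm hm]
    simp [Finsupp.single_apply, eq_comm]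

theorem exists_dual_section (m : M) (ψ : V m →L[ℝ] ℝ) : ∃ φ : ΓAd, φ m = ψ := by
  obtain ⟨n, e, φ, h⟩ := exists_frame E F V m
  refine ⟨∑ i, ψ (e i m) • φ i, ?_⟩
  ext a
  rw [sum_section_apply (F := F →L[ℝ] ℝ) (V := fun m : M => V m →L[ℝ] ℝ)]
  conv_rhs => rw [← h.self_of_nhds.1 a, map_sum]
  rw [sum_apply]
  refine Finset.sum_congr rfl fun i _ => ?_
  rw [map_smul, smul_eq_mul, mul_comm]
  rfl

theorem exists_section (m : M) (a : V m) : ∃ X : ΓA, X m = a := by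
  obtain ⟨n, e, φ, h⟩ := exists_frame E F V m
  refine ⟨∑ i, φ i m a • e i, ?_⟩
  rw [sum_section_apply]
  exact h.self_of_nhds.1 a

/-- The value of a vector is recovered from its components in a frame, and these are pairings with
global dual sections. Identities in `A` thereby reduce to identities between numbers. -/
theorem eq_of_forall_dual {m : M} {a b : V m} (h : ∀ φ : ΓAd, φ m a = φ m b) : a = b := by
  obtain ⟨n, e, φ, h'⟩ := exists_frame E F V m
  rw [← h'.self_of_nhds.1 a, ← h'.self_of_nhds.1 b]
  simp only [h]

theorem section_ext {X Y : ΓA} (h : ∀ (φ : ΓAd) (m : M), φ m (X m) = φ m (Y m)) : X = Y :=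
  ContMDiffSection.ext fun m => eq_of_forall_dual fun φ => h φ m

/-- A section of the dual bundle is smooth if its pairings with smooth sections are. -/
theorem contMDiff_dual_of_pairing {ψ : ∀ m : M, V m →L[ℝ] ℝ}
    (h : ∀ X : ΓA, ContMDiff IM 𝓘(ℝ, ℝ) ∞ (fun m => ψ m (X m))) :
    ContMDiff IM IAd ∞ (fun m => (⟨m, ψ m⟩ : Ad)) := by
  intro m₀
  obtain ⟨n, e, φ, h'⟩ := exists_frame E F V m₀
  refine ((∑ i, smulSection (F := F →L[ℝ] ℝ) (V := fun m : M => V m →L[ℝ] ℝ) _ (h (e i)) (φ i)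
    ).contMDiff m₀).congr_of_eventuallyEq ?_
  filter_upwards [h'] with m hm
  refine congrArg (TotalSpace.mk m) ?_
  rw [sum_section_apply (F := F →L[ℝ] ℝ) (V := fun m : M => V m →L[ℝ] ℝ)]
  ext a
  rw [sum_apply]
  conv_lhs => rw [← hm.1 a, map_sum]
  refine Finset.sum_congr rfl fun i _ => ?_
  rw [map_smul, smul_eq_mul, mul_comm]
  rfl

/-- For a bump function `χ` supported where the frame expansion holds, `χ X = ∑ᵢ χ ⟨φᵢ, X⟩ eᵢ` is an
identity of global sections. Function-linearity of `Q` may then be applied, and `χ = 1` at `m₀`. -/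
theorem eq_frame_sum_of_tensorial {Q : ΓA → M → ℝ}
    (hadd : ∀ X Y m, Q (X + Y) m = Q X m + Q Y m)
    (hsmul : ∀ f hf X m, Q (smulSection f hf X) m = f m * Q X m) {m₀ : M} {n : ℕ} {e : Fin n → ΓA}
    {φ : Fin n → ΓAd} (h : ∀ᶠ m in 𝓝 m₀, ∀ a : V m, ∑ i, φ i m a • e i m = a) (X : ΓA) :
    Q X m₀ = ∑ i, φ i m₀ (X m₀) * Q (e i) m₀ := by
  obtain ⟨χ, hχ, h1, hs⟩ := exists_bump (J := IM) h
  have h0 : ∀ m, Q 0 m = 0 := fun m => by simpa using hadd 0 0 m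
  have hsum : ∀ s : Finset (Fin n), ∀ Y : Fin n → ΓA, ∀ m, Q (∑ i ∈ s, Y i) m = ∑ i ∈ s, Q (Y i) m := by
    classical
    intro s Y m
    induction s using Finset.induction_on with
    | empty => simp [h0]
    | insert i s hi ih => rw [Finset.sum_insert hi, Finset.sum_insert hi, hadd, ih]
  have hX : smulSection χ hχ X =
      ∑ i, smulSection _ (hχ.mul (contMDiff_pairing (φ i) X)) (e i) := by
    ext m
    rw [sum_section_apply]
    by_cases hm : χ m = 0
    · simp [hm]
    · have := hs (subset_tsupport χ hm) (X m)
      conv_lhs => rw [smulSection_apply, ← this, Finset.smul_sum]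
      refine Finset.sum_congr rfl fun i _ => ?_
      rw [smul_smul]
      rfl
  have h2 := congrArg (fun Y => Q Y m₀) hX
  simp only [hsmul, hsum, h1.self_of_nhds, one_mul] at h2
  rw [h2]
  refine Finset.sum_congr rfl fun i _ => ?_
  simp [h1.self_of_nhds]

/-- A function-linear map from sections to functions is given by a section of the dual bundle. -/
theorem exists_dual_of_tensorial {Q : ΓA → M → ℝ} (hQ : ∀ X, ContMDiff IM 𝓘(ℝ, ℝ) ∞ (Q X))
    (hadd : ∀ X Y m, Q (X + Y) m = Q X m + Q Y m)
    (hsmul : ∀ f hf X m, Q (smulSection f hf X) m = f m * Q X m) :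
    ∃ ψ : ΓAd, ∀ X m, ψ m (X m) = Q X m := by
  have hloc : ∀ m : M, ∃ l : V m →L[ℝ] ℝ, ∀ X : ΓA, l (X m) = Q X m := by
    intro m
    obtain ⟨n, e, φ, h⟩ := exists_frame E F V m
    refine ⟨∑ i, Q (e i) m • φ i m, fun X => ?_⟩
    rw [eq_frame_sum_of_tensorial hadd hsmul (h.mono fun _ h => h.1) X, sum_apply]
    exact Finset.sum_congr rfl fun i _ => mul_comm _ _
  choose l hl using hloc
  exact ⟨⟨l, contMDiff_dual_of_pairing fun X => by simpa only [hl] using hQ X⟩, fun X m => hl m X⟩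

end Sections

end LieAlgebroidTheory
end

noncomputable section

namespace LieAlgebroidTheory

/-! ### Locality of the bracket and the Lie derivative of dual sections -/

section Algebroid

set_option linter.unusedSectionVars false

variable {E : Type*} [NormedAddCommGroup E] [NormedSpace ℝ E]
  {M : Type*} [TopologicalSpace M] [ChartedSpace E M]
  {F : Type*} [NormedAddCommGroup F] [NormedSpace ℝ F]
  {V : M → Type*} [TopologicalSpace (TotalSpace F V)] [∀ m, AddCommGroup (V m)]
  [∀ m, Module ℝ (V m)] [∀ m, TopologicalSpace (V m)] [FiberBundle F V] [VectorBundle ℝ F V]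

local notation "IM" => modelWithCornersSelf ℝ E
local notation "IA" => ModelWithCorners.prod (modelWithCornersSelf ℝ E) (modelWithCornersSelf ℝ F)
local notation "IAd" =>
  ModelWithCorners.prod (modelWithCornersSelf ℝ E) (modelWithCornersSelf ℝ (F →L[ℝ] ℝ))
local notation "TM" => TangentBundle (modelWithCornersSelf ℝ E) M
local notation "TA" => TangentBundle
  (ModelWithCorners.prod (modelWithCornersSelf ℝ E) (modelWithCornersSelf ℝ F)) (TotalSpace F V)
local notation "Ad" => TotalSpace (F →L[ℝ] ℝ) (fun m : M => V m →L[ℝ] ℝ)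
local notation "ΓA" => ContMDiffSection (modelWithCornersSelf ℝ E) F ∞ V
local notation "ΓAd" => ContMDiffSection (modelWithCornersSelf ℝ E) (F →L[ℝ] ℝ) ∞
  (fun m : M => V m →L[ℝ] ℝ)

variable [IsManifold 𝓘(ℝ, E) ∞ M] [ContMDiffVectorBundle ∞ F V 𝓘(ℝ, E)] [T2Space M]
  [FiniteDimensional ℝ E] [FiniteDimensional ℝ F]

namespace LieAlgebroid

variable (L : LieAlgebroid E F V)

theorem bracket_add (X Y Z : ΓA) : L.bracket X (Y + Z) = L.bracket X Y + L.bracket X Z := by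
  rw [L.bracket_antisymm, L.add_bracket, L.bracket_antisymm Y, L.bracket_antisymm Z]
  abel

theorem bracket_zero (X : ΓA) : L.bracket X 0 = 0 := by
  have h := L.bracket_add X 0 0
  rwa [add_zero, left_eq_add] at h

theorem bracket_neg (X Y : ΓA) : L.bracket X (-Y) = -L.bracket X Y := by
  rw [eq_neg_iff_add_eq_zero, ← L.bracket_add, neg_add_cancel, L.bracket_zero]

theorem bracket_sub (X Y Z : ΓA) : L.bracket X (Y - Z) = L.bracket X Y - L.bracket X Z := by
  rw [sub_eq_add_neg, L.bracket_add, L.bracket_neg, sub_eq_add_neg]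

theorem bracket_sum {ι : Type*} (s : Finset ι) (X : ΓA) (Y : ι → ΓA) :
    L.bracket X (∑ i ∈ s, Y i) = ∑ i ∈ s, L.bracket X (Y i) := by
  classical
  induction s using Finset.induction_on with
  | empty => simp [L.bracket_zero]
  | insert i s hi ih => rw [Finset.sum_insert hi, Finset.sum_insert hi, L.bracket_add, ih]

theorem sum_bracket {ι : Type*} (s : Finset ι) (X : ΓA) (Y : ι → ΓA) :
    L.bracket (∑ i ∈ s, Y i) X = ∑ i ∈ s, L.bracket (Y i) X := by
  rw [L.bracket_antisymm, L.bracket_sum, ← Finset.sum_neg_distrib]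
  exact Finset.sum_congr rfl fun i _ => (L.bracket_antisymm _ _).symm

theorem bracket_smulSection (X : ΓA) (f : M → ℝ) (hf : ContMDiff IM 𝓘(ℝ, ℝ) ∞ f) (Y : ΓA) (m : M) :
    L.bracket X (smulSection f hf Y) m = f m • L.bracket X Y m +
      derivAlong f (L.anchorMap ⟨m, X m⟩) • Y m :=
  L.leibniz f hf X Y _ (fun _ => rfl) m

theorem smulSection_bracket (f : M → ℝ) (hf : ContMDiff IM 𝓘(ℝ, ℝ) ∞ f) (X Y : ΓA) (m : M) :
    L.bracket (smulSection f hf X) Y m = f m • L.bracket X Y m -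
      derivAlong f (L.anchorMap ⟨m, Y m⟩) • X m := by
  rw [L.bracket_antisymm, L.bracket_antisymm X Y]
  change -(L.bracket Y (smulSection f hf X) m) = f m • -(L.bracket Y X m) - _
  rw [L.bracket_smulSection, smul_neg, neg_add, sub_eq_add_neg]

/-- Locality follows from the Leibniz rule: if `χ` is supported where `Y = Y'`, then `χ (Y - Y') =
0`. In the expansion of `[X, χ (Y - Y')]` at `m` the derivative term vanishes with `Y - Y'`, and
`χ(m) = 1`. -/
theorem bracket_congr_right (X : ΓA) {Y Y' : ΓA} {m : M} (h : ∀ᶠ m' in 𝓝 m, Y m' = Y' m') :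
    L.bracket X Y m = L.bracket X Y' m := by
  obtain ⟨χ, hχ, h1, hs⟩ := exists_bump (J := IM) h
  have h2 : smulSection χ hχ (Y - Y') = 0 := by
    ext m'
    by_cases hm : χ m' = 0
    · simp [hm]
    · have : Y m' = Y' m' := hs (subset_tsupport χ hm)
      simp [this]
  have h3 := L.bracket_smulSection X χ hχ (Y - Y') m
  rw [h2, L.bracket_zero, h1.self_of_nhds, one_smul, L.bracket_sub] at h3
  have h4 : (Y - Y') m = 0 := by simp [h.self_of_nhds]
  rw [h4, smul_zero, add_zero] at h3
  exact (sub_eq_zero.1 h3.symm)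

theorem bracket_congr {X X' Y Y' : ΓA} {m : M} (h : ∀ᶠ m' in 𝓝 m, X m' = X' m')
    (h' : ∀ᶠ m' in 𝓝 m, Y m' = Y' m') : L.bracket X Y m = L.bracket X' Y' m := by
  rw [L.bracket_congr_right X h', L.bracket_antisymm, L.bracket_antisymm X']
  exact congrArg Neg.neg (L.bracket_congr_right Y' h)

theorem anchorMap_proj (p : TotalSpace F V) : (L.anchorMap p).proj = p.proj := rfl

theorem contMDiff_anchorMap : ContMDiff IA (IM).tangent ∞ L.anchorMap := L.smooth_anchor

theorem contMDiff_anchor_section (X : ΓA) :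
    ContMDiff IM (IM).tangent ∞ (fun m => L.anchorMap ⟨m, X m⟩) :=
  L.contMDiff_anchorMap.comp X.contMDiff

theorem contMDiff_anchor_derivAlong (X : ΓA) {f : M → ℝ} (hf : ContMDiff IM 𝓘(ℝ, ℝ) ∞ f) :
    ContMDiff IM 𝓘(ℝ, ℝ) ∞ (fun m => derivAlong f (L.anchorMap ⟨m, X m⟩)) :=
  (contMDiff_derivAlong hf).comp (L.contMDiff_anchor_section X)

theorem derivAlong_anchorMap_smul (f : M → ℝ) (m : M) (c : ℝ) (a : V m) :
    derivAlong f (L.anchorMap ⟨m, c • a⟩) = c * derivAlong f (L.anchorMap ⟨m, a⟩) := by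
  unfold anchorMap
  dsimp only
  rw [map_smul, derivAlong_mk_smul]

/-- The pullback by the anchor of the differential of a function. -/
def coAnchor (f : M → ℝ) (hf : ContMDiff IM 𝓘(ℝ, ℝ) ∞ f) : ΓAd :=
  ⟨fun m => (mfderiv IM 𝓘(ℝ, ℝ) f m : E →L[ℝ] ℝ).comp (L.anchor m),
    contMDiff_dual_of_pairing fun X => L.contMDiff_anchor_derivAlong X hf⟩

theorem coAnchor_apply (f : M → ℝ) (hf : ContMDiff IM 𝓘(ℝ, ℝ) ∞ f) (m : M) (a : V m) :
    L.coAnchor f hf m a = derivAlong f (L.anchorMap ⟨m, a⟩) := rfl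

/-- Replacing `X` by `f X` produces the term `a(Y)(f) ⟨φ, X⟩` twice with opposite signs, so the
expression is function-linear in `X`. -/
theorem exists_lieDual (Y : ΓA) (φ : ΓAd) : ∃ ψ : ΓAd, ∀ (X : ΓA) (m : M),
    ψ m (X m) = derivAlong (fun m' => φ m' (X m')) (L.anchorMap ⟨m, Y m⟩) - φ m (L.bracket Y X m) := by
  have hd : ∀ X : ΓA, MDifferentiable IM 𝓘(ℝ, ℝ) (fun m' => φ m' (X m')) := fun X =>
    (contMDiff_pairing φ X).mdifferentiable (by simp)
  refine exists_dual_of_tensorial (Q := fun X m => derivAlong (fun m' => φ m' (X m'))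
    (L.anchorMap ⟨m, Y m⟩) - φ m (L.bracket Y X m)) (fun X => ?_) (fun X X' m => ?_)
    (fun f hf X m => ?_)
  · exact (L.contMDiff_anchor_derivAlong Y (contMDiff_pairing φ X)).sub (contMDiff_pairing φ _)
  · have h1 : (fun m' => φ m' ((X + X') m')) = fun m' => φ m' (X m') + φ m' (X' m') :=
      funext fun m' => (φ m').map_add _ _
    rw [h1, derivAlong_add (hd X _) (hd X' _), L.bracket_add]
    have h2 : φ m ((L.bracket Y X + L.bracket Y X') m) = φ m (L.bracket Y X m) +
      φ m (L.bracket Y X' m) := (φ m).map_add _ _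
    rw [h2]
    ring
  · have h1 : (fun m' => φ m' (smulSection f hf X m')) = fun m' => f m' * φ m' (X m') :=
      funext fun m' => (φ m').map_smul _ _
    rw [h1, derivAlong_mul (hf.mdifferentiable (by simp) _) (hd X _), L.bracket_smulSection, map_add,
      map_smul, map_smul, smul_eq_mul, smul_eq_mul, anchorMap_proj]
    ring

/-- The Lie derivative of a section of the dual bundle. -/
def lieDual (Y : ΓA) (φ : ΓAd) : ΓAd := (L.exists_lieDual Y φ).choose

theorem lieDual_apply (Y : ΓA) (φ : ΓAd) (X : ΓA) (m : M) : L.lieDual Y φ m (X m) =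
    derivAlong (fun m' => φ m' (X m')) (L.anchorMap ⟨m, Y m⟩) - φ m (L.bracket Y X m) :=
  (L.exists_lieDual Y φ).choose_spec X m

end LieAlgebroid

end Algebroid

end LieAlgebroidTheory
end

noncomputable section

namespace LieAlgebroidTheory

/-! ### Second derivatives on `TM`, and the linear functions that separate the fibres of `TA → TM`
-/

section Algebroid

set_option linter.unusedSectionVars false

variable {E : Type*} [NormedAddCommGroup E] [NormedSpace ℝ E]
  {M : Type*} [TopologicalSpace M] [ChartedSpace E M]
  {F : Type*} [NormedAddCommGroup F] [NormedSpace ℝ F]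
  {V : M → Type*} [TopologicalSpace (TotalSpace F V)] [∀ m, AddCommGroup (V m)]
  [∀ m, Module ℝ (V m)] [∀ m, TopologicalSpace (V m)] [FiberBundle F V] [VectorBundle ℝ F V]

local notation "IM" => modelWithCornersSelf ℝ E
local notation "IA" => ModelWithCorners.prod (modelWithCornersSelf ℝ E) (modelWithCornersSelf ℝ F)
local notation "IAd" =>
  ModelWithCorners.prod (modelWithCornersSelf ℝ E) (modelWithCornersSelf ℝ (F →L[ℝ] ℝ))
local notation "TM" => TangentBundle (modelWithCornersSelf ℝ E) M
local notation "TA" => TangentBundle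
  (ModelWithCorners.prod (modelWithCornersSelf ℝ E) (modelWithCornersSelf ℝ F)) (TotalSpace F V)
local notation "Ad" => TotalSpace (F →L[ℝ] ℝ) (fun m : M => V m →L[ℝ] ℝ)
local notation "ΓA" => ContMDiffSection (modelWithCornersSelf ℝ E) F ∞ V
local notation "ΓAd" => ContMDiffSection (modelWithCornersSelf ℝ E) (F →L[ℝ] ℝ) ∞
  (fun m : M => V m →L[ℝ] ℝ)

variable [IsManifold 𝓘(ℝ, E) ∞ M] [ContMDiffVectorBundle ∞ F V 𝓘(ℝ, E)] [T2Space M]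
  [FiniteDimensional ℝ E] [FiniteDimensional ℝ F]

theorem contDiffAt_comp_extChartAt_symm {f : M → ℝ} {m₀ : M} {U : Set M} (hU : IsOpen U)
    (hf : ContMDiffOn IM 𝓘(ℝ, ℝ) ∞ f U) {y : E} (hy : y ∈ (extChartAt IM m₀).target)
    (hyU : (extChartAt IM m₀).symm y ∈ U) :
    ContDiffAt ℝ ∞ (fun y => f ((extChartAt IM m₀).symm y)) y := by
  have h1 : ContMDiffAt 𝓘(ℝ, E) IM ∞ (extChartAt IM m₀).symm y :=
    (contMDiffOn_extChartAt_symm m₀).contMDiffAt ((isOpen_extChartAt_target m₀).mem_nhds hy)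
  exact ((hf.contMDiffAt (hU.mem_nhds hyU)).comp y h1).contDiffAt

/-- The differential of a function in the coordinates of a chart. -/
theorem mfderiv_symm_trivializationAt {f : M → ℝ} {m₀ : M} {y : E}
    (hy : y ∈ (extChartAt IM m₀).target)
    (hf : MDifferentiableAt IM 𝓘(ℝ, ℝ) f ((extChartAt IM m₀).symm y)) (b : E) :
    mfderiv IM 𝓘(ℝ, ℝ) f ((extChartAt IM m₀).symm y)
      ((trivializationAt E (TangentSpace IM) m₀).symm ((extChartAt IM m₀).symm y) b) =
      fderiv ℝ (fun y => f ((extChartAt IM m₀).symm y)) y b := by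
  have : IsManifold IM 1 M := IsManifold.of_le (n := ∞) (by simp)
  have hs : (extChartAt IM m₀).symm y ∈ (chartAt E m₀).source := by
    have := (extChartAt IM m₀).map_target hy
    rwa [extChartAt_source] at this
  have h1 := TangentBundle.symmL_trivializationAt (I := IM) hs
  rw [(extChartAt IM m₀).right_inv hy] at h1
  have h2 : (trivializationAt E (TangentSpace IM) m₀).symmL ℝ ((extChartAt IM m₀).symm y) b =
    (trivializationAt E (TangentSpace IM) m₀).symm ((extChartAt IM m₀).symm y) b :=
    (trivializationAt E (TangentSpace IM) m₀).symmL_apply (by simpa using hs) b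
  rw [← h2, h1]
  have h3 : MDifferentiableAt 𝓘(ℝ, E) IM (extChartAt IM m₀).symm y := by
    have := mdifferentiableWithinAt_extChartAt_symm (I := IM) hy
    rwa [modelWithCornersSelf_coe, range_id, mdifferentiableWithinAt_univ] at this
  have h4 := mfderiv_comp (I' := IM) y hf h3
  rw [modelWithCornersSelf_coe, range_id, mfderivWithin_univ]
  refine (congrArg (fun A : E →L[ℝ] ℝ => A b) h4).symm.trans ?_
  exact congrArg (fun A : E →L[ℝ] ℝ => A b) mfderiv_eq_fderiv

theorem tangent_trivialization_snd (m : M) (a : E) :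
    (trivializationAt E (TangentSpace IM) m (⟨m, a⟩ : TM)).2 = a :=
  tangentCoordChange_self (I := IM) (mem_extChartAt_source m)

/-- In the chart at `m` the function `df` on `TM` is `(y, b) ↦ Df(y) b`. Its derivative combines the
second derivative, in the direction of the base, with `Df(y)` in the direction of the fibre. -/
theorem hasMFDerivAt_derivAlong {f : M → ℝ} {m : M} {U : Set M} (hU : IsOpen U) (hm : m ∈ U)
    (hf : ContMDiffOn IM 𝓘(ℝ, ℝ) ∞ f U) (a : E) :
    HasMFDerivAt (IM).tangent 𝓘(ℝ, ℝ) (fun z : TM => derivAlong f z) (⟨m, a⟩ : TM)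
      (((fderiv ℝ (fderiv ℝ (fun y => f ((extChartAt IM m).symm y))) (extChartAt IM m m)).flip a).comp
        (ContinuousLinearMap.fst ℝ E E) +
      (fderiv ℝ (fun y => f ((extChartAt IM m).symm y)) (extChartAt IM m m)).comp
        (ContinuousLinearMap.snd ℝ E E)) := by
  have hsm := contMDiffOn_mfderiv_apply (J := IM) hU hf
  have hO : IsOpen (π E (TangentSpace IM : M → Type _) ⁻¹' U) :=
    hU.preimage (FiberBundle.continuous_proj E (TangentSpace IM : M → Type _))
  refine ⟨(hsm.contMDiffAt (hO.mem_nhds hm)).continuousAt, ?_⟩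
  apply HasFDerivAt.hasFDerivWithinAt
  have hx : extChartAt (IM).tangent (⟨m, a⟩ : TM) (⟨m, a⟩ : TM) = (extChartAt IM m m, a) := by
    rw [FiberBundle.extChartAt]
    refine Prod.ext ?_ ?_
    · have h0 : (trivializationAt E (TangentSpace IM) m (⟨m, a⟩ : TM)).1 = m :=
        Trivialization.coe_fst' _ (FiberBundle.mem_baseSet_trivializationAt' m)
      exact congrArg (extChartAt IM m) h0
    · exact tangent_trivialization_snd m a
  rw [hx]
  have hU' : ∀ᶠ y in 𝓝 (extChartAt IM m m), (extChartAt IM m).symm y ∈ U :=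
    (continuousAt_extChartAt_symm m).preimage_mem_nhds (by
      rw [extChartAt_to_inv]; exact hU.mem_nhds hm)
  have hc : ContDiffAt ℝ ∞ (fun y => f ((extChartAt IM m).symm y)) (extChartAt IM m m) :=
    contDiffAt_comp_extChartAt_symm hU hf (mem_extChartAt_target m)
      (by rw [extChartAt_to_inv]; exact hm)
  have hd : DifferentiableAt ℝ (fderiv ℝ (fun y => f ((extChartAt IM m).symm y)))
      (extChartAt IM m m) :=
    (hc.fderiv_right (m := 1) (by norm_cast)).differentiableAt (by simp)
  have h1 : HasFDerivAt (fun z : E × E => fderiv ℝ (fun y => f ((extChartAt IM m).symm y)) z.1 z.2)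
      (((fderiv ℝ (fderiv ℝ (fun y => f ((extChartAt IM m).symm y))) (extChartAt IM m m)).flip a).comp
        (ContinuousLinearMap.fst ℝ E E) +
      (fderiv ℝ (fun y => f ((extChartAt IM m).symm y)) (extChartAt IM m m)).comp
        (ContinuousLinearMap.snd ℝ E E)) (extChartAt IM m m, a) := by
    have h2 : HasFDerivAt (fun z : E × E => fderiv ℝ (fun y => f ((extChartAt IM m).symm y)) z.1)
      ((fderiv ℝ (fderiv ℝ (fun y => f ((extChartAt IM m).symm y))) (extChartAt IM m m)).comp
        (ContinuousLinearMap.fst ℝ E E)) (extChartAt IM m m, a) :=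
      HasFDerivAt.comp (extChartAt IM m m, a) hd.hasFDerivAt hasFDerivAt_fst
    refine (h2.clm_apply hasFDerivAt_snd).congr_fderiv ?_
    ext z <;> simp
  refine h1.congr_of_eventuallyEq ?_
  have ht : ∀ᶠ z : E × E in 𝓝 (extChartAt IM m m, a), z.1 ∈ (extChartAt IM m).target ∧
      (extChartAt IM m).symm z.1 ∈ U :=
    (continuousAt_fst (p := (extChartAt IM m m, a))).eventually
      ((show ∀ᶠ y in 𝓝 (extChartAt IM m m), y ∈ (extChartAt IM m).target from
        extChartAt_target_mem_nhds (I := IM) m).and hU')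
  filter_upwards [ht] with z hz
  have h5 := mfderiv_symm_trivializationAt hz.1 ((hf.contMDiffAt (hU.mem_nhds hz.2)).mdifferentiableAt
    (by simp)) z.2
  rw [← h5]
  simp only [writtenInExtChartAt, Function.comp]
  have h6 : (extChartAt (IM).tangent (⟨m, a⟩ : TM)).symm z = (⟨(extChartAt IM m).symm z.1,
    (trivializationAt E (TangentSpace IM) m).symm ((extChartAt IM m).symm z.1) z.2⟩ : TM) := by
    rw [FiberBundle.extChartAt]
    have h7 : (extChartAt IM m).symm z.1 ∈ (trivializationAt E (TangentSpace IM) m).baseSet := by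
      have := (extChartAt IM m).map_target hz.1
      simpa using this
    exact ((trivializationAt E (TangentSpace IM) m).mk_symm h7 z.2).symm
  rw [h6]
  rfl

theorem derivAlong_derivAlong {f : M → ℝ} {m : M} {U : Set M} (hU : IsOpen U) (hm : m ∈ U)
    (hf : ContMDiffOn IM 𝓘(ℝ, ℝ) ∞ f U) (a u b : E) :
    derivAlong (fun z : TM => derivAlong f z)
      (⟨⟨m, a⟩, ((u, b) : E × E)⟩ : TangentBundle (IM).tangent TM) =
      fderiv ℝ (fderiv ℝ (fun y => f ((extChartAt IM m).symm y))) (extChartAt IM m m) u a +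
      fderiv ℝ (fun y => f ((extChartAt IM m).symm y)) (extChartAt IM m m) b :=
  congrArg (fun A : E × E →L[ℝ] ℝ => A (u, b)) (hasMFDerivAt_derivAlong hU hm hf a).mfderiv

/-- The differential of a function, regarded as a function on `TM`, has the same derivative along a
vector and along its image by the canonical involution. -/
theorem derivAlong_canonicalInvolution {f : M → ℝ} (hf : ContMDiff IM 𝓘(ℝ, ℝ) ∞ f)
    (w : TangentBundle (IM).tangent TM) :
    derivAlong (fun z : TM => derivAlong f z) (canonicalInvolution w) =
      derivAlong (fun z : TM => derivAlong f z) w := by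
  obtain ⟨⟨m, a⟩, ⟨u, b⟩⟩ := w
  have hc : ContDiffAt ℝ ∞ (fun y => f ((extChartAt IM m).symm y)) (extChartAt IM m m) :=
    contDiffAt_comp_extChartAt_symm isOpen_univ hf.contMDiffOn (mem_extChartAt_target m) trivial
  -- The involution exchanges the two arguments of the second derivative and leaves the remaining
  -- term alone.
  have hs := hc.isSymmSndFDerivAt (by
    rw [minSmoothness_of_isRCLikeNormedField]
    exact WithTop.coe_le_coe.2 (le_top : (2 : ℕ∞) ≤ ⊤)) u a
  refine (derivAlong_derivAlong isOpen_univ trivial hf.contMDiffOn u a b).trans ?_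
  rw [← hs]
  exact (derivAlong_derivAlong isOpen_univ trivial hf.contMDiffOn a u b).symm

theorem derivAlong_comp_proj {f : M → ℝ} (hf : MDifferentiable IM 𝓘(ℝ, ℝ) f) (ξ : TA) :
    derivAlong (fun p : TotalSpace F V => f p.proj) ξ =
      derivAlong f (tangentMap IA IM (π F V) ξ) :=
  derivAlong_comp (J₂ := IM) (k := π F V) (hf _) (hasMFDerivAt_proj _).mdifferentiableAt

theorem exists_const_section (m : M) (a : F) :
    ∃ X : ΓA, ∀ᶠ m' in 𝓝 m, X m' = (trivializationAt F V m).symm m' a := by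
  refine exists_section_eventuallyEq (trivializationAt F V m).open_baseSet
    (FiberBundle.mem_baseSet_trivializationAt' m) ?_
  rw [(trivializationAt F V m).contMDiffOn_section_baseSet_iff]
  refine (contMDiffOn_const (c := a)).congr fun m' hm' => ?_
  rw [(trivializationAt F V m).apply_mk_symm hm']

theorem derivAlong_linearFunction_tangentSection (φ : ΓAd) (X : ΓA) (v : TM) :
    derivAlong (linearFunction φ) (tangentSection X v).val = derivAlong (fun m => φ m (X m)) v :=
  (derivAlong_comp (J₂ := IA) (h := linearFunction φ) (mdifferentiable_linearFunction φ _)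
    (X.mdifferentiableAt (x := v.proj))).symm

theorem derivAlong_linearFunction_verticalLift (φ : ΓAd) (m : M) (a b : V m) :
    derivAlong (linearFunction φ) (⟨⟨m, a⟩, verticalLift E F a b⟩ : TA) = φ m b :=
  mfderiv_verticalLift (E := E) (mdifferentiable_linearFunction φ ⟨m, a⟩) (c := φ m b)
    (fun _ => ((φ m).map_add _ _).trans (congrArg _ ((φ m).map_smul _ _)))

/-- The summand `T(0)(v)` contributes nothing since `ℓ_φ` vanishes on the zero section; on the
vertical summand `ℓ_φ` is linear. -/
theorem derivAlong_linearFunction_coreSection (φ : ΓAd) (X : ΓA) (v : TM) :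
    derivAlong (linearFunction φ) (coreSection X v).val = φ v.proj (X v.proj) := by
  refine (derivAlong_mk_add _ _ _).trans ?_
  rw [derivAlong_linearFunction_verticalLift]
  have h1 := derivAlong_linearFunction_tangentSection φ 0 v
  have h2 : (fun m => φ m ((0 : ΓA) m)) = fun _ => 0 := funext fun m => (φ m).map_zero
  rw [h2, derivAlong_const] at h1
  refine (congrArg (· + _) h1).trans (zero_add _)

/-- The fibre coordinate of `T(X)(v)` vanishes for a section `X` that is constant in the
trivialization. -/
theorem tangentSection_of_eventuallyEq_const {m : M} {a : F} {X : ΓA}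
    (hX : ∀ᶠ m' in 𝓝 m, X m' = (trivializationAt F V m).symm m' a) (v : E) :
    tangentSection X (⟨m, v⟩ : TM) = (TqFiber.coord F V (⟨m, v⟩ : TM)).symm (a, 0) := by
  rw [Equiv.eq_symm_apply]
  refine Prod.ext ?_ ?_
  · change (trivializationAt F V m ⟨m, X m⟩).2 = a
    rw [hX.self_of_nhds, (trivializationAt F V m).apply_mk_symm
      (FiberBundle.mem_baseSet_trivializationAt' m)]
  · have h1 := mfderiv_comp (I' := IA) m
      (hasMFDerivAt_triv (⟨m, X m⟩ : TotalSpace F V)).mdifferentiableAt (X.mdifferentiableAt (x := m))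
    have h2 : ((fun r : TotalSpace F V => (trivializationAt F V m r).2) ∘
        fun m' => (⟨m', X m'⟩ : TotalSpace F V)) =ᶠ[𝓝 m] fun _ => a := by
      filter_upwards [hX, (trivializationAt F V m).open_baseSet.mem_nhds
        (FiberBundle.mem_baseSet_trivializationAt' m)] with m' h h'
      simp only [Function.comp, h]
      rw [(trivializationAt F V m).apply_mk_symm h']
    have h3 := h2.mfderiv_eq (I := IM) (I' := 𝓘(ℝ, F))
    rw [mfderiv_const] at h3
    exact congrArg (fun A : E →L[ℝ] F => A v) (h1.symm.trans h3)

theorem coord_symm_eq (v : TM) (a b : F) :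
    ((TqFiber.coord F V v).symm (a, b)).val =
      (⟨⟨v.proj, (trivializationAt F V v.proj).symm v.proj a⟩, ((v.snd, b) : E × F)⟩ : TA) := rfl

/-- The element with coordinates `(a, b)` is `T(X)(v)`, for a section `X` which is constant in the
trivialization, plus a vertical vector. The first part is differentiated by the chain rule, the
second by linearity of `ℓ_φ`. -/
theorem derivAlong_linearFunction_coord_symm (φ : ΓAd) (v : TM) {X : ΓA} {a : F}
    (hX : ∀ᶠ m' in 𝓝 v.proj, X m' = (trivializationAt F V v.proj).symm m' a) (b : F) :
    derivAlong (linearFunction φ) ((TqFiber.coord F V v).symm (a, b)).val =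
      derivAlong (fun m => φ m (X m)) v +
        φ v.proj ((trivializationAt F V v.proj).symm v.proj b) := by
  rw [← derivAlong_linearFunction_tangentSection, ← derivAlong_linearFunction_verticalLift φ v.proj
    ((trivializationAt F V v.proj).symm v.proj a)]
  have h1 : (tangentSection X v).val = ((TqFiber.coord F V v).symm (a, 0)).val :=
    congrArg TqFiber.val (tangentSection_of_eventuallyEq_const hX v.snd)
  rw [h1]
  refine Eq.trans ?_ (derivAlong_mk_add _ _ _)
  rw [verticalLift_eq,
    (trivializationAt F V v.proj).apply_mk_symm (FiberBundle.mem_baseSet_trivializationAt' v.proj)]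
  refine congrArg (fun w : E × F => derivAlong (linearFunction φ)
    (⟨⟨v.proj, (trivializationAt F V v.proj).symm v.proj a⟩, w⟩ : TA)) ?_
  refine Prod.ext ?_ ?_
  · exact (add_zero _).symm
  · exact (zero_add _).symm

variable (F V) in
/-- `TqFiber.coord` as a linear equivalence. -/
def TqFiber.linearCoord (v : TM) : TqFiber F V v ≃ₗ[ℝ] F × F :=
  (TqFiber.coord F V v).linearEquiv ℝ

theorem symm_trivializationAt_eq (m : M) (a : F) : (trivializationAt F V m).symm m a =
    (trivializationAt F V m).symmL ℝ m a :=
  ((trivializationAt F V m).symmL_apply (FiberBundle.mem_baseSet_trivializationAt' m) a).symm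

/-- The linear function on `T(q)⁻¹(v)` given by the value of `ℓ_φ` at the base point. -/
def valuePairing (φ : ΓAd) (v : TM) : TqFiber F V v →ₗ[ℝ] ℝ :=
  ((φ v.proj).toLinearMap ∘ₗ ((trivializationAt F V v.proj).symmL ℝ v.proj).toLinearMap ∘ₗ
    LinearMap.fst ℝ F F) ∘ₗ (TqFiber.linearCoord F V v).toLinearMap

theorem valuePairing_apply (φ : ΓAd) (v : TM) (ξ : TqFiber F V v) :
    valuePairing φ v ξ = linearFunction φ ξ.val.proj := by
  obtain ⟨⟨a, b⟩, rfl⟩ := (TqFiber.coord F V v).symm.surjective ξ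
  rw [coord_symm_eq, symm_trivializationAt_eq]
  simp only [valuePairing, TqFiber.linearCoord, LinearMap.comp_apply, LinearEquiv.coe_coe,
    Equiv.linearEquiv_apply, Equiv.apply_symm_apply]
  rfl

/-- Additivity refers to the bundle structure over `TM`: elements with different base points in `A`
are added, so linearity of a differential at one point is not enough. Sections constant in the
trivialization turn it into additivity of `X ↦ ⟨φ, X⟩`. -/
theorem derivAlong_linearFunction_coord_add (φ : ΓAd) (v : TM) (c d : F × F) :
    derivAlong (linearFunction φ) ((TqFiber.coord F V v).symm (c + d)).val =
      derivAlong (linearFunction φ) ((TqFiber.coord F V v).symm c).val +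
      derivAlong (linearFunction φ) ((TqFiber.coord F V v).symm d).val := by
  obtain ⟨a, b⟩ := c
  obtain ⟨a', b'⟩ := d
  obtain ⟨X, hX⟩ := exists_const_section (E := E) (V := V) v.proj a
  obtain ⟨X', hX'⟩ := exists_const_section (E := E) (V := V) v.proj a'
  have hXX' : ∀ᶠ m' in 𝓝 v.proj, (X + X') m' = (trivializationAt F V v.proj).symm m' (a + a') := by
    filter_upwards [hX, hX', (trivializationAt F V v.proj).open_baseSet.mem_nhds
        (FiberBundle.mem_baseSet_trivializationAt' v.proj)] with m h h' hm
    rw [← (trivializationAt F V v.proj).symmL_apply (R := ℝ) hm, map_add,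
      (trivializationAt F V v.proj).symmL_apply (R := ℝ) hm,
      (trivializationAt F V v.proj).symmL_apply (R := ℝ) hm, ← h, ← h']
    rfl
  rw [Prod.mk_add_mk, derivAlong_linearFunction_coord_symm φ v hXX',
    derivAlong_linearFunction_coord_symm φ v hX, derivAlong_linearFunction_coord_symm φ v hX',
    symm_trivializationAt_eq, symm_trivializationAt_eq, symm_trivializationAt_eq, map_add, map_add]
  have h1 : (fun m => φ m ((X + X') m)) = fun m => φ m (X m) + φ m (X' m) :=
    funext fun m => (φ m).map_add _ _
  rw [h1, derivAlong_add ((contMDiff_pairing φ X).mdifferentiable (by simp) _)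
    ((contMDiff_pairing φ X').mdifferentiable (by simp) _)]
  ring

theorem derivAlong_linearFunction_coord_smul (φ : ΓAd) (v : TM) (r : ℝ) (c : F × F) :
    derivAlong (linearFunction φ) ((TqFiber.coord F V v).symm (r • c)).val =
      r * derivAlong (linearFunction φ) ((TqFiber.coord F V v).symm c).val := by
  obtain ⟨a, b⟩ := c
  obtain ⟨X, hX⟩ := exists_const_section (E := E) (V := V) v.proj a
  have hrX : ∀ᶠ m' in 𝓝 v.proj, (r • X) m' = (trivializationAt F V v.proj).symm m' (r • a) := by
    filter_upwards [hX, (trivializationAt F V v.proj).open_baseSet.mem_nhds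
        (FiberBundle.mem_baseSet_trivializationAt' v.proj)] with m h hm
    rw [← (trivializationAt F V v.proj).symmL_apply (R := ℝ) hm, map_smul,
      (trivializationAt F V v.proj).symmL_apply (R := ℝ) hm, ← h]
    rfl
  rw [Prod.smul_mk, derivAlong_linearFunction_coord_symm φ v hrX,
    derivAlong_linearFunction_coord_symm φ v hX,
    symm_trivializationAt_eq, symm_trivializationAt_eq, map_smul, map_smul]
  have h1 : (fun m => φ m ((r • X) m)) = fun m => r * φ m (X m) :=
    funext fun m => (φ m).map_smul _ _
  rw [h1, derivAlong_mul mdifferentiableAt_const ((contMDiff_pairing φ X).mdifferentiable (by simp) _),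
    derivAlong_const, smul_eq_mul]
  ring

/-- The linear function on `T(q)⁻¹(v)` given by the differential of `ℓ_φ`. -/
def derivPairing (φ : ΓAd) (v : TM) : TqFiber F V v →ₗ[ℝ] ℝ :=
  { toFun := fun c => derivAlong (linearFunction φ) ((TqFiber.coord F V v).symm c).val
    map_add' := derivAlong_linearFunction_coord_add φ v
    map_smul' := derivAlong_linearFunction_coord_smul φ v : F × F →ₗ[ℝ] ℝ} ∘ₗ
    (TqFiber.linearCoord F V v).toLinearMap

theorem derivPairing_apply (φ : ΓAd) (v : TM) (ξ : TqFiber F V v) :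
    derivPairing φ v ξ = derivAlong (linearFunction φ) ξ.val := by
  change derivAlong (linearFunction φ) ((TqFiber.coord F V v).symm (TqFiber.coord F V v ξ)).val = _
  rw [Equiv.symm_apply_apply]

/-- The values of the `ℓ_φ` determine the base point in `A`. With the base point fixed, the
differentials of the `ℓ_φ` differ only through the vertical coordinate and determine it. -/
theorem TqFiber.ext_pairing {v : TM} {ξ η : TqFiber F V v}
    (h0 : ∀ φ : ΓAd, valuePairing φ v ξ = valuePairing φ v η)
    (h1 : ∀ φ : ΓAd, derivPairing φ v ξ = derivPairing φ v η) : ξ = η := by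
  simp only [valuePairing_apply, derivPairing_apply] at h0 h1
  obtain ⟨⟨a, b⟩, rfl⟩ := (TqFiber.coord F V v).symm.surjective ξ
  obtain ⟨⟨a', b'⟩, rfl⟩ := (TqFiber.coord F V v).symm.surjective η
  have hinj : ∀ c d : F, (trivializationAt F V v.proj).symm v.proj c =
      (trivializationAt F V v.proj).symm v.proj d → c = d := by
    intro c d hcd
    have hm := FiberBundle.mem_baseSet_trivializationAt' (F := F) (E := V) v.proj
    have h2 := congrArg (fun r => (trivializationAt F V v.proj ⟨v.proj, r⟩).2) hcd
    simpa only [(trivializationAt F V v.proj).apply_mk_symm hm] using h2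
  have ha : a = a' := hinj a a' (eq_of_forall_dual (E := E) (F := F) fun φ => h0 φ)
  subst ha
  obtain ⟨X, hX⟩ := exists_const_section (E := E) (V := V) v.proj a
  have hb : b = b' := by
    refine hinj b b' (eq_of_forall_dual (E := E) (F := F) fun φ => ?_)
    have h2 := h1 φ
    rw [derivAlong_linearFunction_coord_symm φ v hX, derivAlong_linearFunction_coord_symm φ v hX] at h2
    exact add_left_cancel h2
  rw [hb]

@[simp] theorem valuePairing_tangentSection (φ : ΓAd) (X : ΓA) (v : TM) :
    valuePairing φ v (tangentSection X v) = φ v.proj (X v.proj) := valuePairing_apply _ _ _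

@[simp] theorem valuePairing_coreSection (φ : ΓAd) (X : ΓA) (v : TM) :
    valuePairing φ v (coreSection X v) = 0 :=
  (valuePairing_apply _ _ _).trans (φ v.proj).map_zero

@[simp] theorem derivPairing_tangentSection (φ : ΓAd) (X : ΓA) (v : TM) :
    derivPairing φ v (tangentSection X v) = derivAlong (fun m => φ m (X m)) v :=
  (derivPairing_apply _ _ _).trans (derivAlong_linearFunction_tangentSection φ X v)

@[simp] theorem derivPairing_coreSection (φ : ΓAd) (X : ΓA) (v : TM) :
    derivPairing φ v (coreSection X v) = φ v.proj (X v.proj) :=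
  (derivPairing_apply _ _ _).trans (derivAlong_linearFunction_coreSection φ X v)

end Algebroid

end LieAlgebroidTheory
end

noncomputable section

namespace LieAlgebroidTheory

/-! ### The anchor and the bracket of the tangent Lie algebroid, tested on linear functions -/

section Algebroid

set_option linter.unusedSectionVars false

variable {E : Type*} [NormedAddCommGroup E] [NormedSpace ℝ E]
  {M : Type*} [TopologicalSpace M] [ChartedSpace E M]
  {F : Type*} [NormedAddCommGroup F] [NormedSpace ℝ F]
  {V : M → Type*} [TopologicalSpace (TotalSpace F V)] [∀ m, AddCommGroup (V m)]
  [∀ m, Module ℝ (V m)] [∀ m, TopologicalSpace (V m)] [FiberBundle F V] [VectorBundle ℝ F V]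

local notation "IM" => modelWithCornersSelf ℝ E
local notation "IA" => ModelWithCorners.prod (modelWithCornersSelf ℝ E) (modelWithCornersSelf ℝ F)
local notation "IAd" =>
  ModelWithCorners.prod (modelWithCornersSelf ℝ E) (modelWithCornersSelf ℝ (F →L[ℝ] ℝ))
local notation "TM" => TangentBundle (modelWithCornersSelf ℝ E) M
local notation "TA" => TangentBundle
  (ModelWithCorners.prod (modelWithCornersSelf ℝ E) (modelWithCornersSelf ℝ F)) (TotalSpace F V)
local notation "Ad" => TotalSpace (F →L[ℝ] ℝ) (fun m : M => V m →L[ℝ] ℝ)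
local notation "ΓA" => ContMDiffSection (modelWithCornersSelf ℝ E) F ∞ V
local notation "ΓAd" => ContMDiffSection (modelWithCornersSelf ℝ E) (F →L[ℝ] ℝ) ∞
  (fun m : M => V m →L[ℝ] ℝ)

variable [IsManifold 𝓘(ℝ, E) ∞ M] [ContMDiffVectorBundle ∞ F V 𝓘(ℝ, E)] [T2Space M]
  [FiniteDimensional ℝ E] [FiniteDimensional ℝ F]

/-- Tangent vectors of `TM` are separated by the functions `f ∘ π` and `df`. -/
theorem tangentBundle_tangent_ext {v : TM} {u w : E × E}
    (h0 : ∀ f : M → ℝ, ContMDiff IM 𝓘(ℝ, ℝ) ∞ f →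
      derivAlong (fun z : TM => f z.proj) (⟨v, u⟩ : TangentBundle (IM).tangent TM) =
        derivAlong (fun z : TM => f z.proj) (⟨v, w⟩ : TangentBundle (IM).tangent TM))
    (h1 : ∀ f : M → ℝ, ContMDiff IM 𝓘(ℝ, ℝ) ∞ f →
      derivAlong (fun z : TM => derivAlong f z) (⟨v, u⟩ : TangentBundle (IM).tangent TM) =
        derivAlong (fun z : TM => derivAlong f z) (⟨v, w⟩ : TangentBundle (IM).tangent TM)) :
    u = w := by
  obtain ⟨m, a⟩ := v
  obtain ⟨u, b⟩ := u
  obtain ⟨u', b'⟩ := w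
  have hu : u = u' := by
    refine tangent_ext (J := IM) (p := m) fun f hf => ?_
    have h2 := h0 f hf
    have h3 : ∀ c : E × E, derivAlong (fun z : TM => f z.proj)
        (⟨⟨m, a⟩, c⟩ : TangentBundle (IM).tangent TM) = derivAlong f (⟨m, c.1⟩ : TM) := by
      intro c
      rw [← tangentMap_proj_mk (F := E) (V := (TangentSpace IM : M → Type _)) m a c]
      exact derivAlong_comp_proj (F := E) (V := (TangentSpace IM : M → Type _))
        (hf.mdifferentiable (by simp)) _
    rwa [h3, h3] at h2
  subst hu
  -- With equal first components the second derivative terms of `df` agree, which leaves `df(b) =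
  -- df(b')`.
  have hb : b = b' := by
    refine tangent_ext (J := IM) (p := m) fun f hf => ?_
    have h2 := ((derivAlong_derivAlong isOpen_univ trivial hf.contMDiffOn a u b).symm.trans
      (h1 f hf)).trans (derivAlong_derivAlong isOpen_univ trivial hf.contMDiffOn a u b')
    rw [add_right_inj] at h2
    have h3 : ∀ c : E, derivAlong f (⟨m, c⟩ : TM) =
        fderiv ℝ (fun y => f ((extChartAt IM m).symm y)) (extChartAt IM m m) c := by
      intro c
      have h4 := mfderiv_symm_trivializationAt (mem_extChartAt_target (I := IM) m)
        (f := f) (hf.mdifferentiable (by simp) _) c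
      rw [← h4, extChartAt_to_inv]
      have h5 : (trivializationAt E (TangentSpace IM : M → Type _) m).symm m c = c := by
        have h6 := (trivializationAt E (TangentSpace IM : M → Type _) m).symm_apply_apply_mk
          (FiberBundle.mem_baseSet_trivializationAt' m) c
        rwa [tangent_trivialization_snd] at h6
      rw [h5]
      rfl
    rwa [h3, h3]
  rw [hb]

namespace LieAlgebroid

variable (L : LieAlgebroid E F V)

/-- The involution exchanges the two projections of `T(TM)` to `TM`, and `a` covers the identity of
`M`, so the footpoint of `J(T(a)(ξ))` is the image of `ξ` under the tangent map of the projection of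
`A`. -/
theorem tangentAnchor_proj (ξ : TA) :
    (L.tangentAnchor ξ).proj = tangentMap IA IM (π F V) ξ := by
  have h1 : π E (TangentSpace IM : M → Type _) ∘ L.anchorMap = π F V := rfl
  have h2 := mfderiv_comp (I' := (IM).tangent) ξ.proj
    (g := π E (TangentSpace IM : M → Type _))
    (hasMFDerivAt_proj (F := E) (V := (TangentSpace IM : M → Type _)) _).mdifferentiableAt
    (L.contMDiff_anchorMap.mdifferentiable (by simp) ξ.proj)
  rw [h1, mfderiv_proj (F := E) (V := (TangentSpace IM : M → Type _))] at h2
  refine congrArg (TotalSpace.mk ξ.proj.proj) ?_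
  exact (congrArg (fun A : E × F →L[ℝ] E => A ξ.snd) h2).symm

theorem derivAlong_proj_tangentAnchor {f : M → ℝ} (hf : ContMDiff IM 𝓘(ℝ, ℝ) ∞ f) (ξ : TA) :
    derivAlong (fun z : TM => f z.proj) (L.tangentAnchor ξ) =
      linearFunction (L.coAnchor f hf) ξ.proj := by
  refine (derivAlong_comp_proj (F := E) (V := (TangentSpace IM : M → Type _))
    (hf.mdifferentiable (by simp)) _).trans ?_
  refine (congrArg (derivAlong f) (tangentMap_proj_mk (F := E)
    (V := (TangentSpace IM : M → Type _)) _ _ _)).trans ?_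
  rfl

/-- The involution does not affect the derivative of `df`, and `df ∘ a` is the fibrewise linear
function of the pullback of `df` by the anchor. -/
theorem derivAlong_derivAlong_tangentAnchor {f : M → ℝ} (hf : ContMDiff IM 𝓘(ℝ, ℝ) ∞ f) (ξ : TA) :
    derivAlong (fun z : TM => derivAlong f z) (L.tangentAnchor ξ) =
      derivAlong (linearFunction (L.coAnchor f hf)) ξ := by
  refine (derivAlong_canonicalInvolution hf _).trans ?_
  exact (derivAlong_comp (J₂ := (IM).tangent) (h := fun z : TM => derivAlong f z) (k := L.anchorMap)
    ((contMDiff_derivAlong hf).mdifferentiable (by simp) _)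
    (L.contMDiff_anchorMap.mdifferentiable (by simp) ξ.proj)).symm

/-- Rewrites the anchor with footpoint literally `v`, so that anchors of different elements of one
fibre lie in a single vector space and can be added. -/
theorem tangentAnchor_eq {v : TM} (ξ : TqFiber F V v) :
    L.tangentAnchor ξ.val = (⟨v, (show E × E from (L.tangentAnchor ξ.val).snd)⟩ :
      TangentBundle (IM).tangent TM) := by
  have h := (L.tangentAnchor_proj ξ.val).trans ξ.property
  generalize L.tangentAnchor ξ.val = w at h ⊢
  subst h
  rfl

/-- The anchor of the tangent Lie algebroid on the fibre over `v`. -/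
def tangentAnchorFiber (v : TM) : TqFiber F V v →ₗ[ℝ] E × E where
  toFun ξ := (show E × E from (L.tangentAnchor ξ.val).snd)
  map_add' ξ η := by
    -- On the functions `f ∘ π` and `df` the anchor of `TA` becomes the two pairings with the
    -- pullback of `df`, whose linearity is known.
    refine tangentBundle_tangent_ext (v := v) (fun f hf => ?_) (fun f hf => ?_)
    · refine Eq.trans ?_ (derivAlong_mk_add (J := (IM).tangent) v _ _).symm
      rw [← tangentAnchor_eq, ← tangentAnchor_eq, ← tangentAnchor_eq]
      simp only [L.derivAlong_proj_tangentAnchor hf, ← valuePairing_apply, map_add]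
    · refine Eq.trans ?_ (derivAlong_mk_add (J := (IM).tangent) v _ _).symm
      rw [← tangentAnchor_eq, ← tangentAnchor_eq, ← tangentAnchor_eq]
      simp only [L.derivAlong_derivAlong_tangentAnchor hf, ← derivPairing_apply, map_add]
  map_smul' c ξ := by
    refine tangentBundle_tangent_ext (v := v) (fun f hf => ?_) (fun f hf => ?_)
    · refine Eq.trans ?_ (derivAlong_mk_smul (J := (IM).tangent) v _ _).symm
      rw [← tangentAnchor_eq, ← tangentAnchor_eq]
      simp only [L.derivAlong_proj_tangentAnchor hf, ← valuePairing_apply, map_smul, smul_eq_mul, RingHom.id_apply]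
    · refine Eq.trans ?_ (derivAlong_mk_smul (J := (IM).tangent) v _ _).symm
      rw [← tangentAnchor_eq, ← tangentAnchor_eq]
      simp only [L.derivAlong_derivAlong_tangentAnchor hf, ← derivPairing_apply, map_smul, smul_eq_mul, RingHom.id_apply]

/-- The derivative of a function on `TM` along the anchor of `TA`, as a linear function. -/
def anchorDeriv (g : TM → ℝ) (v : TM) : TqFiber F V v →ₗ[ℝ] ℝ :=
  (show E × E →L[ℝ] ℝ from mfderiv (IM).tangent 𝓘(ℝ, ℝ) g v).toLinearMap ∘ₗ L.tangentAnchorFiber v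

theorem anchorDeriv_apply (g : TM → ℝ) (v : TM) (ξ : TqFiber F V v) :
    L.anchorDeriv g v ξ = derivAlong g (L.tangentAnchor ξ.val) := by
  rw [tangentAnchor_eq]
  rfl

theorem anchorDeriv_proj {f : M → ℝ} (hf : ContMDiff IM 𝓘(ℝ, ℝ) ∞ f) (v : TM) (ξ : TqFiber F V v) :
    L.anchorDeriv (fun z : TM => f z.proj) v ξ = valuePairing (L.coAnchor f hf) v ξ := by
  rw [anchorDeriv_apply, valuePairing_apply, L.derivAlong_proj_tangentAnchor hf]

theorem anchorDeriv_derivAlong {f : M → ℝ} (hf : ContMDiff IM 𝓘(ℝ, ℝ) ∞ f) (v : TM)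
    (ξ : TqFiber F V v) :
    L.anchorDeriv (fun z : TM => derivAlong f z) v ξ = derivPairing (L.coAnchor f hf) v ξ := by
  rw [anchorDeriv_apply, derivPairing_apply, L.derivAlong_derivAlong_tangentAnchor hf]

theorem anchorDeriv_congr {g g' : TM → ℝ} {v : TM} (h : g =ᶠ[𝓝 v] g') :
    L.anchorDeriv g v = L.anchorDeriv g' v := by
  unfold anchorDeriv
  rw [h.mfderiv_eq]

theorem anchorDeriv_mul {g g' : TM → ℝ} (hg : ContMDiff (IM).tangent 𝓘(ℝ, ℝ) ∞ g)
    (hg' : ContMDiff (IM).tangent 𝓘(ℝ, ℝ) ∞ g') (v : TM) (ξ : TqFiber F V v) :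
    L.anchorDeriv (fun z => g z * g' z) v ξ =
      g v * L.anchorDeriv g' v ξ + L.anchorDeriv g v ξ * g' v := by
  simp only [anchorDeriv_apply, tangentAnchor_eq]
  exact derivAlong_mul (z := (⟨v, _⟩ : TangentBundle (IM).tangent TM))
    (hg.mdifferentiable (by simp) v) (hg'.mdifferentiable (by simp) v)

theorem anchorDeriv_add {g g' : TM → ℝ} (hg : ContMDiff (IM).tangent 𝓘(ℝ, ℝ) ∞ g)
    (hg' : ContMDiff (IM).tangent 𝓘(ℝ, ℝ) ∞ g') (v : TM) (ξ : TqFiber F V v) :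
    L.anchorDeriv (fun z => g z + g' z) v ξ = L.anchorDeriv g v ξ + L.anchorDeriv g' v ξ := by
  simp only [anchorDeriv_apply, tangentAnchor_eq]
  exact derivAlong_add (z := (⟨v, _⟩ : TangentBundle (IM).tangent TM))
    (hg.mdifferentiable (by simp) v) (hg'.mdifferentiable (by simp) v)

theorem anchorDeriv_sum {ι : Type} (s : Finset ι) {g : ι → TM → ℝ}
    (hg : ∀ i, ContMDiff (IM).tangent 𝓘(ℝ, ℝ) ∞ (g i)) (v : TM) (ξ : TqFiber F V v) :
    L.anchorDeriv (fun z => ∑ i ∈ s, g i z) v ξ = ∑ i ∈ s, L.anchorDeriv (g i) v ξ := by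
  simp only [anchorDeriv_apply, tangentAnchor_eq]
  exact derivAlong_sum (z := (⟨v, _⟩ : TangentBundle (IM).tangent TM))
    (fun i _ => (hg i).mdifferentiable (by simp) v)

end LieAlgebroid

theorem contMDiff_valuePairing (φ : ΓAd) (σ : TqSection E F V) :
    ContMDiff (IM).tangent 𝓘(ℝ, ℝ) ∞ (fun v : TM => valuePairing φ v (σ.toFun v)) := by
  simp only [valuePairing_apply]
  exact (contMDiff_linearFunction φ).comp
    ((contMDiff_proj (TangentSpace IA : TotalSpace F V → Type _)).comp σ.smooth)

theorem contMDiff_derivPairing (φ : ΓAd) (σ : TqSection E F V) :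
    ContMDiff (IM).tangent 𝓘(ℝ, ℝ) ∞ (fun v : TM => derivPairing φ v (σ.toFun v)) := by
  simp only [derivPairing_apply]
  exact (contMDiff_derivAlong (contMDiff_linearFunction φ)).comp σ.smooth

/-- In a frame `eᵢ` with dual frame `φᵢ` the coefficients of `T(eᵢ)` and of the core section of `eᵢ`
are the value and the derivative pairing of `φᵢ` with `σ`. For the derivative pairings this is the
product rule applied to `ℓ_κ = ∑ᵢ ⟨κ, eᵢ⟩ ℓ_φᵢ`. -/
theorem nonempty_expansion (σ : TqSection E F V) (v₀ : TM) : Nonempty (Expansion σ.toFun v₀) := by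
  obtain ⟨n, e, φ, h⟩ := exists_frame E F V v₀.proj
  refine ⟨⟨n, e, fun i v => valuePairing (φ i) v (σ.toFun v),
    fun i v => derivPairing (φ i) v (σ.toFun v), fun i => contMDiff_valuePairing _ _,
    fun i => contMDiff_derivPairing _ _, ?_⟩⟩
  have hc : ContinuousAt (π E (TangentSpace IM : M → Type _)) v₀ :=
    (FiberBundle.continuous_proj E (TangentSpace IM : M → Type _)).continuousAt
  filter_upwards [hc.eventually h.eventually_nhds] with v hv
  refine TqFiber.ext_pairing (fun κ => ?_) (fun κ => ?_)
  · simp only [map_sum, map_add, map_smul, valuePairing_tangentSection, valuePairing_coreSection,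
      smul_eq_mul, mul_zero, add_zero]
    simp only [valuePairing_apply]
    have hp : (σ.toFun v).val.proj.proj = v.proj := congrArg TotalSpace.proj (σ.toFun v).property
    generalize (σ.toFun v).val.proj = p at hp ⊢
    obtain ⟨m, a⟩ := p
    change m = v.proj at hp
    subst hp
    have := congrArg (κ v.proj) (hv.self_of_nhds.1 a)
    rw [map_sum] at this
    rw [linearFunction, ← this]
    exact Finset.sum_congr rfl fun i _ => map_smul _ _ _
  · simp only [map_sum, map_add, map_smul, derivPairing_tangentSection, derivPairing_coreSection,
      smul_eq_mul]
    simp only [valuePairing_apply, derivPairing_apply]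
    have hp : (σ.toFun v).val.proj.proj = v.proj := congrArg TotalSpace.proj (σ.toFun v).property
    have h1 : linearFunction κ =ᶠ[𝓝 (σ.toFun v).val.proj]
        fun p => ∑ i, κ p.proj (e i p.proj) * linearFunction (φ i) p := by
      have hc2 : ContinuousAt (π F V) (σ.toFun v).val.proj :=
        (FiberBundle.continuous_proj F V).continuousAt
      have hv' : ∀ᶠ m in 𝓝 (π F V (σ.toFun v).val.proj), _ := hp ▸ hv
      filter_upwards [hc2.eventually hv'] with p hp'
      have := congrArg (κ p.proj) (hp'.1 p.snd)
      rw [map_sum] at this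
      rw [linearFunction, ← this]
      exact Finset.sum_congr rfl fun i _ => (map_smul _ _ _).trans (mul_comm _ _)
    have hs : ∀ i, ContMDiff IA 𝓘(ℝ, ℝ) ∞ (fun p : TotalSpace F V => κ p.proj (e i p.proj)) := fun i =>
      (contMDiff_pairing κ (e i)).comp (contMDiff_proj V)
    rw [derivAlong_congr h1, derivAlong_sum (f := fun i p => κ p.proj (e i p.proj) * linearFunction (φ i) p)
      (fun i _ => ((hs i).mul (contMDiff_linearFunction (φ i))).mdifferentiable (by simp) _)]
    refine Finset.sum_congr rfl fun i _ => ?_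
    rw [derivAlong_mul ((hs i).mdifferentiable (by simp) _)
      (mdifferentiable_linearFunction (φ i) _), hp,
      derivAlong_comp_proj (f := fun m => κ m (e i m)) ((contMDiff_pairing κ (e i)).mdifferentiable
        (by simp)), (σ.toFun v).property]
    ring

/-- The algebra behind `⟨φ, [X, Y]⟩ = a(X)⟨φ, Y⟩ - ⟨L_X φ, Y⟩` on `TA`: `P`, `Q` stand for pairings
with the brackets and `R`, `S` for derivatives of pairings, so `R - P` and `S - Q` are pairings with
Lie derivatives. -/
theorem sum_leibniz_identity {n k : ℕ} (α β : Fin n → ℝ) (γ δ : Fin k → ℝ) (P Q R S : Fin n → Fin k → ℝ) :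
    ∑ i, ∑ j, (α i * γ j * P i j + (α i * δ j + β i * γ j) * Q i j) =
      ∑ j, (γ j * ∑ i, (α i * R i j + β i * S i j) + δ j * ∑ i, α i * S i j) -
      ∑ i, (α i * ∑ j, (γ j * (R i j - P i j) + δ j * (S i j - Q i j)) +
        β i * ∑ j, γ j * (S i j - Q i j)) := by
  simp only [Finset.mul_sum, ← Finset.sum_add_distrib]
  rw [Finset.sum_comm (s := (Finset.univ : Finset (Fin k))), ← Finset.sum_sub_distrib]
  refine Finset.sum_congr rfl fun i _ => ?_
  rw [← Finset.sum_sub_distrib]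
  exact Finset.sum_congr rfl fun j _ => by ring

namespace Expansion

theorem valuePairing_eq {σ : ∀ v : TM, TqFiber F V v} {v₀ : TM} (r : Expansion σ v₀)
    (φ : ΓAd) : ∀ᶠ v in 𝓝 v₀,
    valuePairing φ v (σ v) = ∑ i, r.α i v * φ v.proj (r.X i v.proj) := by
  filter_upwards [r.eq] with v hv
  simp [hv]

theorem derivPairing_eq {σ : ∀ v : TM, TqFiber F V v} {v₀ : TM} (r : Expansion σ v₀)
    (φ : ΓAd) : ∀ᶠ v in 𝓝 v₀,
    derivPairing φ v (σ v) = ∑ i, (r.α i v * derivAlong (fun m => φ m (r.X i m)) v +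
      r.β i v * φ v.proj (r.X i v.proj)) := by
  filter_upwards [r.eq] with v hv
  simp [hv]

end Expansion

namespace LieAlgebroid

variable (L : LieAlgebroid E F V)

theorem derivAlong_lieDual (X : ΓA) (φ : ΓAd) (Y : ΓA) (v : TM) :
    derivAlong (fun m => L.lieDual X φ m (Y m)) v =
      derivAlong (fun m => derivAlong (fun m' => φ m' (Y m')) (L.anchorMap ⟨m, X m⟩)) v -
        derivAlong (fun m => φ m (L.bracket X Y m)) v := by
  simp only [lieDual_apply]
  exact derivAlong_sub ((L.contMDiff_anchor_derivAlong X (contMDiff_pairing φ Y)).mdifferentiable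
    (by simp) _) ((contMDiff_pairing φ _).mdifferentiable (by simp) _)

/-- The analogue for `TA` of `⟨φ, [X, Y]⟩ = a(X)⟨φ, Y⟩ - ⟨L_X φ, Y⟩`. Only the expansion of `σ`
enters on the right; the other section enters through its pairings, that is, in a form which does
not see how `τ` was expanded. -/
theorem derivPairing_expansionBracket {σ τ : ∀ v : TM, TqFiber F V v} {v : TM} (r : Expansion σ v)
    (s : Expansion τ v) (φ : ΓAd) :
    derivPairing φ v (L.expansionBracket r s) =
      L.anchorDeriv (fun z => derivPairing φ z (τ z)) v (σ v) -
      (∑ i, (r.α i v * derivPairing (L.lieDual (r.X i) φ) v (τ v) +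
        r.β i v * valuePairing (L.lieDual (r.X i) φ) v (τ v))) -
      ∑ i, (L.anchorDeriv (r.α i) v (τ v) * derivAlong (fun m => φ m (r.X i m)) v +
        L.anchorDeriv (r.β i) v (τ v) * φ v.proj (r.X i v.proj)) := by
  have hd : ∀ Y : ΓA, ContMDiff (IM).tangent 𝓘(ℝ, ℝ) ∞
      (fun z : TM => derivAlong (fun m => φ m (Y m)) z) := fun Y =>
    contMDiff_derivAlong (contMDiff_pairing φ Y)
  have hp : ∀ Y : ΓA, ContMDiff (IM).tangent 𝓘(ℝ, ℝ) ∞ (fun z : TM => φ z.proj (Y z.proj)) := fun Y =>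
    (contMDiff_pairing φ Y).comp (contMDiff_proj (TangentSpace IM : M → Type _))
  have h1 : L.anchorDeriv (fun z => derivPairing φ z (τ z)) v (σ v) =
      ∑ j, (s.α j v * (∑ i, (r.α i v * derivAlong (fun m => derivAlong (fun m' => φ m' (s.X j m'))
          (L.anchorMap ⟨m, r.X i m⟩)) v +
          r.β i v * derivAlong (fun m' => φ m' (s.X j m')) (L.anchorMap ⟨v.proj, r.X i v.proj⟩))) +
        s.β j v * (∑ i, r.α i v * derivAlong (fun m' => φ m' (s.X j m'))
          (L.anchorMap ⟨v.proj, r.X i v.proj⟩))) +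
      ∑ j, (L.anchorDeriv (s.α j) v (σ v) * derivAlong (fun m => φ m (s.X j m)) v +
        L.anchorDeriv (s.β j) v (σ v) * φ v.proj (s.X j v.proj)) := by
    rw [L.anchorDeriv_congr (s.derivPairing_eq φ), L.anchorDeriv_sum
      (g := fun j z => s.α j z * derivAlong (fun m => φ m (s.X j m)) z +
      s.β j z * φ z.proj (s.X j z.proj)) _ (fun j => ((s.smooth_α j).mul (hd _)).add
        ((s.smooth_β j).mul (hp _))), ← Finset.sum_add_distrib]
    refine Finset.sum_congr rfl fun j _ => ?_
    rw [L.anchorDeriv_add (g := fun z => s.α j z * derivAlong (fun m => φ m (s.X j m)) z)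
        (g' := fun z => s.β j z * φ z.proj (s.X j z.proj)) ((s.smooth_α j).mul (hd _))
        ((s.smooth_β j).mul (hp _)), L.anchorDeriv_mul (s.smooth_α j) (hd _), L.anchorDeriv_mul (s.smooth_β j) (hp _),
      L.anchorDeriv_derivAlong (contMDiff_pairing φ _), L.anchorDeriv_proj (f := fun m => φ m (s.X j m))
        (contMDiff_pairing φ _), (r.derivPairing_eq _).self_of_nhds, (r.valuePairing_eq _).self_of_nhds]
    simp only [coAnchor_apply]
    ring
  have h3 := fun κ => (s.derivPairing_eq κ).self_of_nhds
  have h4 := fun κ => (s.valuePairing_eq κ).self_of_nhds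
  simp only [h1, h3, h4, derivAlong_lieDual]
  simp only [lieDual_apply]
  have h2 := sum_leibniz_identity (fun i => r.α i v) (fun i => r.β i v) (fun j => s.α j v)
    (fun j => s.β j v) (fun i j => derivAlong (fun m => φ m (L.bracket (r.X i) (s.X j) m)) v)
    (fun i j => φ v.proj (L.bracket (r.X i) (s.X j) v.proj))
    (fun i j => derivAlong (fun m => derivAlong (fun m' => φ m' (s.X j m'))
          (L.anchorMap ⟨m, r.X i m⟩)) v)
    (fun i j => derivAlong (fun m' => φ m' (s.X j m')) (L.anchorMap ⟨v.proj, r.X i v.proj⟩))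
  unfold expansionBracket
  simp only [map_add, map_sub, map_sum, map_smul, derivPairing_tangentSection,
    derivPairing_coreSection, smul_eq_mul, ← anchorDeriv_apply]
  rw [h2]
  ring

theorem valuePairing_expansionBracket {σ τ : ∀ v : TM, TqFiber F V v} {v : TM} (r : Expansion σ v)
    (s : Expansion τ v) (φ : ΓAd) :
    valuePairing φ v (L.expansionBracket r s) =
      L.anchorDeriv (fun z => valuePairing φ z (τ z)) v (σ v) -
      (∑ i, r.α i v * valuePairing (L.lieDual (r.X i) φ) v (τ v)) -
      ∑ i, L.anchorDeriv (r.α i) v (τ v) * φ v.proj (r.X i v.proj) := by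
  have hp : ∀ Y : ΓA, ContMDiff (IM).tangent 𝓘(ℝ, ℝ) ∞ (fun z : TM => φ z.proj (Y z.proj)) := fun Y =>
    (contMDiff_pairing φ Y).comp (contMDiff_proj (TangentSpace IM : M → Type _))
  have h1 : L.anchorDeriv (fun z => valuePairing φ z (τ z)) v (σ v) =
      ∑ j, (s.α j v * (∑ i, r.α i v * derivAlong (fun m' => φ m' (s.X j m'))
          (L.anchorMap ⟨v.proj, r.X i v.proj⟩))) +
      ∑ j, L.anchorDeriv (s.α j) v (σ v) * φ v.proj (s.X j v.proj) := by
    rw [L.anchorDeriv_congr (s.valuePairing_eq φ), L.anchorDeriv_sum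
      (g := fun j z => s.α j z * φ z.proj (s.X j z.proj)) _ (fun j => (s.smooth_α j).mul (hp _)),
      ← Finset.sum_add_distrib]
    refine Finset.sum_congr rfl fun j _ => ?_
    rw [L.anchorDeriv_mul (s.smooth_α j) (hp _), L.anchorDeriv_proj (f := fun m => φ m (s.X j m))
        (contMDiff_pairing φ _), (r.valuePairing_eq _).self_of_nhds]
    simp only [coAnchor_apply]
  have h3 := fun κ => (s.valuePairing_eq κ).self_of_nhds
  simp only [h1, h3, lieDual_apply]
  -- Core sections have value pairing zero, so every term that belongs to them is set to zero in the
  -- same identity.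
  have h2 := sum_leibniz_identity (fun i => r.α i v) 0 (fun j => s.α j v)
    0 (fun i j => φ v.proj (L.bracket (r.X i) (s.X j) v.proj)) 0
    (fun i j => derivAlong (fun m' => φ m' (s.X j m')) (L.anchorMap ⟨v.proj, r.X i v.proj⟩)) 0
  simp only [Pi.zero_apply, mul_zero, zero_mul, add_zero, Finset.sum_const_zero] at h2
  unfold expansionBracket
  simp only [map_add, map_sub, map_sum, map_smul, valuePairing_tangentSection,
    valuePairing_coreSection, smul_eq_mul, ← anchorDeriv_apply, mul_zero, add_zero]
  rw [h2]
  ring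

end LieAlgebroid

end Algebroid

end LieAlgebroidTheory
end

noncomputable section

namespace LieAlgebroidTheory

/-! ### The operator of a linear vector field and its compatibility with the anchor -/

section Algebroid

set_option linter.unusedSectionVars false

variable {E : Type*} [NormedAddCommGroup E] [NormedSpace ℝ E]
  {M : Type*} [TopologicalSpace M] [ChartedSpace E M]
  {F : Type*} [NormedAddCommGroup F] [NormedSpace ℝ F]
  {V : M → Type*} [TopologicalSpace (TotalSpace F V)] [∀ m, AddCommGroup (V m)]
  [∀ m, Module ℝ (V m)] [∀ m, TopologicalSpace (V m)] [FiberBundle F V] [VectorBundle ℝ F V]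

local notation "IM" => modelWithCornersSelf ℝ E
local notation "IA" => ModelWithCorners.prod (modelWithCornersSelf ℝ E) (modelWithCornersSelf ℝ F)
local notation "IAd" =>
  ModelWithCorners.prod (modelWithCornersSelf ℝ E) (modelWithCornersSelf ℝ (F →L[ℝ] ℝ))
local notation "TM" => TangentBundle (modelWithCornersSelf ℝ E) M
local notation "TA" => TangentBundle
  (ModelWithCorners.prod (modelWithCornersSelf ℝ E) (modelWithCornersSelf ℝ F)) (TotalSpace F V)
local notation "Ad" => TotalSpace (F →L[ℝ] ℝ) (fun m : M => V m →L[ℝ] ℝ)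
local notation "ΓA" => ContMDiffSection (modelWithCornersSelf ℝ E) F ∞ V
local notation "ΓAd" => ContMDiffSection (modelWithCornersSelf ℝ E) (F →L[ℝ] ℝ) ∞
  (fun m : M => V m →L[ℝ] ℝ)

variable [IsManifold 𝓘(ℝ, E) ∞ M] [ContMDiffVectorBundle ∞ F V 𝓘(ℝ, E)] [T2Space M]
  [FiniteDimensional ℝ E] [FiniteDimensional ℝ F]

/-- The core section is a restriction of a tangent map: its value at `v` is the image of `(v, ∂ₛ)`
at `s = 0` under the tangent map of the smooth map `(m, s) ↦ s X(m)`. -/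
theorem contMDiff_core (X : ΓA) :
    ContMDiff (IM).tangent (IA).tangent ∞ (fun v : TM => (coreSection X v).val) := by
  let S : M × ℝ → TotalSpace F V := fun z => ⟨z.1, z.2 • X z.1⟩
  have hS : ContMDiff ((IM).prod 𝓘(ℝ, ℝ)) IA ∞ S := by
    intro z
    rw [contMDiffAt_totalSpace]
    refine ⟨contMDiffAt_fst, ?_⟩
    have h2 := ContMDiffAt.comp z ((contMDiffAt_section z.1).1 (X.contMDiff z.1))
      (contMDiffAt_fst (I := IM) (J := 𝓘(ℝ, ℝ)) (N := ℝ))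
    refine (contMDiffAt_snd.smul h2).congr_of_eventuallyEq ?_
    have h3 : ∀ᶠ z' : M × ℝ in 𝓝 z, z'.1 ∈ (trivializationAt F V z.1).baseSet :=
      continuousAt_fst.eventually ((trivializationAt F V z.1).open_baseSet.mem_nhds
        (FiberBundle.mem_baseSet_trivializationAt' z.1))
    filter_upwards [h3] with z' hz'
    exact ((trivializationAt F V z.1).linear ℝ hz').map_smul _ _
  have : IsManifold IM 1 M := IsManifold.of_le (n := ∞) (by simp)
  have h1 : ContMDiff (IM).tangent ((IM).prod 𝓘(ℝ, ℝ)).tangent ∞ (fun v : TM =>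
      (equivTangentBundleProd IM M 𝓘(ℝ, ℝ) ℝ).symm (v, (⟨(0 : ℝ), (1 : ℝ)⟩ : TangentBundle 𝓘(ℝ, ℝ) ℝ))) :=
    contMDiff_equivTangentBundleProd_symm.comp (contMDiff_id.prodMk contMDiff_const)
  refine ((hS.contMDiff_tangentMap (m := ∞) (by simp)).comp h1).congr fun v => ?_
  set w := (equivTangentBundleProd IM M 𝓘(ℝ, ℝ) ℝ).symm
    (v, (⟨(0 : ℝ), (1 : ℝ)⟩ : TangentBundle 𝓘(ℝ, ℝ) ℝ)) with hw
  have hfst : tangentMap ((IM).prod 𝓘(ℝ, ℝ)) IM Prod.fst w = v := by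
    rw [tangentMap_prodFst]
    rfl
  have hsnd : derivAlong (fun z : M × ℝ => z.2) w = 1 := by
    have h2 := mfderiv_snd (I := IM) (I' := 𝓘(ℝ, ℝ)) (x := w.proj)
    exact congrArg (fun A : E × ℝ →L[ℝ] ℝ => A w.snd) h2
  have hSw := hS.mdifferentiable (by simp) w.proj
  have hq : tangentMap IA IM (π F V) (tangentMap ((IM).prod 𝓘(ℝ, ℝ)) IA S w) = v := by
    rw [← tangentMap_comp_at (g := π F V) (I' := IA) w (hasMFDerivAt_proj _).mdifferentiableAt hSw]
    exact hfst
  refine congrArg TqFiber.val (a₂ := ⟨_, hq⟩) (TqFiber.ext_pairing (fun φ => ?_) (fun φ => ?_))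
  · rw [valuePairing_coreSection, valuePairing_apply]
    exact (((φ v.proj).map_smul (0 : ℝ) (X v.proj)).trans (zero_mul _)).symm
  · rw [derivPairing_coreSection, derivPairing_apply]
    refine Eq.trans ?_ (derivAlong_comp (J₂ := IA) (mdifferentiable_linearFunction φ _) hSw)
    have h3 : (fun z => linearFunction φ (S z)) = fun z : M × ℝ => z.2 * φ z.1 (X z.1) :=
      funext fun z => (φ z.1).map_smul _ _
    rw [h3, derivAlong_mul (g := fun z : M × ℝ => φ z.1 (X z.1)) mdifferentiableAt_snd
      (((contMDiff_pairing φ X).comp contMDiff_fst).mdifferentiable (by simp) _), hsnd, one_mul]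
    exact (zero_add _).symm.trans (congrArg (· + _) (zero_mul _).symm)

/-- The section `T(X)` of `TA → TM` as a smooth section. -/
def tangentTqSection (X : ΓA) : TqSection E F V :=
  ⟨tangentSection X, X.contMDiff.contMDiff_tangentMap (m := ∞) (by simp)⟩

/-- The section `X^` of `TA → TM` as a smooth section. -/
def coreTqSection (X : ΓA) : TqSection E F V := ⟨coreSection X, contMDiff_core X⟩

namespace LinearVectorField

variable (Ξ : LinearVectorField E F V)

theorem contMDiff_base_derivAlong {f : M → ℝ} (hf : ContMDiff IM 𝓘(ℝ, ℝ) ∞ f) :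
    ContMDiff IM 𝓘(ℝ, ℝ) ∞ (fun m => derivAlong f (⟨m, Ξ.base m⟩ : TM)) :=
  (contMDiff_derivAlong hf).comp Ξ.smooth_base

theorem valuePairing_fiberMap (φ : ΓAd) (m : M) (a : V m) :
    valuePairing φ (⟨m, Ξ.base m⟩ : TM) (Ξ.fiberMap m a) = φ m a :=
  valuePairing_apply _ _ _

theorem derivPairing_fiberMap (φ : ΓAd) (X : ΓA) (m : M) :
    derivPairing φ (⟨m, Ξ.base m⟩ : TM) (Ξ.fiberMap m (X m)) =
      derivAlong (fun m => φ m (X m)) (⟨m, Ξ.base m⟩ : TM) - φ m (Ξ.operator X m) := by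
  rw [Ξ.apply_operator, derivPairing_apply]
  exact (sub_sub_cancel _ _).symm

/-- This is the relation between `D_Ξ` and `Ξ` read in the fibres of `T(q)`: subtracting a vertical
vector at `X(m)` amounts to subtracting a core section. It exhibits `Ξ ∘ X` as a combination of
sections along `x`. -/
theorem fiberMap_eq (X : ΓA) (m : M) : Ξ.fiberMap m (X m) =
    tangentSection X (⟨m, Ξ.base m⟩ : TM) - coreSection (Ξ.operator X) (⟨m, Ξ.base m⟩ : TM) := by
  refine TqFiber.ext_pairing (fun φ => ?_) (fun φ => ?_)
  · rw [valuePairing_fiberMap, map_sub, valuePairing_tangentSection, valuePairing_coreSection, sub_zero]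
  · rw [derivPairing_fiberMap, map_sub, derivPairing_tangentSection, derivPairing_coreSection]

/-- Linearity of `Ξ` gives `Ξ ∘ (f X) = f (Ξ ∘ X)` in the fibres of `T(q)`, while differentiating `f
⟨φ, X⟩` along `x` produces the extra term. -/
theorem operator_smulSection (f : M → ℝ) (hf : ContMDiff IM 𝓘(ℝ, ℝ) ∞ f) (X : ΓA) (m : M) :
    Ξ.operator (smulSection f hf X) m = f m • Ξ.operator X m +
      derivAlong f (⟨m, Ξ.base m⟩ : TM) • X m := by
  refine eq_of_forall_dual (E := E) (F := F) fun φ => ?_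
  have h1 := Ξ.derivPairing_fiberMap φ (smulSection f hf X) m
  rw [smulSection_apply, _root_.map_smul, _root_.map_smul, Ξ.derivPairing_fiberMap, smul_eq_mul] at h1
  have h2 : (fun m => φ m (smulSection f hf X m)) = fun m => f m * φ m (X m) :=
    funext fun m => (φ m).map_smul _ _
  rw [h2, derivAlong_mul (hf.mdifferentiable (by simp) _)
    ((contMDiff_pairing φ X).mdifferentiable (by simp) _)] at h1
  rw [_root_.map_add, _root_.map_smul, _root_.map_smul, smul_eq_mul, smul_eq_mul]
  dsimp only at h1 ⊢
  linarith

theorem operator_add (X Y : ΓA) : Ξ.operator (X + Y) = Ξ.operator X + Ξ.operator Y := by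
  refine section_ext fun φ m => ?_
  have h1 := Ξ.derivPairing_fiberMap φ (X + Y) m
  have h3 : Ξ.fiberMap m ((X + Y) m) = Ξ.fiberMap m (X m) + Ξ.fiberMap m (Y m) := 
    (Ξ.fiberMap m).map_add _ _
  rw [h3, _root_.map_add, Ξ.derivPairing_fiberMap, Ξ.derivPairing_fiberMap] at h1
  have h2 : (fun m => φ m ((X + Y) m)) = fun m => φ m (X m) + φ m (Y m) :=
    funext fun m => (φ m).map_add _ _
  rw [h2, derivAlong_add ((contMDiff_pairing φ X).mdifferentiable (by simp) _)
    ((contMDiff_pairing φ Y).mdifferentiable (by simp) _)] at h1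
  have h4 : φ m ((Ξ.operator X + Ξ.operator Y) m) = φ m (Ξ.operator X m) + φ m (Ξ.operator Y m) :=
    (φ m).map_add _ _
  rw [h4]
  linarith

end LinearVectorField

namespace LieAlgebroid

variable (L : LieAlgebroid E F V) (Ξ : LinearVectorField E F V)

/-- The compatibility of the operator `D_Ξ` with the anchor: `a(D_Ξ X) = [x, a(X)]`. -/
def AnchorCompatible : Prop :=
  ∀ f : M → ℝ, ContMDiff IM 𝓘(ℝ, ℝ) ∞ f → ∀ (X : ΓA) (m : M),
    derivAlong f (L.anchorMap ⟨m, Ξ.operator X m⟩) =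
      derivAlong (fun m' => derivAlong f (L.anchorMap ⟨m', X m'⟩)) (⟨m, Ξ.base m⟩ : TM) -
      derivAlong (fun m' => derivAlong f (⟨m', Ξ.base m'⟩ : TM)) (L.anchorMap ⟨m, X m⟩)

variable {L Ξ}

/-- A pointwise form of the compatibility, obtained by pairing `D_Ξ X` with the pullback of `df`;
the section `X` disappears since every point of `A` is a value of one. -/
theorem AnchorCompatible.derivAlong_linearFunction (h : L.AnchorCompatible Ξ) {f : M → ℝ}
    (hf : ContMDiff IM 𝓘(ℝ, ℝ) ∞ f) (p : TotalSpace F V) :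
    derivAlong (linearFunction (L.coAnchor f hf)) (⟨p, Ξ.vf p⟩ : TA) =
      derivAlong (fun m' => derivAlong f (⟨m', Ξ.base m'⟩ : TM)) (L.anchorMap p) := by
  obtain ⟨m, a⟩ := p
  obtain ⟨X, rfl⟩ := exists_section (E := E) (F := F) m a
  have h1 := Ξ.apply_operator X (L.coAnchor f hf) m
  rw [L.coAnchor_apply, h f hf X m] at h1
  simp only [L.coAnchor_apply] at h1
  linarith

/-- Both sides are tangent vectors of `TM` at `x(m)`. They always agree on the functions `f ∘ π`,
and agreement on the functions `df` is the compatibility. -/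
theorem anchor_iff_anchorCompatible :
    (∀ p : TotalSpace F V, L.tangentAnchor (⟨p, Ξ.vf p⟩ : TA) =
      tangentMap IM (IM).tangent (fun m => (⟨m, Ξ.base m⟩ : TM)) (L.anchorMap p)) ↔
      L.AnchorCompatible Ξ := by
  have hT : ∀ (g : TM → ℝ), ContMDiff (IM).tangent 𝓘(ℝ, ℝ) ∞ g → ∀ p : TotalSpace F V,
      derivAlong g (tangentMap IM (IM).tangent (fun m => (⟨m, Ξ.base m⟩ : TM)) (L.anchorMap p)) =
      derivAlong (fun m => g ⟨m, Ξ.base m⟩) (L.anchorMap p) := fun g hg p =>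
    (derivAlong_comp (J₂ := (IM).tangent) (hg.mdifferentiable (by simp) _)
      (Ξ.smooth_base.mdifferentiable (by simp) _)).symm
  constructor
  · intro h f hf X m
    have h1 := L.derivAlong_derivAlong_tangentAnchor hf (⟨⟨m, X m⟩, Ξ.vf ⟨m, X m⟩⟩ : TA)
    rw [h, hT _ (contMDiff_derivAlong hf)] at h1
    have h2 := Ξ.apply_operator X (L.coAnchor f hf) m
    rw [← h1, L.coAnchor_apply] at h2
    exact h2
  · intro h p
    have hp : (L.tangentAnchor (⟨p, Ξ.vf p⟩ : TA)).proj = (⟨p.proj, Ξ.base p.proj⟩ : TM) :=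
      (L.tangentAnchor_proj _).trans (Ξ.proj_eq p.proj p.snd)
    have h0 : ∀ f : M → ℝ, ContMDiff IM 𝓘(ℝ, ℝ) ∞ f →
        derivAlong (fun z : TM => f z.proj) (L.tangentAnchor (⟨p, Ξ.vf p⟩ : TA)) =
        derivAlong (fun z : TM => f z.proj) (tangentMap IM (IM).tangent
          (fun m => (⟨m, Ξ.base m⟩ : TM)) (L.anchorMap p)) := by
      intro f hf
      rw [L.derivAlong_proj_tangentAnchor hf,
        hT (fun z : TM => f z.proj) (hf.comp (contMDiff_proj (TangentSpace IM : M → Type _)))]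
      rfl
    have h1 : ∀ f : M → ℝ, ContMDiff IM 𝓘(ℝ, ℝ) ∞ f →
        derivAlong (fun z : TM => derivAlong f z) (L.tangentAnchor (⟨p, Ξ.vf p⟩ : TA)) =
        derivAlong (fun z : TM => derivAlong f z) (tangentMap IM (IM).tangent
          (fun m => (⟨m, Ξ.base m⟩ : TM)) (L.anchorMap p)) := by
      intro f hf
      rw [L.derivAlong_derivAlong_tangentAnchor hf, hT _ (contMDiff_derivAlong hf),
        h.derivAlong_linearFunction hf]
    generalize L.tangentAnchor (⟨p, Ξ.vf p⟩ : TA) = w at hp h0 h1 ⊢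
    obtain ⟨v, w⟩ := w
    dsimp only at hp
    subst hp
    exact congrArg (TotalSpace.mk _) (tangentBundle_tangent_ext h0 h1)

/-- Expanding `D_Ξ [X, f Y]` by the Leibniz rules and by the derivation property, everything cancels
at `m` except multiples of `Y(m)`; comparing coefficients gives the claim when `Y(m) ≠ 0`. -/
theorem IsDerivation.anchorCompatible (h : L.IsDerivation Ξ.operator) : L.AnchorCompatible Ξ := by
  intro f hf X m
  by_cases hV : ∃ a : V m, a ≠ 0
  · obtain ⟨a, ha⟩ := hV
    obtain ⟨Y, rfl⟩ := exists_section (E := E) (F := F) m a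
    have h1 : L.bracket X (smulSection f hf Y) = smulSection f hf (L.bracket X Y) +
        smulSection _ (L.contMDiff_anchor_derivAlong X hf) Y :=
      ContMDiffSection.ext fun m' => L.bracket_smulSection X f hf Y m'
    have h2 : Ξ.operator (smulSection f hf Y) = smulSection f hf (Ξ.operator Y) +
        smulSection _ (Ξ.contMDiff_base_derivAlong hf) Y :=
      ContMDiffSection.ext fun m' => Ξ.operator_smulSection f hf Y m'
    have h3 := congrArg (fun Z : ΓA => Z m) (h X (smulSection f hf Y))
    simp only [h1, h2, Ξ.operator_add, L.bracket_add, ContMDiffSection.coe_add, Pi.add_apply,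
      Ξ.operator_smulSection, L.bracket_smulSection, h X Y, smul_add] at h3
    have h4 : derivAlong (fun m' => derivAlong f (L.anchorMap ⟨m', X m'⟩)) (⟨m, Ξ.base m⟩ : TM) • Y m =
        derivAlong f (L.anchorMap ⟨m, Ξ.operator X m⟩) • Y m +
        derivAlong (fun m' => derivAlong f (⟨m', Ξ.base m'⟩ : TM)) (L.anchorMap ⟨m, X m⟩) • Y m := by
      rw [← sub_eq_zero] at h3 ⊢
      rw [← h3]
      abel
    rw [← add_smul] at h4
    have h5 := smul_left_injective ℝ ha h4
    linarith
  -- A zero fibre at one point forces the model fibre, hence all fibres, to be zero. Every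
  -- derivative along the anchor is then zero and both sides vanish.
  · push Not at hV
    have hF : ∀ b : F, b = 0 := by
      intro b
      have hm := FiberBundle.mem_baseSet_trivializationAt' (F := F) (E := V) m
      have h2 := (trivializationAt F V m).apply_mk_symm hm b
      rw [hV ((trivializationAt F V m).symm m b), ← hV ((trivializationAt F V m).symm m 0),
        (trivializationAt F V m).apply_mk_symm hm] at h2
      exact (congrArg Prod.snd h2).symm
    have hV' : ∀ (m' : M) (a : V m'), a = 0 := by
      intro m' a
      have hm := FiberBundle.mem_baseSet_trivializationAt' (F := F) (E := V) m'
      rw [← (trivializationAt F V m').symm_apply_apply_mk hm a, hF (trivializationAt F V m' ⟨m', a⟩).2,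
        ← (trivializationAt F V m').symmL_apply (R := ℝ) hm, map_zero]
    have h0 : ∀ (g : M → ℝ) (m' : M) (a : V m'), derivAlong g (L.anchorMap ⟨m', a⟩) = 0 := by
      intro g m' a
      have := L.derivAlong_anchorMap_smul g m' 0 a
      rwa [zero_mul, zero_smul, ← hV' m' a] at this
    simp only [h0, derivAlong_const, sub_zero]

end LieAlgebroid

end Algebroid

end LieAlgebroidTheory
end

noncomputable section

namespace LieAlgebroidTheory

/-! ### Morphic vector fields and derivations -/

section Algebroid

set_option linter.unusedSectionVars false

variable {E : Type*} [NormedAddCommGroup E] [NormedSpace ℝ E]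
  {M : Type*} [TopologicalSpace M] [ChartedSpace E M]
  {F : Type*} [NormedAddCommGroup F] [NormedSpace ℝ F]
  {V : M → Type*} [TopologicalSpace (TotalSpace F V)] [∀ m, AddCommGroup (V m)]
  [∀ m, Module ℝ (V m)] [∀ m, TopologicalSpace (V m)] [FiberBundle F V] [VectorBundle ℝ F V]

local notation "IM" => modelWithCornersSelf ℝ E
local notation "IA" => ModelWithCorners.prod (modelWithCornersSelf ℝ E) (modelWithCornersSelf ℝ F)
local notation "IAd" =>
  ModelWithCorners.prod (modelWithCornersSelf ℝ E) (modelWithCornersSelf ℝ (F →L[ℝ] ℝ))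
local notation "TM" => TangentBundle (modelWithCornersSelf ℝ E) M
local notation "TA" => TangentBundle
  (ModelWithCorners.prod (modelWithCornersSelf ℝ E) (modelWithCornersSelf ℝ F)) (TotalSpace F V)
local notation "Ad" => TotalSpace (F →L[ℝ] ℝ) (fun m : M => V m →L[ℝ] ℝ)
local notation "ΓA" => ContMDiffSection (modelWithCornersSelf ℝ E) F ∞ V
local notation "ΓAd" => ContMDiffSection (modelWithCornersSelf ℝ E) (F →L[ℝ] ℝ) ∞
  (fun m : M => V m →L[ℝ] ℝ)

variable [IsManifold 𝓘(ℝ, E) ∞ M] [ContMDiffVectorBundle ∞ F V 𝓘(ℝ, E)] [T2Space M]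
  [FiniteDimensional ℝ E] [FiniteDimensional ℝ F]

namespace LieAlgebroid

variable {L : LieAlgebroid E F V} {Ξ : LinearVectorField E F V}

section Combination

variable {K : Type} [Fintype K] {A B : K → M → ℝ} {m : M}

/-- The Leibniz rule in the first argument of the bracket differentiates the coefficients `A k`
along the anchor of `Y`, with a sign that the Lie derivative turns positive. -/
theorem lieDual_combination {W : K → ΓA} {X : ΓA} (hA : ∀ k, ContMDiff IM 𝓘(ℝ, ℝ) ∞ (A k))
    (hX : ∀ᶠ m' in 𝓝 m, X m' = ∑ k, A k m' • W k m') (φ : ΓAd) (Y : ΓA) :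
    L.lieDual X φ m (Y m) = ∑ k, (A k m * L.lieDual (W k) φ m (Y m) +
      derivAlong (A k) (L.anchorMap ⟨m, Y m⟩) * φ m (W k m)) := by
  have h1 : L.bracket X Y m = ∑ k, (A k m • L.bracket (W k) Y m -
      derivAlong (A k) (L.anchorMap ⟨m, Y m⟩) • W k m) := by
    have h2 : ∀ᶠ m' in 𝓝 m, X m' = (∑ k, smulSection (A k) (hA k) (W k)) m' := by
      filter_upwards [hX] with m' hm'
      rw [hm', sum_section_apply]
      rfl
    rw [L.bracket_congr h2 (Eventually.of_forall fun _ => rfl), L.sum_bracket, sum_section_apply]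
    exact Finset.sum_congr rfl fun k _ => L.smulSection_bracket _ _ _ _ _
  have h3 : derivAlong (fun m' => φ m' (Y m')) (L.anchorMap ⟨m, X m⟩) =
      ∑ k, A k m * derivAlong (fun m' => φ m' (Y m')) (L.anchorMap ⟨m, W k m⟩) := by
    rw [← L.coAnchor_apply _ (contMDiff_pairing φ Y), hX.self_of_nhds, map_sum]
    simp only [map_smul, smul_eq_mul]
    rfl
  rw [lieDual_apply, h1, h3, map_sum, ← Finset.sum_sub_distrib]
  refine Finset.sum_congr rfl fun k _ => ?_
  rw [lieDual_apply, map_sub, map_smul, map_smul, smul_eq_mul, smul_eq_mul]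
  ring

theorem apply_bracket_combination {W : K → ΓA} {X : ΓA} (hA : ∀ k, ContMDiff IM 𝓘(ℝ, ℝ) ∞ (A k))
    (hX : ∀ᶠ m' in 𝓝 m, X m' = ∑ k, A k m' • W k m') (φ : ΓAd) (Y : ΓA) :
    φ m (L.bracket X Y m) =
      derivAlong (fun m' => φ m' (Y m')) (L.anchorMap ⟨m, X m⟩) -
      (∑ k, A k m * L.lieDual (W k) φ m (Y m)) -
      ∑ k, derivAlong (A k) (L.anchorMap ⟨m, Y m⟩) * φ m (W k m) := by
  have h := lieDual_combination (L := L) hA hX φ Y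
  rw [lieDual_apply, Finset.sum_add_distrib] at h
  linarith

/-- The left hand side is the derivative pairing of the morphism formula when `Ξ ∘ X = ∑ₖ (Aₖ T(Wₖ)
+ Bₖ Wₖ^)` along `x`, and the right hand side is that of `T([X,Y]) - ([DX,Y] + [X,DY])^`. They agree
by expanding the Lie derivatives along `X` and `DX` in the `Wₖ` and differentiating the first along
`x`; compatibility exchanges the orders of differentiation along `x` and along anchors. -/
theorem AnchorCompatible.combination {W : K → ΓA} {X : ΓA} (hAC : L.AnchorCompatible Ξ)
    (hA : ∀ k, ContMDiff IM 𝓘(ℝ, ℝ) ∞ (A k)) (hB : ∀ k, ContMDiff IM 𝓘(ℝ, ℝ) ∞ (B k))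
    (hX : ∀ᶠ m' in 𝓝 m, X m' = ∑ k, A k m' • W k m')
    (hDX : ∀ᶠ m' in 𝓝 m, Ξ.operator X m' =
      ∑ k, (derivAlong (A k) (⟨m', Ξ.base m'⟩ : TM) - B k m') • W k m') (φ : ΓAd) (Y : ΓA) :
    derivAlong (fun m' => derivAlong (fun m'' => φ m'' (Y m'')) (⟨m', Ξ.base m'⟩ : TM) -
        φ m' (Ξ.operator Y m')) (L.anchorMap ⟨m, X m⟩) -
      (∑ k, (A k m * (derivAlong (fun m' => L.lieDual (W k) φ m' (Y m')) (⟨m, Ξ.base m⟩ : TM) -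
        L.lieDual (W k) φ m (Ξ.operator Y m)) + B k m * L.lieDual (W k) φ m (Y m))) -
      ∑ k, (derivAlong (A k) (L.anchorMap ⟨m, Y m⟩) *
          derivAlong (fun m' => φ m' (W k m')) (⟨m, Ξ.base m⟩ : TM) +
        derivAlong (B k) (L.anchorMap ⟨m, Y m⟩) * φ m (W k m)) =
    derivAlong (fun m' => φ m' (L.bracket X Y m')) (⟨m, Ξ.base m⟩ : TM) -
      φ m (L.bracket X (Ξ.operator Y) m) - φ m (L.bracket (Ξ.operator X) Y m) := by
  have hd : ∀ (κ : ΓAd) (Z : ΓA), MDifferentiable IM 𝓘(ℝ, ℝ) (fun m' => κ m' (Z m')) := fun κ Z =>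
    (contMDiff_pairing κ Z).mdifferentiable (by simp)
  have hAd : ∀ k, MDifferentiable IM 𝓘(ℝ, ℝ) (A k) := fun k => (hA k).mdifferentiable (by simp)
  have haY : ∀ k, MDifferentiable IM 𝓘(ℝ, ℝ) (fun m' => derivAlong (A k) (L.anchorMap ⟨m', Y m'⟩)) :=
    fun k => (L.contMDiff_anchor_derivAlong Y (hA k)).mdifferentiable (by simp)
  have hxA : ∀ k, ContMDiff IM 𝓘(ℝ, ℝ) ∞ (fun m' => derivAlong (A k) (⟨m', Ξ.base m'⟩ : TM)) := fun k =>
    Ξ.contMDiff_base_derivAlong (hA k)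
  have e1 := lieDual_combination (L := L) hA hX φ (Ξ.operator Y)
  have e2 := lieDual_combination (L := L) (fun k => (hxA k).sub (hB k)) hDX φ Y
  have e3 : derivAlong (fun m' => L.lieDual X φ m' (Y m')) (⟨m, Ξ.base m⟩ : TM) =
      ∑ k, (A k m * derivAlong (fun m' => L.lieDual (W k) φ m' (Y m')) (⟨m, Ξ.base m⟩ : TM) +
        derivAlong (A k) (⟨m, Ξ.base m⟩ : TM) * L.lieDual (W k) φ m (Y m) +
        derivAlong (A k) (L.anchorMap ⟨m, Y m⟩) *
          derivAlong (fun m' => φ m' (W k m')) (⟨m, Ξ.base m⟩ : TM) +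
        derivAlong (fun m' => derivAlong (A k) (L.anchorMap ⟨m', Y m'⟩)) (⟨m, Ξ.base m⟩ : TM) *
          φ m (W k m)) := by
    have h1 : (fun m' => L.lieDual X φ m' (Y m')) =ᶠ[𝓝 m] fun m' => ∑ k,
        (A k m' * L.lieDual (W k) φ m' (Y m') +
          derivAlong (A k) (L.anchorMap ⟨m', Y m'⟩) * φ m' (W k m')) := by
      filter_upwards [hX.eventually_nhds] with m' hm'
      exact lieDual_combination (L := L) hA hm' φ Y
    rw [derivAlong_congr h1, derivAlong_sum (f := fun k m' => A k m' * L.lieDual (W k) φ m' (Y m') +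
          derivAlong (A k) (L.anchorMap ⟨m', Y m'⟩) * φ m' (W k m'))
      (fun k _ => (((hAd k).mul (hd _ _)).add ((haY k).mul (hd _ _))) _)]
    refine Finset.sum_congr rfl fun k _ => ?_
    rw [derivAlong_add (f := fun m' => A k m' * L.lieDual (W k) φ m' (Y m'))
      (g := fun m' => derivAlong (A k) (L.anchorMap ⟨m', Y m'⟩) * φ m' (W k m'))
      (((hAd k).mul (hd _ _)) _) (((haY k).mul (hd _ _)) _), derivAlong_mul (hAd k _) (hd _ _ _),
      derivAlong_mul (haY k _) (hd _ _ _)]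
    ring
  have e4 : derivAlong (fun m' => derivAlong (fun m'' => φ m'' (Y m'')) (⟨m', Ξ.base m'⟩ : TM) -
        φ m' (Ξ.operator Y m')) (L.anchorMap ⟨m, X m⟩) =
      derivAlong (fun m' => derivAlong (fun m'' => φ m'' (Y m'')) (⟨m', Ξ.base m'⟩ : TM))
        (L.anchorMap ⟨m, X m⟩) -
      derivAlong (fun m' => φ m' (Ξ.operator Y m')) (L.anchorMap ⟨m, X m⟩) :=
    derivAlong_sub ((Ξ.contMDiff_base_derivAlong (contMDiff_pairing φ Y)).mdifferentiable (by simp) _)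
      (hd _ _ _)
  have e5 := hAC _ (contMDiff_pairing φ Y) X m
  have e6 : ∀ k, derivAlong (fun m' => derivAlong (A k) (⟨m', Ξ.base m'⟩ : TM) - B k m')
      (L.anchorMap ⟨m, Y m⟩) = derivAlong (fun m' => derivAlong (A k) (L.anchorMap ⟨m', Y m'⟩))
        (⟨m, Ξ.base m⟩ : TM) - derivAlong (A k) (L.anchorMap ⟨m, Ξ.operator Y m⟩) -
        derivAlong (B k) (L.anchorMap ⟨m, Y m⟩) := by
    intro k
    rw [derivAlong_sub ((hxA k).mdifferentiable (by simp) _) ((hB k).mdifferentiable (by simp) _),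
      hAC _ (hA k) Y m]
    ring
  have e2' : L.lieDual (Ξ.operator X) φ m (Y m) = _ := e2.trans (Finset.sum_congr rfl fun k _ =>
    congrArg (fun c => _ + c * _) (e6 k))
  rw [lieDual_apply] at e1
  rw [lieDual_apply] at e2'
  rw [derivAlong_lieDual] at e3
  rw [e4]
  -- The subtracted sums of the goal, regrouped as the sum in `e3` minus the sums in `e1` and `e2'`.
  have e7 : (∑ k, (A k m * (derivAlong (fun m' => L.lieDual (W k) φ m' (Y m')) (⟨m, Ξ.base m⟩ : TM) -
        L.lieDual (W k) φ m (Ξ.operator Y m)) + B k m * L.lieDual (W k) φ m (Y m))) +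
      (∑ k, (derivAlong (A k) (L.anchorMap ⟨m, Y m⟩) *
          derivAlong (fun m' => φ m' (W k m')) (⟨m, Ξ.base m⟩ : TM) +
        derivAlong (B k) (L.anchorMap ⟨m, Y m⟩) * φ m (W k m))) =
      (∑ k, (A k m * derivAlong (fun m' => L.lieDual (W k) φ m' (Y m')) (⟨m, Ξ.base m⟩ : TM) +
        derivAlong (A k) (⟨m, Ξ.base m⟩ : TM) * L.lieDual (W k) φ m (Y m) +
        derivAlong (A k) (L.anchorMap ⟨m, Y m⟩) *
          derivAlong (fun m' => φ m' (W k m')) (⟨m, Ξ.base m⟩ : TM) +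
        derivAlong (fun m' => derivAlong (A k) (L.anchorMap ⟨m', Y m'⟩)) (⟨m, Ξ.base m⟩ : TM) *
          φ m (W k m))) -
      (∑ k, (A k m * L.lieDual (W k) φ m (Ξ.operator Y m) +
        derivAlong (A k) (L.anchorMap ⟨m, Ξ.operator Y m⟩) * φ m (W k m))) -
      ∑ k, ((derivAlong (A k) (⟨m, Ξ.base m⟩ : TM) - B k m) * L.lieDual (W k) φ m (Y m) +
        (derivAlong (fun m' => derivAlong (A k) (L.anchorMap ⟨m', Y m'⟩))
        (⟨m, Ξ.base m⟩ : TM) - derivAlong (A k) (L.anchorMap ⟨m, Ξ.operator Y m⟩) -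
        derivAlong (B k) (L.anchorMap ⟨m, Y m⟩)) * φ m (W k m)) := by
    rw [← Finset.sum_add_distrib, ← Finset.sum_sub_distrib, ← Finset.sum_sub_distrib]
    exact Finset.sum_congr rfl fun k _ => by ring
  linarith

end Combination

/-- Compatibility says that the anchor of `Ξ(a)` is the image under `T(x)` of the anchor of `a`, so
a derivative along it is a derivative of the restriction to `x`. -/
theorem AnchorCompatible.anchorDeriv_fiberMap (h : L.AnchorCompatible Ξ) {g : TM → ℝ}
    (hg : ContMDiff (IM).tangent 𝓘(ℝ, ℝ) ∞ g) (m : M) (a : V m) :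
    L.anchorDeriv g (⟨m, Ξ.base m⟩ : TM) (Ξ.fiberMap m a) =
      derivAlong (fun m' => g ⟨m', Ξ.base m'⟩) (L.anchorMap ⟨m, a⟩) := by
  rw [anchorDeriv_apply]
  refine (congrArg (derivAlong g) (anchor_iff_anchorCompatible.2 h ⟨m, a⟩)).trans ?_
  exact (derivAlong_comp (J₂ := (IM).tangent) (hg.mdifferentiable (by simp) _)
      (Ξ.smooth_base.mdifferentiable (by simp) _)).symm

/-- Treats value and derivative pairings together. The hypothesis on the brackets makes `P([σᵢ,
τⱼ])` the derivative of `P(τⱼ)` along `σᵢ` minus a linear function of `τⱼ`. The sums over `j` then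
reassemble to pairings with `Ξ ∘ Y`, and the decomposition of `Ξ ∘ Y` drops out. -/
theorem AnchorCompatible.pairing_bracket_sum (h : L.AnchorCompatible Ξ) {X Y : ΓA} {n k : ℕ}
    {c : Fin n → M → ℝ} {d : Fin k → M → ℝ} {σ : Fin n → TqSection E F V} {τ : Fin k → TqSection E F V}
    (hd : ∀ j, ContMDiff IM 𝓘(ℝ, ℝ) ∞ (d j))
    (hX : ∀ m, Ξ.fiberMap m (X m) = ∑ i, c i m • (σ i).toFun ⟨m, Ξ.base m⟩)
    (hY : ∀ m, Ξ.fiberMap m (Y m) = ∑ j, d j m • (τ j).toFun ⟨m, Ξ.base m⟩) (m : M)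
    (P : ∀ v : TM, TqFiber F V v →ₗ[ℝ] ℝ) (hP : ∀ j, ContMDiff (IM).tangent 𝓘(ℝ, ℝ) ∞
      (fun v => P v ((τ j).toFun v))) (N : Fin n → TqFiber F V (⟨m, Ξ.base m⟩ : TM) →ₗ[ℝ] ℝ)
    (hN : ∀ i j, P ⟨m, Ξ.base m⟩ (L.tangentBracket (σ i).toFun (τ j).toFun ⟨m, Ξ.base m⟩) =
      L.anchorDeriv (fun v => P v ((τ j).toFun v)) ⟨m, Ξ.base m⟩ ((σ i).toFun ⟨m, Ξ.base m⟩) -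
      N i ((τ j).toFun ⟨m, Ξ.base m⟩)) :
    P ⟨m, Ξ.base m⟩ ((∑ i, ∑ j, (c i m * d j m) •
          L.tangentBracket (σ i).toFun (τ j).toFun ⟨m, Ξ.base m⟩) +
      (∑ j, derivAlong (d j) (L.anchorMap ⟨m, X m⟩) • (τ j).toFun ⟨m, Ξ.base m⟩) -
      (∑ i, derivAlong (c i) (L.anchorMap ⟨m, Y m⟩) • (σ i).toFun ⟨m, Ξ.base m⟩)) =
    derivAlong (fun m' => P ⟨m', Ξ.base m'⟩ (Ξ.fiberMap m' (Y m'))) (L.anchorMap ⟨m, X m⟩) -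
      ∑ i, (c i m * N i (Ξ.fiberMap m (Y m)) +
        derivAlong (c i) (L.anchorMap ⟨m, Y m⟩) * P ⟨m, Ξ.base m⟩ ((σ i).toFun ⟨m, Ξ.base m⟩)) := by
  have hPx : ∀ j, ContMDiff IM 𝓘(ℝ, ℝ) ∞
      (fun m' => P ⟨m', Ξ.base m'⟩ ((τ j).toFun ⟨m', Ξ.base m'⟩)) := fun j =>
    (hP j).comp Ξ.smooth_base
  have h1 : derivAlong (fun m' => P ⟨m', Ξ.base m'⟩ (Ξ.fiberMap m' (Y m'))) (L.anchorMap ⟨m, X m⟩) =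
      ∑ j, (d j m * L.anchorDeriv (fun v => P v ((τ j).toFun v)) ⟨m, Ξ.base m⟩ (Ξ.fiberMap m (X m)) +
        derivAlong (d j) (L.anchorMap ⟨m, X m⟩) *
          P ⟨m, Ξ.base m⟩ ((τ j).toFun ⟨m, Ξ.base m⟩)) := by
    simp only [hY, map_sum, map_smul, smul_eq_mul]
    rw [derivAlong_sum (f := fun j m' => d j m' * P ⟨m', Ξ.base m'⟩ ((τ j).toFun ⟨m', Ξ.base m'⟩))
      (fun j _ => ((hd j).mul (hPx j)).mdifferentiable (by simp) _)]
    refine Finset.sum_congr rfl fun j _ => ?_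
    rw [derivAlong_mul ((hd j).mdifferentiable (by simp) _) ((hPx j).mdifferentiable (by simp) _),
      h.anchorDeriv_fiberMap (hP j)]
    rfl
  have h2 : ∀ i, N i (Ξ.fiberMap m (Y m)) = ∑ j, d j m * N i ((τ j).toFun ⟨m, Ξ.base m⟩) := by
    intro i
    rw [hY, map_sum]
    simp only [map_smul, smul_eq_mul]
  rw [h1]
  simp only [h2, hX, map_sub, map_add, map_sum, map_smul, smul_eq_mul, hN, Finset.mul_sum,
    Finset.sum_add_distrib, mul_sub, Finset.sum_sub_distrib]
  rw [Finset.sum_comm (s := (Finset.univ : Finset (Fin k)))]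
  have h3 : ∀ i j (t : ℝ), d j m * (c i m * t) = c i m * d j m * t := fun i j t => by ring
  have h4 : ∀ i j (t : ℝ), c i m * (d j m * t) = c i m * d j m * t := fun i j t => by ring
  simp only [h3, h4]
  ring

/-- The right hand side of the bracket condition for a morphic vector field. -/
theorem AnchorCompatible.bracket_sum_eq (h : L.AnchorCompatible Ξ) {X Y : ΓA} {n k : ℕ}
    {c : Fin n → M → ℝ} {d : Fin k → M → ℝ} {σ : Fin n → TqSection E F V} {τ : Fin k → TqSection E F V}
    (hc : ∀ i, ContMDiff IM 𝓘(ℝ, ℝ) ∞ (c i)) (hd : ∀ j, ContMDiff IM 𝓘(ℝ, ℝ) ∞ (d j))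
    (hX : ∀ m, Ξ.fiberMap m (X m) = ∑ i, c i m • (σ i).toFun ⟨m, Ξ.base m⟩)
    (hY : ∀ m, Ξ.fiberMap m (Y m) = ∑ j, d j m • (τ j).toFun ⟨m, Ξ.base m⟩) (m : M) :
    (∑ i, ∑ j, (c i m * d j m) • L.tangentBracket (σ i).toFun (τ j).toFun ⟨m, Ξ.base m⟩) +
      (∑ j, derivAlong (d j) (L.anchorMap ⟨m, X m⟩) • (τ j).toFun ⟨m, Ξ.base m⟩) -
      (∑ i, derivAlong (c i) (L.anchorMap ⟨m, Y m⟩) • (σ i).toFun ⟨m, Ξ.base m⟩) =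
    tangentSection (L.bracket X Y) ⟨m, Ξ.base m⟩ -
      coreSection (L.bracket (Ξ.operator X) Y + L.bracket X (Ξ.operator Y)) ⟨m, Ξ.base m⟩ := by
  let r := fun i => (nonempty_expansion (σ i) (⟨m, Ξ.base m⟩ : TM)).some
  let s := fun j => (nonempty_expansion (τ j) (⟨m, Ξ.base m⟩ : TM)).some
  have hTB : ∀ i j, L.tangentBracket (σ i).toFun (τ j).toFun ⟨m, Ξ.base m⟩ =
      L.expansionBracket (r i) (s j) := fun i j =>
    dif_pos ⟨nonempty_expansion (σ i) _, nonempty_expansion (τ j) _⟩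
  -- Expanding each `σᵢ` and pulling the coefficients back along `x` gives, near `m`, an expansion
  -- of `Ξ ∘ X` whose index runs over pairs.
  let A : (Σ i, Fin (r i).n) → M → ℝ := fun κ m' => c κ.1 m' * (r κ.1).α κ.2 ⟨m', Ξ.base m'⟩
  let B : (Σ i, Fin (r i).n) → M → ℝ := fun κ m' => c κ.1 m' * (r κ.1).β κ.2 ⟨m', Ξ.base m'⟩
  let W : (Σ i, Fin (r i).n) → ΓA := fun κ => (r κ.1).X κ.2
  have hα : ∀ i q, ContMDiff IM 𝓘(ℝ, ℝ) ∞ (fun m' => (r i).α q ⟨m', Ξ.base m'⟩) := fun i q =>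
    ((r i).smooth_α q).comp Ξ.smooth_base
  have hβ : ∀ i q, ContMDiff IM 𝓘(ℝ, ℝ) ∞ (fun m' => (r i).β q ⟨m', Ξ.base m'⟩) := fun i q =>
    ((r i).smooth_β q).comp Ξ.smooth_base
  have hA : ∀ κ, ContMDiff IM 𝓘(ℝ, ℝ) ∞ (A κ) := fun κ => (hc κ.1).mul (hα κ.1 κ.2)
  have hB : ∀ κ, ContMDiff IM 𝓘(ℝ, ℝ) ∞ (B κ) := fun κ => (hc κ.1).mul (hβ κ.1 κ.2)
  have hAY : ∀ κ, derivAlong (A κ) (L.anchorMap ⟨m, Y m⟩) =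
      c κ.1 m * derivAlong (fun m' => (r κ.1).α κ.2 ⟨m', Ξ.base m'⟩) (L.anchorMap ⟨m, Y m⟩) +
      derivAlong (c κ.1) (L.anchorMap ⟨m, Y m⟩) * (r κ.1).α κ.2 ⟨m, Ξ.base m⟩ := fun κ =>
    derivAlong_mul ((hc κ.1).mdifferentiable (by simp) _) ((hα κ.1 κ.2).mdifferentiable (by simp) _)
  have hBY : ∀ κ, derivAlong (B κ) (L.anchorMap ⟨m, Y m⟩) =
      c κ.1 m * derivAlong (fun m' => (r κ.1).β κ.2 ⟨m', Ξ.base m'⟩) (L.anchorMap ⟨m, Y m⟩) +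
      derivAlong (c κ.1) (L.anchorMap ⟨m, Y m⟩) * (r κ.1).β κ.2 ⟨m, Ξ.base m⟩ := fun κ =>
    derivAlong_mul ((hc κ.1).mdifferentiable (by simp) _) ((hβ κ.1 κ.2).mdifferentiable (by simp) _)
  have hexp : ∀ᶠ m' in 𝓝 m, Ξ.fiberMap m' (X m') =
      ∑ κ, (A κ m' • tangentSection (W κ) (⟨m', Ξ.base m'⟩ : TM) +
        B κ m' • coreSection (W κ) (⟨m', Ξ.base m'⟩ : TM)) := by
    have h1 : ∀ i, ∀ᶠ m' in 𝓝 m, _ := fun i =>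
      (Ξ.smooth_base.continuous.continuousAt (x := m)).eventually (r i).eq
    filter_upwards [eventually_all.2 h1] with m' hm'
    rw [hX, Fintype.sum_sigma]
    refine Finset.sum_congr rfl fun i _ => ?_
    rw [hm' i, Finset.smul_sum]
    refine Finset.sum_congr rfl fun q _ => ?_
    rw [smul_add, smul_smul, smul_smul]
  -- The value pairings of the expansion of `Ξ ∘ X` determine `X`; below, its derivative pairings
  -- determine `D_Ξ X`.
  have hX' : ∀ᶠ m' in 𝓝 m, X m' = ∑ κ, A κ m' • W κ m' := by
    filter_upwards [hexp] with m' hm'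
    refine eq_of_forall_dual (E := E) (F := F) fun φ => ?_
    rw [← Ξ.valuePairing_fiberMap, hm', map_sum, map_sum]
    refine Finset.sum_congr rfl fun κ _ => ?_
    simp only [map_add, map_smul, valuePairing_tangentSection, valuePairing_coreSection, smul_zero,
      add_zero]
  have hDX : ∀ᶠ m' in 𝓝 m, Ξ.operator X m' =
      ∑ κ, (derivAlong (A κ) (⟨m', Ξ.base m'⟩ : TM) - B κ m') • W κ m' := by
    filter_upwards [hexp, hX'.eventually_nhds] with m' hm' hm''
    refine eq_of_forall_dual (E := E) (F := F) fun φ => ?_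
    have h1 := Ξ.derivPairing_fiberMap φ X m'
    have h2 : (fun m => φ m (X m)) =ᶠ[𝓝 m'] fun m => ∑ κ, A κ m * φ m (W κ m) := by
      filter_upwards [hm''] with p hp
      rw [hp, map_sum]
      exact Finset.sum_congr rfl fun κ _ => map_smul _ _ _
    have hp : ∀ κ, MDifferentiable IM 𝓘(ℝ, ℝ) (fun p => φ p (W κ p)) := fun κ =>
      (contMDiff_pairing φ (W κ)).mdifferentiable (by simp)
    have hAd : ∀ κ, MDifferentiable IM 𝓘(ℝ, ℝ) (A κ) := fun κ => (hA κ).mdifferentiable (by simp)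
    rw [hm', derivAlong_congr h2, derivAlong_sum (f := fun κ m => A κ m * φ m (W κ m))
      (fun κ _ => ((hAd κ).mul (hp κ)) _), map_sum, eq_sub_iff_add_eq, ← eq_sub_iff_add_eq',
      ← Finset.sum_sub_distrib] at h1
    rw [h1, map_sum]
    refine Finset.sum_congr rfl fun κ _ => ?_
    rw [derivAlong_mul (hAd κ _) (hp κ _)]
    simp only [map_add, map_smul, derivPairing_tangentSection, derivPairing_coreSection, smul_eq_mul]
    ring
  have hτ : ∀ (φ : ΓAd) j, ContMDiff (IM).tangent 𝓘(ℝ, ℝ) ∞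
      (fun v => derivPairing φ v ((τ j).toFun v)) := fun φ j => contMDiff_derivPairing φ (τ j)
  have hτ' : ∀ (φ : ΓAd) j, ContMDiff (IM).tangent 𝓘(ℝ, ℝ) ∞
      (fun v => valuePairing φ v ((τ j).toFun v)) := fun φ j => contMDiff_valuePairing φ (τ j)
  refine TqFiber.ext_pairing (fun φ => ?_) (fun φ => ?_)
  -- The linear functions supplied here collect every term of the bracket formula in which the
  -- second section enters undifferentiated, whether through a Lie derivative or through its anchor.
  · rw [h.pairing_bracket_sum hd hX hY m (valuePairing φ) (hτ' φ)
      (fun i => ∑ q, ((r i).α q ⟨m, Ξ.base m⟩ • valuePairing (L.lieDual ((r i).X q) φ) ⟨m, Ξ.base m⟩ +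
        φ m ((r i).X q m) • L.anchorDeriv ((r i).α q) ⟨m, Ξ.base m⟩)) (fun i j => by
          rw [hTB, valuePairing_expansionBracket, LinearMap.sum_apply, sub_sub,
            ← Finset.sum_add_distrib]
          refine congrArg _ (Finset.sum_congr rfl fun q _ => ?_)
          simp only [LinearMap.add_apply, LinearMap.smul_apply, smul_eq_mul]
          ring)]
    have h1 := apply_bracket_combination (L := L) hA hX' φ Y
    rw [map_sub, valuePairing_tangentSection, valuePairing_coreSection, sub_zero]
    dsimp only
    rw [h1, sub_sub, ← Finset.sum_add_distrib, Fintype.sum_sigma]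
    simp only [Ξ.valuePairing_fiberMap]
    refine congrArg _ (Finset.sum_congr rfl fun i _ => ?_)
    rw [((r i).valuePairing_eq φ).self_of_nhds, LinearMap.sum_apply, Finset.mul_sum, Finset.mul_sum,
      ← Finset.sum_add_distrib]
    refine Finset.sum_congr rfl fun q _ => ?_
    rw [hAY]
    simp only [LinearMap.add_apply, LinearMap.smul_apply, smul_eq_mul, Ξ.valuePairing_fiberMap,
      h.anchorDeriv_fiberMap ((r i).smooth_α q), A, W]
    ring
  · rw [h.pairing_bracket_sum hd hX hY m (derivPairing φ) (hτ φ)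
      (fun i => ∑ q, ((r i).α q ⟨m, Ξ.base m⟩ • derivPairing (L.lieDual ((r i).X q) φ) ⟨m, Ξ.base m⟩ +
        (r i).β q ⟨m, Ξ.base m⟩ • valuePairing (L.lieDual ((r i).X q) φ) ⟨m, Ξ.base m⟩ +
        (derivAlong (fun m => φ m ((r i).X q m)) (⟨m, Ξ.base m⟩ : TM) •
            L.anchorDeriv ((r i).α q) ⟨m, Ξ.base m⟩ +
          φ m ((r i).X q m) • L.anchorDeriv ((r i).β q) ⟨m, Ξ.base m⟩))) (fun i j => by
          rw [hTB, derivPairing_expansionBracket, LinearMap.sum_apply, sub_sub,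
            ← Finset.sum_add_distrib]
          refine congrArg _ (Finset.sum_congr rfl fun q _ => ?_)
          simp only [LinearMap.add_apply, LinearMap.smul_apply, smul_eq_mul]
          ring)]
    have h1 := h.combination hA hB hX' hDX φ Y
    have h2 : φ m ((L.bracket (Ξ.operator X) Y + L.bracket X (Ξ.operator Y)) m) =
      φ m (L.bracket (Ξ.operator X) Y m) + φ m (L.bracket X (Ξ.operator Y) m) := (φ m).map_add _ _
    rw [map_sub, derivPairing_tangentSection, derivPairing_coreSection]
    dsimp only
    rw [h2, ← sub_sub, sub_right_comm, ← h1, sub_sub, ← Finset.sum_add_distrib, Fintype.sum_sigma]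
    simp only [Ξ.derivPairing_fiberMap]
    refine congrArg _ (Finset.sum_congr rfl fun i _ => ?_)
    rw [((r i).derivPairing_eq φ).self_of_nhds, LinearMap.sum_apply, Finset.mul_sum, Finset.mul_sum,
      ← Finset.sum_add_distrib]
    refine Finset.sum_congr rfl fun q _ => ?_
    rw [hAY, hBY]
    simp only [LinearMap.add_apply, LinearMap.smul_apply, smul_eq_mul, Ξ.valuePairing_fiberMap,
      Ξ.derivPairing_fiberMap, h.anchorDeriv_fiberMap ((r i).smooth_α q),
      h.anchorDeriv_fiberMap ((r i).smooth_β q), A, B, W]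
    ring

/-- Under the anchor condition the two sides of the bracket condition differ exactly by the core
section of the failure of `D_Ξ` to be a derivation. A derivation satisfies the anchor condition
automatically. -/
theorem isMorphic_iff_isDerivation : L.IsMorphic Ξ ↔ L.IsDerivation Ξ.operator := by
  constructor
  · intro h X Y
    have hAC := anchor_iff_anchorCompatible.1 h.anchor
    -- One decomposition of `Ξ ∘ Z`, with the constant coefficients `1` and `-1`, is enough to
    -- extract the derivation property.
    have hrep : ∀ (Z : ΓA) (m : M), Ξ.fiberMap m (Z m) = ∑ i : Fin 2, ((![fun _ => 1, fun _ => -1] :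
        Fin 2 → M → ℝ) i m) • (![tangentTqSection Z, coreTqSection (Ξ.operator Z)] i).toFun
          ⟨m, Ξ.base m⟩ := by
      intro Z m
      rw [Ξ.fiberMap_eq, Fin.sum_univ_two]
      simp [tangentTqSection, coreTqSection, sub_eq_add_neg]
    have hc : ∀ i : Fin 2, ContMDiff IM 𝓘(ℝ, ℝ) ∞ ((![fun _ => 1, fun _ => -1] :
        Fin 2 → M → ℝ) i) := by
      intro i
      fin_cases i
      · exact contMDiff_const
      · exact contMDiff_const
    refine section_ext fun φ m => ?_
    have h1 := h.bracket X Y 2 2 _ _ _ _ hc hc (hrep X) (hrep Y) m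
    rw [hAC.bracket_sum_eq hc hc (hrep X) (hrep Y), Ξ.fiberMap_eq, sub_right_inj] at h1
    have h2 := congrArg (derivPairing φ (⟨m, Ξ.base m⟩ : TM)) h1
    rwa [derivPairing_coreSection, derivPairing_coreSection] at h2
  · intro h
    have hAC := h.anchorCompatible
    refine ⟨anchor_iff_anchorCompatible.2 hAC, fun X Y n k c d σ τ hc hd hX hY m => ?_⟩
    rw [hAC.bracket_sum_eq hc hd hX hY, Ξ.fiberMap_eq, h X Y]

end LieAlgebroid

end Algebroid

end LieAlgebroidTheory
end

noncomputable section

namespace LieAlgebroidTheory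

/-! ### Differentials in coordinates and the symmetry of second derivatives -/

section ChartExpansion

set_option linter.unusedSectionVars false

variable {E' H' N : Type*} [NormedAddCommGroup E'] [NormedSpace ℝ E'] [TopologicalSpace H']
  {J : ModelWithCorners ℝ E' H'} [TopologicalSpace N] [ChartedSpace H' N] [IsManifold J ∞ N]
  [J.Boundaryless]

theorem derivAlong_comp_extChartAt (p : N) {h : E' → ℝ} {z : TangentBundle J N}
    (hz : z.proj ∈ (extChartAt J p).source) (hh : DifferentiableAt ℝ h (extChartAt J p z.proj)) :
    derivAlong (fun η => h (extChartAt J p η)) z =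
      fderiv ℝ h (extChartAt J p z.proj) (mfderiv J 𝓘(ℝ, E') (extChartAt J p) z.proj z.snd) := by
  have : IsManifold J 1 N := IsManifold.of_le (n := ∞) (by simp)
  have h1 := mfderiv_comp (I' := 𝓘(ℝ, E')) z.proj hh.mdifferentiableAt
    (mdifferentiableAt_extChartAt (I := J) (by simpa using hz))
  refine (congrArg (fun A : E' →L[ℝ] ℝ => A z.snd) h1).trans ?_
  exact congrArg (fun A : E' →L[ℝ] ℝ =>
    A (mfderiv J 𝓘(ℝ, E') (extChartAt J p) z.proj z.snd)) mfderiv_eq_fderiv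

theorem derivAlong_comp_extChartAt_self (p : N) {h : E' → ℝ}
    (hh : DifferentiableAt ℝ h (extChartAt J p p)) (w : E') :
    derivAlong (fun η => h (extChartAt J p η)) (⟨p, w⟩ : TangentBundle J N) =
      fderiv ℝ h (extChartAt J p p) w := by
  have : IsManifold J 1 N := IsManifold.of_le (n := ∞) (by simp)
  refine (derivAlong_comp_extChartAt p (z := (⟨p, w⟩ : TangentBundle J N))
    (mem_extChartAt_source p) hh).trans ?_
  exact congrArg (fun A : E' →L[ℝ] E' => fderiv ℝ h (extChartAt J p p) (A w)) mfderiv_extChartAt_self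

theorem contDiffAt_comp_symm {G : N → ℝ} (hG : ContMDiff J 𝓘(ℝ, ℝ) ∞ G) (p : N) {y : E'}
    (hy : y ∈ (extChartAt J p).target) :
    ContDiffAt ℝ ∞ (fun y => G ((extChartAt J p).symm y)) y := by
  have h1 : ContMDiffAt 𝓘(ℝ, E') J ∞ (extChartAt J p).symm y :=
    (contMDiffOn_extChartAt_symm p).contMDiffAt ((isOpen_extChartAt_target p).mem_nhds hy)
  exact ((hG _).comp y h1).contDiffAt

/-- The differential of a function is a combination of the differentials of the coordinates `y a` of a
chart; the matrix of the second derivatives is symmetric. -/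
theorem exists_coordinate_expansion {G : N → ℝ} (hG : ContMDiff J 𝓘(ℝ, ℝ) ∞ G) (p : N) {n : ℕ}
    (b : Module.Basis (Fin n) ℝ E') (c : Fin n → E' →L[ℝ] ℝ) (hc : ∀ a w, c a w = b.repr w a)
    {y : Fin n → N → ℝ} (hy : ∀ a, y a =ᶠ[𝓝 p] fun η => c a (extChartAt J p η)) :
    ∃ g : Fin n → N → ℝ, (∀ a, MDifferentiableAt J 𝓘(ℝ, ℝ) (g a) p) ∧
      (∀ᶠ η in 𝓝 p, ∀ w : TangentSpace J η, derivAlong G (⟨η, w⟩ : TangentBundle J N) =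
        ∑ a, g a η * derivAlong (y a) (⟨η, w⟩ : TangentBundle J N)) ∧
      ∀ h k : TangentSpace J p,
        ∑ a, derivAlong (g a) (⟨p, h⟩ : TangentBundle J N) *
            derivAlong (y a) (⟨p, k⟩ : TangentBundle J N) =
          ∑ a, derivAlong (g a) (⟨p, k⟩ : TangentBundle J N) *
            derivAlong (y a) (⟨p, h⟩ : TangentBundle J N) := by
  have : IsManifold J 1 N := IsManifold.of_le (n := ∞) (by simp)
  have hsm : ∀ y ∈ (extChartAt J p).target,
      ContDiffAt ℝ ∞ (fun y => G ((extChartAt J p).symm y)) y := fun y hy =>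
    contDiffAt_comp_symm hG p hy
  have hsum : ∀ w, ∑ a, c a w • b a = w := fun w => by simp only [hc]; exact b.sum_repr w
  have hd2 : DifferentiableAt ℝ (fderiv ℝ (fun y => G ((extChartAt J p).symm y)))
      (extChartAt J p p) :=
    ((hsm _ (mem_extChartAt_target p)).fderiv_right (m := 1) (by norm_cast)).differentiableAt (by simp)
  -- The coefficients are the partial derivatives of `G` in the chart, so their derivatives form the
  -- Hessian.
  refine ⟨fun a η => fderiv ℝ (fun y => G ((extChartAt J p).symm y)) (extChartAt J p η) (b a),
    fun a => ?_, ?_, fun h k => ?_⟩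
  · have h1 : DifferentiableAt ℝ (fun z => fderiv ℝ (fun y => G ((extChartAt J p).symm y)) z (b a))
        (extChartAt J p p) := hd2.clm_apply (differentiableAt_const _)
    exact h1.mdifferentiableAt.comp p
      (mdifferentiableAt_extChartAt (I := J) (mem_chart_source H' p))
  · filter_upwards [(eventually_all.2 hy).eventually_nhds, extChartAt_source_mem_nhds (I := J) p]
      with η h1 h2 w
    have h3 : G =ᶠ[𝓝 η] fun η => (fun y => G ((extChartAt J p).symm y)) (extChartAt J p η) := by
      filter_upwards [(isOpen_extChartAt_source p).mem_nhds h2] with η' h'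
      exact congrArg G ((extChartAt J p).left_inv h').symm
    rw [derivAlong_congr (z := (⟨η, w⟩ : TangentBundle J N)) h3]
    refine (derivAlong_comp_extChartAt p (z := (⟨η, w⟩ : TangentBundle J N)) h2
      ((hsm _ ((extChartAt J p).map_source h2)).differentiableAt (by simp))).trans ?_
    conv_lhs => rw [← hsum (mfderiv J 𝓘(ℝ, E') (extChartAt J p) η w), map_sum]
    refine Finset.sum_congr rfl fun a _ => ?_
    have h4 : y a =ᶠ[𝓝 η] fun η => c a (extChartAt J p η) := h1.mono fun _ h => h a
    rw [derivAlong_congr (z := (⟨η, w⟩ : TangentBundle J N)) h4, map_smul, smul_eq_mul, mul_comm]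
    refine congrArg _ ?_
    refine Eq.symm ((derivAlong_comp_extChartAt p (z := (⟨η, w⟩ : TangentBundle J N)) h2
      (c a).differentiableAt).trans ?_)
    rw [(c a).fderiv]
  · have h1 : ∀ (a : Fin n) (w : E'), derivAlong (fun η => fderiv ℝ (fun y =>
        G ((extChartAt J p).symm y)) (extChartAt J p η) (b a)) (⟨p, w⟩ : TangentBundle J N) =
        fderiv ℝ (fderiv ℝ (fun y => G ((extChartAt J p).symm y))) (extChartAt J p p) w (b a) := by
      intro a w
      rw [derivAlong_comp_extChartAt_self p
        (h := fun z => fderiv ℝ (fun y => G ((extChartAt J p).symm y)) z (b a))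
        (hd2.clm_apply (differentiableAt_const _)) w]
      rw [fderiv_clm_apply hd2 (differentiableAt_const _)]
      simp
    have h2 : ∀ (a : Fin n) (w : E'), derivAlong (y a) (⟨p, w⟩ : TangentBundle J N) = c a w := by
      intro a w
      rw [derivAlong_congr (z := (⟨p, w⟩ : TangentBundle J N)) (hy a),
        derivAlong_comp_extChartAt_self p (c a).differentiableAt w, (c a).fderiv]
    have h3 : ∀ h k : E', ∑ a, derivAlong (fun η => fderiv ℝ (fun y =>
        G ((extChartAt J p).symm y)) (extChartAt J p η) (b a)) (⟨p, h⟩ : TangentBundle J N) *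
        derivAlong (y a) (⟨p, k⟩ : TangentBundle J N) =
        fderiv ℝ (fderiv ℝ (fun y => G ((extChartAt J p).symm y))) (extChartAt J p p) h k := by
      intro h k
      conv_rhs => rw [← hsum k, map_sum]
      refine Finset.sum_congr rfl fun a _ => ?_
      rw [h1, h2, map_smul, smul_eq_mul, mul_comm]
    have h4 : IsSymmSndFDerivAt ℝ (fun y => G ((extChartAt J p).symm y)) (extChartAt J p p) :=
      (hsm _ (mem_extChartAt_target p)).isSymmSndFDerivAt
        (by simpa using WithTop.coe_le_coe.2 (le_top : (2:ℕ∞) ≤ ⊤))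
    exact (h3 h k).trans ((h4 h k).trans (h3 k h).symm)

end ChartExpansion

end LieAlgebroidTheory

end

noncomputable section

namespace LieAlgebroidTheory

/-! ### The dual Poisson structure and the dual vector field -/

section Algebroid

set_option linter.unusedSectionVars false

variable {E : Type*} [NormedAddCommGroup E] [NormedSpace ℝ E]
  {M : Type*} [TopologicalSpace M] [ChartedSpace E M]
  {F : Type*} [NormedAddCommGroup F] [NormedSpace ℝ F]
  {V : M → Type*} [TopologicalSpace (TotalSpace F V)] [∀ m, AddCommGroup (V m)]
  [∀ m, Module ℝ (V m)] [∀ m, TopologicalSpace (V m)] [FiberBundle F V] [VectorBundle ℝ F V]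

local notation "IM" => modelWithCornersSelf ℝ E
local notation "IA" => ModelWithCorners.prod (modelWithCornersSelf ℝ E) (modelWithCornersSelf ℝ F)
local notation "IAd" =>
  ModelWithCorners.prod (modelWithCornersSelf ℝ E) (modelWithCornersSelf ℝ (F →L[ℝ] ℝ))
local notation "TM" => TangentBundle (modelWithCornersSelf ℝ E) M
local notation "TA" => TangentBundle
  (ModelWithCorners.prod (modelWithCornersSelf ℝ E) (modelWithCornersSelf ℝ F)) (TotalSpace F V)
local notation "Ad" => TotalSpace (F →L[ℝ] ℝ) (fun m : M => V m →L[ℝ] ℝ)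
local notation "ΓA" => ContMDiffSection (modelWithCornersSelf ℝ E) F ∞ V
local notation "ΓAd" => ContMDiffSection (modelWithCornersSelf ℝ E) (F →L[ℝ] ℝ) ∞
  (fun m : M => V m →L[ℝ] ℝ)

variable [IsManifold 𝓘(ℝ, E) ∞ M] [ContMDiffVectorBundle ∞ F V 𝓘(ℝ, E)] [T2Space M]
  [FiniteDimensional ℝ E] [FiniteDimensional ℝ F]

local notation "TAd" => TangentBundle
  (ModelWithCorners.prod (modelWithCornersSelf ℝ E) (modelWithCornersSelf ℝ (F →L[ℝ] ℝ)))
  (TotalSpace (F →L[ℝ] ℝ) (fun m : M => V m →L[ℝ] ℝ))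

/-- The function `ℓ_X + f ∘ q` on the dual bundle. -/
def affineFunction (X : ΓA) (f : M → ℝ) (η : Ad) : ℝ := dualLinearFunction X η + f η.proj

theorem contMDiff_affineFunction (X : ΓA) {f : M → ℝ} (hf : ContMDiff IM 𝓘(ℝ, ℝ) ∞ f) :
    ContMDiff IAd 𝓘(ℝ, ℝ) ∞ (affineFunction X f) :=
  (contMDiff_dualLinearFunction X).add (hf.comp (contMDiff_proj (fun m : M => V m →L[ℝ] ℝ)))

theorem derivAlong_affineFunction (X : ΓA) {f : M → ℝ} (hf : ContMDiff IM 𝓘(ℝ, ℝ) ∞ f) (z : TAd) :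
    derivAlong (affineFunction X f) z =
      derivAlong (dualLinearFunction X) z + derivAlong (fun η : Ad => f η.proj) z :=
  derivAlong_add (mdifferentiable_dualLinearFunction X _)
    ((hf.comp (contMDiff_proj (fun m : M => V m →L[ℝ] ℝ))).mdifferentiable (by simp) _)

/-- Reflexivity of `F`: it turns the fibre part of a linear function in a chart of the dual bundle
into a vector of `F`, which extends to a section of `A`. -/
theorem exists_eval_eq (l : (F →L[ℝ] ℝ) →L[ℝ] ℝ) : ∃ b : F, ∀ k : F →L[ℝ] ℝ, l k = k b := by
  let B := Module.finBasis ℝ F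
  refine ⟨∑ i, l (LinearMap.toContinuousLinearMap (B.coord i)) • B i, fun k => ?_⟩
  have h1 : k = ∑ i, k (B i) • LinearMap.toContinuousLinearMap (B.coord i) := by
    ext b
    conv_lhs => rw [← B.sum_repr b, map_sum]
    rw [sum_apply]
    refine Finset.sum_congr rfl fun i _ => ?_
    rw [map_smul, smul_eq_mul, mul_comm]
    rfl
  conv_lhs => rw [h1, map_sum]
  rw [map_sum]
  refine Finset.sum_congr rfl fun i _ => ?_
  rw [map_smul, map_smul, smul_eq_mul, smul_eq_mul, mul_comm]

theorem dual_trivializationAt_snd (m₀ : M) {η : Ad} (hη : η.proj ∈ (trivializationAt F V m₀).baseSet)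
    (b : F) : (trivializationAt (F →L[ℝ] ℝ) (fun m : M => V m →L[ℝ] ℝ) m₀ η).2 b =
      η.snd ((trivializationAt F V m₀).symm η.proj b) := by
  change (trivializationAt (F →L[ℝ] ℝ) (fun m : M => V m →L[ℝ] Bundle.Trivial M ℝ m) m₀ η).2 b = _
  rw [hom_trivializationAt_apply]
  dsimp only
  rw [ContinuousLinearMap.inCoordinates_eq hη (mem_univ _)]
  have h3 : ((trivializationAt F V m₀).continuousLinearEquivAt ℝ η.proj hη).symm b =
      (trivializationAt F V m₀).symm η.proj b := by
    rw [(trivializationAt F V m₀).symm_continuousLinearEquivAt_eq hη]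
    exact (trivializationAt F V m₀).symmL_apply hη b
  exact congrArg η.snd h3

/-- The linear functions of the chart of the dual bundle at `ψ` are, near `ψ`, of the form
`ℓ_X + f ∘ q`. -/
theorem exists_affineFunction_eventuallyEq (ψ : Ad) (l : E × (F →L[ℝ] ℝ) →L[ℝ] ℝ) :
    ∃ (X : ΓA) (f : M → ℝ), ContMDiff IM 𝓘(ℝ, ℝ) ∞ f ∧
      affineFunction X f =ᶠ[𝓝 ψ] fun η => l (extChartAt IAd ψ η) := by
  obtain ⟨b, hb⟩ := exists_eval_eq (l.comp (ContinuousLinearMap.inr ℝ E (F →L[ℝ] ℝ)))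
  obtain ⟨X, hX⟩ := exists_const_section (E := E) (V := V) ψ.proj b
  obtain ⟨f, hf, hfe⟩ := exists_contMDiff_eventuallyEq (J := IM) (p := ψ.proj)
    (chartAt E ψ.proj).open_source (mem_chart_source E ψ.proj)
    ((l.comp (ContinuousLinearMap.inl ℝ E (F →L[ℝ] ℝ))).contMDiff.comp_contMDiffOn
      (contMDiffOn_extChartAt (I := IM) (n := ∞) (x := ψ.proj)))
  refine ⟨X, f, hf, ?_⟩
  have hc : ContinuousAt (π (F →L[ℝ] ℝ) (fun m : M => V m →L[ℝ] ℝ)) ψ :=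
    (FiberBundle.continuous_proj _ _).continuousAt
  filter_upwards [hc.eventually hX, hc.eventually hfe, hc.eventually
    ((trivializationAt F V ψ.proj).open_baseSet.mem_nhds
      (FiberBundle.mem_baseSet_trivializationAt' ψ.proj))] with η h1 h2 h3
  have h4 : extChartAt IAd ψ η = (extChartAt IM ψ.proj η.proj,
      (trivializationAt (F →L[ℝ] ℝ) (fun m : M => V m →L[ℝ] ℝ) ψ.proj η).2) := by
    rw [FiberBundle.extChartAt]
    refine Prod.ext ?_ rfl
    have h5 : η.proj ∈ (trivializationAt (F →L[ℝ] ℝ)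
      (fun m : M => V m →L[ℝ] Bundle.Trivial M ℝ m) ψ.proj).baseSet := by
      rw [hom_trivializationAt_baseSet]
      exact ⟨h3, mem_univ _⟩
    have h6 : (trivializationAt (F →L[ℝ] ℝ) (fun m : M => V m →L[ℝ] ℝ) ψ.proj η).1 = η.proj :=
      Trivialization.coe_fst' _ h5
    exact congrArg (extChartAt IM ψ.proj) h6
  have h7 : ∀ (a : E) (k : F →L[ℝ] ℝ), l (a, k) = l (a, 0) + k b := fun a k => by
    rw [← hb k]
    refine Eq.trans ?_ (l.map_add _ _)
    simp
  rw [h4, h7, dual_trivializationAt_snd ψ.proj h3]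
  refine (add_comm _ _).trans (congrArg₂ (· + ·) h2 ?_)
  exact congrArg η.snd h1

/-- Every linear form on the tangent space at `ψ` is the differential of some `ℓ_X + f ∘ q`. No
smoothness of `G` is involved, since only the value of `mfderiv` has to be matched. -/
theorem nonempty_linearApprox (G : Ad → ℝ) (ψ : Ad) : Nonempty (LinearApprox (E := E) G ψ) := by
  obtain ⟨X, f, hf, h⟩ := exists_affineFunction_eventuallyEq ψ (mfderiv IAd 𝓘(ℝ, ℝ) G ψ)
  refine ⟨⟨X, f, hf, ?_⟩⟩
  refine ContinuousLinearMap.ext fun w => ?_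
  have h1 := derivAlong_congr (z := (⟨ψ, w⟩ : TAd)) h
  have h2 := h1.trans (derivAlong_comp_extChartAt_self (J := IAd) ψ
    (h := (mfderiv IAd 𝓘(ℝ, ℝ) G ψ : E × (F →L[ℝ] ℝ) →L[ℝ] ℝ))
    (ContinuousLinearMap.differentiableAt _) w)
  refine Eq.trans ?_ h2.symm
  exact congrArg (fun A : E × (F →L[ℝ] ℝ) →L[ℝ] ℝ => A w) (ContinuousLinearMap.fderiv
    (mfderiv IAd 𝓘(ℝ, ℝ) G ψ : E × (F →L[ℝ] ℝ) →L[ℝ] ℝ)).symm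

namespace LieAlgebroid

variable (L : LieAlgebroid E F V)

/-- The Poisson bracket of `ℓ_X + f ∘ q` and `ℓ_Y + g ∘ q`. -/
def affineBracket (X : ΓA) (f : M → ℝ) (Y : ΓA) (g : M → ℝ) (ψ : Ad) : ℝ :=
  dualLinearFunction (L.bracket X Y) ψ + derivAlong g (L.anchorMap ⟨ψ.proj, X ψ.proj⟩) -
    derivAlong f (L.anchorMap ⟨ψ.proj, Y ψ.proj⟩)

theorem affineBracket_antisymm (X : ΓA) (f : M → ℝ) (Y : ΓA) (g : M → ℝ) (ψ : Ad) :
    L.affineBracket X f Y g ψ = -L.affineBracket Y g X f ψ := by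
  have h : dualLinearFunction (L.bracket X Y) ψ = -dualLinearFunction (L.bracket Y X) ψ := by
    rw [L.bracket_antisymm]
    exact ψ.snd.map_neg _
  unfold affineBracket
  rw [h]
  ring

/-- The Hamiltonian vector of `ℓ_X + f ∘ q`. -/
theorem exists_hamiltonian_affine (X : ΓA) {f : M → ℝ} (hf : ContMDiff IM 𝓘(ℝ, ℝ) ∞ f) (ψ : Ad) :
    ∃ h : TangentSpace IAd ψ, ∀ (Y : ΓA) (g : M → ℝ), ContMDiff IM 𝓘(ℝ, ℝ) ∞ g →
      derivAlong (affineFunction Y g) (⟨ψ, h⟩ : TAd) = L.affineBracket X f Y g ψ := by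
  obtain ⟨m, ψ⟩ := ψ
  obtain ⟨φ, rfl⟩ := exists_dual_section (E := E) (F := F) m ψ
  -- With a dual section `φ` through `ψ`, the anchor of `X` is lifted by the tangent map of `φ`. The
  -- vertical correction by the Lie derivative of `φ` makes the result act correctly on the `ℓ_Y`,
  -- and the pullback of `df` accounts for `f`.
  refine ⟨mfderiv IM IAd (fun m' => (⟨m', φ m'⟩ : Ad)) m (L.anchor m (X m)) -
    verticalLift E (F →L[ℝ] ℝ) (V := fun m : M => V m →L[ℝ] ℝ) (φ m)
      (L.lieDual X φ m + L.coAnchor f hf m), fun Y g hg => ?_⟩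
  have hq : ContMDiff IAd 𝓘(ℝ, ℝ) ∞ (fun η : Ad => g η.proj) :=
    hg.comp (contMDiff_proj (fun m : M => V m →L[ℝ] ℝ))
  rw [derivAlong_affineFunction Y hg]
  have h1 : derivAlong (dualLinearFunction Y) (⟨⟨m, φ m⟩,
      mfderiv IM IAd (fun m' => (⟨m', φ m'⟩ : Ad)) m (L.anchor m (X m))⟩ : TAd) =
      derivAlong (fun m' => φ m' (Y m')) (L.anchorMap ⟨m, X m⟩) :=
    (derivAlong_comp (J₂ := IAd) (h := dualLinearFunction Y) (k := fun m' => (⟨m', φ m'⟩ : Ad))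
      (z := L.anchorMap ⟨m, X m⟩) (mdifferentiable_dualLinearFunction Y _)
      (φ.mdifferentiableAt (x := m))).symm
  have h2 : derivAlong (dualLinearFunction Y) (⟨⟨m, φ m⟩, verticalLift E (F →L[ℝ] ℝ)
      (V := fun m : M => V m →L[ℝ] ℝ) (φ m) (L.lieDual X φ m + L.coAnchor f hf m)⟩ : TAd) =
      L.lieDual X φ m (Y m) + L.coAnchor f hf m (Y m) :=
    mfderiv_verticalLift (E := E) (F := F →L[ℝ] ℝ) (V := fun m : M => V m →L[ℝ] ℝ)
      (mdifferentiable_dualLinearFunction Y _) (fun t => rfl)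
  have h3 : derivAlong (fun η : Ad => g η.proj) (⟨⟨m, φ m⟩,
      mfderiv IM IAd (fun m' => (⟨m', φ m'⟩ : Ad)) m (L.anchor m (X m))⟩ : TAd) =
      derivAlong g (L.anchorMap ⟨m, X m⟩) :=
    (derivAlong_comp (J₂ := IAd) (h := fun η : Ad => g η.proj) (k := fun m' => (⟨m', φ m'⟩ : Ad))
      (z := L.anchorMap ⟨m, X m⟩) (hq.mdifferentiable (by simp) _)
      (φ.mdifferentiableAt (x := m))).symm
  have h4 : derivAlong (fun η : Ad => g η.proj) (⟨⟨m, φ m⟩, verticalLift E (F →L[ℝ] ℝ)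
      (V := fun m : M => V m →L[ℝ] ℝ) (φ m) (L.lieDual X φ m + L.coAnchor f hf m)⟩ : TAd) = 0 :=
    mfderiv_verticalLift (E := E) (F := F →L[ℝ] ℝ) (V := fun m : M => V m →L[ℝ] ℝ)
      (hq.mdifferentiable (by simp) _) (fun t => by simp)
  refine (congrArg₂ (· + ·) ((derivAlong_mk_sub _ _ _).trans (congrArg₂ (· - ·) h1 h2))
    ((derivAlong_mk_sub _ _ _).trans (congrArg₂ (· - ·) h3 h4))).trans ?_
  rw [lieDual_apply, coAnchor_apply]
  unfold affineBracket
  have h5 : dualLinearFunction (L.bracket X Y) ⟨m, φ m⟩ = φ m (L.bracket X Y m) := rfl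
  rw [h5]
  ring

/-- Exposes the chosen approximations: the one of `G` and its Hamiltonian vector come before `K`, so
that a single vector computes `{G, K}` for all `K`. -/
theorem exists_hamiltonian_aux (G : Ad → ℝ) (ψ : Ad) : ∃ A : LinearApprox (E := E) G ψ,
    ∃ h : TangentSpace IAd ψ, ∀ K, ∃ B : LinearApprox (E := E) K ψ,
      L.poissonBracket G K ψ = L.affineBracket A.X A.f B.X B.f ψ ∧
      derivAlong K (⟨ψ, h⟩ : TAd) = L.affineBracket A.X A.f B.X B.f ψ := by
  obtain ⟨h, hh⟩ := L.exists_hamiltonian_affine (nonempty_linearApprox (E := E) G ψ).some.X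
    (nonempty_linearApprox (E := E) G ψ).some.smooth_f ψ
  refine ⟨(nonempty_linearApprox (E := E) G ψ).some, h, fun K => ⟨(nonempty_linearApprox (E := E) K ψ).some,
    dif_pos ⟨nonempty_linearApprox (E := E) G ψ, nonempty_linearApprox (E := E) K ψ⟩, ?_⟩⟩
  rw [← hh _ _ (nonempty_linearApprox (E := E) K ψ).some.smooth_f]
  exact congrArg (fun A : E × (F →L[ℝ] ℝ) →L[ℝ] ℝ => A h) (nonempty_linearApprox (E := E) K ψ).some.eq

/-- The Hamiltonian vector of a function. -/
theorem exists_hamiltonian (G : Ad → ℝ) (ψ : Ad) : ∃ h : TangentSpace IAd ψ, ∀ K,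
    L.poissonBracket G K ψ = derivAlong K (⟨ψ, h⟩ : TAd) := by
  obtain ⟨A, h, hh⟩ := L.exists_hamiltonian_aux G ψ
  refine ⟨h, fun K => ?_⟩
  obtain ⟨B, h1, h2⟩ := hh K
  exact h1.trans h2.symm

theorem poissonBracket_antisymm (G K : Ad → ℝ) (ψ : Ad) :
    L.poissonBracket G K ψ = -L.poissonBracket K G ψ := by
  have h1 : L.poissonBracket G K ψ = L.affineBracket (nonempty_linearApprox (E := E) G ψ).some.X
    (nonempty_linearApprox (E := E) G ψ).some.f (nonempty_linearApprox (E := E) K ψ).some.X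
    (nonempty_linearApprox (E := E) K ψ).some.f ψ :=
    dif_pos ⟨nonempty_linearApprox (E := E) G ψ, nonempty_linearApprox (E := E) K ψ⟩
  have h2 : L.poissonBracket K G ψ = L.affineBracket (nonempty_linearApprox (E := E) K ψ).some.X
    (nonempty_linearApprox (E := E) K ψ).some.f (nonempty_linearApprox (E := E) G ψ).some.X
    (nonempty_linearApprox (E := E) G ψ).some.f ψ :=
    dif_pos ⟨nonempty_linearApprox (E := E) K ψ, nonempty_linearApprox (E := E) G ψ⟩
  rw [h1, h2]
  exact L.affineBracket_antisymm _ _ _ _ _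

/-- The bracket is computed with arbitrary approximations, which need not be the given sections and
functions. It depends only on the differential of its second argument, being a derivative along a
Hamiltonian vector of the first, and by antisymmetry only on the differential of the first. -/
theorem poissonBracket_affineFunction (X : ΓA) {f : M → ℝ} (hf : ContMDiff IM 𝓘(ℝ, ℝ) ∞ f) (Y : ΓA)
    {g : M → ℝ} (hg : ContMDiff IM 𝓘(ℝ, ℝ) ∞ g) (ψ : Ad) :
    L.poissonBracket (affineFunction X f) (affineFunction Y g) ψ = L.affineBracket X f Y g ψ := by
  obtain ⟨h, hh⟩ := L.exists_hamiltonian_affine X hf ψ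
  obtain ⟨B, k', hB⟩ := L.exists_hamiltonian_aux (affineFunction Y g) ψ
  obtain ⟨A, h1, h2⟩ := hB (affineFunction X f)
  rw [L.poissonBracket_antisymm, h1, ← affineBracket_antisymm, ← hh Y g hg]
  obtain ⟨h', hh'⟩ := L.exists_hamiltonian_affine B.X B.smooth_f ψ
  have e1 : derivAlong (affineFunction X f) (⟨ψ, h'⟩ : TAd) =
      derivAlong (affineFunction A.X A.f) (⟨ψ, h'⟩ : TAd) :=
    congrArg (fun A : E × (F →L[ℝ] ℝ) →L[ℝ] ℝ => A h') A.eq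
  rw [hh' X f hf, hh' A.X A.f A.smooth_f] at e1
  rw [affineBracket_antisymm, ← e1, ← affineBracket_antisymm, ← hh B.X B.f B.smooth_f]
  exact (congrArg (fun A : E × (F →L[ℝ] ℝ) →L[ℝ] ℝ => A h) B.eq).symm

/-- The bracket with `G` is a derivative along a fixed vector, hence linear in the differential at
`ψ` of the other argument. -/
theorem poissonBracket_eq_sum_right {n : ℕ} (G : Ad → ℝ) {K : Ad → ℝ} {y : Fin n → Ad → ℝ}
    {k : Fin n → ℝ} {ψ : Ad} (h : ∀ w : TangentSpace IAd ψ, derivAlong K (⟨ψ, w⟩ : TAd) =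
      ∑ a, k a * derivAlong (y a) (⟨ψ, w⟩ : TAd)) :
    L.poissonBracket G K ψ = ∑ a, k a * L.poissonBracket G (y a) ψ := by
  obtain ⟨v, hv⟩ := L.exists_hamiltonian G ψ
  simp only [hv, h]

theorem poissonBracket_eq_sum_left {n : ℕ} (G : Ad → ℝ) {K : Ad → ℝ} {y : Fin n → Ad → ℝ}
    {k : Fin n → ℝ} {ψ : Ad} (h : ∀ w : TangentSpace IAd ψ, derivAlong K (⟨ψ, w⟩ : TAd) =
      ∑ a, k a * derivAlong (y a) (⟨ψ, w⟩ : TAd)) :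
    L.poissonBracket K G ψ = ∑ a, k a * L.poissonBracket (y a) G ψ := by
  rw [poissonBracket_antisymm, L.poissonBracket_eq_sum_right G h, ← Finset.sum_neg_distrib]
  refine Finset.sum_congr rfl fun a _ => ?_
  rw [L.poissonBracket_antisymm (y a), mul_neg]

theorem affineBracket_eq_affineFunction (X : ΓA) (f : M → ℝ) (Y : ΓA) (g : M → ℝ) :
    L.affineBracket X f Y g = affineFunction (L.bracket X Y) (fun m =>
      derivAlong g (L.anchorMap ⟨m, X m⟩) - derivAlong f (L.anchorMap ⟨m, Y m⟩)) :=
  funext fun _ => add_sub_assoc _ _ _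

variable (Ξ : LinearVectorField E F V)

theorem _root_.LieAlgebroidTheory.LinearVectorField.derivAlong_affineFunction_dual (X : ΓA) {f : M → ℝ}
    (hf : ContMDiff IM 𝓘(ℝ, ℝ) ∞ f) (ψ : Ad) :
    derivAlong (affineFunction X f) (⟨ψ, Ξ.dual ψ⟩ : TAd) =
      affineFunction (Ξ.operator X) (fun m => derivAlong f (⟨m, Ξ.base m⟩ : TM)) ψ := by
  have h := (Ξ.exists_isDualAt ψ).choose_spec
  rw [derivAlong_affineFunction X hf]
  exact congrArg₂ (· + ·) (h.1 X) (h.2 f hf)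

variable {L Ξ}

/-- The dual vector field is a derivation of the Poisson bracket of functions `ℓ_X + f ∘ q`. -/
theorem IsDerivation.derivAlong_affineBracket (hD : L.IsDerivation Ξ.operator) (X : ΓA) {f : M → ℝ}
    (hf : ContMDiff IM 𝓘(ℝ, ℝ) ∞ f) (Y : ΓA) {g : M → ℝ} (hg : ContMDiff IM 𝓘(ℝ, ℝ) ∞ g) (ψ : Ad) :
    derivAlong (L.affineBracket X f Y g) (⟨ψ, Ξ.dual ψ⟩ : TAd) =
      L.affineBracket (Ξ.operator X) (fun m => derivAlong f (⟨m, Ξ.base m⟩ : TM)) Y g ψ +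
      L.affineBracket X f (Ξ.operator Y) (fun m => derivAlong g (⟨m, Ξ.base m⟩ : TM)) ψ := by
  have h1 := L.contMDiff_anchor_derivAlong X hg
  have h2 := L.contMDiff_anchor_derivAlong Y hf
  have hA := hD.anchorCompatible
  rw [affineBracket_eq_affineFunction, Ξ.derivAlong_affineFunction_dual _ (h1.sub h2), hD X Y]
  unfold affineFunction affineBracket
  dsimp only
  rw [derivAlong_sub (f := fun m => derivAlong g (L.anchorMap ⟨m, X m⟩))
    (g := fun m => derivAlong f (L.anchorMap ⟨m, Y m⟩))
    (h1.mdifferentiable (by simp) _) (h2.mdifferentiable (by simp) _), hA g hg X, hA f hf Y]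
  have h3 : dualLinearFunction (L.bracket (Ξ.operator X) Y + L.bracket X (Ξ.operator Y)) ψ =
    dualLinearFunction (L.bracket (Ξ.operator X) Y) ψ +
      dualLinearFunction (L.bracket X (Ξ.operator Y)) ψ := ψ.snd.map_add _ _
  rw [h3]
  ring

/-- Write `dG = ∑ gₐ dyₐ` and `dK = ∑ kₐ dyₐ` in coordinates `yₐ` of the form `ℓ_X + f ∘ q`, for
which the identity is known. What remains are terms with derivatives of the coefficients, and these
match because the matrices of second derivatives of `G` and `K` are symmetric. -/
theorem IsDerivation.isPoisson (hD : L.IsDerivation Ξ.operator) : L.IsPoisson Ξ.dual := by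
  intro G K hG hK ψ
  let b := Module.finBasis ℝ (E × (F →L[ℝ] ℝ))
  let c := fun a => LinearMap.toContinuousLinearMap (b.coord a)
  choose X f hf hy using fun a => exists_affineFunction_eventuallyEq (V := V) ψ (c a)
  obtain ⟨y, hydef⟩ : ∃ y : Fin _ → Ad → ℝ, ∀ a, y a = affineFunction (X a) (f a) :=
    ⟨_, fun _ => rfl⟩
  simp only [← hydef] at hy
  obtain ⟨g, hgd, hg, hgs⟩ := exists_coordinate_expansion hG ψ b c (fun a w => rfl) hy
  obtain ⟨k, hkd, hk, hks⟩ := exists_coordinate_expansion hK ψ b c (fun a w => rfl) hy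
  obtain ⟨vG, hvG⟩ := L.exists_hamiltonian G ψ
  obtain ⟨vK, hvK⟩ := L.exists_hamiltonian K ψ
  let xf := fun a m => derivAlong (f a) (⟨m, Ξ.base m⟩ : TM)
  have hxs : ∀ a, ContMDiff IM 𝓘(ℝ, ℝ) ∞ (xf a) := fun a => Ξ.contMDiff_base_derivAlong (hf a)
  obtain ⟨u, hudef⟩ : ∃ u : Fin _ → Ad → ℝ, ∀ a, u a = affineFunction (Ξ.operator (X a)) (xf a) :=
    ⟨_, fun _ => rfl⟩
  have hu : ∀ a η, derivAlong (y a) (⟨η, Ξ.dual η⟩ : TAd) = u a η := fun a η => by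
    rw [hydef, hudef]
    exact Ξ.derivAlong_affineFunction_dual (X a) (hf a) η
  have hud : ∀ a, MDifferentiableAt IAd 𝓘(ℝ, ℝ) (u a) ψ := fun a => by
    rw [hudef]
    exact (contMDiff_affineFunction _ (hxs a)).mdifferentiable (by simp) _
  obtain ⟨W, hW⟩ : ∃ W : Fin _ → Fin _ → Ad → ℝ,
      ∀ a a', W a a' = L.affineBracket (X a) (f a) (X a') (f a') := ⟨_, fun _ _ => rfl⟩
  have hWd : ∀ a a', MDifferentiableAt IAd 𝓘(ℝ, ℝ) (W a a') ψ := fun a a' => by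
    rw [hW, affineBracket_eq_affineFunction]
    exact (contMDiff_affineFunction _ ((L.contMDiff_anchor_derivAlong _ (hf _)).sub
      (L.contMDiff_anchor_derivAlong _ (hf _)))).mdifferentiable (by simp) _
  have hyy : ∀ a a' η, L.poissonBracket (y a) (y a') η = W a a' η := fun a a' η => by
    rw [hydef, hydef, hW]
    exact L.poissonBracket_affineFunction _ (hf a) _ (hf a') η
  have hGy : ∀ᶠ η in 𝓝 ψ, ∀ a', L.poissonBracket G (y a') η = ∑ a, g a η * W a a' η := by
    filter_upwards [hg] with η h a'
    rw [L.poissonBracket_eq_sum_left (y a') h]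
    simp only [hyy]
  have hGK : L.poissonBracket G K =ᶠ[𝓝 ψ] fun η => ∑ a', ∑ a, k a' η * (g a η * W a a' η) := by
    filter_upwards [hGy, hk] with η h h'
    rw [L.poissonBracket_eq_sum_right G h']
    simp only [h, Finset.mul_sum]
  have hgW : ∀ a a', MDifferentiableAt IAd 𝓘(ℝ, ℝ) (fun η => g a η * W a a' η) ψ := fun a a' =>
    (hgd a).mul (hWd a a')
  have hkgW : ∀ a a', MDifferentiableAt IAd 𝓘(ℝ, ℝ) (fun η => k a' η * (g a η * W a a' η)) ψ :=
    fun a a' => (hkd a').mul (hgW a a')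
  have e1 : derivAlong (L.poissonBracket G K) (⟨ψ, Ξ.dual ψ⟩ : TAd) = ∑ a', ∑ a,
      (k a' ψ * (g a ψ * derivAlong (W a a') (⟨ψ, Ξ.dual ψ⟩ : TAd) +
        derivAlong (g a) (⟨ψ, Ξ.dual ψ⟩ : TAd) * W a a' ψ) +
        derivAlong (k a') (⟨ψ, Ξ.dual ψ⟩ : TAd) * (g a ψ * W a a' ψ)) := by
    rw [derivAlong_congr (z := (⟨ψ, Ξ.dual ψ⟩ : TAd)) hGK]
    rw [derivAlong_sum (z := (⟨ψ, Ξ.dual ψ⟩ : TAd))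
      (f := fun a' η => ∑ a, k a' η * (g a η * W a a' η)) (fun a' _ => by
        have := MDifferentiableAt.sum (t := Finset.univ)
          (f := fun a η => k a' η * (g a η * W a a' η)) (fun a _ => hkgW a a')
        refine this.congr_of_eventuallyEq (Eventually.of_forall fun η => ?_)
        rw [Finset.sum_apply])]
    refine Finset.sum_congr rfl fun a' _ => ?_
    rw [derivAlong_sum (z := (⟨ψ, Ξ.dual ψ⟩ : TAd))
      (f := fun a η => k a' η * (g a η * W a a' η)) (fun a _ => hkgW a a')]
    refine Finset.sum_congr rfl fun a _ => ?_
    rw [derivAlong_mul (z := (⟨ψ, Ξ.dual ψ⟩ : TAd)) (f := k a') (g := fun η => g a η * W a a' η)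
      (hkd a') (hgW a a'),
      derivAlong_mul (z := (⟨ψ, Ξ.dual ψ⟩ : TAd)) (f := g a) (g := W a a') (hgd a) (hWd a a')]
  have hHG : (fun η => derivAlong G (⟨η, Ξ.dual η⟩ : TAd)) =ᶠ[𝓝 ψ] fun η => ∑ a, g a η * u a η := by
    filter_upwards [hg] with η h
    rw [h]
    simp only [hu]
  have hHK : (fun η => derivAlong K (⟨η, Ξ.dual η⟩ : TAd)) =ᶠ[𝓝 ψ] fun η => ∑ a, k a η * u a η := by
    filter_upwards [hk] with η h
    rw [h]
    simp only [hu]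
  have hsum : ∀ (l : Fin _ → Ad → ℝ), (∀ a, MDifferentiableAt IAd 𝓘(ℝ, ℝ) (l a) ψ) →
      ∀ v : TangentSpace IAd ψ, derivAlong (fun η => ∑ a, l a η * u a η) (⟨ψ, v⟩ : TAd) =
      ∑ a, (l a ψ * derivAlong (u a) (⟨ψ, v⟩ : TAd) +
        derivAlong (l a) (⟨ψ, v⟩ : TAd) * u a ψ) := fun l hl v => by
    rw [derivAlong_sum (z := (⟨ψ, v⟩ : TAd)) (f := fun a η => l a η * u a η)
      (fun a _ => (hl a).mul (hud a))]
    refine Finset.sum_congr rfl fun a _ => ?_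
    rw [derivAlong_mul (z := (⟨ψ, v⟩ : TAd)) (f := l a) (g := u a) (hl a) (hud a)]
  obtain ⟨R, hR⟩ : ∃ R : Fin _ → Fin _ → ℝ, ∀ a a',
      R a a' = L.affineBracket (Ξ.operator (X a)) (xf a) (X a') (f a') ψ := ⟨_, fun _ _ => rfl⟩
  have huy : ∀ a a', L.poissonBracket (u a) (y a') ψ = R a a' := fun a a' => by
    rw [hudef, hydef, hR]
    exact L.poissonBracket_affineFunction _ (hxs a) _ (hf a') ψ
  have hvu : ∀ a, derivAlong (u a) (⟨ψ, vK⟩ : TAd) = -∑ a', k a' ψ * R a a' := fun a => by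
    rw [← hvK, poissonBracket_antisymm, L.poissonBracket_eq_sum_right _ hk.self_of_nhds]
    simp only [huy]
  have hvu' : ∀ a', derivAlong (u a') (⟨ψ, vG⟩ : TAd) = -∑ a, g a ψ * R a' a := fun a => by
    rw [← hvG, poissonBracket_antisymm, L.poissonBracket_eq_sum_right _ hg.self_of_nhds]
    simp only [huy]
  have hvy : ∀ a, derivAlong (y a) (⟨ψ, vK⟩ : TAd) = -∑ a', k a' ψ * W a a' ψ := fun a => by
    rw [← hvK, poissonBracket_antisymm, L.poissonBracket_eq_sum_right _ hk.self_of_nhds]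
    simp only [hyy]
  have hvy' : ∀ a', derivAlong (y a') (⟨ψ, vG⟩ : TAd) = ∑ a, g a ψ * W a a' ψ := fun a' => by
    rw [← hvG, hGy.self_of_nhds]
  have e2 : L.poissonBracket (fun η => derivAlong G (⟨η, Ξ.dual η⟩ : TAd)) K ψ =
      ∑ a, g a ψ * ∑ a', k a' ψ * R a a' +
        ∑ a, derivAlong (g a) (⟨ψ, Ξ.dual ψ⟩ : TAd) * ∑ a', k a' ψ * W a a' ψ := by
    rw [poissonBracket_antisymm, hvK, derivAlong_congr (z := (⟨ψ, vK⟩ : TAd)) hHG, hsum g hgd,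
      Finset.sum_add_distrib]
    -- The symmetry of the Hessian of `G` moves the derivative of the coefficients from the
    -- Hamiltonian vector of `K` to `Ξ_*`.
    have h1 := hgs vK (Ξ.dual ψ)
    simp only [hu, hvy] at h1
    rw [h1]
    simp only [hvu, mul_neg, Finset.sum_neg_distrib]
    ring
  have e3 : L.poissonBracket G (fun η => derivAlong K (⟨η, Ξ.dual η⟩ : TAd)) ψ =
      -∑ a', k a' ψ * ∑ a, g a ψ * R a' a +
        ∑ a', derivAlong (k a') (⟨ψ, Ξ.dual ψ⟩ : TAd) * ∑ a, g a ψ * W a a' ψ := by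
    rw [hvG, derivAlong_congr (z := (⟨ψ, vG⟩ : TAd)) hHK, hsum k hkd, Finset.sum_add_distrib]
    have h1 := hks vG (Ξ.dual ψ)
    simp only [hu, hvy'] at h1
    rw [h1]
    simp only [hvu', mul_neg, Finset.sum_neg_distrib]
  rw [e1, e2, e3]
  -- The only place where the derivation property enters the computation: the identity for pairs of
  -- coordinates.
  have hlin : ∀ a a', derivAlong (W a a') (⟨ψ, Ξ.dual ψ⟩ : TAd) = R a a' - R a' a := fun a a' => by
    rw [hW, hD.derivAlong_affineBracket (X a) (hf a) (X a') (hf a') ψ,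
      L.affineBracket_antisymm (X a), ← sub_eq_add_neg, hR, hR]
  simp only [hlin, Finset.mul_sum]
  rw [Finset.sum_comm (f := fun a a' => g a ψ * (k a' ψ * R a a')),
    Finset.sum_comm (f := fun a a' =>
      derivAlong (g a) (⟨ψ, Ξ.dual ψ⟩ : TAd) * (k a' ψ * W a a' ψ)),
    ← Finset.sum_neg_distrib, ← Finset.sum_add_distrib, ← Finset.sum_add_distrib,
    ← Finset.sum_add_distrib]
  refine Finset.sum_congr rfl fun a' _ => ?_
  rw [← Finset.sum_neg_distrib, ← Finset.sum_add_distrib, ← Finset.sum_add_distrib,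
    ← Finset.sum_add_distrib]
  refine Finset.sum_congr rfl fun a _ => ?_
  ring

theorem affineFunction_zero (X : ΓA) : affineFunction (V := V) X (fun _ => 0) = dualLinearFunction X :=
  funext fun _ => add_zero _

/-- On the functions `ℓ_X` both the bracket and `Ξ_*` are given by sections, and evaluation at the
points of dual sections recovers the derivation identity. -/
theorem isPoisson_iff_isDerivation : L.IsPoisson Ξ.dual ↔ L.IsDerivation Ξ.operator := by
  refine ⟨fun h X Y => section_ext fun φ m => ?_, fun h => h.isPoisson⟩
  have h0 : ContMDiff IM 𝓘(ℝ, ℝ) ∞ (fun _ : M => (0 : ℝ)) := contMDiff_const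
  have hl : ∀ X Y : ΓA, L.poissonBracket (dualLinearFunction X) (dualLinearFunction Y) =
      dualLinearFunction (L.bracket X Y) := fun X Y => funext fun η => by
    rw [← affineFunction_zero X, ← affineFunction_zero Y,
      L.poissonBracket_affineFunction X h0 Y h0]
    unfold affineBracket
    rw [derivAlong_const, derivAlong_const, sub_zero, add_zero]
  have hd : ∀ X : ΓA, (fun η => derivAlong (dualLinearFunction X) (⟨η, Ξ.dual η⟩ : TAd)) =
      dualLinearFunction (Ξ.operator X) := fun X =>
    funext fun η => (Ξ.exists_isDualAt η).choose_spec.1 X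
  have h1 := h (dualLinearFunction X) (dualLinearFunction Y) (contMDiff_dualLinearFunction X)
    (contMDiff_dualLinearFunction Y) ⟨m, φ m⟩
  rw [hd, hd, hl, hl, hl] at h1
  exact ((congrFun (hd _) _).symm.trans h1).trans ((φ m).map_add _ _).symm

end LieAlgebroid

/-- The derivative of a curve in the total space of a bundle is determined by the derivatives of its
projection and of its component in a trivialization. -/
theorem hasMFDerivAt_curve_iff {γ : ℝ → TotalSpace F V} {t : ℝ} {w : E × F} :
    HasMFDerivAt 𝓘(ℝ, ℝ) IA γ t ((1 : ℝ →L[ℝ] ℝ).smulRight w : ℝ →L[ℝ] E × F) ↔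
      HasMFDerivAt 𝓘(ℝ, ℝ) IM (fun s => (γ s).proj) t ((1 : ℝ →L[ℝ] ℝ).smulRight w.1 : ℝ →L[ℝ] E) ∧
      HasDerivAt (fun s => (trivializationAt F V (γ t).proj (γ s)).2) w.2 t := by
  have key : ∀ D : ℝ →L[ℝ] E × F, HasMFDerivAt 𝓘(ℝ, ℝ) IA γ t D →
      HasMFDerivAt 𝓘(ℝ, ℝ) IM (fun s => (γ s).proj) t ((ContinuousLinearMap.fst ℝ E F).comp D) ∧
      HasDerivAt (fun s => (trivializationAt F V (γ t).proj (γ s)).2) (D 1).2 t := by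
    intro D hD
    refine ⟨(hasMFDerivAt_proj (E := E) (γ t)).comp t hD, ?_⟩
    have h := (hasMFDerivAt_triv (E := E) (γ t)).comp t hD
    have h' : HasFDerivAt (fun s => (trivializationAt F V (γ t).proj (γ s)).2)
      ((ContinuousLinearMap.snd ℝ E F).comp D) t := hasMFDerivAt_iff_hasFDerivAt.1 h
    exact h'.hasDerivAt
  constructor
  · intro h
    obtain ⟨h1, h2⟩ := key _ h
    refine ⟨h1.congr_mfderiv ?_, ?_⟩
    · refine ContinuousLinearMap.ext fun r => rfl
    · have h3 : (((1 : ℝ →L[ℝ] ℝ).smulRight w : ℝ →L[ℝ] E × F) 1) = w := one_smul ℝ w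
      rwa [h3] at h2
  · rintro ⟨h1, h2⟩
    have hd : MDifferentiableAt 𝓘(ℝ, ℝ) IA γ t := by
      rw [mdifferentiableAt_totalSpace]
      exact ⟨h1.mdifferentiableAt, h2.differentiableAt.mdifferentiableAt⟩
    obtain ⟨h3, h4⟩ := key _ hd.hasMFDerivAt
    refine hd.hasMFDerivAt.congr_mfderiv ?_
    have h5 : (ContinuousLinearMap.fst ℝ E F).comp (mfderiv 𝓘(ℝ, ℝ) IA γ t : ℝ →L[ℝ] E × F) =
      ((1 : ℝ →L[ℝ] ℝ).smulRight w.1 : ℝ →L[ℝ] E) := hasMFDerivAt_unique h3 h1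
    refine ContinuousLinearMap.ext_ring ?_
    refine Prod.ext ?_ ?_
    · exact congrArg (fun A : ℝ →L[ℝ] E => A 1) h5
    · refine (h4.unique h2).trans ?_
      exact (one_smul ℝ w.2).symm

/-! ### Flows of linear vector fields -/

namespace LinearVectorField

variable (Ξ : LinearVectorField E F V)

theorem fst_vf (p : TotalSpace F V) : (show E × F from Ξ.vf p).1 = Ξ.base p.proj := by
  obtain ⟨m, a⟩ := p
  have h := Ξ.proj_eq m a
  rw [tangentMap_proj_mk (F := F) m a (Ξ.vf ⟨m, a⟩)] at h
  exact eq_of_heq (TotalSpace.mk.inj h).2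

theorem hasMFDerivAt_iff {γ : ℝ → TotalSpace F V} {t : ℝ} :
    HasMFDerivAt 𝓘(ℝ, ℝ) IA γ t ((1 : ℝ →L[ℝ] ℝ).smulRight (Ξ.vf (γ t))) ↔
      HasMFDerivAt 𝓘(ℝ, ℝ) IM (fun s => (γ s).proj) t
        ((1 : ℝ →L[ℝ] ℝ).smulRight (Ξ.base (γ t).proj)) ∧
      HasDerivAt (fun s => (trivializationAt F V (γ t).proj (γ s)).2)
        (show E × F from Ξ.vf (γ t)).2 t := by
  rw [← Ξ.fst_vf (γ t)]
  exact hasMFDerivAt_curve_iff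

/-- The integral curves of a linear vector field over a fixed curve form a vector space. -/
theorem hasMFDerivAt_smul_add {c : ℝ → M} {a b : ∀ s, V (c s)} {t : ℝ}
    (ha : HasMFDerivAt 𝓘(ℝ, ℝ) IA (fun s => (⟨c s, a s⟩ : TotalSpace F V)) t
      ((1 : ℝ →L[ℝ] ℝ).smulRight (Ξ.vf ⟨c t, a t⟩)))
    (hb : HasMFDerivAt 𝓘(ℝ, ℝ) IA (fun s => (⟨c s, b s⟩ : TotalSpace F V)) t
      ((1 : ℝ →L[ℝ] ℝ).smulRight (Ξ.vf ⟨c t, b t⟩))) (r : ℝ) :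
    HasMFDerivAt 𝓘(ℝ, ℝ) IA (fun s => (⟨c s, r • a s + b s⟩ : TotalSpace F V)) t
      ((1 : ℝ →L[ℝ] ℝ).smulRight (Ξ.vf ⟨c t, r • a t + b t⟩)) := by
  have ha' := (Ξ.hasMFDerivAt_iff (γ := fun s => (⟨c s, a s⟩ : TotalSpace F V))).1 ha
  have hb' := (Ξ.hasMFDerivAt_iff (γ := fun s => (⟨c s, b s⟩ : TotalSpace F V))).1 hb
  refine (Ξ.hasMFDerivAt_iff (γ := fun s => (⟨c s, r • a s + b s⟩ : TotalSpace F V))).2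
    ⟨ha'.1, ?_⟩
  rw [Ξ.snd_add, Ξ.snd_smul]
  refine ((ha'.2.const_smul r).add hb'.2).congr_of_eventuallyEq ?_
  have hc : ContinuousAt c t := ha'.1.continuousAt
  filter_upwards [hc.preimage_mem_nhds ((trivializationAt F V (c t)).open_baseSet.mem_nhds
    (FiberBundle.mem_baseSet_trivializationAt' (c t)))] with s hs
  have hl := (trivializationAt F V (c t)).linear ℝ hs
  exact (hl.map_add _ _).trans (congrArg (· + _) (hl.map_smul _ _))

theorem proj_flow [T2Space (TotalSpace F V)] {t : ℝ} {p : TotalSpace F V}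
    (hp : p ∈ flowDomain Ξ.vf t) :
    p.proj ∈ flowDomain Ξ.base t ∧ (flow Ξ.vf t p).proj = flow Ξ.base t p.proj := by
  obtain ⟨a, b, h0, ht, -, hγ, hγ0⟩ := exists_isMIntegralCurveOn_flow Ξ.smooth_vf hp
  have h1 : IsMIntegralCurveOn (fun s => (flow Ξ.vf s p).proj) Ξ.base (Ioo a b) := fun s hs =>
    ((Ξ.hasMFDerivAt_iff (γ := fun s => flow Ξ.vf s p)).1
      ((hγ s hs).hasMFDerivAt (Ioo_mem_nhds hs.1 hs.2))).1.hasMFDerivWithinAt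
  have h2 := mem_flowDomain_of_Ioo h1 h0 ht
  have h3 := flow_eq_of_Ioo Ξ.smooth_base h1 h0 ht
  rw [hγ0] at h2 h3
  exact ⟨h2, h3.symm⟩

/-- Presents a flow line of `Ξ` as a family of vectors over the flow line of `x`, so that two flow
lines over the same base curve can be added. -/
theorem exists_curve [T2Space (TotalSpace F V)] {t : ℝ} {m : M} {a : V m}
    (hp : (⟨m, a⟩ : TotalSpace F V) ∈ flowDomain Ξ.vf t) :
    ∃ l u : ℝ, (0 : ℝ) ∈ Ioo l u ∧ t ∈ Ioo l u ∧ ∃ α : ∀ s, V (flow Ξ.base s m),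
      ∀ s ∈ Ioo l u, flow Ξ.vf s ⟨m, a⟩ = ⟨flow Ξ.base s m, α s⟩ ∧
        HasMFDerivAt 𝓘(ℝ, ℝ) IA (fun s => (⟨flow Ξ.base s m, α s⟩ : TotalSpace F V)) s
          ((1 : ℝ →L[ℝ] ℝ).smulRight (Ξ.vf ⟨flow Ξ.base s m, α s⟩)) := by
  obtain ⟨l, u, h0, ht, hd, hγ, hγ0⟩ := exists_isMIntegralCurveOn_flow Ξ.smooth_vf hp
  have h1 : ∀ s, ∃ α : V (flow Ξ.base s m), s ∈ Ioo l u →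
      flow Ξ.vf s ⟨m, a⟩ = ⟨flow Ξ.base s m, α⟩ := by
    intro s
    by_cases hs : s ∈ Ioo l u
    · have h2 := (Ξ.proj_flow (hd s hs)).2
      generalize flow Ξ.vf s ⟨m, a⟩ = q at h2
      obtain ⟨n, β⟩ := q
      change n = flow Ξ.base s m at h2
      subst h2
      exact ⟨β, fun _ => rfl⟩
    -- Outside the interval the value is arbitrary.
    · exact ⟨0, fun h => absurd h hs⟩
  choose α hα using h1
  refine ⟨l, u, h0, ht, α, fun s hs => ⟨hα s hs, ?_⟩⟩
  have h3 := (hγ s hs).hasMFDerivAt (Ioo_mem_nhds hs.1 hs.2)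
  have h4 : (fun s => (⟨flow Ξ.base s m, α s⟩ : TotalSpace F V)) =ᶠ[𝓝 s]
      fun s => flow Ξ.vf s ⟨m, a⟩ := by
    filter_upwards [Ioo_mem_nhds hs.1 hs.2] with s' hs'
    exact (hα s' hs').symm
  refine (h3.congr_of_eventuallyEq h4).congr_mfderiv ?_
  exact congrArg (fun q => ((1 : ℝ →L[ℝ] ℝ).smulRight (show E × F from Ξ.vf q) : ℝ →L[ℝ] E × F))
    (hα s hs)

/-- Superposition: on the common interval a linear combination of two flow lines over the same base
curve is again an integral curve, and uniqueness makes it the flow line of the combined initial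
value. -/
theorem flow_smul_add [T2Space (TotalSpace F V)] {t : ℝ} {m : M} {a b : V m}
    (ha : (⟨m, a⟩ : TotalSpace F V) ∈ flowDomain Ξ.vf t)
    (hb : (⟨m, b⟩ : TotalSpace F V) ∈ flowDomain Ξ.vf t) (r : ℝ) :
    (⟨m, r • a + b⟩ : TotalSpace F V) ∈ flowDomain Ξ.vf t ∧
      ∀ α β : V (flow Ξ.base t m), flow Ξ.vf t ⟨m, a⟩ = ⟨flow Ξ.base t m, α⟩ →
        flow Ξ.vf t ⟨m, b⟩ = ⟨flow Ξ.base t m, β⟩ →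
        flow Ξ.vf t ⟨m, r • a + b⟩ = ⟨flow Ξ.base t m, r • α + β⟩ := by
  obtain ⟨l, u, h0, ht, α, hα⟩ := Ξ.exists_curve ha
  obtain ⟨l', u', h0', ht', β, hβ⟩ := Ξ.exists_curve hb
  have hI : IsMIntegralCurveOn (fun s => (⟨flow Ξ.base s m, r • α s + β s⟩ : TotalSpace F V)) Ξ.vf
      (Ioo (max l l') (min u u')) := by
    intro s hs
    rw [← Ioo_inter_Ioo] at hs
    exact (Ξ.hasMFDerivAt_smul_add (hα s hs.1).2 (hβ s hs.2).2 r).hasMFDerivWithinAt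
  have h00 : (0 : ℝ) ∈ Ioo (max l l') (min u u') := by
    rw [← Ioo_inter_Ioo]; exact ⟨h0, h0'⟩
  have htt : t ∈ Ioo (max l l') (min u u') := by
    rw [← Ioo_inter_Ioo]; exact ⟨ht, ht'⟩
  have hstart : (⟨flow Ξ.base 0 m, r • α 0 + β 0⟩ : TotalSpace F V) = ⟨m, r • a + b⟩ := by
    have h1 := (hα 0 h0).1.symm.trans (flow_zero Ξ.smooth_vf _)
    have h2 := (hβ 0 h0').1.symm.trans (flow_zero Ξ.smooth_vf _)
    -- The types of `α 0` and `β 0` depend on the point `flow Ξ.base 0 m`, which can be replaced by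
    -- `m` only after these vectors have been generalized.
    revert h1 h2
    generalize α 0 = α₀
    generalize β 0 = β₀
    revert α₀ β₀
    rw [flow_zero Ξ.smooth_base m]
    intro α₀ β₀ h1 h2
    rw [eq_of_heq (TotalSpace.mk.inj h1).2, eq_of_heq (TotalSpace.mk.inj h2).2]
  have h1 := mem_flowDomain_of_Ioo hI h00 htt
  have h2 := flow_eq_of_Ioo Ξ.smooth_vf hI h00 htt
  rw [hstart] at h1 h2
  refine ⟨h1, fun α' β' h3 h4 => ?_⟩
  have h5 := (hα t ht).1.symm.trans h3
  have h6 := (hβ t ht').1.symm.trans h4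
  rw [h2, eq_of_heq (TotalSpace.mk.inj h5).2, eq_of_heq (TotalSpace.mk.inj h6).2]

theorem smul_mem_flowDomain [T2Space (TotalSpace F V)] {t : ℝ} {m : M} {a : V m}
    (ha : (⟨m, a⟩ : TotalSpace F V) ∈ flowDomain Ξ.vf t) (r : ℝ) :
    (⟨m, r • a⟩ : TotalSpace F V) ∈ flowDomain Ξ.vf t := by
  have h := (Ξ.flow_smul_add ha ha (r - 1)).1
  rwa [sub_smul, one_smul, sub_add_cancel] at h

/-- Near every point of the base the flow is defined on the fibres for a uniform time. -/
theorem exists_uniform_time [T2Space (TotalSpace F V)] (q : M) : ∃ ε > 0, ∃ O : Set M,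
    IsOpen O ∧ q ∈ O ∧ ∀ p : TotalSpace F V, p.proj ∈ O → ∀ u ∈ Ioo (-ε) ε, p ∈ flowDomain Ξ.vf u := by
  have h1 := (isOpen_flowDomain_prod Ξ.smooth_vf).mem_nhds
    (show ((0, ⟨q, 0⟩) : ℝ × TotalSpace F V).2 ∈ flowDomain Ξ.vf ((0, ⟨q, 0⟩) : ℝ × TotalSpace F V).1
      from mem_flowDomain_zero Ξ.smooth_vf _)
  rw [nhds_prod_eq, mem_prod_iff] at h1
  obtain ⟨I, hI, O, hO, h⟩ := h1
  obtain ⟨ε, hε, hIε⟩ := Metric.mem_nhds_iff.1 hI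
  obtain ⟨O', hO', hO'o, hqO'⟩ := mem_nhds_iff.1 hO
  have hz : Continuous (fun m : M => (⟨m, 0⟩ : TotalSpace F V)) :=
    (0 : ContMDiffSection IM F ∞ V).contMDiff.continuous
  refine ⟨ε, hε, _, hO'o.preimage hz, hqO', ?_⟩
  rintro ⟨m, a⟩ hm u hu
  have hline : ContinuousAt (fun t : ℝ => (⟨m, 0 + t • a⟩ : TotalSpace F V)) 0 :=
    (hasMFDerivAt_line (E := E) (F := F) m 0 a).continuousAt
  have h2 : ∀ᶠ r : ℝ in 𝓝 0, (⟨m, 0 + r • a⟩ : TotalSpace F V) ∈ O' :=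
    hline.preimage_mem_nhds (hO'o.mem_nhds (by simpa using hm))
  -- A vector of any size is shrunk by some `r ≠ 0` until it is close to the zero section, where the
  -- time is uniform; linearity then scales back by `r⁻¹`.
  obtain ⟨r, hr, hr0⟩ := ((h2.filter_mono nhdsWithin_le_nhds).and
    (self_mem_nhdsWithin : {0}ᶜ ∈ 𝓝[≠] (0 : ℝ))).exists
  rw [zero_add] at hr
  have h3 : (⟨m, r • a⟩ : TotalSpace F V) ∈ flowDomain Ξ.vf u :=
    h (mk_mem_prod (hIε (by simpa [abs_lt] using hu)) (hO' hr))
  have h4 := Ξ.smul_mem_flowDomain h3 r⁻¹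
  rwa [smul_smul, inv_mul_cancel₀ hr0, one_smul] at h4

/-- Linear equations do not blow up. Near each point of the base the flow exists on whole fibres for
a uniform time, so existence of the flow line of `p` propagates along the base curve, whose interval
is connected. -/
theorem flowDomain_vf [T2Space (TotalSpace F V)] (t : ℝ) :
    flowDomain Ξ.vf t = π F V ⁻¹' flowDomain Ξ.base t := by
  refine Subset.antisymm (fun p hp => (Ξ.proj_flow hp).1) fun p hp => ?_
  obtain ⟨l, u, h0, ht, -, hγ, hγ0⟩ := exists_isMIntegralCurveOn_flow Ξ.smooth_base hp
  have h := (isPreconnected_Ioo (a := l) (b := u)).induction₂'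
    (fun s s' => p ∈ flowDomain Ξ.vf s → p ∈ flowDomain Ξ.vf s') ?_
    (fun _ _ _ _ _ _ h1 h2 h3 => h2 (h1 h3)) h0 ht
  · exact h (mem_flowDomain_zero Ξ.smooth_vf p)
  · intro s hs
    obtain ⟨ε, hε, O, hO, hq, hstep⟩ := Ξ.exists_uniform_time (flow Ξ.base s p.proj)
    have hstep' : ∀ s₁ s₂, flow Ξ.base s₁ p.proj ∈ O → s₂ - s₁ ∈ Ioo (-ε) ε →
        p ∈ flowDomain Ξ.vf s₁ → p ∈ flowDomain Ξ.vf s₂ := by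
      intro s₁ s₂ h1 h2 h3
      have h4 := hstep (flow Ξ.vf s₁ p) (by rwa [(Ξ.proj_flow h3).2]) _ h2
      have h5 := (flow_add Ξ.smooth_vf h3 h4).1
      rwa [add_sub_cancel] at h5
    have hc : ContinuousAt (fun s' => flow Ξ.base s' p.proj) s :=
      ((hγ s hs).hasMFDerivAt (Ioo_mem_nhds hs.1 hs.2)).continuousAt
    refine Eventually.filter_mono nhdsWithin_le_nhds ?_
    filter_upwards [hc.preimage_mem_nhds (hO.mem_nhds hq),
      Ioo_mem_nhds (show s - ε < s by linarith) (show s < s + ε by linarith)] with s' h1 h2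
    exact ⟨hstep' s s' hq ⟨by linarith [h2.1], by linarith [h2.2]⟩,
      hstep' s' s h1 ⟨by linarith [h2.2], by linarith [h2.1]⟩⟩

/-- The flow of a linear vector field is fibrewise linear. -/
theorem exists_flow_linear [T2Space (TotalSpace F V)] (t : ℝ) (m : M) :
    ∃ Λ : V m →ₗ[ℝ] V (flow Ξ.base t m), m ∈ flowDomain Ξ.base t →
      ∀ a : V m, flow Ξ.vf t ⟨m, a⟩ = ⟨flow Ξ.base t m, Λ a⟩ := by
  by_cases hm : m ∈ flowDomain Ξ.base t
  · have hd : ∀ a : V m, (⟨m, a⟩ : TotalSpace F V) ∈ flowDomain Ξ.vf t := fun a => by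
      rw [Ξ.flowDomain_vf]; exact hm
    have hex : ∀ a : V m, ∃ α : V (flow Ξ.base t m), flow Ξ.vf t ⟨m, a⟩ = ⟨flow Ξ.base t m, α⟩ := by
      intro a
      obtain ⟨l, u, -, ht, α, hα⟩ := Ξ.exists_curve (hd a)
      exact ⟨α t, (hα t ht).1⟩
    choose Λ hΛ using hex
    have hlin : ∀ (r : ℝ) (a b : V m), Λ (r • a + b) = r • Λ a + Λ b := fun r a b =>
      eq_of_heq (TotalSpace.mk.inj ((hΛ _).symm.trans
        ((Ξ.flow_smul_add (hd a) (hd b) r).2 _ _ (hΛ a) (hΛ b)))).2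
    have h0 : Λ 0 = 0 := by
      have h := hlin 1 0 0
      rw [one_smul, one_smul, add_zero] at h
      exact left_eq_add.1 h
    refine ⟨⟨⟨Λ, fun a b => ?_⟩, fun r a => ?_⟩, fun _ a => hΛ a⟩
    · have h := hlin 1 a b
      rwa [one_smul, one_smul] at h
    · have h := hlin r a 0
      rwa [add_zero, h0, add_zero] at h
  · exact ⟨0, fun h => absurd h hm⟩

end LinearVectorField

end Algebroid

end LieAlgebroidTheory

end

noncomputable section

namespace LieAlgebroidTheory

/-! ### Uniqueness for linear systems, and mixed derivatives in time and space -/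

section MixedDerivative

set_option linter.unusedSectionVars false

/-- Uniqueness for a family `S` of functions with `(S i)' = S (T i)` which locally is governed by a
finite linear system. -/
theorem eq_zero_of_linear_system {ι : Type*} {S : ι → ℝ → ℝ} {T : ι → ι} {l u : ℝ}
    (hS : ∀ i, ∀ k ∈ Ioo l u, HasDerivAt (S i) (S (T i) k) k)
    (hloc : ∀ k₀ ∈ Ioo l u, ∃ (n : ℕ) (y : Fin n → ι) (c : Fin n → Fin n → ℝ → ℝ),
      (∀ a b, ContinuousAt (c a b) k₀) ∧ ∀ᶠ k in 𝓝 k₀,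
        (∀ a, S (T (y a)) k = ∑ b, c a b k * S (y b) k) ∧ ((∀ b, S (y b) k = 0) → ∀ i, S i k = 0))
    {k₁ : ℝ} (hk₁ : k₁ ∈ Ioo l u) (hz : ∀ i, S i k₁ = 0) {k₂ : ℝ} (hk₂ : k₂ ∈ Ioo l u) (i : ι) :
    S i k₂ = 0 := by
  have h := (isPreconnected_Ioo (a := l) (b := u)).induction₂'
    (fun s s' => (∀ i, S i s = 0) → ∀ i, S i s' = 0) ?_
    (fun _ _ _ _ _ _ h1 h2 h3 => h2 (h1 h3)) hk₁ hk₂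
  · exact h hz i
  intro k₀ hk₀
  obtain ⟨n, y, c, hc, hev⟩ := hloc k₀ hk₀
  -- By continuity `K` bounds all coefficients near `k₀`, thanks to the added `1`. The system then
  -- has Lipschitz constant `n * K` for the supremum norm, and its solution is compared with the
  -- zero solution.
  let K : ℝ := ∑ a, ∑ b, (|c a b k₀| + 1)
  have hK : ∀ a b, |c a b k₀| + 1 ≤ K := fun a b =>
    (Finset.single_le_sum (f := fun b => |c a b k₀| + 1) (fun _ _ => by positivity)
      (Finset.mem_univ b)).trans
    (Finset.single_le_sum (f := fun a => ∑ b, (|c a b k₀| + 1))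
      (fun _ _ => Finset.sum_nonneg fun _ _ => by positivity) (Finset.mem_univ a))
  have hK0 : 0 ≤ K := Finset.sum_nonneg fun _ _ => Finset.sum_nonneg fun _ _ => by positivity
  have hbd : ∀ᶠ k in 𝓝 k₀, ∀ a b, |c a b k| ≤ K := by
    refine eventually_all.2 fun a => eventually_all.2 fun b => ?_
    filter_upwards [(hc a b).abs.eventually_lt_const (show |c a b k₀| < |c a b k₀| + 1 by linarith)]
      with k hk using hk.le.trans (hK a b)
  obtain ⟨ε, hε, hball⟩ := Metric.eventually_nhds_iff_ball.1
    ((hev.and hbd).and (Ioo_mem_nhds hk₀.1 hk₀.2))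
  rw [Real.ball_eq_Ioo] at hball
  have key : ∀ s ∈ Ioo (k₀ - ε) (k₀ + ε), ∀ s' ∈ Ioo (k₀ - ε) (k₀ + ε),
      (∀ i, S i s = 0) → ∀ i, S i s' = 0 := by
    intro s hs s' hs' h0
    refine (hball s' hs').1.1.2 ?_
    have h1 := ODE_solution_unique_of_mem_Ioo (v := fun k (x : Fin n → ℝ) a => ∑ b, c a b k * x b)
      (s := fun _ => univ) (K := Real.toNNReal (n * K)) (a := k₀ - ε) (b := k₀ + ε)
      (f := fun k a => S (y a) k) (g := fun _ _ => 0) (t₀ := s) ?_ hs ?_ ?_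
      (funext fun a => h0 (y a)) hs'
    · exact fun b => congrFun h1 b
    · intro k hk
      refine (LipschitzWith.of_dist_le_mul fun x x' => ?_).lipschitzOnWith
      rw [Real.coe_toNNReal _ (by positivity), dist_pi_le_iff (by positivity)]
      intro a
      rw [Real.dist_eq, ← Finset.sum_sub_distrib]
      refine (Finset.abs_sum_le_sum_abs _ _).trans ?_
      have h2 : ∀ b ∈ Finset.univ, |c a b k * x b - c a b k * x' b| ≤ K * dist x x' := fun b _ => by
        rw [← mul_sub, abs_mul, ← Real.dist_eq]
        exact mul_le_mul ((hball k hk).1.2 a b) (dist_le_pi_dist x x' b) dist_nonneg hK0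
      refine (Finset.sum_le_sum h2).trans ?_
      rw [Finset.sum_const, Finset.card_univ, Fintype.card_fin, nsmul_eq_mul, mul_assoc]
    · intro k hk
      refine ⟨hasDerivAt_pi.2 fun a => ?_, mem_univ _⟩
      rw [← (hball k hk).1.1.1 a]
      exact hS (y a) k (hball k hk).2
    · intro k hk
      refine ⟨?_, mem_univ _⟩
      refine (hasDerivAt_const k (fun _ : Fin n => (0 : ℝ))).congr_deriv (funext fun a => ?_)
      simp
  refine Eventually.filter_mono nhdsWithin_le_nhds ?_
  filter_upwards [Ioo_mem_nhds (show k₀ - ε < k₀ by linarith) (show k₀ < k₀ + ε by linarith)]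
    with k hk
  have hm : k₀ ∈ Ioo (k₀ - ε) (k₀ + ε) := ⟨by linarith, by linarith⟩
  exact ⟨key _ hm _ hk, key _ hk _ hm⟩

variable {E' H' N : Type*} [NormedAddCommGroup E'] [NormedSpace ℝ E'] [TopologicalSpace H']
  {J : ModelWithCorners ℝ E' H'} [TopologicalSpace N] [ChartedSpace H' N] [IsManifold J ∞ N]
  [J.Boundaryless]

/-- The symmetry of the mixed derivatives of a function of a real parameter and of a point of a
manifold. -/
theorem hasDerivAt_derivAlong {W : ℝ × N → ℝ} {k₀ : ℝ} {p : N}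
    (hW : ContMDiffAt (𝓘(ℝ, ℝ).prod J) 𝓘(ℝ, ℝ) ∞ W (k₀, p)) (v : E') :
    HasDerivAt (fun k => derivAlong (fun q => W (k, q)) (⟨p, v⟩ : TangentBundle J N))
      (derivAlong (fun q => deriv (fun k => W (k, q)) k₀) (⟨p, v⟩ : TangentBundle J N)) k₀ := by
  let c := extChartAt J p
  let Ŵ : ℝ × E' → ℝ := fun z => W (z.1, c.symm z.2)
  have hcs : ContMDiffAt 𝓘(ℝ, E') J ∞ c.symm (c p) :=
    (contMDiffOn_extChartAt_symm p).contMDiffAt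
      ((isOpen_extChartAt_target p).mem_nhds (mem_extChartAt_target p))
  have hcp : c.symm (c p) = p := extChartAt_to_inv p
  have hsm : ContDiffAt ℝ ∞ Ŵ (k₀, c p) := by
    have h1 : ContMDiffAt 𝓘(ℝ, ℝ × E') 𝓘(ℝ, ℝ) ∞ (Prod.fst : ℝ × E' → ℝ) (k₀, c p) :=
      contDiff_fst.contMDiff _
    have h2 : ContMDiffAt 𝓘(ℝ, ℝ × E') 𝓘(ℝ, E') ∞ (Prod.snd : ℝ × E' → E') (k₀, c p) :=
      contDiff_snd.contMDiff _
    have h3 : ContMDiffAt 𝓘(ℝ, ℝ × E') J ∞ (fun z : ℝ × E' => c.symm z.2) (k₀, c p) :=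
      ContMDiffAt.comp (k₀, c p) (g := c.symm) hcs h2
    have h4 := h1.prodMk h3
    refine (ContMDiffAt.comp (k₀, c p) (g := W) ?_ h4).contDiffAt
    rw [hcp]
    exact hW
  have hsm2 : ContDiffAt ℝ 2 Ŵ (k₀, c p) := hsm.of_le (WithTop.coe_le_coe.2 (le_top : (2:ℕ∞) ≤ ⊤))
  have hev : ∀ᶠ z in 𝓝 (k₀, c p), DifferentiableAt ℝ Ŵ z :=
    (hsm2.eventually (by simp)).mono fun z hz => hz.differentiableAt (by simp)
  have hd2 : DifferentiableAt ℝ (fderiv ℝ Ŵ) (k₀, c p) :=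
    (hsm2.fderiv_right (m := 1) (by norm_num)).differentiableAt (by simp)
  have hWc : ∀ k, ∀ q ∈ c.source, W (k, q) = Ŵ (k, c q) := fun k q hq =>
    congrArg (fun q => W (k, q)) (c.left_inv hq).symm
  have hA : (fun k => derivAlong (fun q => W (k, q)) (⟨p, v⟩ : TangentBundle J N)) =ᶠ[𝓝 k₀]
      fun k => fderiv ℝ Ŵ (k, c p) (0, v) := by
    have hc : ContinuousAt (fun k : ℝ => (k, c p)) k₀ := by fun_prop
    filter_upwards [hc.eventually hev] with k hk
    have h1 : (fun q => W (k, q)) =ᶠ[𝓝 p] fun q => (fun y => Ŵ (k, y)) (c q) := by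
      filter_upwards [extChartAt_source_mem_nhds (I := J) p] with q hq using hWc k q hq
    have h2 : HasFDerivAt (fun y => Ŵ (k, y))
        ((fderiv ℝ Ŵ (k, c p)).comp (ContinuousLinearMap.inr ℝ ℝ E')) (c p) :=
      HasFDerivAt.comp (c p) hk.hasFDerivAt (hasFDerivAt_prodMk_right k (c p))
    rw [derivAlong_congr (z := (⟨p, v⟩ : TangentBundle J N)) h1,
      derivAlong_comp_extChartAt_self p (h := fun y => Ŵ (k, y)) h2.differentiableAt v, h2.fderiv]
    rfl
  have hB : HasDerivAt (fun k => fderiv ℝ Ŵ (k, c p) (0, v))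
      (fderiv ℝ (fderiv ℝ Ŵ) (k₀, c p) (1, 0) (0, v)) k₀ := by
    have h1 : HasDerivAt (fun k => (k, c p)) ((1 : ℝ), (0 : E')) k₀ :=
      (hasDerivAt_id k₀).prodMk (hasDerivAt_const k₀ (c p))
    have h2 : HasDerivAt (fun k => fderiv ℝ Ŵ (k, c p)) _ k₀ :=
      hd2.hasFDerivAt.comp_hasDerivAt k₀ h1
    simpa using h2.clm_apply (hasDerivAt_const k₀ ((0 : ℝ), v))
  have hC : derivAlong (fun q => deriv (fun k => W (k, q)) k₀) (⟨p, v⟩ : TangentBundle J N) =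
      fderiv ℝ (fderiv ℝ Ŵ) (k₀, c p) (0, v) (1, 0) := by
    have h1 : (fun q => deriv (fun k => W (k, q)) k₀) =ᶠ[𝓝 p]
        fun q => (fun y => fderiv ℝ Ŵ (k₀, y) (1, 0)) (c q) := by
      have hc : ContinuousAt (fun q : N => (k₀, c q)) p :=
        continuousAt_const.prodMk (continuousAt_extChartAt p)
      filter_upwards [hc.eventually hev, extChartAt_source_mem_nhds (I := J) p] with q h1 h2
      have h3 : (fun k => W (k, q)) = fun k => Ŵ (k, c q) := funext fun k => hWc k q h2
      rw [h3]
      have h4 : HasDerivAt (fun k => (k, c q)) ((1 : ℝ), (0 : E')) k₀ :=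
        (hasDerivAt_id k₀).prodMk (hasDerivAt_const k₀ (c q))
      exact (h1.hasFDerivAt.comp_hasDerivAt k₀ h4).deriv
    have h2 : HasFDerivAt (fun y => fderiv ℝ Ŵ (k₀, y))
        ((fderiv ℝ (fderiv ℝ Ŵ) (k₀, c p)).comp (ContinuousLinearMap.inr ℝ ℝ E')) (c p) :=
      HasFDerivAt.comp (c p) hd2.hasFDerivAt (hasFDerivAt_prodMk_right k₀ (c p))
    have h3 := h2.clm_apply (hasFDerivAt_const ((1 : ℝ), (0 : E')) (c p))
    rw [derivAlong_congr (z := (⟨p, v⟩ : TangentBundle J N)) h1,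
      derivAlong_comp_extChartAt_self p (h := fun y => fderiv ℝ Ŵ (k₀, y) (1, 0))
        h3.differentiableAt v, h3.fderiv]
    simp
  -- The two orders of differentiation are the two orders of the arguments of the second derivative
  -- in the chart.
  rw [hC, hsm2.isSymmSndFDerivAt (by simp) (0, v) (1, 0)]
  exact hB.congr_of_eventuallyEq hA

variable [T2Space N] [FiniteDimensional ℝ E'] {y : ∀ p : N, TangentSpace J p}

theorem hasDerivAt_comp_flow (hy : ContMDiff J J.tangent ∞ (fun p => (⟨p, y p⟩ : TangentBundle J N)))
    {g : N → ℝ} (hg : MDifferentiable J 𝓘(ℝ, ℝ) g) {t : ℝ} {p : N} (hp : p ∈ flowDomain y t) :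
    HasDerivAt (fun s => g (flow y s p))
      (derivAlong g (⟨flow y t p, y (flow y t p)⟩ : TangentBundle J N)) t := by
  have h := (hg (flow y t p)).hasMFDerivAt.comp t (hasMFDerivAt_flow hy hp)
  let A : E' →L[ℝ] ℝ := mfderiv J 𝓘(ℝ, ℝ) g (flow y t p)
  let B : ℝ →L[ℝ] E' := (1 : ℝ →L[ℝ] ℝ).smulRight (y (flow y t p))
  have h' : HasFDerivAt (fun s => g (flow y s p)) (A.comp B) t := hasMFDerivAt_iff_hasFDerivAt.1 h
  have h2 : B 1 = y (flow y t p) := one_smul ℝ (y (flow y t p) : E')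
  exact h'.hasDerivAt.congr_deriv (congrArg A h2)

/-- The derivative in the time `k` of the derivative along `v` of `g ∘ f_k ∘ s`, for the flow `f_k` of
a vector field. -/
theorem hasDerivAt_derivAlong_flow
    (hy : ContMDiff J J.tangent ∞ (fun p => (⟨p, y p⟩ : TangentBundle J N)))
    {g : N → ℝ} (hg : ContMDiff J 𝓘(ℝ, ℝ) ∞ g)
    {E₂ H₂ N₂ : Type*} [NormedAddCommGroup E₂] [NormedSpace ℝ E₂]
    [TopologicalSpace H₂] {J₂ : ModelWithCorners ℝ E₂ H₂} [TopologicalSpace N₂] [ChartedSpace H₂ N₂]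
    [IsManifold J₂ ∞ N₂] [J₂.Boundaryless] {s : N₂ → N} (hs : ContMDiff J₂ J ∞ s) {t : ℝ} {q : N₂}
    (hq : s q ∈ flowDomain y t) (v : TangentSpace J₂ q) :
    HasDerivAt (fun k => derivAlong (fun q' => g (flow y k (s q'))) (⟨q, v⟩ : TangentBundle J₂ N₂))
      (derivAlong (fun q' => derivAlong g
        (⟨flow y t (s q'), y (flow y t (s q'))⟩ : TangentBundle J N)) (⟨q, v⟩ : TangentBundle J₂ N₂))
      t := by
  have h1 : ContMDiffAt (𝓘(ℝ, ℝ).prod J₂) 𝓘(ℝ, ℝ) ∞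
      (fun z : ℝ × N₂ => g (flow y z.1 (s z.2))) (t, q) := by
    have h2 : ContMDiffAt (𝓘(ℝ, ℝ).prod J₂) (𝓘(ℝ, ℝ).prod J) ∞
        (fun z : ℝ × N₂ => (z.1, s z.2)) (t, q) :=
      contMDiffAt_fst.prodMk ((hs q).comp (t, q) contMDiffAt_snd)
    have h3 := ContMDiffAt.comp (t, q) (g := fun z : ℝ × N => flow y z.1 z.2)
      (contMDiffAt_flow hy hq) h2
    exact ContMDiffAt.comp (t, q) (g := g) (hg _) h3
  refine (hasDerivAt_derivAlong h1 v).congr_deriv (derivAlong_congr ?_)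
  have h2 : ∀ᶠ q' in 𝓝 q, s q' ∈ flowDomain y t :=
    hs.continuous.continuousAt.preimage_mem_nhds ((isOpen_flowDomain hy t).mem_nhds hq)
  filter_upwards [h2] with q' hq'
  exact (hasDerivAt_comp_flow hy (hg.mdifferentiable (by simp)) hq').deriv

end MixedDerivative

end LieAlgebroidTheory

end

noncomputable section

namespace LieAlgebroidTheory

/-! ### The adjoint operator on dual sections, and the flow against the anchor -/

section Algebroid

set_option linter.unusedSectionVars false

variable {E : Type*} [NormedAddCommGroup E] [NormedSpace ℝ E]
  {M : Type*} [TopologicalSpace M] [ChartedSpace E M]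
  {F : Type*} [NormedAddCommGroup F] [NormedSpace ℝ F]
  {V : M → Type*} [TopologicalSpace (TotalSpace F V)] [∀ m, AddCommGroup (V m)]
  [∀ m, Module ℝ (V m)] [∀ m, TopologicalSpace (V m)] [FiberBundle F V] [VectorBundle ℝ F V]

local notation "IM" => modelWithCornersSelf ℝ E
local notation "IA" => ModelWithCorners.prod (modelWithCornersSelf ℝ E) (modelWithCornersSelf ℝ F)
local notation "IAd" =>
  ModelWithCorners.prod (modelWithCornersSelf ℝ E) (modelWithCornersSelf ℝ (F →L[ℝ] ℝ))
local notation "TM" => TangentBundle (modelWithCornersSelf ℝ E) M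
local notation "TA" => TangentBundle
  (ModelWithCorners.prod (modelWithCornersSelf ℝ E) (modelWithCornersSelf ℝ F)) (TotalSpace F V)
local notation "Ad" => TotalSpace (F →L[ℝ] ℝ) (fun m : M => V m →L[ℝ] ℝ)
local notation "ΓA" => ContMDiffSection (modelWithCornersSelf ℝ E) F ∞ V
local notation "ΓAd" => ContMDiffSection (modelWithCornersSelf ℝ E) (F →L[ℝ] ℝ) ∞
  (fun m : M => V m →L[ℝ] ℝ)

variable [IsManifold 𝓘(ℝ, E) ∞ M] [ContMDiffVectorBundle ∞ F V 𝓘(ℝ, E)] [T2Space M]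
  [FiniteDimensional ℝ E] [FiniteDimensional ℝ F]

namespace LinearVectorField

variable (Ξ : LinearVectorField E F V)

/-- The derivative along `Ξ` of a fibrewise linear function is fibrewise linear. -/
theorem exists_adjoint (φ : ΓAd) : ∃ ψ : ΓAd, ∀ p : TotalSpace F V,
    derivAlong (linearFunction φ) (⟨p, Ξ.vf p⟩ : TA) = linearFunction ψ p := by
  have hlin : ∀ (m : M) (a : V m), derivAlong (linearFunction φ) (⟨⟨m, a⟩, Ξ.vf ⟨m, a⟩⟩ : TA) =
      derivPairing φ (⟨m, Ξ.base m⟩ : TM) (Ξ.fiberMap m a) := fun m a =>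
    (derivPairing_apply φ (⟨m, Ξ.base m⟩ : TM) (Ξ.fiberMap m a)).symm
  have hψ : ∃ ψ : ΓAd, ∀ (X : ΓA) (m : M), ψ m (X m) =
      derivPairing φ (⟨m, Ξ.base m⟩ : TM) (Ξ.fiberMap m (X m)) := by
    refine exists_dual_of_tensorial (E := E) (F := F) (V := V)
      (Q := fun X m => derivPairing φ (⟨m, Ξ.base m⟩ : TM) (Ξ.fiberMap m (X m))) (fun X => ?_)
      (fun X Y m => ?_) (fun f hf X m => ?_)
    · simp only [Ξ.derivPairing_fiberMap]
      exact (Ξ.contMDiff_base_derivAlong (contMDiff_pairing φ X)).sub (contMDiff_pairing φ _)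
    · have h : Ξ.fiberMap m ((X + Y) m) = Ξ.fiberMap m (X m) + Ξ.fiberMap m (Y m) :=
        (Ξ.fiberMap m).map_add _ _
      rw [h, _root_.map_add]
    · have h : Ξ.fiberMap m (smulSection f hf X m) = f m • Ξ.fiberMap m (X m) :=
        (Ξ.fiberMap m).map_smul _ _
      rw [h, _root_.map_smul, smul_eq_mul]
  obtain ⟨ψ, hψ⟩ := hψ
  refine ⟨ψ, fun ⟨m, a⟩ => ?_⟩
  obtain ⟨X, rfl⟩ := exists_section (E := E) (F := F) m a
  exact (hlin m (X m)).trans (hψ X m).symm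

/-- The operator on sections of the dual bundle that is adjoint to `-D_Ξ`. -/
def adjoint (φ : ΓAd) : ΓAd := (Ξ.exists_adjoint φ).choose

theorem derivAlong_linearFunction (φ : ΓAd) (p : TotalSpace F V) :
    derivAlong (linearFunction φ) (⟨p, Ξ.vf p⟩ : TA) = linearFunction (Ξ.adjoint φ) p :=
  (Ξ.exists_adjoint φ).choose_spec p

theorem adjoint_apply (φ : ΓAd) (X : ΓA) (m : M) : Ξ.adjoint φ m (X m) =
    derivAlong (fun m => φ m (X m)) (⟨m, Ξ.base m⟩ : TM) - φ m (Ξ.operator X m) := by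
  rw [Ξ.apply_operator, sub_sub_cancel]
  exact (Ξ.derivAlong_linearFunction φ ⟨m, X m⟩).symm

end LinearVectorField

namespace LieAlgebroid

variable (L : LieAlgebroid E F V) (Ξ : LinearVectorField E F V)

/-- The failure of the flow to commute with the anchor, tested on a function `h`. -/
def anchorDefect (p : TotalSpace F V) (h : M → ℝ) (k : ℝ) : ℝ :=
  derivAlong h (L.anchorMap (flow Ξ.vf k p)) -
    derivAlong (fun m' => h (flow Ξ.base k m')) (L.anchorMap p)

theorem hasDerivAt_anchorDefect [T2Space (TotalSpace F V)] {p : TotalSpace F V} {k : ℝ}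
    (hp : p ∈ flowDomain Ξ.vf k) {h : M → ℝ} (hh : ContMDiff IM 𝓘(ℝ, ℝ) ∞ h) :
    HasDerivAt (L.anchorDefect Ξ p h)
      (derivAlong (linearFunction (L.coAnchor h hh)) (⟨flow Ξ.vf k p, Ξ.vf (flow Ξ.vf k p)⟩ : TA) -
        derivAlong (fun m' => derivAlong h
          (⟨flow Ξ.base k m', Ξ.base (flow Ξ.base k m')⟩ : TM)) (L.anchorMap p)) k :=
  (hasDerivAt_comp_flow Ξ.smooth_vf (mdifferentiable_linearFunction (L.coAnchor h hh)) hp).sub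
    (hasDerivAt_derivAlong_flow Ξ.smooth_base hh (s := fun m' : M => m') contMDiff_id
      (Ξ.proj_flow hp).1 (L.anchor p.proj p.snd))

/-- The defect is the derivative of `h` along a single vector `w`, the difference of the two sides
of the anchor condition. Finitely many functions `h` therefore decide whether it vanishes. -/
theorem exists_anchorDefect_eq [T2Space (TotalSpace F V)] {p : TotalSpace F V} {k : ℝ}
    (hp : p ∈ flowDomain Ξ.vf k) : ∃ w : TangentSpace IM (flow Ξ.base k p.proj),
      (∀ h : M → ℝ, ContMDiff IM 𝓘(ℝ, ℝ) ∞ h → L.anchorDefect Ξ p h k =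
        derivAlong h (⟨flow Ξ.base k p.proj, w⟩ : TM)) ∧
      (w = 0 → L.anchorMap (flow Ξ.vf k p) = tangentMap IM IM (flow Ξ.base k) (L.anchorMap p)) := by
  obtain ⟨m, a⟩ := p
  have hm := (Ξ.proj_flow hp).1
  obtain ⟨Λ, hΛ⟩ := Ξ.exists_flow_linear k m
  refine ⟨L.anchor _ (Λ a) - mfderiv IM IM (flow Ξ.base k) m (L.anchor m a), fun h hh => ?_,
    fun hw => ?_⟩
  · unfold anchorDefect
    rw [hΛ hm a, derivAlong_mk_sub]
    refine congrArg₂ (· - ·) rfl ?_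
    exact derivAlong_comp (J₂ := IM) (z := L.anchorMap ⟨m, a⟩) (h := h) (k := flow Ξ.base k)
      (hh.mdifferentiable (by simp) _)
      ((contMDiffAt_flow_time Ξ.smooth_base hm).mdifferentiableAt (by simp))
  · rw [hΛ hm a]
    exact congrArg (fun w => (⟨flow Ξ.base k m, w⟩ : TM)) (sub_eq_zero.1 hw)

theorem anchorDefect_zero [T2Space (TotalSpace F V)] (p : TotalSpace F V) (h : M → ℝ) :
    L.anchorDefect Ξ p h 0 = 0 := by
  unfold anchorDefect
  rw [flow_zero Ξ.smooth_vf]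
  simp only [flow_zero Ξ.smooth_base, sub_self]

variable {L Ξ}

/-- If `D_Ξ` is compatible with the anchor, then so is the flow of `Ξ`. -/
theorem AnchorCompatible.anchorMap_flow [T2Space (TotalSpace F V)] (hA : L.AnchorCompatible Ξ) {t : ℝ}
    {p : TotalSpace F V} (hp : p ∈ flowDomain Ξ.vf t) :
    L.anchorMap (flow Ξ.vf t p) = tangentMap IM IM (flow Ξ.base t) (L.anchorMap p) := by
  have : IsManifold IM 1 M := IsManifold.of_le (n := ∞) (by simp)
  obtain ⟨l, u, h0, ht, hd, -, -⟩ := exists_isMIntegralCurveOn_flow Ξ.smooth_vf hp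
  obtain ⟨w, hw, hw0⟩ := L.exists_anchorDefect_eq Ξ hp
  refine hw0 (tangent_ext fun h hh => ?_)
  rw [← hw h hh]
  refine Eq.trans ?_ (mfderiv IM 𝓘(ℝ, ℝ) h (flow Ξ.base t p.proj)).map_zero.symm
  -- By compatibility the time derivative of the defect of `h` is the defect of `x(h)`, a linear
  -- system indexed by all smooth functions.
  refine eq_zero_of_linear_system (ι := {h : M → ℝ // ContMDiff IM 𝓘(ℝ, ℝ) ∞ h})
    (S := fun h k => L.anchorDefect Ξ p h.1 k)
    (T := fun h => ⟨_, Ξ.contMDiff_base_derivAlong h.2⟩) (fun h k hk => ?_) (fun k₀ hk₀ => ?_) h0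
    (fun h => L.anchorDefect_zero Ξ p h.1) ht ⟨h, hh⟩
  · have h1 := L.hasDerivAt_anchorDefect Ξ (hd k hk) h.2
    rwa [hA.derivAlong_linearFunction h.2] at h1
  · let n₀ := flow Ξ.base k₀ p.proj
    let b := Module.finBasis ℝ E
    let c := fun a => LinearMap.toContinuousLinearMap (b.coord a)
    have hy : ∀ a, ∃ y : M → ℝ, ContMDiff IM 𝓘(ℝ, ℝ) ∞ y ∧
        y =ᶠ[𝓝 n₀] fun η => c a (extChartAt IM n₀ η) := fun a =>
      exists_contMDiff_eventuallyEq (J := IM) (chartAt E n₀).open_source (mem_chart_source E n₀)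
        ((c a).contMDiff.comp_contMDiffOn (contMDiffOn_extChartAt (I := IM) (n := ∞) (x := n₀)))
    choose y hys hye using hy
    -- Near a given time the system closes up on the chart coordinates, because the differential of
    -- `x(yₐ)` is a combination of the differentials of the coordinates.
    choose g hgd hg _ using fun a => exists_coordinate_expansion (J := IM)
      (Ξ.contMDiff_base_derivAlong (hys a)) n₀ b c (fun a w => rfl) hye
    have hcurve : ContinuousAt (fun k => flow Ξ.base k p.proj) k₀ :=
      (hasMFDerivAt_flow Ξ.smooth_base (Ξ.proj_flow (hd k₀ hk₀)).1).continuousAt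
    refine ⟨_, fun a => ⟨y a, hys a⟩, fun a a' k => g a a' (flow Ξ.base k p.proj),
      fun a a' => ContinuousAt.comp (f := fun k => flow Ξ.base k p.proj) (hgd a a').continuousAt hcurve,
      ?_⟩
    filter_upwards [Ioo_mem_nhds hk₀.1 hk₀.2, hcurve.eventually (eventually_all.2 hg),
      hcurve.eventually (extChartAt_source_mem_nhds (I := IM) n₀),
      hcurve.eventually ((eventually_all.2 hye).eventually_nhds)] with k hk hgk hsrc hyk
    obtain ⟨w, hw, -⟩ := L.exists_anchorDefect_eq Ξ (hd k hk)
    refine ⟨fun a => ?_, fun hz h => ?_⟩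
    · rw [hw _ (Ξ.contMDiff_base_derivAlong (hys a)), hgk a w]
      exact Finset.sum_congr rfl fun a' _ => by rw [hw _ (hys a')]
    · have h1 : ∀ a, c a (mfderiv IM 𝓘(ℝ, E) (extChartAt IM n₀) (flow Ξ.base k p.proj) w) = 0 := by
        intro a
        have h2 : y a =ᶠ[𝓝 (flow Ξ.base k p.proj)] fun η => c a (extChartAt IM n₀ η) :=
          hyk.mono fun _ h => h a
        have h3 := hz a
        rw [hw _ (hys a), derivAlong_congr (z := (⟨flow Ξ.base k p.proj, w⟩ : TM)) h2] at h3
        have h4 := derivAlong_comp_extChartAt n₀ (z := (⟨flow Ξ.base k p.proj, w⟩ : TM)) hsrc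
          (c a).differentiableAt
        rw [(c a).fderiv] at h4
        exact h4.symm.trans h3
      have h5 : mfderiv IM 𝓘(ℝ, E) (extChartAt IM n₀) (flow Ξ.base k p.proj) w = (0 : E) :=
        b.ext_elem fun a => (h1 a).trans (by simp)
      have h6 := (isInvertible_mfderiv_extChartAt (I := IM) hsrc).injective
      have h7 : w = 0 := h6 (h5.trans (map_zero _).symm)
      rw [hw _ h.2, h7]
      exact (mfderiv IM 𝓘(ℝ, ℝ) h.1 (flow Ξ.base k p.proj)).map_zero

/-- The defect vanishes near the time `0`, hence so does its derivative there, which expresses the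
compatibility. -/
theorem anchorCompatible_of_flow [T2Space (TotalSpace F V)]
    (hF : ∀ (t : ℝ) (p : TotalSpace F V), p ∈ flowDomain Ξ.vf t →
      L.anchorMap (flow Ξ.vf t p) = tangentMap IM IM (flow Ξ.base t) (L.anchorMap p)) :
    L.AnchorCompatible Ξ := by
  intro f hf X m
  have hp := mem_flowDomain_zero Ξ.smooth_vf (⟨m, X m⟩ : TotalSpace F V)
  have h1 := L.hasDerivAt_anchorDefect Ξ hp hf
  obtain ⟨l, u, h0, -, hd, -, -⟩ := exists_isMIntegralCurveOn_flow Ξ.smooth_vf hp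
  have h2 : L.anchorDefect Ξ ⟨m, X m⟩ f =ᶠ[𝓝 0] fun _ => 0 := by
    filter_upwards [Ioo_mem_nhds h0.1 h0.2] with k hk
    unfold anchorDefect
    rw [hF k _ (hd k hk)]
    refine sub_eq_zero.2 (Eq.symm ?_)
    exact derivAlong_comp (J₂ := IM) (z := L.anchorMap ⟨m, X m⟩) (h := f) (k := flow Ξ.base k)
      (hf.mdifferentiable (by simp) _)
      ((contMDiffAt_flow_time Ξ.smooth_base (Ξ.proj_flow (hd k hk)).1).mdifferentiableAt (by simp))
  have h3 := h1.unique ((hasDerivAt_const (0 : ℝ) (0 : ℝ)).congr_of_eventuallyEq h2)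
  rw [flow_zero Ξ.smooth_vf] at h3
  have h5 : (fun m' => derivAlong f (⟨flow Ξ.base 0 m', Ξ.base (flow Ξ.base 0 m')⟩ : TM)) =
      fun m' => derivAlong f (⟨m', Ξ.base m'⟩ : TM) := funext fun m' =>
    congrArg (fun q => derivAlong f (⟨q, Ξ.base q⟩ : TM)) (flow_zero Ξ.smooth_base m')
  rw [h5] at h3
  have h4 := Ξ.apply_operator X (L.coAnchor f hf) m
  rw [sub_eq_zero.1 h3] at h4
  exact h4

end LieAlgebroid

/-! ### The differential of dual sections and its derivative along `Ξ` -/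

namespace LieAlgebroid

variable (L : LieAlgebroid E F V) (Ξ : LinearVectorField E F V)

/-- The differential `dφ(Z, W) = a(Z)⟨φ, W⟩ - a(W)⟨φ, Z⟩ - ⟨φ, [Z, W]⟩`. -/
def differential (φ : ΓAd) (Z W : ΓA) (m : M) : ℝ :=
  derivAlong (fun m' => φ m' (W m')) (L.anchorMap ⟨m, Z m⟩) -
    derivAlong (fun m' => φ m' (Z m')) (L.anchorMap ⟨m, W m⟩) - φ m (L.bracket Z W m)

theorem contMDiff_differential (φ : ΓAd) (Z W : ΓA) :
    ContMDiff IM 𝓘(ℝ, ℝ) ∞ (L.differential φ Z W) :=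
  ((L.contMDiff_anchor_derivAlong Z (contMDiff_pairing φ W)).sub
    (L.contMDiff_anchor_derivAlong W (contMDiff_pairing φ Z))).sub (contMDiff_pairing φ _)

theorem differential_antisymm (φ : ΓAd) (Z W : ΓA) (m : M) :
    L.differential φ Z W m = -L.differential φ W Z m := by
  have h : φ m (L.bracket Z W m) = -φ m (L.bracket W Z m) := by
    rw [L.bracket_antisymm Z W]
    exact (φ m).map_neg _
  unfold differential
  rw [h]
  ring

/-- As a function of `W` the differential is the pairing with `L_Z φ - a^* d⟨φ, Z⟩`, so it depends
only on the value of `W` at `m`. -/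
theorem differential_eq_sum_right (φ : ΓAd) (Z W : ΓA) {m : M} {n : ℕ} {e : Fin n → ΓA}
    {ε : Fin n → ΓAd} (h : ∀ a : V m, ∑ i, ε i m a • e i m = a) :
    L.differential φ Z W m = ∑ j, ε j m (W m) * L.differential φ Z (e j) m := by
  have h1 : ∀ W : ΓA, L.differential φ Z W m =
      (L.lieDual Z φ m - L.coAnchor _ (contMDiff_pairing φ Z) m) (W m) := fun W => by
    refine Eq.trans ?_ (sub_apply _ _ _).symm
    rw [L.lieDual_apply, L.coAnchor_apply]
    unfold differential
    ring
  rw [h1 W]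
  conv_lhs => rw [← h (W m), map_sum]
  refine Finset.sum_congr rfl fun j _ => ?_
  rw [h1 (e j), map_smul, smul_eq_mul]

theorem differential_eq_sum (φ : ΓAd) (Z W : ΓA) {m : M} {n : ℕ} {e : Fin n → ΓA}
    {ε : Fin n → ΓAd} (h : ∀ a : V m, ∑ i, ε i m a • e i m = a) :
    L.differential φ Z W m =
      ∑ i, ∑ j, ε i m (Z m) * (ε j m (W m) * L.differential φ (e i) (e j) m) := by
  rw [L.differential_antisymm, L.differential_eq_sum_right φ W Z h, ← Finset.sum_neg_distrib]
  refine Finset.sum_congr rfl fun i _ => ?_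
  rw [L.differential_antisymm φ W, mul_neg, neg_neg, L.differential_eq_sum_right φ (e i) W h,
    Finset.mul_sum]

/-- The derivative of `dφ` along a linear vector field, in a frame. -/
theorem sum_derivative_differential (φ : ΓAd) (Z W : ΓA) {m : M} {n : ℕ} {e : Fin n → ΓA}
    {ε : Fin n → ΓAd} (h : ∀ᶠ m' in 𝓝 m, ∀ a : V m', ∑ i, ε i m' a • e i m' = a) :
    ∑ i, ∑ j, (Ξ.adjoint (ε i) m (Z m) * (ε j m (W m) * L.differential φ (e i) (e j) m) +
      ε i m (Z m) * (Ξ.adjoint (ε j) m (W m) * L.differential φ (e i) (e j) m +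
        ε j m (W m) * derivAlong (L.differential φ (e i) (e j)) (⟨m, Ξ.base m⟩ : TM))) =
      derivAlong (L.differential φ Z W) (⟨m, Ξ.base m⟩ : TM) -
        L.differential φ (Ξ.operator Z) W m - L.differential φ Z (Ξ.operator W) m := by
  have h1 : L.differential φ Z W =ᶠ[𝓝 m] fun m' => ∑ i, ∑ j, ε i m' (Z m') * (ε j m' (W m') *
      L.differential φ (e i) (e j) m') := by
    filter_upwards [h] with m' hm' using L.differential_eq_sum φ Z W hm'
  have hp : ∀ (ψ : ΓAd) (X : ΓA), MDifferentiableAt IM 𝓘(ℝ, ℝ) (fun m' => ψ m' (X m')) m :=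
    fun ψ X => (contMDiff_pairing ψ X).mdifferentiable (by simp) _
  have hb : ∀ i j, MDifferentiableAt IM 𝓘(ℝ, ℝ) (L.differential φ (e i) (e j)) m := fun i j =>
    (L.contMDiff_differential _ _ _).mdifferentiable (by simp) _
  have hpb : ∀ i j, MDifferentiableAt IM 𝓘(ℝ, ℝ)
      (fun m' => ε j m' (W m') * L.differential φ (e i) (e j) m') m := fun i j => (hp _ _).mul (hb i j)
  have hppb : ∀ i j, MDifferentiableAt IM 𝓘(ℝ, ℝ)
      (fun m' => ε i m' (Z m') * (ε j m' (W m') * L.differential φ (e i) (e j) m')) m :=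
    fun i j => (hp _ _).mul (hpb i j)
  have hsum : ∀ i, MDifferentiableAt IM 𝓘(ℝ, ℝ) (fun m' => ∑ j, ε i m' (Z m') *
      (ε j m' (W m') * L.differential φ (e i) (e j) m')) m := fun i => by
    have := MDifferentiableAt.sum (t := Finset.univ) (f := fun j m' => ε i m' (Z m') *
      (ε j m' (W m') * L.differential φ (e i) (e j) m')) (fun j _ => hppb i j)
    refine this.congr_of_eventuallyEq (Eventually.of_forall fun η => ?_)
    rw [Finset.sum_apply]
  rw [derivAlong_congr (z := (⟨m, Ξ.base m⟩ : TM)) h1,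
    derivAlong_sum (z := (⟨m, Ξ.base m⟩ : TM)) (f := fun i m' => ∑ j, ε i m' (Z m') *
      (ε j m' (W m') * L.differential φ (e i) (e j) m')) (fun i _ => hsum i),
    L.differential_eq_sum φ _ W h.self_of_nhds, L.differential_eq_sum φ Z _ h.self_of_nhds,
    ← Finset.sum_sub_distrib, ← Finset.sum_sub_distrib]
  refine Finset.sum_congr rfl fun i _ => ?_
  rw [derivAlong_sum (z := (⟨m, Ξ.base m⟩ : TM)) (f := fun j m' => ε i m' (Z m') *
      (ε j m' (W m') * L.differential φ (e i) (e j) m')) (fun j _ => hppb i j),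
    ← Finset.sum_sub_distrib, ← Finset.sum_sub_distrib]
  refine Finset.sum_congr rfl fun j _ => ?_
  rw [derivAlong_mul (z := (⟨m, Ξ.base m⟩ : TM)) (f := fun m' => ε i m' (Z m'))
      (g := fun m' => ε j m' (W m') * L.differential φ (e i) (e j) m') (hp _ _) (hpb i j),
    derivAlong_mul (z := (⟨m, Ξ.base m⟩ : TM)) (f := fun m' => ε j m' (W m'))
      (g := L.differential φ (e i) (e j)) (hp _ _) (hb i j), Ξ.adjoint_apply, Ξ.adjoint_apply]
  ring

variable {L Ξ}

/-- The failure of `D_Ξ` to be a derivation, in terms of the differential. -/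
theorem AnchorCompatible.differential_adjoint (hA : L.AnchorCompatible Ξ) (φ : ΓAd) (Z W : ΓA) (m : M) :
    derivAlong (fun m' => Ξ.adjoint φ m' (W m')) (L.anchorMap ⟨m, Z m⟩) -
      derivAlong (fun m' => Ξ.adjoint φ m' (Z m')) (L.anchorMap ⟨m, W m⟩) -
      (derivAlong (L.differential φ Z W) (⟨m, Ξ.base m⟩ : TM) -
        L.differential φ (Ξ.operator Z) W m - L.differential φ Z (Ξ.operator W) m) =
      Ξ.adjoint φ m (L.bracket Z W m) + (φ m (Ξ.operator (L.bracket Z W) m) -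
        φ m (L.bracket (Ξ.operator Z) W m) - φ m (L.bracket Z (Ξ.operator W) m)) := by
  have hp : ∀ (ψ : ΓAd) (X : ΓA) (n : M), MDifferentiableAt IM 𝓘(ℝ, ℝ) (fun m' => ψ m' (X m')) n :=
    fun ψ X => (contMDiff_pairing ψ X).mdifferentiable (by simp)
  have hx : ∀ (X : ΓA) (n : M), MDifferentiableAt IM 𝓘(ℝ, ℝ) (fun m' =>
      derivAlong (fun m => φ m (X m)) (⟨m', Ξ.base m'⟩ : TM)) n := fun X =>
    (Ξ.contMDiff_base_derivAlong (contMDiff_pairing φ X)).mdifferentiable (by simp)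
  have ha : ∀ (X Y : ΓA) (n : M), MDifferentiableAt IM 𝓘(ℝ, ℝ) (fun m' =>
      derivAlong (fun m => φ m (X m)) (L.anchorMap ⟨m', Y m'⟩)) n := fun X Y =>
    (L.contMDiff_anchor_derivAlong Y (contMDiff_pairing φ X)).mdifferentiable (by simp)
  have h1 : ∀ X Y : ΓA, derivAlong (fun m' => Ξ.adjoint φ m' (X m')) (L.anchorMap ⟨m, Y m⟩) =
      derivAlong (fun m' => derivAlong (fun m => φ m (X m)) (⟨m', Ξ.base m'⟩ : TM))
        (L.anchorMap ⟨m, Y m⟩) -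
      derivAlong (fun m' => φ m' (Ξ.operator X m')) (L.anchorMap ⟨m, Y m⟩) := fun X Y => by
    simp only [Ξ.adjoint_apply]
    exact derivAlong_sub (f := fun m' => derivAlong (fun m => φ m (X m)) (⟨m', Ξ.base m'⟩ : TM))
      (g := fun m' => φ m' (Ξ.operator X m')) (hx X _) (hp φ _ _)
  have h2 : derivAlong (L.differential φ Z W) (⟨m, Ξ.base m⟩ : TM) =
      derivAlong (fun m' => derivAlong (fun m => φ m (W m)) (L.anchorMap ⟨m', Z m'⟩))
        (⟨m, Ξ.base m⟩ : TM) -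
      derivAlong (fun m' => derivAlong (fun m => φ m (Z m)) (L.anchorMap ⟨m', W m'⟩))
        (⟨m, Ξ.base m⟩ : TM) -
      derivAlong (fun m' => φ m' (L.bracket Z W m')) (⟨m, Ξ.base m⟩ : TM) := by
    refine (derivAlong_sub (z := (⟨m, Ξ.base m⟩ : TM))
      (f := fun m' => derivAlong (fun m => φ m (W m)) (L.anchorMap ⟨m', Z m'⟩) -
        derivAlong (fun m => φ m (Z m)) (L.anchorMap ⟨m', W m'⟩))
      (g := fun m' => φ m' (L.bracket Z W m')) ((ha W Z _).sub (ha Z W _)) (hp φ _ _)).trans ?_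
    rw [derivAlong_sub (z := (⟨m, Ξ.base m⟩ : TM))
      (f := fun m' => derivAlong (fun m => φ m (W m)) (L.anchorMap ⟨m', Z m'⟩))
      (g := fun m' => derivAlong (fun m => φ m (Z m)) (L.anchorMap ⟨m', W m'⟩)) (ha W Z _) (ha Z W _)]
  rw [h1, h1, h2, Ξ.adjoint_apply]
  unfold differential
  -- Compatibility replaces the derivatives along `a(D_Ξ Z)` and `a(D_Ξ W)` by commutators, which
  -- cancel all second order terms. Only the bracket terms survive.
  rw [hA _ (contMDiff_pairing φ W) Z m, hA _ (contMDiff_pairing φ Z) W m]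
  ring

end LieAlgebroid

/-! ### Transport of sections and of their brackets by the flow -/

namespace LinearVectorField

variable (Ξ : LinearVectorField E F V)

/-- The time `k` flow of `Ξ` maps the section `X` near `m` to the section `X'`. -/
def Related (k : ℝ) (m : M) (X X' : ΓA) : Prop :=
  ∀ᶠ m' in 𝓝 m, flow Ξ.vf k ⟨m', X m'⟩ = ⟨flow Ξ.base k m', X' (flow Ξ.base k m')⟩

theorem related_zero [T2Space (TotalSpace F V)] (m : M) (X : ΓA) : Ξ.Related 0 m X X :=
  Eventually.of_forall fun m' => by rw [flow_zero Ξ.smooth_vf, flow_zero Ξ.smooth_base]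

/-- The section `X` is transported by the flow over the domain of the inverse flow, where it is
smooth, and is then cut off to a global section with the same germ at the image of `m`. -/
theorem exists_related [T2Space (TotalSpace F V)] {k : ℝ} {m : M} (hm : m ∈ flowDomain Ξ.base k)
    (X : ΓA) : ∃ X' : ΓA, Ξ.Related k m X X' := by
  have hinv : ∀ n ∈ flowDomain Ξ.base (-k), flow Ξ.base (-k) n ∈ flowDomain Ξ.base k ∧
      flow Ξ.base k (flow Ξ.base (-k) n) = n := fun n hn => by
    have := flow_neg Ξ.smooth_base hn
    rwa [neg_neg] at this
  have hdom : ∀ m' ∈ flowDomain Ξ.base k, (⟨m', X m'⟩ : TotalSpace F V) ∈ flowDomain Ξ.vf k :=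
    fun m' hm' => by rw [Ξ.flowDomain_vf]; exact hm'
  have hex : ∀ n, ∃ α : V n, n ∈ flowDomain Ξ.base (-k) →
      flow Ξ.vf k ⟨flow Ξ.base (-k) n, X (flow Ξ.base (-k) n)⟩ = ⟨n, α⟩ := by
    intro n
    by_cases hn : n ∈ flowDomain Ξ.base (-k)
    · have h1 := (Ξ.proj_flow (hdom _ (hinv n hn).1)).2.trans (hinv n hn).2
      generalize flow Ξ.vf k ⟨flow Ξ.base (-k) n, X (flow Ξ.base (-k) n)⟩ = q at h1
      obtain ⟨n', α⟩ := q
      change n' = n at h1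
      subst h1
      exact ⟨α, fun _ => rfl⟩
    · exact ⟨0, fun h => absurd h hn⟩
  choose α hα using hex
  have hsm : ContMDiffOn IM IA ∞ (fun n => (⟨n, α n⟩ : TotalSpace F V)) (flowDomain Ξ.base (-k)) := by
    have h1 : ContMDiffOn IM IA ∞ (fun n => flow Ξ.vf k
        ⟨flow Ξ.base (-k) n, X (flow Ξ.base (-k) n)⟩) (flowDomain Ξ.base (-k)) := fun n hn =>
      (ContMDiffAt.comp (I' := IA) n (g := flow Ξ.vf k)
        (contMDiffAt_flow_time Ξ.smooth_vf (hdom _ (hinv n hn).1))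
        (ContMDiffAt.comp n (g := fun m' => (⟨m', X m'⟩ : TotalSpace F V)) X.contMDiff.contMDiffAt
          (contMDiffAt_flow_time Ξ.smooth_base hn))).contMDiffWithinAt
    exact h1.congr fun n hn => (hα n hn).symm
  obtain ⟨X', hX'⟩ := exists_section_eventuallyEq (isOpen_flowDomain Ξ.smooth_base (-k))
    (flow_neg Ξ.smooth_base hm).1 hsm
  refine ⟨X', ?_⟩
  filter_upwards [(contMDiffAt_flow_time Ξ.smooth_base hm).continuousAt.eventually hX',
    (isOpen_flowDomain Ξ.smooth_base k).mem_nhds hm] with m' h1 h2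
  obtain ⟨h3, h4⟩ := flow_neg Ξ.smooth_base h2
  rw [h1, ← hα _ h3, h4]

/-- The transported section is only determined as a germ, which is enough because the bracket is
local. -/
theorem Related.eventuallyEq [T2Space (TotalSpace F V)] {Ξ : LinearVectorField E F V} {k : ℝ} {m : M}
    (hm : m ∈ flowDomain Ξ.base k) {X X' X'' : ΓA} (h' : Ξ.Related k m X X')
    (h'' : Ξ.Related k m X X'') : ∀ᶠ n in 𝓝 (flow Ξ.base k m), X' n = X'' n := by
  obtain ⟨hn, hnm⟩ := flow_neg Ξ.smooth_base hm
  have hc := (contMDiffAt_flow_time Ξ.smooth_base hn).continuousAt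
  unfold ContinuousAt at hc
  rw [hnm] at hc
  filter_upwards [hc.eventually h', hc.eventually h'',
    (isOpen_flowDomain Ξ.smooth_base (-k)).mem_nhds hn] with n h1 h2 h3
  have h4 := (flow_neg Ξ.smooth_base h3).2
  rw [neg_neg] at h4
  have h5 := h1.symm.trans h2
  rw [h4] at h5
  exact eq_of_heq (TotalSpace.mk.inj h5).2

end LinearVectorField

namespace LieAlgebroid

variable {L : LieAlgebroid E F V} {Ξ : LinearVectorField E F V}

/-- Moves the differentiation from the image point back to `m`, where the direction `a(X)` is fixed.
The dependence on `k` then sits in the flow alone and can be differentiated by exchanging mixed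
derivatives. -/
theorem AnchorCompatible.derivAlong_pairing_related [T2Space (TotalSpace F V)]
    (hA : L.AnchorCompatible Ξ) {k : ℝ} {m : M} (hm : m ∈ flowDomain Ξ.base k) {X X' Y Y' : ΓA}
    (hX : Ξ.Related k m X X') (hY : Ξ.Related k m Y Y') (φ : ΓAd) :
    derivAlong (fun n => φ n (Y' n)) (L.anchorMap ⟨flow Ξ.base k m, X' (flow Ξ.base k m)⟩) =
      derivAlong (fun m' => linearFunction φ (flow Ξ.vf k ⟨m', Y m'⟩)) (L.anchorMap ⟨m, X m⟩) := by
  have hp : (⟨m, X m⟩ : TotalSpace F V) ∈ flowDomain Ξ.vf k := by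
    rw [Ξ.flowDomain_vf]; exact hm
  have hX0 : flow Ξ.vf k ⟨m, X m⟩ = ⟨flow Ξ.base k m, X' (flow Ξ.base k m)⟩ := hX.self_of_nhds
  rw [← hX0, hA.anchorMap_flow hp]
  refine (derivAlong_comp (J₂ := IM) (z := L.anchorMap ⟨m, X m⟩) (h := fun n => φ n (Y' n))
    (k := flow Ξ.base k) ((contMDiff_pairing φ Y').mdifferentiable (by simp) _)
    ((contMDiffAt_flow_time Ξ.smooth_base hm).mdifferentiableAt (by simp))).symm.trans ?_
  refine derivAlong_congr (z := L.anchorMap ⟨m, X m⟩) ?_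
  filter_upwards [hY] with m' h
  rw [h]
  rfl

/-- The derivative in the time `k` of the bracket of the images `X'ₖ`, `Y'ₖ` of two sections under the
flow of `Ξ`. -/
theorem AnchorCompatible.hasDerivAt_bracket [T2Space (TotalSpace F V)] (hA : L.AnchorCompatible Ξ)
    {k₀ : ℝ} {m : M} (hm : m ∈ flowDomain Ξ.base k₀) {X Y : ΓA} {X' Y' : ℝ → ΓA}
    (hX : ∀ᶠ k in 𝓝 k₀, Ξ.Related k m X (X' k)) (hY : ∀ᶠ k in 𝓝 k₀, Ξ.Related k m Y (Y' k)) (φ : ΓAd) :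
    HasDerivAt (fun k => φ (flow Ξ.base k m) (L.bracket (X' k) (Y' k) (flow Ξ.base k m)))
      (Ξ.adjoint φ (flow Ξ.base k₀ m) (L.bracket (X' k₀) (Y' k₀) (flow Ξ.base k₀ m)) +
        (φ (flow Ξ.base k₀ m) (Ξ.operator (L.bracket (X' k₀) (Y' k₀)) (flow Ξ.base k₀ m)) -
          φ (flow Ξ.base k₀ m) (L.bracket (Ξ.operator (X' k₀)) (Y' k₀) (flow Ξ.base k₀ m)) -
          φ (flow Ξ.base k₀ m) (L.bracket (X' k₀) (Ξ.operator (Y' k₀)) (flow Ξ.base k₀ m)))) k₀ := by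
  obtain ⟨n, e, ε, hfr⟩ := exists_frame E F V (flow Ξ.base k₀ m)
  have hfr' : ∀ᶠ m' in 𝓝 (flow Ξ.base k₀ m), ∀ a : V m', ∑ i, ε i m' a • e i m' = a :=
    hfr.mono fun _ h => h.1
  have hdom : ∀ {k}, m ∈ flowDomain Ξ.base k → ∀ Z : ΓA,
      (⟨m, Z m⟩ : TotalSpace F V) ∈ flowDomain Ξ.vf k := fun hk Z => by
    rw [Ξ.flowDomain_vf]; exact hk
  have hcurve : ContinuousAt (fun k => flow Ξ.base k m) k₀ :=
    (hasMFDerivAt_flow Ξ.smooth_base hm).continuousAt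
  have hmk : ∀ᶠ k in 𝓝 k₀, m ∈ flowDomain Ξ.base k := by
    obtain ⟨l, u, -, ht, hd, -, -⟩ := exists_isMIntegralCurveOn_flow Ξ.smooth_base hm
    filter_upwards [Ioo_mem_nhds ht.1 ht.2] with k hk using hd k hk
  have hval : ∀ {k} {Z Z' : ΓA}, Ξ.Related k m Z Z' → ∀ ψ : ΓAd,
      linearFunction ψ (flow Ξ.vf k ⟨m, Z m⟩) =
        ψ (flow Ξ.base k m) (Z' (flow Ξ.base k m)) := fun hZ ψ =>
    congrArg (linearFunction ψ) hZ.self_of_nhds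
  -- The families `X'`, `Y'` are arbitrary choices with no regularity in `k`. Writing the bracket
  -- through the differential of `φ`, expanded in a frame, leaves only the flow applied to the fixed
  -- sections `X` and `Y`.
  have hev : (fun k => φ (flow Ξ.base k m) (L.bracket (X' k) (Y' k) (flow Ξ.base k m))) =ᶠ[𝓝 k₀]
      fun k => derivAlong (fun m' => linearFunction φ (flow Ξ.vf k ⟨m', Y m'⟩)) (L.anchorMap ⟨m, X m⟩) -
        derivAlong (fun m' => linearFunction φ (flow Ξ.vf k ⟨m', X m'⟩)) (L.anchorMap ⟨m, Y m⟩) -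
        ∑ i, ∑ j, linearFunction (ε i) (flow Ξ.vf k ⟨m, X m⟩) *
          (linearFunction (ε j) (flow Ξ.vf k ⟨m, Y m⟩) *
            L.differential φ (e i) (e j) (flow Ξ.base k m)) := by
    filter_upwards [hX, hY, hmk, hcurve.eventually hfr'] with k h1 h2 h3 h4
    rw [← hA.derivAlong_pairing_related h3 h1 h2 φ, ← hA.derivAlong_pairing_related h3 h2 h1 φ]
    simp only [hval h1, hval h2]
    rw [← L.differential_eq_sum φ (X' k) (Y' k) h4]
    unfold differential
    ring
  have hs : ∀ Z : ΓA, ContMDiff IM IA ∞ (fun m' => (⟨m', Z m'⟩ : TotalSpace F V)) :=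
    fun Z => Z.contMDiff
  have hd1 : ∀ Z W : ΓA, HasDerivAt (fun k =>
      derivAlong (fun m' => linearFunction φ (flow Ξ.vf k ⟨m', W m'⟩)) (L.anchorMap ⟨m, Z m⟩))
      (derivAlong (fun m' => linearFunction (Ξ.adjoint φ) (flow Ξ.vf k₀ ⟨m', W m'⟩))
        (L.anchorMap ⟨m, Z m⟩)) k₀ := fun Z W => by
    have h := hasDerivAt_derivAlong_flow Ξ.smooth_vf (contMDiff_linearFunction φ) (hs W) (q := m)
      (hdom hm W) (L.anchor m (Z m))
    simp only [Ξ.derivAlong_linearFunction] at h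
    exact h
  have hd2 : ∀ (ψ : ΓAd) (Z : ΓA), HasDerivAt (fun k => linearFunction ψ (flow Ξ.vf k ⟨m, Z m⟩))
      (linearFunction (Ξ.adjoint ψ) (flow Ξ.vf k₀ ⟨m, Z m⟩)) k₀ := fun ψ Z => by
    have h := hasDerivAt_comp_flow Ξ.smooth_vf (mdifferentiable_linearFunction ψ) (hdom hm Z)
    rwa [Ξ.derivAlong_linearFunction] at h
  have hd3 : ∀ i j, HasDerivAt (fun k => L.differential φ (e i) (e j) (flow Ξ.base k m))
      (derivAlong (L.differential φ (e i) (e j))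
        (⟨flow Ξ.base k₀ m, Ξ.base (flow Ξ.base k₀ m)⟩ : TM)) k₀ := fun i j =>
    hasDerivAt_comp_flow Ξ.smooth_base ((L.contMDiff_differential _ _ _).mdifferentiable (by simp)) hm
  refine HasDerivAt.congr_of_eventuallyEq ?_ hev
  have hX0 := hX.self_of_nhds
  have hY0 := hY.self_of_nhds
  rw [← hA.differential_adjoint φ (X' k₀) (Y' k₀) (flow Ξ.base k₀ m),
    ← L.sum_derivative_differential Ξ φ (X' k₀) (Y' k₀) hfr',
    hA.derivAlong_pairing_related hm hX0 hY0, hA.derivAlong_pairing_related hm hY0 hX0]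
  simp only [← hval hX0, ← hval hY0]
  refine ((hd1 X Y).sub (hd1 Y X)).sub (HasDerivAt.fun_sum fun i _ => HasDerivAt.fun_sum fun j _ => ?_)
  exact (hd2 (ε i) X).mul ((hd2 (ε j) Y).mul (hd3 i j))

/-- The bracket of the transported sections and the transported bracket agree at time `0`. For a
derivation their difference, paired with `φ`, has as time derivative its pairing with the adjoint of
`φ`; a frame makes this locally a finite linear system, so the difference vanishes. -/
theorem IsDerivation.flow_bracket [T2Space (TotalSpace F V)] (hD : L.IsDerivation Ξ.operator) {t : ℝ}
    {m : M} (hm : m ∈ flowDomain Ξ.base t) {X X' Y Y' : ΓA} (hX : Ξ.Related t m X X')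
    (hY : Ξ.Related t m Y Y') :
    flow Ξ.vf t ⟨m, L.bracket X Y m⟩ = ⟨flow Ξ.base t m, L.bracket X' Y' (flow Ξ.base t m)⟩ := by
  have hA := hD.anchorCompatible
  obtain ⟨l, u, h0, ht, hd, -, -⟩ := exists_isMIntegralCurveOn_flow Ξ.smooth_base hm
  have hfam : ∀ Z : ΓA, ∃ Z' : ℝ → ΓA, ∀ k ∈ Ioo l u, Ξ.Related k m Z (Z' k) := fun Z => by
    have : ∀ k, ∃ Z' : ΓA, k ∈ Ioo l u → Ξ.Related k m Z Z' := fun k => by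
      by_cases hk : k ∈ Ioo l u
      · obtain ⟨Z', h⟩ := Ξ.exists_related (hd k hk) Z
        exact ⟨Z', fun _ => h⟩
      · exact ⟨0, fun h => absurd h hk⟩
    choose Z' hZ' using this
    exact ⟨Z', hZ'⟩
  obtain ⟨Xf, hXf⟩ := hfam X
  obtain ⟨Yf, hYf⟩ := hfam Y
  rw [L.bracket_congr (hX.eventuallyEq hm (hXf t ht)) (hY.eventuallyEq hm (hYf t ht))]
  have hdom : ∀ k ∈ Ioo l u, (⟨m, L.bracket X Y m⟩ : TotalSpace F V) ∈ flowDomain Ξ.vf k :=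
    fun k hk => by rw [Ξ.flowDomain_vf]; exact hd k hk
  let S : ΓAd → ℝ → ℝ := fun φ k =>
    φ (flow Ξ.base k m) (L.bracket (Xf k) (Yf k) (flow Ξ.base k m)) -
      linearFunction φ (flow Ξ.vf k ⟨m, L.bracket X Y m⟩)
  have hr : ∀ k ∈ Ioo l u, ∃ r : V (flow Ξ.base k m), (∀ φ, S φ k = φ (flow Ξ.base k m) r) ∧
      (r = 0 → flow Ξ.vf k ⟨m, L.bracket X Y m⟩ =
        ⟨flow Ξ.base k m, L.bracket (Xf k) (Yf k) (flow Ξ.base k m)⟩) := by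
    intro k hk
    obtain ⟨Λ, hΛ⟩ := Ξ.exists_flow_linear k m
    refine ⟨L.bracket (Xf k) (Yf k) (flow Ξ.base k m) - Λ (L.bracket X Y m), fun φ => ?_, fun h => ?_⟩
    · change φ (flow Ξ.base k m) _ - linearFunction φ (flow Ξ.vf k _) = _
      rw [hΛ (hd k hk)]
      exact ((φ (flow Ξ.base k m)).map_sub _ _).symm
    · rw [hΛ (hd k hk), sub_eq_zero.1 h]
  obtain ⟨r, hrt, hr0⟩ := hr t ht
  refine hr0 (eq_of_forall_dual (E := E) (F := F) fun φ => ?_)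
  rw [← hrt φ, map_zero]
  refine eq_zero_of_linear_system (S := S) (T := Ξ.adjoint) (fun φ k hk => ?_) (fun k₀ hk₀ => ?_) h0
    (fun φ => ?_) ht φ
  · have h1 := hA.hasDerivAt_bracket (hd k hk)
      (eventually_of_mem (Ioo_mem_nhds hk.1 hk.2) hXf) (eventually_of_mem (Ioo_mem_nhds hk.1 hk.2) hYf) φ
    have h2 := hasDerivAt_comp_flow Ξ.smooth_vf (mdifferentiable_linearFunction φ) (hdom k hk)
    rw [Ξ.derivAlong_linearFunction] at h2
    refine (h1.sub h2).congr_deriv ?_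
    have h3 : φ (flow Ξ.base k m) (Ξ.operator (L.bracket (Xf k) (Yf k)) (flow Ξ.base k m)) =
        φ (flow Ξ.base k m) (L.bracket (Ξ.operator (Xf k)) (Yf k) (flow Ξ.base k m)) +
        φ (flow Ξ.base k m) (L.bracket (Xf k) (Ξ.operator (Yf k)) (flow Ξ.base k m)) := by
      rw [hD (Xf k) (Yf k)]
      exact (φ (flow Ξ.base k m)).map_add _ _
    rw [h3]
    change _ = Ξ.adjoint φ (flow Ξ.base k m) _ - _
    ring
  · obtain ⟨n, e, ε, hfr⟩ := exists_frame E F V (flow Ξ.base k₀ m)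
    have hcurve : ContinuousAt (fun k => flow Ξ.base k m) k₀ :=
      (hasMFDerivAt_flow Ξ.smooth_base (hd k₀ hk₀)).continuousAt
    refine ⟨n, ε, fun i j k => Ξ.adjoint (ε i) (flow Ξ.base k m) (e j (flow Ξ.base k m)),
      fun i j => ContinuousAt.comp (f := fun k => flow Ξ.base k m)
        (contMDiff_pairing (Ξ.adjoint (ε i)) (e j)).continuous.continuousAt hcurve, ?_⟩
    filter_upwards [Ioo_mem_nhds hk₀.1 hk₀.2, hcurve.eventually hfr] with k hk hfk
    obtain ⟨r, hr, -⟩ := hr k hk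
    -- The difference is a vector in one fibre, so its components in the frame govern all its
    -- pairings.
    have hexp : ∀ ψ : ΓAd, S ψ k = ∑ j, ψ (flow Ξ.base k m) (e j (flow Ξ.base k m)) * S (ε j) k := by
      intro ψ
      rw [hr ψ]
      conv_lhs => rw [← hfk.1 r, map_sum]
      refine Finset.sum_congr rfl fun j _ => ?_
      rw [hr (ε j), map_smul, smul_eq_mul, mul_comm]
    refine ⟨fun i => hexp _, fun hz ψ => ?_⟩
    rw [hexp ψ]
    exact Finset.sum_eq_zero fun j _ => by rw [hz j, mul_zero]
  · change φ (flow Ξ.base 0 m) _ - linearFunction φ (flow Ξ.vf 0 _) = 0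
    have hm0 := hd 0 h0
    rw [L.bracket_congr ((hXf 0 h0).eventuallyEq hm0 (Ξ.related_zero m X))
      ((hYf 0 h0).eventuallyEq hm0 (Ξ.related_zero m Y)), flow_zero Ξ.smooth_vf,
      flow_zero Ξ.smooth_base]
    exact sub_self _

theorem IsDerivation.flowsAreLocalAutomorphisms (hD : L.IsDerivation Ξ.operator) :
    L.FlowsAreLocalAutomorphisms Ξ := by
  have : T2Space (TotalSpace F V) := t2Space_totalSpace
  intro t
  have hdom := Ξ.flowDomain_vf t
  refine ⟨hdom, isLocalDiffeo_flow Ξ.smooth_base t, ?_, ?_, fun p hp => ?_, ?_⟩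
  · rw [← Ξ.flowDomain_vf, ← Ξ.flowDomain_vf]
    exact isLocalDiffeo_flow Ξ.smooth_vf t
  · choose Λ hΛ using Ξ.exists_flow_linear t
    exact ⟨Λ, hΛ⟩
  · exact hD.anchorCompatible.anchorMap_flow (by rw [hdom]; exact hp)
  · intro W hW hWU X Y X' Y' hX hY m hm
    exact hD.flow_bracket (hWU hm) (eventually_of_mem (hW.mem_nhds hm) hX)
      (eventually_of_mem (hW.mem_nhds hm) hY)

/-- If the flow preserves brackets, the bracket of the transported sections coincides with the
transported bracket for all small times. Equating the two derivatives at time `0` leaves the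
derivation identity. -/
theorem FlowsAreLocalAutomorphisms.isDerivation (hF : L.FlowsAreLocalAutomorphisms Ξ) :
    L.IsDerivation Ξ.operator := by
  have : T2Space (TotalSpace F V) := t2Space_totalSpace
  have hA : L.AnchorCompatible Ξ := anchorCompatible_of_flow fun t p hp =>
    (hF t).2.anchor p (by rw [(hF t).1] at hp; exact hp)
  intro X Y
  refine section_ext fun φ m => ?_
  obtain ⟨l, u, h0, -, hd, -, -⟩ := exists_isMIntegralCurveOn_flow Ξ.smooth_base
    (mem_flowDomain_zero Ξ.smooth_base m)
  -- At time `0` the family is made to equal `Z` itself and not merely near `m`, so that the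
  -- derivative there involves `X` and `Y` literally.
  have hfam : ∀ Z : ΓA, ∃ Z' : ℝ → ΓA, Z' 0 = Z ∧ ∀ k ∈ Ioo l u, Ξ.Related k m Z (Z' k) := fun Z => by
    have : ∀ k, ∃ Z' : ΓA, (k = 0 → Z' = Z) ∧ (k ∈ Ioo l u → Ξ.Related k m Z Z') := fun k => by
      by_cases hk0 : k = 0
      · exact ⟨Z, fun _ => rfl, fun _ => by rw [hk0]; exact Ξ.related_zero m Z⟩
      by_cases hk : k ∈ Ioo l u
      · obtain ⟨Z', h⟩ := Ξ.exists_related (hd k hk) Z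
        exact ⟨Z', fun h => absurd h hk0, fun _ => h⟩
      · exact ⟨0, fun h => absurd h hk0, fun h => absurd h hk⟩
    choose Z' hZ' using this
    exact ⟨Z', (hZ' 0).1 rfl, fun k => (hZ' k).2⟩
  obtain ⟨Xf, hX0, hXf⟩ := hfam X
  obtain ⟨Yf, hY0, hYf⟩ := hfam Y
  have h1 := hA.hasDerivAt_bracket (hd 0 h0) (eventually_of_mem (Ioo_mem_nhds h0.1 h0.2) hXf)
    (eventually_of_mem (Ioo_mem_nhds h0.1 h0.2) hYf) φ
  have h2 := hasDerivAt_comp_flow Ξ.smooth_vf (mdifferentiable_linearFunction φ)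
    (mem_flowDomain_zero Ξ.smooth_vf (⟨m, L.bracket X Y m⟩ : TotalSpace F V))
  rw [Ξ.derivAlong_linearFunction] at h2
  have h3 : (fun k => φ (flow Ξ.base k m) (L.bracket (Xf k) (Yf k) (flow Ξ.base k m))) =ᶠ[𝓝 0]
      fun k => linearFunction φ (flow Ξ.vf k ⟨m, L.bracket X Y m⟩) := by
    filter_upwards [Ioo_mem_nhds h0.1 h0.2] with k hk
    obtain ⟨W, hW, hWo, hmW⟩ := eventually_nhds_iff.1 ((hXf k hk).and (hYf k hk))
    have h4 := (hF k).2.bracket (W ∩ flowDomain Ξ.base k)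
      (hWo.inter (isOpen_flowDomain Ξ.smooth_base k)) inter_subset_right X Y (Xf k) (Yf k)
      (fun m' hm' => (hW m' hm'.1).1) (fun m' hm' => (hW m' hm'.1).2) m ⟨hmW, hd k hk⟩
    rw [h4]
    rfl
  have h5 := h1.unique (h2.congr_of_eventuallyEq h3)
  rw [hX0, hY0, flow_zero Ξ.smooth_vf, flow_zero Ξ.smooth_base] at h5
  change _ = Ξ.adjoint φ m (L.bracket X Y m) at h5
  refine Eq.trans ?_ ((φ m).map_add _ _).symm
  linarith

theorem flowsAreLocalAutomorphisms_iff_isDerivation :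
    L.FlowsAreLocalAutomorphisms Ξ ↔ L.IsDerivation Ξ.operator :=
  ⟨fun h => h.isDerivation, fun h => h.flowsAreLocalAutomorphisms⟩

end LieAlgebroid

end Algebroid

end LieAlgebroidTheory

end

/-! ### The equivalence, with the derivation property as the hub -/

theorem mainTheorem1
    {E : Type*} [NormedAddCommGroup E] [NormedSpace ℝ E] [FiniteDimensional ℝ E]
    {M : Type*} [TopologicalSpace M] [T2Space M] [SecondCountableTopology M]
    [ChartedSpace E M] [IsManifold 𝓘(ℝ, E) ∞ M]
    {F : Type*} [NormedAddCommGroup F] [NormedSpace ℝ F] [FiniteDimensional ℝ F]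
    {V : M → Type*} [TopologicalSpace (TotalSpace F V)] [∀ m, AddCommGroup (V m)]
    [∀ m, Module ℝ (V m)] [∀ m, TopologicalSpace (V m)] [FiberBundle F V] [VectorBundle ℝ F V]
    [ContMDiffVectorBundle ∞ F V 𝓘(ℝ, E)]
    (L : LieAlgebroidTheory.LieAlgebroid E F V) (Ξ : LieAlgebroidTheory.LinearVectorField E F V) :
    List.TFAE
      [L.IsMorphic Ξ,
        L.IsPoisson Ξ.dual,
        L.IsDerivation Ξ.operator,
        L.FlowsAreLocalAutomorphisms Ξ] := by
  tfae_have 1 ↔ 3 := LieAlgebroidTheory.LieAlgebroid.isMorphic_iff_isDerivation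
  tfae_have 2 ↔ 3 := LieAlgebroidTheory.LieAlgebroid.isPoisson_iff_isDerivation
  tfae_have 4 ↔ 3 := LieAlgebroidTheory.LieAlgebroid.flowsAreLocalAutomorphisms_iff_isDerivation
  tfae_finish
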